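/- **Setting.** Let $(M,\mathbf g,F)$ be a bi-axisymmetric solution of 5-dimensional minimal supergravity with cosmological constant $\Lambda\ge 0$: $M$ is a smooth oriented 5-manifold, $\mathbf g$ a Lorentzian metric of signature $(-,+,+,+,+)$, $F$ a closed 2-form, $$R_{ab}=\tfrac12F_{ac}F_b{}^{c}-\tfrac1{12}|F|^2\mathbf g_{ab}+4\Lambda\mathbf g_{ab},\qquad d\star F+\tfrac1{\sqrt3}F\wedge F=0 ,$$ and $U(1)^2$ acts smoothly on $M$ preserving $\mathbf g$ and $F$, with generators $\eta_{(1)},\eta_{(2)}$ of period $2\pi$. Let $\mathcal B\subset M$ be a bi-axisymmetric stable MOTS, i.e. a closed connected embedded spacelike $U(1)^2$-invariant 3-dimensional surface, on which $U(1)^2$ acts effectively, with induced metric $\gamma$ and area $A$, such that for $U(1)^2$-invariant null normals $\mathbf n=\partial_u$, $\mathbf l=\partial_r$ with $\mathbf g(\mathbf n,\mathbf l)=-1$, extended by Gaussian null coordinates $\mathbf g=-2du(dr-\alpha r^2du-r\beta_mdy^m)+\gamma_{mn}dy^mdy^n$ near $\mathcal B=\{u=r=0\}$, the expansion $\theta_{\mathbf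 n}=\frac12\gamma^{mn}\partial_u\gamma_{mn}$ satisfies $\theta_{\mathbf n}=0$ and $\mathfrak L_{\mathbf l}\theta_{\mathbf n}\le0$ on $\mathcal B$. The orbit space $\mathcal B/U(1)^2$ is parametrized by $x=\cos\theta\in[-1,1]$ with $dx=\mathcal C\,\mathrm{Vol}_\gamma(\eta_{(1)},\eta_{(2)},\cdot)$ for a constant $\mathcal C>0$, and one of the following holds: $s=0$, $p\ge1$, $\gcd(p,q)=1$, $\eta_{(1)}=0$ at $x=1$ and $q\eta_{(1)}+p\eta_{(2)}=0$ at $x=-1$ ($\mathcal B\cong S^3$ if $p=1,q=0$, and $\mathcal B\cong L(p,q)$ if $1\le q\le p-1$); or $s=1$, $p=1$, $q=0$ and $\eta_{(2)}=0$ at $x=\pm1$ ($\mathcal B\cong S^1\times S^2$). **Induced map.** Let $\lambda_{ij}=\gamma(\eta_{(i)},\eta_{(j)})$, $Z=\begin{pmatrix}1&q\\0&p\end{pmatrix}$, $\bar\lambda=Z^T\lambda Z$. The map $\Psi=(U,V,W,\zeta^1,\zeta^2,\chi,\psi^1,\psi^2)$, a function of $\theta\in(0,\pi)$, is defined by $$\bar\lambda_{11}=e^{2U+V}(1-x)\cosh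 W,\quad \bar\lambda_{22}=e^{2U-V}(1+x)\cosh W,\quad \bar\lambda_{12}=e^{2U}\sqrt{1-x^2}\,\sinh W,$$ and, on $\mathcal B$, with $\Upsilon=-\iota_{\eta_{(1)}}\iota_{\eta_{(2)}}\star F$ and $\Theta^i=\star(\eta_{(1)}\wedge\eta_{(2)}\wedge d\eta_{(i)})$, by $$d\psi^i=\iota_{\eta_{(i)}}F,\quad d\chi=\Upsilon-\tfrac1{\sqrt3}(\psi^1d\psi^2-\psi^2d\psi^1),\quad d\zeta^i=\Theta^i-\psi^i\big[d\chi+\tfrac1{3\sqrt3}(\psi^1d\psi^2-\psi^2d\psi^1)\big].$$ Put $\bar\Theta=Z^T\Theta$, $\bar\psi=Z^T\psi$, $h_1=\frac12\log\sin\theta$, $h_2=\log\tan\frac\theta2$, $V_s=V+2sh_1+sh_2$. **Functional.** Let $\xi$ be any smooth positive function of $x\in[-1,1]$, and set $\alpha_\xi=\frac12(\xi(1)+\xi(-1))$, $$\beta^s_\xi=\int_0^\pi\Big(\frac{(\partial_\theta\xi)^2}{4\xi}+\frac{3+s}4\xi\Big)\sin\theta\,d\theta,$$ $$\begin{aligned}\mathcal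 I_{\mathcal B}(\Psi)=\frac14\int_0^\pi\xi\Big\{&12(\partial_\theta U)^2+(\partial_\theta V_s)^2+(\partial_\theta W)^2+\sinh^2W(\partial_\theta V+\partial_\theta h_2)^2\\ &+p^2\frac{e^{-6h_1-h_2-6U-V}}{\cosh W}(\bar\Theta^1_\theta)^2+p^2e^{-6h_1+h_2-6U+V}\cosh W\big(e^{-h_2-V}\tanh W\,\bar\Theta^1_\theta-\bar\Theta^2_\theta\big)^2\\ &+\frac{e^{-2h_1-h_2-2U-V}}{\cosh W}(\partial_\theta\bar\psi^1)^2+e^{-2h_1+h_2-2U+V}\cosh W\big(e^{-h_2-V}\tanh W\,\partial_\theta\bar\psi^1-\partial_\theta\bar\psi^2\big)^2\\ &+p^2e^{-4h_1-4U}\Upsilon_\theta^2+3p^2\Lambda\Big(\frac{A}{2\sqrt2\pi^2}\Big)^2e^{-4U}\\ &-\xi^{-1}\Big[2V_s\,\partial_\theta\big((1-2s\cos^2\tfrac\theta2)\xi\big)+12U\,\partial_\theta(\cos\theta\,\xi)\Big]\partial_\theta h_2\Big\}\sin\theta\,d\theta .\end{aligned}$$ **Proposition.** The integrand of $\mathcal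 I_{\mathcal B}(\Psi)$ is integrable on $(0,\pi)$, and $$A\ \ge\ \frac{4\sqrt{2^{1+s}}\,\pi^2}{p}\,\exp\!\Big(\frac{\mathcal I_{\mathcal B}(\Psi)-\beta_\xi^s}{2\alpha_\xi}\Big),$$ that is, with the constant $4\sqrt2\,\pi^2/p$ for $S^3$ and $L(p,q)$, and $8\pi^2$ for $S^1\times S^2$. -/

import Mathlib

open scoped Manifold ContDiff ENNReal

noncomputable section

namespace BiaxialMOTS

/-! ### Tensor fields and local coordinates on `n`-manifolds -/

section General

variable {n : ℕ} {N : Type*} [TopologicalSpace N] [ChartedSpace (EuclideanSpace ℝ (Fin n)) N]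

/-- `σ`, restricted to the open set `V`, is a smooth local parametrization of `N`
(a local diffeomorphism onto its image), i.e. a system of local coordinates. -/
structure IsLocalCoord (σ : (Fin n → ℝ) → N) (V : Set (Fin n → ℝ)) : Prop where
  isOpen : IsOpen V
  smooth : ContMDiffOn 𝓘(ℝ, Fin n → ℝ) (𝓡 n) ∞ σ V
  bijective : ∀ y ∈ V, Function.Bijective (mfderiv 𝓘(ℝ, Fin n → ℝ) (𝓡 n) σ y)

/-- The coordinate vector field `∂_a` of the parametrization `σ`. -/
def coordVec (σ : (Fin n → ℝ) → N) (y : Fin n → ℝ) (a : Fin n) : TangentSpace (𝓡 n) (σ y) :=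
  mfderiv 𝓘(ℝ, Fin n → ℝ) (𝓡 n) σ y (Pi.single a (1 : ℝ) : Fin n → ℝ)

variable (n N) in
/-- Fields of bilinear forms on the tangent spaces of `N`. -/
abbrev TwoTensor := ∀ m : N, LinearMap.BilinForm ℝ (TangentSpace (𝓡 n) m)

variable (n N) in
/-- Fields of alternating `n`-forms on the tangent spaces of the `n`-manifold `N`. -/
abbrev TopForm := ∀ m : N, (TangentSpace (𝓡 n) m) [⋀^Fin n]→ₗ[ℝ] ℝ

/-- The components `h_{ab}` of a bilinear form field in local coordinates. -/
def comp (h : TwoTensor n N) (σ : (Fin n → ℝ) → N) (y : Fin n → ℝ) : Matrix (Fin n) (Fin n) ℝ :=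
  Matrix.of fun a b => h (σ y) (coordVec σ y a) (coordVec σ y b)

/-- A bilinear form field is smooth if its components are smooth in all local coordinates. -/
def IsSmoothTensor (h : TwoTensor n N) : Prop :=
  ∀ σ V, IsLocalCoord (N := N) σ V → ∀ a b, ContDiffOn ℝ ∞ (fun y => comp h σ y a b) V

/-- `vol` is the metric volume form of `h` for one of the orientations of `N`; an orientation of
`N` is encoded by the choice of such a form. -/
structure IsVolumeForm (h : TwoTensor n N) (vol : TopForm n N) : Prop where
  sq_eq : ∀ m (v : Fin n → TangentSpace (𝓡 n) m),
    vol m v ^ 2 = |(Matrix.of fun i j => h m (v i) (v j)).det|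
  continuous : ∀ σ V, IsLocalCoord (N := N) σ V →
    ContinuousOn (fun y => vol (σ y) (coordVec σ y)) V

/-- The Riemannian volume of `(N, h)`: the supremum of the total volumes of finite families of
pairwise disjoint, injectively parametrized coordinate patches. -/
def riemannianVolume (h : TwoTensor n N) : ℝ≥0∞ :=
  ⨆ (k : ℕ) (σ : Fin k → (Fin n → ℝ) → N) (V : Fin k → Set (Fin n → ℝ))
    (_ : (∀ j, IsLocalCoord (σ j) (V j) ∧ Set.InjOn (σ j) (V j)) ∧
      Pairwise fun i j => Disjoint (σ i '' V i) (σ j '' V j)),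
    ∑ j, ∫⁻ y in V j, ENNReal.ofReal (Real.sqrt (comp h (σ j) y).det)

/-- The differential of a real function. -/
def dfun (f : N → ℝ) (m : N) (v : TangentSpace (𝓡 n) m) : ℝ :=
  mfderiv (𝓡 n) 𝓘(ℝ, ℝ) f m v

/-! ### Torus actions -/

/-- The group `U(1)²`. -/
abbrev Torus : Type := Circle × Circle

/-- The element of angle `t` in the `i`-th circle factor of `U(1)²`. -/
def rotation (i : Fin 2) (t : ℝ) : Torus :=
  if i = 0 then (Circle.exp t, 1) else (1, Circle.exp t)

variable [MulAction Torus N]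

variable (n N) in
/-- The action of `U(1)²` on `N` is smooth. -/
def IsSmoothAction : Prop :=
  ContMDiff (((𝓡 1).prod (𝓡 1)).prod (𝓡 n)) (𝓡 n) ∞ (fun z : Torus × N => z.1 • z.2)

/-- The generators `η_(1)`, `η_(2)` (here `i = 0, 1`) of the `U(1)²` action, with
`2π`-periodic flows. -/
def generator (i : Fin 2) (m : N) : TangentSpace (𝓡 n) m :=
  mfderiv 𝓘(ℝ, ℝ) (𝓡 n) (fun t : ℝ => rotation i t • m) 0 (1 : ℝ)

/-- The bilinear form field `h` is invariant under the `U(1)²` action. -/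
def IsInvariant (h : TwoTensor n N) : Prop :=
  ∀ (t : Torus) (m : N) (v w : TangentSpace (𝓡 n) m),
    h (t • m) (mfderiv (𝓡 n) (𝓡 n) (fun m' : N => t • m') m v)
      (mfderiv (𝓡 n) (𝓡 n) (fun m' : N => t • m') m w) = h m v w

end General

/-! ### Coordinate expressions of curvature and of the field equations -/

section Coordinates

/-- Partial derivative in the `a`-th coordinate. -/
def pd {n : ℕ} (a : Fin n) (f : (Fin n → ℝ) → ℝ) (y : Fin n → ℝ) : ℝ :=
  fderiv ℝ f y (Pi.single a 1)

/-- Christoffel symbols `Γ^c_{ab}` of the metric with component matrix `G`. -/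
def christoffel {n : ℕ} (G : (Fin n → ℝ) → Matrix (Fin n) (Fin n) ℝ) (c a b : Fin n)
    (y : Fin n → ℝ) : ℝ :=
  1 / 2 * ∑ d, (G y)⁻¹ c d *
    (pd a (fun z => G z d b) y + pd b (fun z => G z d a) y - pd d (fun z => G z a b) y)

/-- Ricci tensor `R_{ab}` of the metric with component matrix `G`. -/
def ricci {n : ℕ} (G : (Fin n → ℝ) → Matrix (Fin n) (Fin n) ℝ) (a b : Fin n)
    (y : Fin n → ℝ) : ℝ :=
  ∑ c, (pd c (christoffel G c a b) y - pd b (christoffel G c a c) y) +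
    ∑ c, ∑ d, (christoffel G c c d y * christoffel G d a b y -
      christoffel G c b d y * christoffel G d a c y)

/-- Both indices of a two-tensor raised: `τ^{ab} = G^{ac} G^{bd} τ_{cd}`. -/
def raise {n : ℕ} (G τ : Matrix (Fin n) (Fin n) ℝ) : Matrix (Fin n) (Fin n) ℝ :=
  Matrix.of fun a b => ∑ c, ∑ d, G⁻¹ a c * G⁻¹ b d * τ c d

/-- `|F|² = F_{ab} F^{ab}`. -/
def normSq {n : ℕ} (G τ : Matrix (Fin n) (Fin n) ℝ) : ℝ := ∑ a, ∑ b, τ a b * raise G τ a b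

/-- `F_{ac} F_b{}^c`. -/
def contract {n : ℕ} (G τ : Matrix (Fin n) (Fin n) ℝ) (a b : Fin n) : ℝ :=
  ∑ c, ∑ d, G⁻¹ c d * τ a c * τ b d

end Coordinates

/-! ### Bi-axisymmetric solutions of five dimensional minimal supergravity -/

section Spacetime

variable {M : Type*} [TopologicalSpace M] [ChartedSpace (EuclideanSpace ℝ (Fin 5)) M]

/-- `g` is a smooth Lorentzian metric of signature `(-,+,+,+,+)`. -/
structure IsLorentzianMetric (g : TwoTensor 5 M) : Prop where
  smooth : IsSmoothTensor g
  signature : ∀ m, ∃ e : Module.Basis (Fin 5) ℝ (TangentSpace (𝓡 5) m),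
    ∀ a b, g m (e a) (e b) = if a = b then (if a = 0 then -1 else 1) else 0

/-- The components `(⋆F)_{cde} = ½ F^{ab} ε_{abcde}` of the Hodge dual of a two-form. -/
def starComp (g F : TwoTensor 5 M) (vol : TopForm 5 M) (σ : (Fin 5 → ℝ) → M) (c d e : Fin 5)
    (y : Fin 5 → ℝ) : ℝ :=
  1 / 2 * ∑ a, ∑ b, raise (comp g σ y) (comp F σ y) a b *
    vol (σ y) ![coordVec σ y a, coordVec σ y b, coordVec σ y c, coordVec σ y d, coordVec σ y e]

/-- The closedness of `F` and the field equations
`R_{ab} = ½ F_{ac} F_b{}^c - (1/12) |F|² g_{ab} + 4 Λ g_{ab}` and `d ⋆F + (1/√3) F ∧ F = 0`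
at the point with coordinates `y`. -/
structure FieldEquationsAt (Λ : ℝ) (g F : TwoTensor 5 M) (vol : TopForm 5 M)
    (σ : (Fin 5 → ℝ) → M) (y : Fin 5 → ℝ) : Prop where
  closed : ∀ a b c, pd a (fun z => comp F σ z b c) y + pd b (fun z => comp F σ z c a) y +
    pd c (fun z => comp F σ z a b) y = 0
  einstein : ∀ a b, ricci (comp g σ) a b y =
    1 / 2 * contract (comp g σ y) (comp F σ y) a b -
      1 / 12 * normSq (comp g σ y) (comp F σ y) * comp g σ y a b + 4 * Λ * comp g σ y a b
  maxwell : ∀ a b c d,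
    (pd a (starComp g F vol σ b c d) y - pd b (starComp g F vol σ a c d) y +
      pd c (starComp g F vol σ a b d) y - pd d (starComp g F vol σ a b c) y) +
    1 / Real.sqrt 3 * (2 * (comp F σ y a b * comp F σ y c d - comp F σ y a c * comp F σ y b d +
      comp F σ y a d * comp F σ y b c)) = 0

variable [MulAction Torus M]

/-- `(M, g, F)`, oriented by the volume form `vol`, is a bi-axisymmetric solution of minimal
supergravity with cosmological constant `Λ`. -/
structure IsBiaxisymmetricSolution (Λ : ℝ) (g F : TwoTensor 5 M) (vol : TopForm 5 M) :
    Prop where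
  lorentzian : IsLorentzianMetric g
  alternating : ∀ m v, F m v v = 0
  smooth : IsSmoothTensor F
  oriented : IsVolumeForm g vol
  action : IsSmoothAction 5 M
  invariant_metric : IsInvariant g
  invariant_field : IsInvariant F
  field_equations : ∀ σ V, IsLocalCoord (N := M) σ V →
    ∀ y ∈ V, FieldEquationsAt Λ g F vol σ y

/-- The metric dual `η_(i)♭` of a generator, in components. -/
def generatorFlat (g : TwoTensor 5 M) (σ : (Fin 5 → ℝ) → M) (i : Fin 2) (a : Fin 5)
    (y : Fin 5 → ℝ) : ℝ :=
  g (σ y) (generator i (σ y)) (coordVec σ y a)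

/-- The components of the two-form `d η_(i)♭`. -/
def dGeneratorFlat (g : TwoTensor 5 M) (σ : (Fin 5 → ℝ) → M) (i : Fin 2) (y : Fin 5 → ℝ) :
    Matrix (Fin 5) (Fin 5) ℝ :=
  Matrix.of fun a b => pd a (generatorFlat g σ i b) y - pd b (generatorFlat g σ i a) y

/-- The electric one-form `Υ = -ι_{η_(1)} ι_{η_(2)} ⋆F`, i.e.
`Υ_e = -½ F^{ab} ε_{abcde} η_(2)^c η_(1)^d`. -/
def electricForm (g F : TwoTensor 5 M) (vol : TopForm 5 M) (σ : (Fin 5 → ℝ) → M)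
    (y : Fin 5 → ℝ) (v : TangentSpace (𝓡 5) (σ y)) : ℝ :=
  -(1 / 2 * ∑ a, ∑ b, raise (comp g σ y) (comp F σ y) a b *
    vol (σ y) ![coordVec σ y a, coordVec σ y b, generator 1 (σ y), generator 0 (σ y), v])

/-- The twist one-forms `Θ^i = ⋆(η_(1) ∧ η_(2) ∧ d η_(i))`, i.e.
`Θ^i_e = ½ η_(1)^a η_(2)^b (d η_(i))^{cd} ε_{abcde}`. -/
def twistForm (g : TwoTensor 5 M) (vol : TopForm 5 M) (σ : (Fin 5 → ℝ) → M) (i : Fin 2)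
    (y : Fin 5 → ℝ) (v : TangentSpace (𝓡 5) (σ y)) : ℝ :=
  1 / 2 * ∑ c, ∑ d, raise (comp g σ y) (dGeneratorFlat g σ i y) c d *
    vol (σ y) ![generator 0 (σ y), generator 1 (σ y), coordVec σ y c, coordVec σ y d, v]

end Spacetime

/-! ### Bi-axisymmetric stable MOTS -/

section Surface

variable {M : Type*} [TopologicalSpace M] [ChartedSpace (EuclideanSpace ℝ (Fin 5)) M]
variable {B : Type*} [TopologicalSpace B] [ChartedSpace (EuclideanSpace ℝ (Fin 3)) B]

/-- The pullback of `g` to `B` under a map `f : B → M`. -/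
def induced (g : TwoTensor 5 M) (f : B → M) : TwoTensor 3 B := fun b =>
  LinearMap.BilinForm.comp (g (f b)) (mfderiv (𝓡 3) (𝓡 5) f b : _ →ₗ[ℝ] _)
    (mfderiv (𝓡 3) (𝓡 5) f b : _ →ₗ[ℝ] _)

variable [MulAction Torus M] [MulAction Torus B]

/-- `ι : B → M` is a spacelike embedded surface to whose image the generators are tangent,
and on which `U(1)²` acts effectively. -/
structure IsBiaxisymmetricSurface (g : TwoTensor 5 M) (ι : B → M) : Prop where
  embedding : Manifold.IsSmoothEmbedding (𝓡 3) (𝓡 5) ∞ ι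
  spacelike : ∀ b (v : TangentSpace (𝓡 3) b), v ≠ 0 → 0 < induced g ι b v v
  action : IsSmoothAction 3 B
  faithful : FaithfulSMul Torus B
  equivariant : ∀ (t : Torus) b, ι (t • b) = t • ι b

/-- `∂_u` at `Φ (u, r, b)`. -/
def vecU (Φ : ℝ × ℝ × B → M) (u r : ℝ) (b : B) : TangentSpace (𝓡 5) (Φ (u, r, b)) :=
  mfderiv 𝓘(ℝ, ℝ) (𝓡 5) (fun u' : ℝ => Φ (u', r, b)) u (1 : ℝ)

/-- `∂_r` at `Φ (u, r, b)`. -/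
def vecR (Φ : ℝ × ℝ × B → M) (u r : ℝ) (b : B) : TangentSpace (𝓡 5) (Φ (u, r, b)) :=
  mfderiv 𝓘(ℝ, ℝ) (𝓡 5) (fun r' : ℝ => Φ (u, r', b)) r (1 : ℝ)

/-- The vector tangent to the leaf `B(u, r)` at `Φ (u, r, b)` which corresponds to `v`. -/
def vecB (Φ : ℝ × ℝ × B → M) (u r : ℝ) (b : B) (v : TangentSpace (𝓡 3) b) :
    TangentSpace (𝓡 5) (Φ (u, r, b)) :=
  mfderiv (𝓡 3) (𝓡 5) (fun b' : B => Φ (u, r, b')) b v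

/-- The domain `|u| < ε`, `|r| < ε` of the Gaussian null coordinates. -/
def nullDomain (B : Type*) (ε : ℝ) : Set (ℝ × ℝ × B) :=
  Set.Ioo (-ε) ε ×ˢ Set.Ioo (-ε) ε ×ˢ Set.univ

/-- `Φ` gives Gaussian null coordinates `(u, r, y)`, adapted to the `U(1)²` action, near the
surface `ι = Φ (0, 0, ·)`. The metric is `-2 du (dr - α r² du - r β_m dy^m) + γ_{mn} dy^m dy^n`:
`g_{ur} = -1` and `g_{rr} = g_{rm} = 0` everywhere, `g_{um}` vanishes at `r = 0`, and `g_{uu}`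
vanishes to second order at `r = 0`. In particular `n = ∂_u` and `l = ∂_r` are null normals
of the surface with `g(n, l) = -1`. -/
structure IsGaussianNull (g : TwoTensor 5 M) (ι : B → M) (ε : ℝ) (Φ : ℝ × ℝ × B → M) :
    Prop where
  pos : 0 < ε
  smooth : ContMDiffOn (𝓘(ℝ, ℝ).prod (𝓘(ℝ, ℝ).prod (𝓡 3))) (𝓡 5) ∞ Φ (nullDomain B ε)
  injective : Set.InjOn Φ (nullDomain B ε)
  bijective : ∀ z ∈ nullDomain B ε, Function.Bijective
    (mfderiv (𝓘(ℝ, ℝ).prod (𝓘(ℝ, ℝ).prod (𝓡 3))) (𝓡 5) Φ z)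
  base : ∀ b, Φ (0, 0, b) = ι b
  equivariant : ∀ u ∈ Set.Ioo (-ε) ε, ∀ r ∈ Set.Ioo (-ε) ε, ∀ (t : Torus) b,
    Φ (u, r, t • b) = t • Φ (u, r, b)
  metric_rr : ∀ u ∈ Set.Ioo (-ε) ε, ∀ r ∈ Set.Ioo (-ε) ε, ∀ b,
    g (Φ (u, r, b)) (vecR Φ u r b) (vecR Φ u r b) = 0
  metric_ur : ∀ u ∈ Set.Ioo (-ε) ε, ∀ r ∈ Set.Ioo (-ε) ε, ∀ b,
    g (Φ (u, r, b)) (vecU Φ u r b) (vecR Φ u r b) = -1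
  metric_rm : ∀ u ∈ Set.Ioo (-ε) ε, ∀ r ∈ Set.Ioo (-ε) ε, ∀ b v,
    g (Φ (u, r, b)) (vecR Φ u r b) (vecB Φ u r b v) = 0
  metric_um : ∀ u ∈ Set.Ioo (-ε) ε, ∀ b v,
    g (Φ (u, 0, b)) (vecU Φ u 0 b) (vecB Φ u 0 b v) = 0
  metric_uu : ∀ u ∈ Set.Ioo (-ε) ε, ∀ b,
    g (Φ (u, 0, b)) (vecU Φ u 0 b) (vecU Φ u 0 b) = 0
  metric_uu_deriv : ∀ u ∈ Set.Ioo (-ε) ε, ∀ b,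
    deriv (fun r => g (Φ (u, r, b)) (vecU Φ u r b) (vecU Φ u r b)) 0 = 0

/-- The matrix of the induced metric of the leaf `B(u, r)` in a fixed basis of `T_b B`. -/
def leafGram (g : TwoTensor 5 M) (Φ : ℝ × ℝ × B → M) (u r : ℝ) (b : B) :
    Matrix (Fin 3) (Fin 3) ℝ :=
  Matrix.of fun m k => g (Φ (u, r, b))
    (vecB Φ u r b (EuclideanSpace.single m (1 : ℝ) : EuclideanSpace ℝ (Fin 3)))
    (vecB Φ u r b (EuclideanSpace.single k (1 : ℝ) : EuclideanSpace ℝ (Fin 3)))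

/-- The expansion `θ_n = ½ γ^{mn} (𝔏_n γ)_{mn}` of the leaves `B(u, r)` along `n = ∂_u`. -/
def expansion (g : TwoTensor 5 M) (Φ : ℝ × ℝ × B → M) (u r : ℝ) (b : B) : ℝ :=
  1 / 2 * ((leafGram g Φ u r b)⁻¹ *
    Matrix.of fun m k => deriv (fun u' => leafGram g Φ u' r b m k) u).trace

/-- `ι : B → M` is a bi-axisymmetric stable MOTS: for invariant null normals `n`, `l`, extended
by Gaussian null coordinates, `θ_n = 0` and `𝔏_l θ_n ≤ 0` on the surface. -/
structure IsStableMOTS (g : TwoTensor 5 M) (ι : B → M) : Prop where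
  surface : IsBiaxisymmetricSurface g ι
  stable : ∃ ε Φ, IsGaussianNull g ι ε Φ ∧ (∀ b, expansion g Φ 0 0 b = 0) ∧
    ∀ b, deriv (fun r => expansion g Φ 0 r b) 0 ≤ 0

/-! ### The orbit space and the induced harmonic map data -/

/-- `x` parametrizes the orbit space `B / U(1)²` by `[-1, 1]`, with
`dx = C Vol_γ(η_(1), η_(2), ·)`. -/
structure IsOrbitCoordinate (γ : TwoTensor 3 B) (C : ℝ) (x : B → ℝ) : Prop where
  pos : 0 < C
  smooth : ContMDiff (𝓡 3) 𝓘(ℝ, ℝ) ∞ x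
  range_eq : Set.range x = Set.Icc (-1) 1
  eq_iff : ∀ b b', x b = x b' ↔ ∃ t : Torus, b' = t • b
  differential : ∃ vol : TopForm 3 B, IsVolumeForm γ vol ∧
    ∀ b (v : TangentSpace (𝓡 3) b), dfun x b v = C * vol b ![generator 0 b, generator 1 b, v]

/-- The topological type of `B`, in terms of the combinations of the generators that vanish at
the endpoints of the orbit space: `s = 0` for `S³` (`p = 1`, `q = 0`) and the lens spaces
`L(p, q)`, `s = 1` (with `p = 1`, `q = 0`) for the ring `S¹ × S²`. -/
def HasTopology (x : B → ℝ) (p : ℕ) (q : ℤ) (s : ℕ) : Prop :=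
  (s = 0 ∧ 1 ≤ p ∧ IsCoprime (p : ℤ) q ∧
    (∀ b, x b = 1 → (generator 0 b : TangentSpace (𝓡 3) b) = 0) ∧
    (∀ b, x b = -1 → (q : ℝ) • (generator 0 b : TangentSpace (𝓡 3) b) +
      (p : ℝ) • (generator 1 b : TangentSpace (𝓡 3) b) = 0)) ∨
  (s = 1 ∧ p = 1 ∧ q = 0 ∧
    ∀ b, x b = 1 ∨ x b = -1 → (generator 1 b : TangentSpace (𝓡 3) b) = 0)

/-- The Gram matrix `λ_{ij} = γ(η_(i), η_(j))`. -/
def fiberMetric (γ : TwoTensor 3 B) (b : B) : Matrix (Fin 2) (Fin 2) ℝ :=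
  Matrix.of fun i j => γ b (generator i b) (generator j b)

end Surface

/-- Maps `Ψ = (U, V, W, ζ¹, ζ², χ, ψ¹, ψ²)`, as functions of `θ ∈ (0, π)`. -/
structure MapData where
  U : ℝ → ℝ
  V : ℝ → ℝ
  W : ℝ → ℝ
  ζ : Fin 2 → ℝ → ℝ
  χ : ℝ → ℝ
  ψ : Fin 2 → ℝ → ℝ

/-- The matrix `Z` with rows `(1, q)` and `(0, p)`. -/
def lensMatrix (p : ℕ) (q : ℤ) : Matrix (Fin 2) (Fin 2) ℝ := !![1, (q : ℝ); 0, (p : ℝ)]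

section Data

variable {M : Type*} [TopologicalSpace M] [ChartedSpace (EuclideanSpace ℝ (Fin 5)) M]
variable {B : Type*} [TopologicalSpace B] [ChartedSpace (EuclideanSpace ℝ (Fin 3)) B]
variable [MulAction Torus M] [MulAction Torus B]

/-- `Ψ` is the map induced on the orbit space by the surface `ι : B → M` and the fields `g`, `F`,
where `x = cos θ`; for `b ∈ B` off the axes, `θ = arccos (x b)` is its orbit coordinate.
With `λ̄ = Zᵀ λ Z`, the functions `U`, `V`, `W` are defined by
`λ̄₁₁ = e^{2U+V}(1-x) cosh W`, `λ̄₂₂ = e^{2U-V}(1+x) cosh W`, `λ̄₁₂ = e^{2U} √(1-x²) sinh W`,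
and the potentials by `dψ^i = ι_{η_(i)} F`, `dχ = Υ - (1/√3)(ψ¹dψ² - ψ²dψ¹)`,
`dζ^i = Θ^i - ψ^i [dχ + (1/(3√3))(ψ¹dψ² - ψ²dψ¹)]`, all restricted to the surface. -/
structure IsInducedMap (g F : TwoTensor 5 M) (vol : TopForm 5 M) (ι : B → M) (x : B → ℝ)
    (p : ℕ) (q : ℤ) (Ψ : MapData) : Prop where
  metric_zero_zero : ∀ b, -1 < x b → x b < 1 → ∀ θ, θ = Real.arccos (x b) →
    ((lensMatrix p q).transpose * fiberMetric (induced g ι) b * lensMatrix p q) 0 0 =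
      Real.exp (2 * Ψ.U θ + Ψ.V θ) * (1 - x b) * Real.cosh (Ψ.W θ)
  metric_one_one : ∀ b, -1 < x b → x b < 1 → ∀ θ, θ = Real.arccos (x b) →
    ((lensMatrix p q).transpose * fiberMetric (induced g ι) b * lensMatrix p q) 1 1 =
      Real.exp (2 * Ψ.U θ - Ψ.V θ) * (1 + x b) * Real.cosh (Ψ.W θ)
  metric_zero_one : ∀ b, -1 < x b → x b < 1 → ∀ θ, θ = Real.arccos (x b) →
    ((lensMatrix p q).transpose * fiberMetric (induced g ι) b * lensMatrix p q) 0 1 =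
      Real.exp (2 * Ψ.U θ) * Real.sqrt (1 - x b ^ 2) * Real.sinh (Ψ.W θ)
  magnetic_smooth : ∀ i b, -1 < x b → x b < 1 →
    MDifferentiableAt (𝓡 3) 𝓘(ℝ, ℝ) (fun b' => Ψ.ψ i (Real.arccos (x b'))) b
  magnetic : ∀ i b, -1 < x b → x b < 1 → ∀ v : TangentSpace (𝓡 3) b,
    dfun (fun b' => Ψ.ψ i (Real.arccos (x b'))) b v =
      F (ι b) (generator i (ι b)) (mfderiv (𝓡 3) (𝓡 5) ι b v)
  electric_smooth : ∀ b, -1 < x b → x b < 1 →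
    MDifferentiableAt (𝓡 3) 𝓘(ℝ, ℝ) (fun b' => Ψ.χ (Real.arccos (x b'))) b
  electric : ∀ σ V, IsLocalCoord (N := M) σ V → ∀ y ∈ V, ∀ b, σ y = ι b →
    -1 < x b → x b < 1 → ∀ θ, θ = Real.arccos (x b) → ∀ v : TangentSpace (𝓡 3) b,
    dfun (fun b' => Ψ.χ (Real.arccos (x b'))) b v =
      electricForm g F vol σ y (mfderiv (𝓡 3) (𝓡 5) ι b v) -
      1 / Real.sqrt 3 * (Ψ.ψ 0 θ * dfun (fun b' => Ψ.ψ 1 (Real.arccos (x b'))) b v -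
        Ψ.ψ 1 θ * dfun (fun b' => Ψ.ψ 0 (Real.arccos (x b'))) b v)
  twist_smooth : ∀ i b, -1 < x b → x b < 1 →
    MDifferentiableAt (𝓡 3) 𝓘(ℝ, ℝ) (fun b' => Ψ.ζ i (Real.arccos (x b'))) b
  twist : ∀ i σ V, IsLocalCoord (N := M) σ V → ∀ y ∈ V, ∀ b, σ y = ι b →
    -1 < x b → x b < 1 → ∀ θ, θ = Real.arccos (x b) → ∀ v : TangentSpace (𝓡 3) b,
    dfun (fun b' => Ψ.ζ i (Real.arccos (x b'))) b v =
      twistForm g vol σ i y (mfderiv (𝓡 3) (𝓡 5) ι b v) -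
      Ψ.ψ i θ * (dfun (fun b' => Ψ.χ (Real.arccos (x b'))) b v +
        1 / (3 * Real.sqrt 3) *
          (Ψ.ψ 0 θ * dfun (fun b' => Ψ.ψ 1 (Real.arccos (x b'))) b v -
            Ψ.ψ 1 θ * dfun (fun b' => Ψ.ψ 0 (Real.arccos (x b'))) b v))

end Data

/-! ### The renormalized area functional -/

/-- `h₁ = ½ log sin θ`. -/
def h₁ (θ : ℝ) : ℝ := 1 / 2 * Real.log (Real.sin θ)

/-- `h₂ = log tan (θ/2)`. -/
def h₂ (θ : ℝ) : ℝ := Real.log (Real.tan (θ / 2))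

/-- `V_s = V + 2 s h₁ + s h₂`. -/
def MapData.Vs (Ψ : MapData) (s : ℕ) (θ : ℝ) : ℝ := Ψ.V θ + 2 * s * h₁ θ + s * h₂ θ

/-- `ψ¹ ∂_θ ψ² - ψ² ∂_θ ψ¹`. -/
def MapData.wronskian (Ψ : MapData) (θ : ℝ) : ℝ :=
  Ψ.ψ 0 θ * deriv (Ψ.ψ 1) θ - Ψ.ψ 1 θ * deriv (Ψ.ψ 0) θ

/-- `Υ_θ = ∂_θ χ + (1/√3)(ψ¹ ∂_θ ψ² - ψ² ∂_θ ψ¹)`. -/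
def MapData.Υ (Ψ : MapData) (θ : ℝ) : ℝ := deriv Ψ.χ θ + 1 / Real.sqrt 3 * Ψ.wronskian θ

/-- `Θ^i_θ = ∂_θ ζ^i + ψ^i (∂_θ χ + (1/(3√3))(ψ¹ ∂_θ ψ² - ψ² ∂_θ ψ¹))`. -/
def MapData.Θ (Ψ : MapData) (i : Fin 2) (θ : ℝ) : ℝ :=
  deriv (Ψ.ζ i) θ + Ψ.ψ i θ * (deriv Ψ.χ θ + 1 / (3 * Real.sqrt 3) * Ψ.wronskian θ)

/-- `Θ̄_θ = Zᵀ Θ_θ`. -/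
def MapData.Θbar (Ψ : MapData) (p : ℕ) (q : ℤ) (i : Fin 2) (θ : ℝ) : ℝ :=
  ((lensMatrix p q).transpose.mulVec fun j => Ψ.Θ j θ) i

/-- `ψ̄ = Zᵀ ψ`. -/
def MapData.ψbar (Ψ : MapData) (p : ℕ) (q : ℤ) (i : Fin 2) (θ : ℝ) : ℝ :=
  ((lensMatrix p q).transpose.mulVec fun j => Ψ.ψ j θ) i

open Real in
/-- The integrand of the area functional; `ξ` is a function of `x = cos θ`. -/
def areaIntegrand (Λ A : ℝ) (p : ℕ) (q : ℤ) (s : ℕ) (ξ : ℝ → ℝ) (Ψ : MapData) (θ : ℝ) : ℝ :=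
  ξ (cos θ) *
    (12 * deriv Ψ.U θ ^ 2 + deriv (Ψ.Vs s) θ ^ 2 + deriv Ψ.W θ ^ 2 +
      sinh (Ψ.W θ) ^ 2 * (deriv Ψ.V θ + deriv h₂ θ) ^ 2 +
      p ^ 2 * (exp (-6 * h₁ θ - h₂ θ - 6 * Ψ.U θ - Ψ.V θ) / cosh (Ψ.W θ)) *
        Ψ.Θbar p q 0 θ ^ 2 +
      p ^ 2 * exp (-6 * h₁ θ + h₂ θ - 6 * Ψ.U θ + Ψ.V θ) * cosh (Ψ.W θ) *
        (exp (-h₂ θ - Ψ.V θ) * tanh (Ψ.W θ) * Ψ.Θbar p q 0 θ - Ψ.Θbar p q 1 θ) ^ 2 +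
      exp (-2 * h₁ θ - h₂ θ - 2 * Ψ.U θ - Ψ.V θ) / cosh (Ψ.W θ) *
        deriv (Ψ.ψbar p q 0) θ ^ 2 +
      exp (-2 * h₁ θ + h₂ θ - 2 * Ψ.U θ + Ψ.V θ) * cosh (Ψ.W θ) *
        (exp (-h₂ θ - Ψ.V θ) * tanh (Ψ.W θ) * deriv (Ψ.ψbar p q 0) θ -
          deriv (Ψ.ψbar p q 1) θ) ^ 2 +
      p ^ 2 * exp (-4 * h₁ θ - 4 * Ψ.U θ) * Ψ.Υ θ ^ 2 +
      3 * p ^ 2 * Λ * (A / (2 * √2 * π ^ 2)) ^ 2 * exp (-4 * Ψ.U θ) -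
      (ξ (cos θ))⁻¹ *
        (2 * Ψ.Vs s θ * deriv (fun t => (1 - 2 * s * cos (t / 2) ^ 2) * ξ (cos t)) θ +
          12 * Ψ.U θ * deriv (fun t => cos t * ξ (cos t)) θ) * deriv h₂ θ) *
    sin θ

/-- The renormalized area functional `I_B(Ψ)`. -/
def areaFunctional (Λ A : ℝ) (p : ℕ) (q : ℤ) (s : ℕ) (ξ : ℝ → ℝ) (Ψ : MapData) : ℝ :=
  1 / 4 * ∫ θ in (0 : ℝ)..Real.pi, areaIntegrand Λ A p q s ξ Ψ θ

/-- `α_ξ = (ξ(1) + ξ(-1)) / 2`. -/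
def alphaConst (ξ : ℝ → ℝ) : ℝ := (ξ 1 + ξ (-1)) / 2

/-- `β_ξ^s = ∫₀^π ((∂_θ ξ)² / (4 ξ) + (3 + s)/4 ξ) sin θ dθ`. -/
def betaConst (s : ℕ) (ξ : ℝ → ℝ) : ℝ :=
  ∫ θ in (0 : ℝ)..Real.pi,
    (deriv (fun t => ξ (Real.cos t)) θ ^ 2 / (4 * ξ (Real.cos θ)) +
      (3 + s) / 4 * ξ (Real.cos θ)) * Real.sin θ

end BiaxialMOTS

end

open scoped Manifold ContDiff ENNReal

noncomputable section

set_option linter.unusedSectionVars false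

namespace BiaxialMOTS

open Filter Topology MeasureTheory
open scoped Real
open Real (exp log cos sin sqrt cosh sinh arccos exp_sub exp_nat_mul log_mul log_div exp_pos
  sqrt_pos sq_sqrt exp_add hasDerivAt_cos exp_neg sin_pos_of_pos_of_lt_pi)
open Function (invFunOn invFunOn_mem invFunOn_eq)
open ContinuousLinearMap (proj)
open Fin (sum_univ_two)
open Finset (sum_congr mul_sum)
open Set (Ioo Icc Ioc InjOn Ico Ioo_subset_Icc_self)

local notation "𝔼" n:max => EuclideanSpace ℝ (Fin n)

local notation "𝕀" => Set.Ioo (-1 : ℝ) 1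

section MatrixInverse

attribute [local instance] Matrix.linftyOpNormedRing Matrix.linftyOpNormedAlgebra

lemma hasFDerivAt_matrix_inv {n : ℕ} {E : Type*} [NormedAddCommGroup E] [NormedSpace ℝ E]
    {G : E → Matrix (Fin n) (Fin n) ℝ} {y : E}
    (hG : ∀ a b, DifferentiableAt ℝ (fun z => G z a b) y) (hdet : (G y).det ≠ 0) (a b : Fin n) :
    DifferentiableAt ℝ (fun z => (G z)⁻¹ a b) y ∧ ∀ v, fderiv ℝ (fun z => (G z)⁻¹ a b) y v =
        -∑ d, ∑ e, (G y)⁻¹ a d * fderiv ℝ (fun z => G z d e) y v * (G y)⁻¹ e b := by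
  have hGd : DifferentiableAt ℝ G y := by
    have : G = fun z => ∑ i, ∑ j, G z i j • Matrix.single i j (1 : ℝ) := by
      funext z
      simp only [Matrix.smul_single, smul_eq_mul, mul_one]
      exact Matrix.matrix_eq_sum_single (G z)
    rw [this]
    fun_prop
  let ent : Fin n → Fin n → Matrix (Fin n) (Fin n) ℝ →L[ℝ] ℝ := fun i j =>
    LinearMap.toContinuousLinearMap
      { toFun := fun X : Matrix (Fin n) (Fin n) ℝ => X i j
        map_add' := fun _ _ => rfl
        map_smul' := fun _ _ => rfl }
  have hent : ∀ i j (X : Matrix (Fin n) (Fin n) ℝ), ent i j X = X i j := fun _ _ _ => rfl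
  have hunit : IsUnit (G y) := (Matrix.isUnit_iff_isUnit_det _).2 (isUnit_iff_ne_zero.2 hdet)
  have hinv : (fun z => (G z)⁻¹ a b) = fun z => ent a b (Ring.inverse (G z)) := by
    funext z; rw [hent, Matrix.nonsing_inv_eq_ringInverse]
  have h1 : HasFDerivAt (Ring.inverse : Matrix (Fin n) (Fin n) ℝ → Matrix (Fin n) (Fin n) ℝ)
      (-ContinuousLinearMap.mulLeftRight ℝ (Matrix (Fin n) (Fin n) ℝ)
        (hunit.unit⁻¹ : (Matrix (Fin n) (Fin n) ℝ)ˣ) (hunit.unit⁻¹ : (Matrix (Fin n) (Fin n) ℝ)ˣ))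
      (G y) :=
    hasFDerivAt_ringInverse (𝕜 := ℝ) hunit.unit
  have h2 := (ent a b).hasFDerivAt.comp y (h1.comp y hGd.hasFDerivAt)
  have h3 : ((hunit.unit⁻¹ : (Matrix (Fin n) (Fin n) ℝ)ˣ) : Matrix (Fin n) (Fin n) ℝ) = (G y)⁻¹ := by
    rw [← Ring.inverse_unit, Matrix.nonsing_inv_eq_ringInverse]; simp
  have h4 : ∀ v i j, fderiv ℝ G y v i j = fderiv ℝ (fun z => G z i j) y v := by
    intro v i j
    have := (ent i j).hasFDerivAt.comp y hGd.hasFDerivAt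
    have h5 : (fun z => G z i j) = (ent i j) ∘ G := rfl
    rw [h5, this.fderiv]; rfl
  have h6 := h2.congr_of_eventuallyEq (f₁ := fun z => (G z)⁻¹ a b)
    (Filter.Eventually.of_forall fun z => congrFun hinv z)
  refine ⟨h6.differentiableAt, fun v => ?_⟩
  rw [h6.fderiv]
  rw [h3]
  change -(((G y)⁻¹ * fderiv ℝ G y v * (G y)⁻¹) a b) = _
  congr 1
  rw [Matrix.mul_apply]
  simp only [Matrix.mul_apply, h4, Finset.sum_mul]
  exact Finset.sum_comm

end MatrixInverse

section Jets

variable {n : ℕ} {G : (Fin n → ℝ) → Matrix (Fin n) (Fin n) ℝ} {y : Fin n → ℝ}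

lemma differentiableAt_pd {f : (Fin n → ℝ) → ℝ} (hf : ContDiffAt ℝ 2 f y) (a : Fin n) :
    DifferentiableAt ℝ (pd a f) y := by
  have h : DifferentiableAt ℝ (fderiv ℝ f) y :=
    (hf.fderiv_right (m := 1) (by norm_num)).differentiableAt (by norm_num)
  exact h.clm_apply (differentiableAt_const _)

lemma pd_comm {f : (Fin n → ℝ) → ℝ} (hf : ContDiffAt ℝ 2 f y) (a b : Fin n) :
    pd a (pd b f) y = pd b (pd a f) y := by
  have h : DifferentiableAt ℝ (fderiv ℝ f) y :=
    (hf.fderiv_right (m := 1) (by norm_num)).differentiableAt (by norm_num)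
  have key : ∀ c d : Fin n, pd c (pd d f) y =
      fderiv ℝ (fderiv ℝ f) y (Pi.single c 1) (Pi.single d 1) := by
    intro c d
    have := (h.hasFDerivAt.clm_apply (hasFDerivAt_const (Pi.single d (1 : ℝ)) y)).fderiv
    unfold pd
    rw [this]; simp
  rw [key, key]
  exact (hf.isSymmSndFDerivAt (by simp)).eq _ _

/-- First derivatives of the Christoffel symbols in terms of the two-jet of the metric. -/
lemma pd_christoffel (hG : ∀ a b, ContDiffAt ℝ 2 (fun z => G z a b) y) (hdet : (G y).det ≠ 0)
    (e c a b : Fin n) :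
    pd e (christoffel G c a b) y = 1 / 2 * ∑ d,
      ((-∑ f, ∑ h, (G y)⁻¹ c f * pd e (fun z => G z f h) y * (G y)⁻¹ h d) *
        (pd a (fun z => G z d b) y + pd b (fun z => G z d a) y - pd d (fun z => G z a b) y) +
      (G y)⁻¹ c d * (pd e (pd a fun z => G z d b) y + pd e (pd b fun z => G z d a) y -
        pd e (pd d fun z => G z a b) y)) := by
  have hGd : ∀ a b, DifferentiableAt ℝ (fun z => G z a b) y := fun a b =>
    (hG a b).differentiableAt (by norm_num)
  have hterm : ∀ d, HasFDerivAt (fun z => (G z)⁻¹ c d *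
      (pd a (fun z => G z d b) z + pd b (fun z => G z d a) z - pd d (fun z => G z a b) z))
      ((G y)⁻¹ c d • (fderiv ℝ (pd a fun z => G z d b) y + fderiv ℝ (pd b fun z => G z d a) y -
        fderiv ℝ (pd d fun z => G z a b) y) +
        (pd a (fun z => G z d b) y + pd b (fun z => G z d a) y - pd d (fun z => G z a b) y) •
          fderiv ℝ (fun z => (G z)⁻¹ c d) y) y := by
    intro d
    have h1 := (hasFDerivAt_matrix_inv hGd hdet c d).1.hasFDerivAt
    have h2 := (((differentiableAt_pd (hG d b) a).hasFDerivAt.add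
      (differentiableAt_pd (hG d a) b).hasFDerivAt).sub
      (differentiableAt_pd (hG a b) d).hasFDerivAt)
    exact h1.mul h2
  have hsum := (HasFDerivAt.fun_sum (u := Finset.univ) fun d _ => hterm d).const_mul (1 / 2 : ℝ)
  refine (congrArg (fun L : (Fin n → ℝ) →L[ℝ] ℝ => L (Pi.single e (1 : ℝ))) hsum.fderiv).trans ?_
  simp only [_root_.smul_apply, _root_.sum_apply, _root_.add_apply, _root_.sub_apply, smul_eq_mul,
    (hasFDerivAt_matrix_inv hGd hdet c _).2]
  congr 1
  refine sum_congr rfl fun d _ => ?_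
  unfold pd
  ring

end Jets

section NullFrame

/-- The partner of an index in the null frame `(u, r, 2, 3, 4)`. -/
def nullPartner : Fin 5 → Fin 5 := ![1, 0, 2, 3, 4]

/-- The sign of the pairing of an index with its partner in the null frame. -/
def nullSign : Fin 5 → ℝ := ![-1, -1, 1, 1, 1]

/-- The matrix of a metric in a null frame whose spacelike part is orthonormal. -/
def nullFrame : Matrix (Fin 5) (Fin 5) ℝ :=
  Matrix.of fun a b => if b = nullPartner a then nullSign a else 0

lemma sum_nullFrame_mul (a : Fin 5) (f : Fin 5 → ℝ) :
    ∑ d, nullFrame a d * f d = nullSign a * f (nullPartner a) := by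
  simp [nullFrame]

lemma nullFrame_mul_self : nullFrame * nullFrame = 1 := by
  ext a b
  rw [Matrix.mul_apply, sum_nullFrame_mul]
  fin_cases a <;> fin_cases b <;> simp [nullFrame, nullPartner, nullSign]

lemma nullFrame_inv : nullFrame⁻¹ = nullFrame := Matrix.inv_eq_left_inv nullFrame_mul_self

lemma nullFrame_det_ne_zero : nullFrame.det ≠ 0 := by
  intro h
  have := congrArg Matrix.det nullFrame_mul_self
  simp [h] at this

variable {G : (Fin 5 → ℝ) → Matrix (Fin 5) (Fin 5) ℝ} {y : Fin 5 → ℝ}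

lemma christoffel_nullFrame (h0 : G y = nullFrame) (c a b : Fin 5) :
    christoffel G c a b y = 1 / 2 * (nullSign c * (pd a (fun z => G z (nullPartner c) b) y +
      pd b (fun z => G z (nullPartner c) a) y - pd (nullPartner c) (fun z => G z a b) y)) := by
  rw [christoffel, h0, nullFrame_inv, sum_nullFrame_mul]

lemma pd_christoffel_nullFrame (hG : ∀ a b, ContDiffAt ℝ 2 (fun z => G z a b) y)
    (h0 : G y = nullFrame) (e c a b : Fin 5) :
    pd e (christoffel G c a b) y = 1 / 2 * (nullSign c *
      (pd e (pd a fun z => G z (nullPartner c) b) y + pd e (pd b fun z => G z (nullPartner c) a) y -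
        pd e (pd (nullPartner c) fun z => G z a b) y) -
      nullSign c * ∑ h, pd e (fun z => G z (nullPartner c) h) y * (nullSign h *
        (pd a (fun z => G z (nullPartner h) b) y + pd b (fun z => G z (nullPartner h) a) y -
          pd (nullPartner h) (fun z => G z a b) y))) := by
  rw [pd_christoffel hG (by rw [h0]; exact nullFrame_det_ne_zero), h0, nullFrame_inv,
    Finset.sum_add_distrib, sum_nullFrame_mul]
  congr 1
  rw [add_comm, sub_eq_add_neg]
  congr 1
  have key : ∀ d, (∑ f, ∑ h, nullFrame c f * pd e (fun z => G z f h) y * nullFrame h d) =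
      nullSign c * ∑ h, pd e (fun z => G z (nullPartner c) h) y * nullFrame h d := by
    intro d
    rw [← sum_nullFrame_mul c fun f => ∑ h, pd e (fun z => G z f h) y * nullFrame h d]
    simp only [mul_sum, mul_assoc]
  simp only [key, neg_mul, Finset.sum_neg_distrib, mul_sum, Finset.sum_mul]
  rw [Finset.sum_comm]
  refine congrArg Neg.neg (sum_congr rfl fun h _ => ?_)
  rw [← sum_nullFrame_mul h fun x => pd a (fun z => G z x b) y + pd b (fun z => G z x a) y -
    pd x (fun z => G z a b) y, mul_sum, mul_sum]
  exact sum_congr rfl fun d _ => by ring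

lemma ricci_nullFrame_trace (hG : ∀ a b, ContDiffAt ℝ 2 (fun z => G z a b) y)
    (h0 : G y = nullFrame) (hsymm : ∀ z a b, G z a b = G z b a)
    (hc3 : ∀ a b, pd 3 (fun z => G z a b) =ᶠ[nhds y] 0)
    (hc4 : ∀ a b, pd 4 (fun z => G z a b) =ᶠ[nhds y] 0)
    (hc1 : ∀ a b, pd a (fun z => G z b 1) =ᶠ[nhds y] 0) (hu : ∀ a, pd a (fun z => G z 0 0) y = 0)
    (hum : ∀ b, b ≠ 0 → b ≠ 1 → pd 0 (fun z => G z 0 b) y = 0 ∧ pd 2 (fun z => G z 0 b) y = 0)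
    (hx : ∀ b, b = 3 ∨ b = 4 → pd 2 (fun z => G z 2 b) y = 0)
    (hD : pd 2 (fun z => G z 2 2) y = -(pd 2 (fun z => G z 3 3) y + pd 2 (fun z => G z 4 4) y))
    (htr : pd 0 (fun z => G z 2 2) y + pd 0 (fun z => G z 3 3) y + pd 0 (fun z => G z 4 4) y = 0) :
    ricci G 2 2 y + ricci G 3 3 y + ricci G 4 4 y =
      -(pd 2 (pd 2 fun z => G z 3 3) y + pd 2 (pd 2 fun z => G z 4 4) y) -
      3 / 2 * (pd 2 (fun z => G z 3 3) y * pd 2 (fun z => G z 4 4) y -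
        pd 2 (fun z => G z 3 4) y ^ 2) +
      (pd 1 (pd 0 fun z => G z 2 2) y + pd 1 (pd 0 fun z => G z 3 3) y +
        pd 1 (pd 0 fun z => G z 4 4) y) -
      (pd 0 (fun z => G z 2 2) y * pd 1 (fun z => G z 2 2) y +
        pd 0 (fun z => G z 3 3) y * pd 1 (fun z => G z 3 3) y +
        pd 0 (fun z => G z 4 4) y * pd 1 (fun z => G z 4 4) y +
        2 * pd 0 (fun z => G z 2 3) y * pd 1 (fun z => G z 2 3) y +
        2 * pd 0 (fun z => G z 2 4) y * pd 1 (fun z => G z 2 4) y +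
        2 * pd 0 (fun z => G z 3 4) y * pd 1 (fun z => G z 3 4) y) -
      (pd 2 (pd 1 fun z => G z 0 2) y +
        (pd 2 (fun z => G z 3 3) y + pd 2 (fun z => G z 4 4) y) * pd 1 (fun z => G z 0 2) y) -
      1 / 2 * (pd 1 (fun z => G z 0 2) y ^ 2 + pd 1 (fun z => G z 0 3) y ^ 2 +
        pd 1 (fun z => G z 0 4) y ^ 2) := by
  have hpd0 : ∀ {f : (Fin 5 → ℝ) → ℝ} (a : Fin 5), f =ᶠ[nhds y] 0 → pd a f y = 0 := by
    intro f a hf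
    unfold pd
    rw [hf.fderiv_eq]
    simp
  have e3 : ∀ a b, pd 3 (fun z => G z a b) y = 0 := fun a b => (hc3 a b).self_of_nhds
  have e4 : ∀ a b, pd 4 (fun z => G z a b) y = 0 := fun a b => (hc4 a b).self_of_nhds
  have e1 : ∀ a b, pd a (fun z => G z b 1) y = 0 := fun a b => (hc1 a b).self_of_nhds
  have f3 : ∀ c a b, pd c (pd 3 fun z => G z a b) y = 0 := fun c a b => hpd0 c (hc3 a b)
  have f4 : ∀ c a b, pd c (pd 4 fun z => G z a b) y = 0 := fun c a b => hpd0 c (hc4 a b)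
  have f1 : ∀ c a b, pd c (pd a fun z => G z b 1) y = 0 := fun c a b => hpd0 c (hc1 a b)
  have f3' : ∀ c a b, pd 3 (pd c fun z => G z a b) y = 0 := fun c a b => by
    rw [pd_comm (hG a b), f3]
  have f4' : ∀ c a b, pd 4 (pd c fun z => G z a b) y = 0 := fun c a b => by
    rw [pd_comm (hG a b), f4]
  have s1 : ∀ a b, (fun z => G z a b) = fun z => G z b a := fun a b => funext fun z => hsymm z a b
  have c01 : ∀ a b, pd 0 (pd 1 fun z => G z a b) y = pd 1 (pd 0 fun z => G z a b) y :=
    fun a b => pd_comm (hG a b) 0 1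
  have c12 : ∀ a b, pd 1 (pd 2 fun z => G z a b) y = pd 2 (pd 1 fun z => G z a b) y :=
    fun a b => pd_comm (hG a b) 1 2
  have t2 := (hum 2 (by decide) (by decide))
  have t3 := (hum 3 (by decide) (by decide))
  have t4 := (hum 4 (by decide) (by decide))
  have x3 := hx 3 (Or.inl rfl)
  have x4 := hx 4 (Or.inr rfl)
  have D2 : pd 0 (fun z => G z 2 2) y =
    -(pd 0 (fun z => G z 3 3) y + pd 0 (fun z => G z 4 4) y) := by linarith
  simp only [ricci, christoffel_nullFrame h0, pd_christoffel_nullFrame hG h0, Fin.sum_univ_five]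
  simp only [nullPartner, nullSign, Matrix.cons_val, e3, e4, f3, f4, f3', f4', s1 1 0, s1 1 2,
    s1 1 3, s1 1 4, e1, f1, s1 2 0, s1 3 0, s1 4 0, s1 3 2, s1 4 2, s1 4 3, hu, t2.1, t2.2, t3.1,
    t3.2, t4.1, t4.2, x3, x4, c01, c12, hD, D2]
  ring

lemma raise_nullFrame (τ : Matrix (Fin 5) (Fin 5) ℝ) (a b : Fin 5) :
    raise nullFrame τ a b =
      nullSign a * nullSign b * τ (nullPartner a) (nullPartner b) := by
  simp only [raise, Matrix.of_apply, nullFrame_inv, mul_assoc]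
  simp_rw [← mul_sum]
  rw [sum_nullFrame_mul a fun c => ∑ d, nullFrame b d * τ c d, sum_nullFrame_mul]

/-- The spatial trace of the energy-momentum side of the Einstein equation. -/
lemma matter_nullFrame_trace (Λ : ℝ) {τ : Matrix (Fin 5) (Fin 5) ℝ} (h : ∀ a b, τ a b = -τ b a) :
    (1 / 2 * contract nullFrame τ 2 2 - 1 / 12 * normSq nullFrame τ * nullFrame 2 2 +
        4 * Λ * nullFrame 2 2) +
      (1 / 2 * contract nullFrame τ 3 3 - 1 / 12 * normSq nullFrame τ * nullFrame 3 3 +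
        4 * Λ * nullFrame 3 3) +
      (1 / 2 * contract nullFrame τ 4 4 - 1 / 12 * normSq nullFrame τ * nullFrame 4 4 +
        4 * Λ * nullFrame 4 4) =
      1 / 2 * (τ 2 3 ^ 2 + τ 2 4 ^ 2 + τ 3 4 ^ 2) + 1 / 2 * τ 0 1 ^ 2 + 12 * Λ := by
  have hc : ∀ a, contract nullFrame τ a a =
      ∑ c, nullSign c * (τ a (nullPartner c) * τ a c) := by
    intro a
    simp only [contract, nullFrame_inv, mul_assoc]
    refine sum_congr rfl fun c _ => ?_
    rw [sum_nullFrame_mul c fun d => τ a c * τ a d]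
    ring
  have hd : ∀ a, τ a a = 0 := fun a => by linarith [h a a]
  simp only [hc, normSq, raise_nullFrame, Fin.sum_univ_five]
  simp only [nullFrame, nullPartner, nullSign, Matrix.cons_val, Matrix.of_apply, hd, h 1 0, h 2 0,
    h 3 0, h 4 0, h 2 1, h 3 1, h 4 1, h 3 2, h 4 2, h 4 3, if_true]
  ring

end NullFrame

section TorusAction

/-- The exponential map of the torus. -/
def torusExp (φ : Fin 2 → ℝ) : Torus := (Circle.exp (φ 0), Circle.exp (φ 1))

lemma torusExp_add (φ ψ : Fin 2 → ℝ) : torusExp (φ + ψ) = torusExp φ * torusExp ψ := by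
  simp [torusExp, Circle.exp_add]

@[simp] theorem torusExp_zero : torusExp 0 = 1 := by simp [torusExp]

lemma rotation_eq_torusExp (i : Fin 2) (t : ℝ) : rotation i t = torusExp (Pi.single i t) := by
  fin_cases i <;> simp [rotation, torusExp]

lemma torusExp_surjective : Function.Surjective torusExp := by
  rintro ⟨z, w⟩
  refine ⟨![Complex.arg z, Complex.arg w], ?_⟩
  simp [torusExp]

lemma torusExp_eq_one_iff (φ : Fin 2 → ℝ) :
    torusExp φ = 1 ↔ ∀ i, ∃ k : ℤ, φ i = k * (2 * π) := by
  simp [torusExp, Prod.ext_iff, Fin.forall_fin_two, Circle.exp_eq_one]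

lemma contMDiff_torusExp :
    ContMDiff 𝓘(ℝ, Fin 2 → ℝ) ((𝓡 1).prod (𝓡 1)) ∞ torusExp := by
  have h : ∀ i : Fin 2, ContMDiff 𝓘(ℝ, Fin 2 → ℝ) 𝓘(ℝ, ℝ) ∞ fun φ : Fin 2 → ℝ => φ i := fun i =>
    contMDiff_iff_contDiff.2 (contDiff_apply ℝ ℝ i)
  exact (contMDiff_circleExp.comp (h 0)).prodMk (contMDiff_circleExp.comp (h 1))

variable {n : ℕ} {N : Type*} [TopologicalSpace N] [ChartedSpace (𝔼 n) N]
  [MulAction Torus N]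

lemma IsSmoothAction.contMDiff_smul (hN : IsSmoothAction n N) (t : Torus) :
    ContMDiff (𝓡 n) (𝓡 n) ∞ fun m : N => t • m :=
  ContMDiff.comp (I' := ((𝓡 1).prod (𝓡 1)).prod (𝓡 n)) (g := fun z : Torus × N => z.1 • z.2)
    (f := fun m : N => (t, m)) hN (contMDiff_const.prodMk contMDiff_id)

lemma IsSmoothAction.mdifferentiable_smul (hN : IsSmoothAction n N) (t : Torus) :
    MDifferentiable (𝓡 n) (𝓡 n) fun m : N => t • m :=
  (hN.contMDiff_smul t).mdifferentiable (by simp)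

lemma IsSmoothAction.contMDiff_torusExp_smul (hN : IsSmoothAction n N) :
    ContMDiff (𝓘(ℝ, Fin 2 → ℝ).prod (𝓡 n)) (𝓡 n) ∞
      fun z : (Fin 2 → ℝ) × N => torusExp z.1 • z.2 :=
  ContMDiff.comp (I' := ((𝓡 1).prod (𝓡 1)).prod (𝓡 n)) hN
    ((contMDiff_torusExp.comp contMDiff_fst).prodMk contMDiff_snd)

lemma IsSmoothAction.contMDiff_orbit (hN : IsSmoothAction n N) (m : N) :
    ContMDiff 𝓘(ℝ, Fin 2 → ℝ) (𝓡 n) ∞ fun φ : Fin 2 → ℝ => torusExp φ • m :=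
  ContMDiff.comp (I' := 𝓘(ℝ, Fin 2 → ℝ).prod (𝓡 n)) hN.contMDiff_torusExp_smul
    (contMDiff_id.prodMk contMDiff_const)

lemma IsSmoothAction.mdifferentiable_orbit (hN : IsSmoothAction n N) (m : N) :
    MDifferentiable 𝓘(ℝ, Fin 2 → ℝ) (𝓡 n) fun φ : Fin 2 → ℝ => torusExp φ • m :=
  (hN.contMDiff_orbit m).mdifferentiable (by simp)

/-- The derivative of a map, with the tangent spaces replaced by their model. -/
lemma mfderiv_congr_base {E E' H H' N N' : Type*} [NormedAddCommGroup E] [NormedSpace ℝ E]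
    [NormedAddCommGroup E'] [NormedSpace ℝ E'] [TopologicalSpace H] [TopologicalSpace H']
    {I : ModelWithCorners ℝ E H} {I' : ModelWithCorners ℝ E' H'} [TopologicalSpace N]
    [TopologicalSpace N'] [ChartedSpace H N] [ChartedSpace H' N'] {f f' : N → N'} {x x' : N}
    (hf : f = f') (h : x = x') (v : E) :
    (mfderiv I I' f x (v : E) : E') = (mfderiv I I' f' x' (v : E) : E') := by
  subst h hf; rfl

lemma mfderiv_orbit_zero (hN : IsSmoothAction n N) (m : N) (v : Fin 2 → ℝ) :
    (mfderiv 𝓘(ℝ, Fin 2 → ℝ) (𝓡 n) (fun φ : Fin 2 → ℝ => torusExp φ • m) 0 v :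
      𝔼 n) = ∑ i, v i • (generator i m : 𝔼 n) := by
  have hgen : ∀ i, (generator i m : 𝔼 n) =
      mfderiv 𝓘(ℝ, Fin 2 → ℝ) (𝓡 n) (fun φ : Fin 2 → ℝ => torusExp φ • m) 0
        (Pi.single i (1 : ℝ) : Fin 2 → ℝ) := by
    intro i
    have hl : HasFDerivAt (fun t : ℝ => (Pi.single i t : Fin 2 → ℝ))
        (ContinuousLinearMap.single ℝ (fun _ : Fin 2 => ℝ) i) 0 :=
      (ContinuousLinearMap.single ℝ (fun _ : Fin 2 => ℝ) i).hasFDerivAt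
    have h1 : (fun t : ℝ => rotation i t • m) =
        (fun φ : Fin 2 → ℝ => torusExp φ • m) ∘ fun t : ℝ => (Pi.single i t : Fin 2 → ℝ) := by
      funext t; simp [rotation_eq_torusExp]
    have h2 := mfderiv_comp_apply (I := 𝓘(ℝ, ℝ)) (I' := 𝓘(ℝ, Fin 2 → ℝ)) (I'' := 𝓡 n) (0 : ℝ)
      (f := fun t : ℝ => (Pi.single i t : Fin 2 → ℝ))
      ((hN.mdifferentiable_orbit m) _) hl.hasMFDerivAt.mdifferentiableAt (1 : ℝ)
    unfold generator
    rw [h1]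
    refine h2.trans ?_
    rw [hl.hasMFDerivAt.mfderiv]
    exact mfderiv_congr_base rfl (by simp) _
  conv_lhs => rw [show v = ∑ i, v i • (Pi.single i (1 : ℝ) : Fin 2 → ℝ) from by
    ext j; fin_cases j <;> simp [sum_univ_two]]
  simp only [hgen]
  exact (map_sum _ _ _).trans (sum_congr rfl fun i _ => map_smul _ _ _)

lemma mfderiv_orbit (hN : IsSmoothAction n N) (m : N) (φ v : Fin 2 → ℝ) :
    (mfderiv 𝓘(ℝ, Fin 2 → ℝ) (𝓡 n) (fun φ : Fin 2 → ℝ => torusExp φ • m) φ v :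
      𝔼 n) =
      ∑ i, v i • (generator i (torusExp φ • m) : 𝔼 n) := by
  have hl : HasFDerivAt (fun χ : Fin 2 → ℝ => χ - φ)
        (ContinuousLinearMap.id ℝ (Fin 2 → ℝ)) φ := (hasFDerivAt_id φ).sub_const φ
  have h1 : (fun χ : Fin 2 → ℝ => torusExp χ • m) =
      (fun χ : Fin 2 → ℝ => torusExp χ • torusExp φ • m) ∘ fun χ => χ - φ := by
    funext χ; simp [← mul_smul, ← torusExp_add]
  have h2 := mfderiv_comp_apply (I := 𝓘(ℝ, Fin 2 → ℝ)) (I' := 𝓘(ℝ, Fin 2 → ℝ)) (I'' := 𝓡 n) φ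
      (f := fun χ : Fin 2 → ℝ => χ - φ)
      ((hN.mdifferentiable_orbit (torusExp φ • m)) _) hl.hasMFDerivAt.mdifferentiableAt v
  rw [← mfderiv_orbit_zero hN]
  refine (mfderiv_congr_base h1 rfl v).trans (h2.trans ?_)
  rw [hl.hasMFDerivAt.mfderiv]
  exact mfderiv_congr_base rfl (by simp) _

lemma mfderiv_smul_generator (hN : IsSmoothAction n N) (t : Torus) (i : Fin 2) (m : N) :
    (mfderiv (𝓡 n) (𝓡 n) (fun m' : N => t • m') m (generator i m) : 𝔼 n) =
      generator i (t • m) := by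
  have h1 : (fun s : ℝ => rotation i s • t • m) =
      (fun m' : N => t • m') ∘ fun s : ℝ => rotation i s • m := by
    funext s; simp [← mul_smul, mul_comm]
  have hd : MDifferentiable 𝓘(ℝ, ℝ) (𝓡 n) fun s : ℝ => rotation i s • m := by
    have hl : ContMDiff 𝓘(ℝ, ℝ) 𝓘(ℝ, Fin 2 → ℝ) ∞ fun t : ℝ => (Pi.single i t : Fin 2 → ℝ) :=
      contMDiff_iff_contDiff.2 (ContinuousLinearMap.single ℝ (fun _ : Fin 2 => ℝ) i).contDiff
    simp only [rotation_eq_torusExp]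
    exact ((hN.contMDiff_orbit m).comp hl).mdifferentiable (by simp)
  have h2 := mfderiv_comp_apply (I := 𝓘(ℝ, ℝ)) (I' := 𝓡 n) (I'' := 𝓡 n) (0 : ℝ)
      (f := fun s : ℝ => rotation i s • m) (hN.mdifferentiable_smul t _) (hd 0) (1 : ℝ)
  refine Eq.trans ?_ (h2.symm.trans (mfderiv_congr_base h1.symm rfl (1 : ℝ)))
  exact mfderiv_congr_base rfl (by simp [rotation_eq_torusExp]) _

end TorusAction

section LocalCoordinates

variable {n : ℕ} {N : Type*} [TopologicalSpace N] [ChartedSpace (𝔼 n) N]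
  {E : Type*} [NormedAddCommGroup E] [NormedSpace ℝ E]

lemma hasFDerivAt_extChartAt_comp {f : E → N} {y : E} (hf : MDifferentiableAt 𝓘(ℝ, E) (𝓡 n) f y) :
    HasFDerivAt (extChartAt (𝓡 n) (f y) ∘ f)
      (mfderiv 𝓘(ℝ, E) (𝓡 n) f y : E →L[ℝ] 𝔼 n) y := by
  have := hf.hasMFDerivAt.2
  simp only [writtenInExtChartAt, extChartAt_model_space_eq_id, PartialEquiv.refl_symm,
    PartialEquiv.refl_coe, Function.comp_id, modelWithCornersSelf_coe, Set.range_id, id] at this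
  exact hasFDerivWithinAt_univ.1 this

lemma contDiffAt_extChartAt_comp {f : E → N} {y : E} (hf : ContMDiffAt 𝓘(ℝ, E) (𝓡 n) ∞ f y) :
    ContDiffAt ℝ ∞ (extChartAt (𝓡 n) (f y) ∘ f) y :=
  (contMDiffAt_iff_target.1 hf).2.contDiffAt

variable {σ : (Fin n → ℝ) → N} {V : Set (Fin n → ℝ)} {y : Fin n → ℝ}

lemma IsLocalCoord.contMDiffAt (hσ : IsLocalCoord σ V) (hy : y ∈ V) :
    ContMDiffAt 𝓘(ℝ, Fin n → ℝ) (𝓡 n) ∞ σ y :=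
  hσ.smooth.contMDiffAt (hσ.isOpen.mem_nhds hy)

lemma IsLocalCoord.mdifferentiableAt (hσ : IsLocalCoord σ V) (hy : y ∈ V) :
    MDifferentiableAt 𝓘(ℝ, Fin n → ℝ) (𝓡 n) σ y :=
  (hσ.contMDiffAt hy).mdifferentiableAt (by simp)

/-- The derivative of a map from a normed space into a manifold, with the tangent spaces
identified with their models. -/
def modelDeriv (f : E → N) (y : E) : E →L[ℝ] 𝔼 n :=
  mfderiv 𝓘(ℝ, E) (𝓡 n) f y

/-- The derivative of a local parametrization as a linear equivalence. -/
def IsLocalCoord.derivEquiv (hσ : IsLocalCoord σ V) (hy : y ∈ V) :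
    (Fin n → ℝ) ≃L[ℝ] 𝔼 n :=
  (LinearEquiv.ofBijective (modelDeriv σ y).toLinearMap
    (hσ.bijective y hy)).toContinuousLinearEquiv

lemma IsLocalCoord.derivEquiv_apply (hσ : IsLocalCoord σ V) (hy : y ∈ V) (v : Fin n → ℝ) :
    hσ.derivEquiv hy v = mfderiv 𝓘(ℝ, Fin n → ℝ) (𝓡 n) σ y v := rfl

lemma IsLocalCoord.hasFDerivAt_chart (hσ : IsLocalCoord σ V) (hy : y ∈ V) :
    HasFDerivAt (extChartAt (𝓡 n) (σ y) ∘ σ)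
      (hσ.derivEquiv hy : (Fin n → ℝ) →L[ℝ] 𝔼 n) y := by
  have h : (hσ.derivEquiv hy : (Fin n → ℝ) →L[ℝ] 𝔼 n) =
      (mfderiv 𝓘(ℝ, Fin n → ℝ) (𝓡 n) σ y : (Fin n → ℝ) →L[ℝ] 𝔼 n) :=
    ContinuousLinearMap.ext fun v => hσ.derivEquiv_apply hy v
  rw [h]
  exact hasFDerivAt_extChartAt_comp (hσ.mdifferentiableAt hy)

lemma IsLocalCoord.hasStrictFDerivAt_chart (hσ : IsLocalCoord σ V) (hy : y ∈ V) :
    HasStrictFDerivAt (extChartAt (𝓡 n) (σ y) ∘ σ)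
      (hσ.derivEquiv hy : (Fin n → ℝ) →L[ℝ] 𝔼 n) y :=
  (contDiffAt_extChartAt_comp (hσ.contMDiffAt hy)).hasStrictFDerivAt' (hσ.hasFDerivAt_chart hy)
    (by simp)

lemma IsLocalCoord.image_mem_nhds (hσ : IsLocalCoord σ V) (hy : y ∈ V)
    {W : Set (Fin n → ℝ)} (hW : W ∈ 𝓝 y) : σ '' W ∈ 𝓝 (σ y) := by
  have hc : ContinuousAt σ y := (hσ.contMDiffAt hy).continuousAt
  set W' := W ∩ σ ⁻¹' (extChartAt (𝓡 n) (σ y)).source with hW'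
  have h1 : W' ∈ 𝓝 y := inter_mem hW (hc (extChartAt_source_mem_nhds (σ y)))
  have h2 : (extChartAt (𝓡 n) (σ y) ∘ σ) '' W' ∈ 𝓝 (extChartAt (𝓡 n) (σ y) (σ y)) := by
    rw [← Function.comp_apply (f := extChartAt (𝓡 n) (σ y)) (g := σ),
      ← (hσ.hasStrictFDerivAt_chart hy).map_nhds_eq_of_equiv]
    exact image_mem_map h1
  have h3 := (continuousAt_extChartAt (I := 𝓡 n) (σ y)) h2
  filter_upwards [h3, extChartAt_source_mem_nhds (I := 𝓡 n) (σ y)] with z hz hz'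
  obtain ⟨w, hw, hwz⟩ := hz
  exact ⟨w, hw.1, (extChartAt (𝓡 n) (σ y)).injOn hw.2 hz' hwz⟩

lemma IsLocalCoord.isOpen_image (hσ : IsLocalCoord σ V) {W : Set (Fin n → ℝ)} (hW : IsOpen W)
    (hWV : W ⊆ V) : IsOpen (σ '' W) := by
  rw [isOpen_iff_mem_nhds]
  rintro _ ⟨w, hw, rfl⟩
  exact hσ.image_mem_nhds (hWV hw) (hW.mem_nhds hw)

/-- A continuous lift of a smooth map through a local parametrization is smooth. -/
lemma IsLocalCoord.contDiffAt_lift (hσ : IsLocalCoord σ V) {h : E → N} {z : E}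
    (hh : ContMDiffAt 𝓘(ℝ, E) (𝓡 n) ∞ h z) {f : E → Fin n → ℝ} (hf : ContinuousAt f z)
    (hfz : f z ∈ V) (hfh : ∀ᶠ w in 𝓝 z, σ (f w) = h w) : ContDiffAt ℝ ∞ f z := by
  have hz : h z = σ (f z) := hfh.self_of_nhds.symm
  have hs := hσ.hasStrictFDerivAt_chart hfz
  have hcd := contDiffAt_extChartAt_comp (hσ.contMDiffAt hfz)
  have hL : ContDiffAt ℝ ∞ (hs.localInverse) ((extChartAt (𝓡 n) (σ (f z)) ∘ σ) (f z)) :=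
    hcd.to_localInverse (hσ.hasFDerivAt_chart hfz) (by simp)
  have hch : ContDiffAt ℝ ∞ (extChartAt (𝓡 n) (σ (f z)) ∘ h) z := by
    rw [← hz]; exact contDiffAt_extChartAt_comp hh
  have hcomp : ContDiffAt ℝ ∞ (hs.localInverse ∘ (extChartAt (𝓡 n) (σ (f z)) ∘ h)) z := by
    refine ContDiffAt.comp z ?_ hch
    simpa [hz] using hL
  refine hcomp.congr_of_eventuallyEq ?_
  filter_upwards [hfh, hf.eventually hs.eventually_left_inverse] with w hw hw'
  rw [← hw', Function.comp_apply, Function.comp_apply, Function.comp_apply, hw]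

lemma IsLocalCoord.contDiffAt_invFunOn (hσ : IsLocalCoord σ V) (hinj : InjOn σ V)
    {h : E → N} {z : E} (hh : ContMDiffAt 𝓘(ℝ, E) (𝓡 n) ∞ h z) (hz : h z ∈ σ '' V) :
    ContDiffAt ℝ ∞ (fun w => invFunOn σ V (h w)) z ∧
      ∀ᶠ w in 𝓝 z, h w ∈ σ '' V := by
  have hev : ∀ᶠ w in 𝓝 z, h w ∈ σ '' V :=
    hh.continuousAt.eventually ((hσ.isOpen_image hσ.isOpen subset_rfl).mem_nhds hz)
  refine ⟨hσ.contDiffAt_lift hh ?_ (invFunOn_mem hz) ?_, hev⟩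
  · intro W hW
    have hVW : σ '' (V ∩ W) ∈ 𝓝 (h z) := by
      have := hσ.image_mem_nhds (invFunOn_mem hz)
        (inter_mem (hσ.isOpen.mem_nhds (invFunOn_mem hz)) hW)
      rwa [invFunOn_eq hz] at this
    have hev' : ∀ᶠ w in 𝓝 z, h w ∈ σ '' (V ∩ W) := hh.continuousAt hVW
    refine hev'.mono fun w hw => ?_
    obtain ⟨u, hu, huw⟩ := hw
    have : invFunOn σ V (h w) = u := by
      rw [← huw]; exact hinj.leftInvOn_invFunOn hu.1
    change invFunOn σ V (h w) ∈ W
    rw [this]; exact hu.2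
  · filter_upwards [hev] with w hw using invFunOn_eq hw

/-- Every point of a manifold has injective local coordinates centred at it. -/
lemma exists_isLocalCoord [IsManifold (𝓡 n) ∞ N] (m : N) :
    ∃ (σ : (Fin n → ℝ) → N) (V : Set (Fin n → ℝ)), IsLocalCoord σ V ∧ InjOn σ V ∧
      0 ∈ V ∧ σ 0 = m := by
  have : IsManifold (𝓡 n) 1 N := IsManifold.of_le (n := ∞) (by simp)
  let a : (Fin n → ℝ) ≃L[ℝ] 𝔼 n := (EuclideanSpace.equiv (Fin n) ℝ).symm
  let A : (Fin n → ℝ) → 𝔼 n := fun y => a y + extChartAt (𝓡 n) m m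
  have hA : ∀ y, HasFDerivAt A (a : (Fin n → ℝ) →L[ℝ] 𝔼 n) y := fun y => a.hasFDerivAt.add_const _
  have hAc : ContDiff ℝ ∞ A := a.contDiff.add contDiff_const
  have hopen : IsOpen (extChartAt (𝓡 n) m).target := isOpen_extChartAt_target m
  refine ⟨(extChartAt (𝓡 n) m).symm ∘ A, A ⁻¹' (extChartAt (𝓡 n) m).target, ⟨?_, ?_, ?_⟩, ?_, ?_, ?_⟩
  · exact hopen.preimage hAc.continuous
  · exact (contMDiffOn_extChartAt_symm m).comp (contMDiff_iff_contDiff.2 hAc).contMDiffOn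
      subset_rfl
  · intro y hy
    have h1 : MDifferentiableAt 𝓘(ℝ, 𝔼 n) (𝓡 n) (extChartAt (𝓡 n) m).symm
        (A y) :=
      ((contMDiffOn_extChartAt_symm (n := ∞) m).contMDiffAt (hopen.mem_nhds hy)).mdifferentiableAt
        (by simp)
    have h2 := isInvertible_mfderivWithin_extChartAt_symm (I := 𝓡 n) (x := m) hy
    rw [mfderiv_comp y h1 (hA y).hasMFDerivAt.mdifferentiableAt, (hA y).hasMFDerivAt.mfderiv]
    have h3 : Function.Bijective (mfderiv 𝓘(ℝ, 𝔼 n) (𝓡 n)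
        (extChartAt (𝓡 n) m).symm (A y)) := by
      simp only [modelWithCornersSelf_coe, Set.range_id, mfderivWithin_univ] at h2
      exact h2.bijective
    exact h3.comp a.bijective
  · intro y hy y' hy' h
    have h1 : A y = A y' := (extChartAt (𝓡 n) m).symm.injOn hy hy' h
    exact a.injective (add_right_cancel h1)
  · change A 0 ∈ (extChartAt (𝓡 n) m).target
    simp [A]
  · simp [A]

end LocalCoordinates

variable {M : Type*} [TopologicalSpace M] [ChartedSpace (𝔼 5) M]
  {B : Type*} [TopologicalSpace B] [ChartedSpace (𝔼 3) B]
  [MulAction Torus M] [MulAction Torus B] {g F : TwoTensor 5 M} {vol : TopForm 5 M} {ι : B → M}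
  {Φ : ℝ × ℝ × B → M} {γ : TwoTensor 3 B} {x : B → ℝ} {c : ℝ → B} {J : Set ℝ} {ε Λ C : ℝ}
  {P : Matrix (Fin 2) (Fin 2) ℝ} {p s : ℕ} {q : ℤ} {Ψ : MapData}

section GaussianLift

/-- The positions of the surface coordinates among the spacetime coordinates. -/
def tailIdx : Fin 3 → Fin 5 := ![2, 3, 4]

/-- The surface coordinates of a point. -/
def tail3 : (Fin 5 → ℝ) →L[ℝ] (Fin 3 → ℝ) :=
  ContinuousLinearMap.pi fun i => proj (tailIdx i)

lemma tail3_apply (y : Fin 5 → ℝ) (i : Fin 3) : tail3 y i = y (tailIdx i) := rfl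

lemma tail3_eq (y : Fin 5 → ℝ) : tail3 y = ![y 2, y 3, y 4] := by
  ext i; fin_cases i <;> rfl

/-- Spacetime coordinates obtained from Gaussian null coordinates and surface coordinates. -/
def gaussLift (Φ : ℝ × ℝ × B → M) (τ : (Fin 3 → ℝ) → B) (y : Fin 5 → ℝ) : M :=
  Φ (y 0, y 1, τ (tail3 y))

/-- The domain of `gaussLift`. -/
def gaussDomain (ε : ℝ) (V : Set (Fin 3 → ℝ)) : Set (Fin 5 → ℝ) :=
  {y | y 0 ∈ Ioo (-ε) ε ∧ y 1 ∈ Ioo (-ε) ε ∧ tail3 y ∈ V}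

lemma isOpen_gaussDomain (ε : ℝ) {V : Set (Fin 3 → ℝ)} (hV : IsOpen V) :
    IsOpen (gaussDomain ε V) :=
  (isOpen_Ioo.preimage (continuous_apply 0)).inter
    ((isOpen_Ioo.preimage (continuous_apply 1)).inter (hV.preimage tail3.continuous))

lemma isOpen_nullDomain : IsOpen (nullDomain B ε) := isOpen_Ioo.prod (isOpen_Ioo.prod isOpen_univ)

/-- The differential of Gaussian null coordinates, with tangent spaces identified with their
models. -/
def gaussDeriv (Φ : ℝ × ℝ × B → M) (z : ℝ × ℝ × B) :
    (ℝ × ℝ × 𝔼 3) →L[ℝ] 𝔼 5 :=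
  mfderiv (𝓘(ℝ, ℝ).prod (𝓘(ℝ, ℝ).prod (𝓡 3))) (𝓡 5) Φ z

lemma mem_nullDomain {u r : ℝ} (hu : u ∈ Ioo (-ε) ε)
    (hr : r ∈ Ioo (-ε) ε) (b : B) : ((u, r, b) : ℝ × ℝ × B) ∈ nullDomain B ε :=
  ⟨hu, hr, Set.mem_univ b⟩

lemma IsGaussianNull.zero_mem (hΦ : IsGaussianNull g ι ε Φ) : (0 : ℝ) ∈ Ioo (-ε) ε :=
  ⟨by linarith [hΦ.pos], hΦ.pos⟩

lemma IsGaussianNull.contMDiffAt (hΦ : IsGaussianNull g ι ε Φ) {z : ℝ × ℝ × B}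
    (hz : z ∈ nullDomain B ε) :
    ContMDiffAt (𝓘(ℝ, ℝ).prod (𝓘(ℝ, ℝ).prod (𝓡 3))) (𝓡 5) ∞ Φ z :=
  hΦ.smooth.contMDiffAt (isOpen_nullDomain.mem_nhds hz)

lemma IsGaussianNull.hasMFDerivAt (hΦ : IsGaussianNull g ι ε Φ) {z : ℝ × ℝ × B}
    (hz : z ∈ nullDomain B ε) :
    HasMFDerivAt (𝓘(ℝ, ℝ).prod (𝓘(ℝ, ℝ).prod (𝓡 3))) (𝓡 5) Φ z (gaussDeriv Φ z) :=
  ((hΦ.contMDiffAt hz).mdifferentiableAt (by simp)).hasMFDerivAt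

lemma vecU_eq (hΦ : IsGaussianNull g ι ε Φ) {u r : ℝ} {b : B}
    (hz : ((u, r, b) : ℝ × ℝ × B) ∈ nullDomain B ε) :
    (vecU Φ u r b : 𝔼 5) = gaussDeriv Φ (u, r, b) (1, 0, 0) := by
  have h1 : HasMFDerivAt 𝓘(ℝ, ℝ) (𝓘(ℝ, ℝ).prod (𝓘(ℝ, ℝ).prod (𝓡 3)))
      (fun u' : ℝ => ((u', r, b) : ℝ × ℝ × B)) u _ :=
    (hasMFDerivAt_id (I := 𝓘(ℝ, ℝ)) u).prodMk
      ((hasMFDerivAt_const (I := 𝓘(ℝ, ℝ)) (I' := 𝓘(ℝ, ℝ)) r u).prodMk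
        (hasMFDerivAt_const (I := 𝓘(ℝ, ℝ)) (I' := 𝓡 3) b u))
  have h2 := (HasMFDerivAt.comp u (hΦ.hasMFDerivAt hz) h1).mfderiv
  exact congrArg (fun L : ℝ →L[ℝ] 𝔼 5 => L 1) h2

lemma vecR_eq (hΦ : IsGaussianNull g ι ε Φ) {u r : ℝ} {b : B}
    (hz : ((u, r, b) : ℝ × ℝ × B) ∈ nullDomain B ε) :
    (vecR Φ u r b : 𝔼 5) = gaussDeriv Φ (u, r, b) (0, 1, 0) := by
  have h1 : HasMFDerivAt 𝓘(ℝ, ℝ) (𝓘(ℝ, ℝ).prod (𝓘(ℝ, ℝ).prod (𝓡 3)))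
      (fun r' : ℝ => ((u, r', b) : ℝ × ℝ × B)) r _ :=
    (hasMFDerivAt_const (I := 𝓘(ℝ, ℝ)) (I' := 𝓘(ℝ, ℝ)) u r).prodMk
      ((hasMFDerivAt_id (I := 𝓘(ℝ, ℝ)) r).prodMk
        (hasMFDerivAt_const (I := 𝓘(ℝ, ℝ)) (I' := 𝓡 3) b r))
  have h2 := (HasMFDerivAt.comp r (hΦ.hasMFDerivAt hz) h1).mfderiv
  exact congrArg (fun L : ℝ →L[ℝ] 𝔼 5 => L 1) h2

lemma vecB_eq (hΦ : IsGaussianNull g ι ε Φ) {u r : ℝ} {b : B}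
    (hz : ((u, r, b) : ℝ × ℝ × B) ∈ nullDomain B ε) (v : 𝔼 3) :
    (vecB Φ u r b v : 𝔼 5) = gaussDeriv Φ (u, r, b) (0, 0, v) := by
  have h1 : HasMFDerivAt (𝓡 3) (𝓘(ℝ, ℝ).prod (𝓘(ℝ, ℝ).prod (𝓡 3)))
      (fun b' : B => ((u, r, b') : ℝ × ℝ × B)) b _ :=
    (hasMFDerivAt_const (I := 𝓡 3) (I' := 𝓘(ℝ, ℝ)) u b).prodMk
      ((hasMFDerivAt_const (I := 𝓡 3) (I' := 𝓘(ℝ, ℝ)) r b).prodMk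
        (hasMFDerivAt_id (I := 𝓡 3) b))
  have h2 := (HasMFDerivAt.comp b (hΦ.hasMFDerivAt hz) h1).mfderiv
  exact congrArg (fun L : 𝔼 3 →L[ℝ] 𝔼 5 => L v) h2

variable {τ : (Fin 3 → ℝ) → B} {V : Set (Fin 3 → ℝ)}

lemma mem_nullDomain_of_mem_gaussDomain {y : Fin 5 → ℝ} (hy : y ∈ gaussDomain ε V) :
    ((y 0, y 1, τ (tail3 y)) : ℝ × ℝ × B) ∈ nullDomain B ε :=
  ⟨hy.1, hy.2.1, Set.mem_univ _⟩

lemma mfderiv_gaussLift (hΦ : IsGaussianNull g ι ε Φ) (hτ : IsLocalCoord τ V)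
    {y : Fin 5 → ℝ} (hy : y ∈ gaussDomain ε V) (v : Fin 5 → ℝ) :
    (mfderiv 𝓘(ℝ, Fin 5 → ℝ) (𝓡 5) (gaussLift Φ τ) y v : 𝔼 5) =
      gaussDeriv Φ (y 0, y 1, τ (tail3 y)) (v 0, v 1, modelDeriv τ (tail3 y) (tail3 v)) := by
  have h0 : ∀ i : Fin 5, HasMFDerivAt 𝓘(ℝ, Fin 5 → ℝ) 𝓘(ℝ, ℝ) (fun y : Fin 5 → ℝ => y i) y
      (proj i : (Fin 5 → ℝ) →L[ℝ] ℝ) := fun i =>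
    (proj i : (Fin 5 → ℝ) →L[ℝ] ℝ).hasFDerivAt.hasMFDerivAt
  have ht : HasMFDerivAt 𝓘(ℝ, Fin 5 → ℝ) 𝓘(ℝ, Fin 3 → ℝ) (fun y : Fin 5 → ℝ => tail3 y) y tail3 :=
    tail3.hasFDerivAt.hasMFDerivAt
  have hτ' : HasMFDerivAt 𝓘(ℝ, Fin 5 → ℝ) (𝓡 3) (fun y : Fin 5 → ℝ => τ (tail3 y)) y _ :=
    HasMFDerivAt.comp y (hτ.mdifferentiableAt hy.2.2).hasMFDerivAt ht
  have h1 : HasMFDerivAt 𝓘(ℝ, Fin 5 → ℝ) (𝓘(ℝ, ℝ).prod (𝓘(ℝ, ℝ).prod (𝓡 3)))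
      (fun y : Fin 5 → ℝ => ((y 0, y 1, τ (tail3 y)) : ℝ × ℝ × B)) y _ :=
    (h0 0).prodMk ((h0 1).prodMk hτ')
  have h2 := (HasMFDerivAt.comp y (hΦ.hasMFDerivAt (mem_nullDomain_of_mem_gaussDomain hy)) h1).mfderiv
  exact congrArg (fun L : (Fin 5 → ℝ) →L[ℝ] 𝔼 5 => L v) h2

lemma IsGaussianNull.isLocalCoord (hΦ : IsGaussianNull g ι ε Φ) (hτ : IsLocalCoord τ V) :
    IsLocalCoord (gaussLift Φ τ) (gaussDomain ε V) where
  isOpen := isOpen_gaussDomain ε hτ.isOpen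
  smooth := by
    have h0 : ∀ i : Fin 5, ContMDiff 𝓘(ℝ, Fin 5 → ℝ) 𝓘(ℝ, ℝ) ∞ (fun y : Fin 5 → ℝ => y i) :=
      fun i => contMDiff_iff_contDiff.2 (contDiff_apply ℝ ℝ i)
    have ht : ContMDiff 𝓘(ℝ, Fin 5 → ℝ) 𝓘(ℝ, Fin 3 → ℝ) ∞ fun y : Fin 5 → ℝ => tail3 y :=
      contMDiff_iff_contDiff.2 tail3.contDiff
    have h1 : ContMDiffOn 𝓘(ℝ, Fin 5 → ℝ) (𝓡 3) ∞ (fun y : Fin 5 → ℝ => τ (tail3 y))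
        (gaussDomain ε V) := hτ.smooth.comp ht.contMDiffOn fun y hy => hy.2.2
    exact hΦ.smooth.comp ((h0 0).contMDiffOn.prodMk ((h0 1).contMDiffOn.prodMk h1))
      fun y hy => mem_nullDomain_of_mem_gaussDomain hy
  bijective := by
    intro y hy
    have hb : Function.Bijective (gaussDeriv Φ (y 0, y 1, τ (tail3 y))) :=
      hΦ.bijective _ (mem_nullDomain_of_mem_gaussDomain hy)
    have hb2 : Function.Bijective (modelDeriv τ (tail3 y)) := hτ.bijective _ hy.2.2
    have key : Function.Bijective fun v : Fin 5 → ℝ =>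
        ((v 0, v 1, modelDeriv τ (tail3 y) (tail3 v)) : ℝ × ℝ × 𝔼 3) := by
      constructor
      · intro v w h
        simp only [Prod.mk.injEq] at h
        have h3 := hb2.1 h.2.2
        have h4 := fun i => congrFun h3 i
        simp only [tail3_apply] at h4
        ext i
        fin_cases i
        exacts [h.1, h.2.1, h4 0, h4 1, h4 2]
      · rintro ⟨a, b, c⟩
        obtain ⟨w, hw⟩ := hb2.2 c
        refine ⟨![a, b, w 0, w 1, w 2], ?_⟩
        have : tail3 ![a, b, w 0, w 1, w 2] = w := by
          rw [tail3_eq]; ext i; fin_cases i <;> rfl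
        simp [this, hw]
    have := hb.comp key
    have e : (modelDeriv (gaussLift Φ τ) y : (Fin 5 → ℝ) → 𝔼 5) = _ :=
      funext fun v => mfderiv_gaussLift hΦ hτ hy v
    change Function.Bijective (modelDeriv (gaussLift Φ τ) y)
    rw [e]
    exact this

lemma coordVec_gaussLift_zero (hΦ : IsGaussianNull g ι ε Φ) (hτ : IsLocalCoord τ V)
    {y : Fin 5 → ℝ} (hy : y ∈ gaussDomain ε V) :
    coordVec (gaussLift Φ τ) y 0 = vecU Φ (y 0) (y 1) (τ (tail3 y)) := by
  have h := mfderiv_gaussLift hΦ hτ hy (Pi.single 0 1)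
  have h2 : tail3 (Pi.single 0 1) = 0 := by
    ext i; fin_cases i <;> simp [tail3_apply, tailIdx]
  rw [h2, map_zero] at h
  exact h.trans (vecU_eq hΦ (mem_nullDomain_of_mem_gaussDomain hy)).symm

lemma coordVec_gaussLift_one (hΦ : IsGaussianNull g ι ε Φ) (hτ : IsLocalCoord τ V)
    {y : Fin 5 → ℝ} (hy : y ∈ gaussDomain ε V) :
    coordVec (gaussLift Φ τ) y 1 = vecR Φ (y 0) (y 1) (τ (tail3 y)) := by
  have h := mfderiv_gaussLift hΦ hτ hy (Pi.single 1 1)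
  have h2 : tail3 (Pi.single 1 1) = 0 := by
    ext i; fin_cases i <;> simp [tail3_apply, tailIdx]
  rw [h2, map_zero] at h
  exact h.trans (vecR_eq hΦ (mem_nullDomain_of_mem_gaussDomain hy)).symm

lemma coordVec_gaussLift_tail (hΦ : IsGaussianNull g ι ε Φ) (hτ : IsLocalCoord τ V)
    {y : Fin 5 → ℝ} (hy : y ∈ gaussDomain ε V) (i : Fin 3) :
    coordVec (gaussLift Φ τ) y (tailIdx i) =
      vecB Φ (y 0) (y 1) (τ (tail3 y)) (coordVec τ (tail3 y) i) := by
  have h := mfderiv_gaussLift hΦ hτ hy (Pi.single (tailIdx i) 1)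
  have h2 : tail3 (Pi.single (tailIdx i) 1) = Pi.single i 1 := by
    ext j; fin_cases i <;> fin_cases j <;> simp [tail3_apply, tailIdx]
  have h3 : (Pi.single (tailIdx i) (1 : ℝ) : Fin 5 → ℝ) 0 = 0 := by
    fin_cases i <;> simp [tailIdx]
  have h4 : (Pi.single (tailIdx i) (1 : ℝ) : Fin 5 → ℝ) 1 = 0 := by
    fin_cases i <;> simp [tailIdx]
  rw [h2, h3, h4] at h
  exact h.trans (vecB_eq hΦ (mem_nullDomain_of_mem_gaussDomain hy) _).symm

end GaussianLift

section Isotropy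

variable {n : ℕ} {N : Type*} [TopologicalSpace N] [ChartedSpace (𝔼 n) N]
  {E : Type*} [NormedAddCommGroup E] [NormedSpace ℝ E]

lemma modelDeriv_lift {σ : (Fin n → ℝ) → N} {V : Set (Fin n → ℝ)} (hσ : IsLocalCoord σ V)
    {h : E → N} {z : E} {f : E → Fin n → ℝ} (hf : DifferentiableAt ℝ f z) (hfz : f z ∈ V)
    (hfh : ∀ᶠ w in 𝓝 z, σ (f w) = h w) (v : E) :
    modelDeriv (n := n) h z v = modelDeriv σ (f z) (fderiv ℝ f z v) := by
  have h1 : mfderiv 𝓘(ℝ, E) (𝓡 n) h z = mfderiv 𝓘(ℝ, E) (𝓡 n) (σ ∘ f) z :=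
    Filter.EventuallyEq.mfderiv_eq (hfh.mono fun w hw => hw.symm)
  have h2 := mfderiv_comp_apply (I := 𝓘(ℝ, E)) (I' := 𝓘(ℝ, Fin n → ℝ)) (I'' := 𝓡 n) z
    (hσ.mdifferentiableAt hfz) hf.mdifferentiableAt v
  rw [mfderiv_eq_fderiv] at h2
  exact (congrArg (fun L : E →L[ℝ] 𝔼 n => L v) h1).trans h2

lemma IsLocalCoord.bijective_modelDeriv {σ : (Fin n → ℝ) → N} {V : Set (Fin n → ℝ)}
    (hσ : IsLocalCoord σ V) {y : Fin n → ℝ} (hy : y ∈ V) :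
    Function.Bijective (modelDeriv (n := n) σ y) := hσ.bijective y hy

variable [MulAction Torus N]

/-- The differential of a transformation, with tangent spaces identified with their models. -/
def actDeriv (t : Torus) (b : N) : 𝔼 n →L[ℝ] 𝔼 n :=
  mfderiv (𝓡 n) (𝓡 n) (fun m : N => t • m) b

lemma modelDeriv_comp_smul (hN : IsSmoothAction n N) (t : Torus)
    {f : E → N} {z : E} (hf : MDifferentiableAt 𝓘(ℝ, E) (𝓡 n) f z) (v : E) :
    modelDeriv (n := n) (fun w => t • f w) z v = actDeriv t (f z) (modelDeriv f z v) :=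
  mfderiv_comp_apply (I := 𝓘(ℝ, E)) (I' := 𝓡 n) (I'' := 𝓡 n) z
    (hN.mdifferentiable_smul t (f z)) hf v

lemma actDeriv_mul (hN : IsSmoothAction n N) (t s : Torus) (b : N) (v : 𝔼 n) :
    actDeriv (t * s) b v = actDeriv t (s • b) (actDeriv s b v) := by
  have h := mfderiv_comp_apply (I := 𝓡 n) (I' := 𝓡 n) (I'' := 𝓡 n) b
    (f := fun m : N => s • m) (hN.mdifferentiable_smul t (s • b)) (hN.mdifferentiable_smul s b) v
  refine Eq.trans ?_ h
  exact mfderiv_congr_base (funext fun m => mul_smul t s m) rfl v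

lemma actDeriv_one (b : N) (v : 𝔼 n) :
    actDeriv (1 : Torus) b v = v := by
  refine (mfderiv_congr_base (funext fun m => one_smul Torus m) rfl v).trans ?_
  exact congrArg (fun L : 𝔼 n →L[ℝ] 𝔼 n => L v)
    (mfderiv_id (I := 𝓡 n) (x := b))

lemma actDeriv_congr {t : Torus} {b b' : N} (h : b = b') (v : 𝔼 n) :
    actDeriv t b v = actDeriv t b' v := by subst h; rfl

lemma actDeriv_pow_of_fixed (hN : IsSmoothAction n N) {t : Torus} {b : N} (hb : t • b = b)
    (hd : ∀ v : 𝔼 n, actDeriv t b v = v) (k : ℕ) : t ^ k • b = b ∧ ∀ v : 𝔼 n, actDeriv (t ^ k) b v = v := by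
  induction k with
  | zero => exact ⟨by simp, fun v => by rw [pow_zero]; exact actDeriv_one b v⟩
  | succ k ih =>
    refine ⟨by rw [pow_succ, mul_smul, hb, ih.1], fun v => ?_⟩
    rw [pow_succ, actDeriv_mul hN, actDeriv_congr hb, ih.2, hd]

/-- A transformation of finite order which fixes a point to first order is the identity near that
point. -/
lemma eventually_smul_eq_of_fixed [IsManifold (𝓡 n) ∞ N] (hN : IsSmoothAction n N) {t : Torus}
    {k : ℕ} (hk : 0 < k) (ht : t ^ k = 1) {b : N} (hb : t • b = b)
    (hd : ∀ v : 𝔼 n, actDeriv t b v = v) : ∀ᶠ z in 𝓝 b, t • z = z := by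
  obtain ⟨σ, V, hσ, hinj, h0V, hσ0⟩ := exists_isLocalCoord (n := n) b
  let T : ℕ → (Fin n → ℝ) → Fin n → ℝ := fun j y => invFunOn σ V (t ^ j • σ y)
  have hσd : MDifferentiableAt 𝓘(ℝ, Fin n → ℝ) (𝓡 n) σ 0 := hσ.mdifferentiableAt h0V
  have hmap : ∀ j, ContMDiffAt 𝓘(ℝ, Fin n → ℝ) (𝓡 n) ∞ (fun y => t ^ j • σ y) 0 := fun j =>
    (hN.contMDiff_smul (t ^ j)).contMDiffAt.comp 0 (hσ.contMDiffAt h0V)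
  have hfix : ∀ j, t ^ j • σ 0 = σ 0 := fun j => by
    rw [hσ0]; exact (actDeriv_pow_of_fixed hN hb hd j).1
  have hTs : ∀ j, ContDiffAt ℝ ∞ (T j) 0 ∧ ∀ᶠ y in 𝓝 (0 : Fin n → ℝ), t ^ j • σ y ∈ σ '' V :=
    fun j => hσ.contDiffAt_invFunOn hinj (hmap j) (by rw [hfix]; exact ⟨0, h0V, rfl⟩)
  have hT0 : ∀ j, T j 0 = 0 := fun j => by
    simp only [T, hfix]; exact hinj.leftInvOn_invFunOn h0V
  have hTσ : ∀ j, ∀ᶠ y in 𝓝 (0 : Fin n → ℝ), σ (T j y) = t ^ j • σ y := fun j =>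
    (hTs j).2.mono fun y hy => invFunOn_eq hy
  have hder : ∀ j, HasStrictFDerivAt (T j) (ContinuousLinearMap.id ℝ (Fin n → ℝ)) 0 := by
    intro j
    have hs := (hTs j).1.hasStrictFDerivAt (by simp)
    have : fderiv ℝ (T j) 0 = ContinuousLinearMap.id ℝ (Fin n → ℝ) := by
      ext1 v
      have h1 := modelDeriv_lift hσ (hs.hasFDerivAt.differentiableAt) (by rw [hT0]; exact h0V)
        (hTσ j) v
      have h2 := modelDeriv_comp_smul hN (t ^ j) hσd v
      have h3 : modelDeriv (n := n) (fun w => t ^ j • σ w) 0 v = modelDeriv σ 0 v := by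
        rw [h2]
        refine Eq.trans ?_ ((actDeriv_pow_of_fixed hN hb hd j).2 _)
        exact actDeriv_congr hσ0 _
      rw [h3, hT0] at h1
      exact ((hσ.bijective_modelDeriv h0V).1 h1).symm
    rwa [this] at hs
  let A : (Fin n → ℝ) → Fin n → ℝ := fun y => ∑ j ∈ Finset.range k, T j y
  have hkr : (k : ℝ) ≠ 0 := by exact_mod_cast hk.ne'
  let e : (Fin n → ℝ) ≃L[ℝ] (Fin n → ℝ) := ContinuousLinearEquiv.smulLeft (Units.mk0 (k : ℝ) hkr)
  have hA : HasStrictFDerivAt A (e : (Fin n → ℝ) →L[ℝ] (Fin n → ℝ)) 0 := by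
    have := HasStrictFDerivAt.fun_sum (u := Finset.range k) fun j _ => hder j
    have he : (e : (Fin n → ℝ) →L[ℝ] (Fin n → ℝ)) =
        ∑ _j ∈ Finset.range k, ContinuousLinearMap.id ℝ (Fin n → ℝ) := by
      ext1 v
      simp only [e, ContinuousLinearEquiv.coe_coe, ContinuousLinearEquiv.smulLeft_apply_apply,
        Units.smul_def, Units.val_mk0, Finset.sum_const, Finset.card_range, _root_.smul_apply,
        ContinuousLinearMap.id_apply, Nat.cast_smul_eq_nsmul]
    rw [he]
    exact this
  have hTc : Tendsto (T 1) (𝓝 0) (𝓝 0) := by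
    have := (hTs 1).1.continuousAt
    rwa [ContinuousAt, hT0] at this
  have hAT : ∀ᶠ y in 𝓝 (0 : Fin n → ℝ), A (T 1 y) = A y := by
    filter_upwards [hTσ 1] with y hy
    have h1 : ∀ j, T j (T 1 y) = T (j + 1) y := by
      intro j
      simp only [T] at hy ⊢
      rw [hy, ← mul_smul, ← pow_add]
    have h2 : T k y = T 0 y := by simp [T, ht]
    have h3 := Finset.sum_range_succ (fun j => T j y) k
    have h4 := Finset.sum_range_succ' (fun j => T j y) k
    simp only [A, h1]
    rw [h3, h2] at h4
    exact (add_right_cancel h4).symm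
  have hfin : ∀ᶠ y in 𝓝 (0 : Fin n → ℝ), t • σ y = σ y := by
    filter_upwards [hAT, hA.eventually_left_inverse, hTc.eventually hA.eventually_left_inverse,
      hTσ 1] with y h1 h2 h3 h4
    have h5 : T 1 y = y := by rw [← h3, h1, h2]
    rw [h5, pow_one] at h4
    exact h4.symm
  have := hσ.image_mem_nhds h0V hfin
  rw [hσ0] at this
  filter_upwards [this] with z hz
  obtain ⟨y, hy, rfl⟩ := hz
  exact hy

/-- For a faithful torus action on a connected manifold, a transformation of finite order which
fixes a point to first order is trivial. -/
lemma eq_one_of_fixed [IsManifold (𝓡 n) ∞ N] [T2Space N] [ConnectedSpace N]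
    (hN : IsSmoothAction n N) (hf : FaithfulSMul Torus N) {t : Torus}
    {k : ℕ} (hk : 0 < k) (ht : t ^ k = 1) {b : N} (hb : t • b = b)
    (hd : ∀ v : 𝔼 n, actDeriv t b v = v) : t = 1 := by
  let S : Set N := {z | ∀ᶠ w in 𝓝 z, t • w = w}
  have hopen : IsOpen S := isOpen_setOfPred_eventually_nhds
  have hclosed : IsClosed S := by
    rw [← closure_subset_iff_isClosed]
    intro z hz
    have hzf : t • z = z := by
      have hcl : IsClosed {w : N | t • w = w} :=
        isClosed_eq (hN.contMDiff_smul t).continuous continuous_id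
      have : S ⊆ {w : N | t • w = w} := fun w hw => hw.self_of_nhds
      exact closure_minimal this hcl hz
    refine eventually_smul_eq_of_fixed hN hk ht hzf fun v => ?_
    obtain ⟨σ, V, hσ, hinj, h0V, hσ0⟩ := exists_isLocalCoord (n := n) z
    let T : (Fin n → ℝ) → Fin n → ℝ := fun y => invFunOn σ V (t • σ y)
    have hmap : ContMDiffAt 𝓘(ℝ, Fin n → ℝ) (𝓡 n) ∞ (fun y => t • σ y) 0 :=
      (hN.contMDiff_smul t).contMDiffAt.comp 0 (hσ.contMDiffAt h0V)
    have hTs : ContDiffAt ℝ ∞ T 0 ∧ ∀ᶠ y in 𝓝 (0 : Fin n → ℝ), t • σ y ∈ σ '' V :=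
      hσ.contDiffAt_invFunOn hinj hmap (by rw [hσ0, hzf]; exact ⟨0, h0V, hσ0⟩)
    have hT0 : T 0 = 0 := by
      simp only [T, hσ0, hzf]; rw [← hσ0]; exact hinj.leftInvOn_invFunOn h0V
    have hcont : ContinuousAt (fderiv ℝ T) 0 := (hTs.1.fderiv_right (m := 0) (by simp)).continuousAt
    have hfreq : ∃ᶠ y in 𝓝 (0 : Fin n → ℝ), fderiv ℝ T y = ContinuousLinearMap.id ℝ _ := by
      intro hev
      have h1 := hσ.image_mem_nhds h0V (inter_mem hev (hσ.isOpen.mem_nhds h0V))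
      rw [hσ0] at h1
      obtain ⟨_, ⟨y, ⟨hy1, hyV⟩, rfl⟩, hyS⟩ := mem_closure_iff_nhds.1 hz _ h1
      apply hy1
      have h2 : T =ᶠ[𝓝 y] id := by
        have h3 : ∀ᶠ w in 𝓝 y, t • σ w = σ w := ((hσ.contMDiffAt hyV).continuousAt).eventually hyS
        filter_upwards [h3, hσ.isOpen.mem_nhds hyV] with w hw hwV
        simp only [T, hw]
        exact hinj.leftInvOn_invFunOn hwV
      rw [h2.fderiv_eq, fderiv_id]
    have hid : fderiv ℝ T 0 = ContinuousLinearMap.id ℝ _ :=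
      tendsto_nhds_unique_of_frequently_eq hcont tendsto_const_nhds hfreq
    obtain ⟨w, hw⟩ := (hσ.bijective_modelDeriv h0V).2 v
    have h1 := modelDeriv_lift hσ (hTs.1.differentiableAt (by simp)) (by rw [hT0]; exact h0V)
      (hTs.2.mono fun y hy => invFunOn_eq hy) w
    have h2 := modelDeriv_comp_smul hN t (hσ.mdifferentiableAt h0V) w
    rw [h2, hid, hT0, ContinuousLinearMap.id_apply, hw] at h1
    exact (actDeriv_congr hσ0.symm v).trans h1
  have huniv : S = Set.univ := IsClopen.eq_univ ⟨hclosed, hopen⟩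
    ⟨b, eventually_smul_eq_of_fixed hN hk ht hb hd⟩
  refine hf.eq_of_smul_eq_smul fun z => ?_
  have : z ∈ S := huniv ▸ Set.mem_univ z
  rw [one_smul]
  exact this.self_of_nhds

end Isotropy

section Model

variable {n : ℕ} {N : Type*} [TopologicalSpace N] [ChartedSpace (𝔼 n) N]
  {E : Type*} [NormedAddCommGroup E] [NormedSpace ℝ E]

/-- A bilinear form field, with tangent spaces identified with their models. -/
def modelForm (h : TwoTensor n N) (m : N) : LinearMap.BilinForm ℝ (𝔼 n) := h m

/-- The coordinate vector fields, with tangent spaces identified with their models. -/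
def modelCoord (σ : (Fin n → ℝ) → N) (y : Fin n → ℝ) (a : Fin n) : 𝔼 n :=
  modelDeriv σ y (Pi.single a (1 : ℝ))

lemma comp_eq_modelForm (h : TwoTensor n N) (σ : (Fin n → ℝ) → N) (y : Fin n → ℝ) (a b : Fin n) :
    comp h σ y a b = modelForm h (σ y) (modelCoord σ y a) (modelCoord σ y b) := rfl

/-- The differential of a function, with tangent spaces identified with their models. -/
def modelDiff (f : N → ℝ) (m : N) : 𝔼 n →L[ℝ] ℝ :=
  mfderiv (𝓡 n) 𝓘(ℝ, ℝ) f m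

lemma fderiv_comp_modelDeriv {f : N → ℝ} {c : E → N} {z : E}
    (hf : MDifferentiableAt (𝓡 n) 𝓘(ℝ, ℝ) f (c z)) (hc : MDifferentiableAt 𝓘(ℝ, E) (𝓡 n) c z) :
    HasFDerivAt (fun w => f (c w)) ((modelDiff (n := n) f (c z)).comp (modelDeriv c z)) z := by
  have h := HasMFDerivAt.comp z hf.hasMFDerivAt hc.hasMFDerivAt
  exact h.hasFDerivAt

variable [MulAction Torus N]

/-- The generators of a torus action, with tangent spaces identified with their models. -/
def modelGen (i : Fin 2) (m : N) : 𝔼 n := generator i m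

lemma actDeriv_modelGen (hN : IsSmoothAction n N) (t : Torus) (i : Fin 2) (m : N) :
    actDeriv (n := n) t m (modelGen i m) = modelGen i (t • m) := mfderiv_smul_generator hN t i m

lemma modelDeriv_orbit (hN : IsSmoothAction n N) (m : N) (φ v : Fin 2 → ℝ) :
    modelDeriv (n := n) (fun φ : Fin 2 → ℝ => torusExp φ • m) φ v =
      ∑ i, v i • modelGen i (torusExp φ • m) := mfderiv_orbit hN m φ v

lemma modelForm_smul {h : TwoTensor n N} (hh : IsInvariant h) (t : Torus) (m : N) (v w : 𝔼 n) :
    modelForm h (t • m) (actDeriv t m v) (actDeriv t m w) = modelForm h m v w := hh t m v w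

end Model

/-- A Riemannian metric `γ` invariant under an effective torus action, with orbit coordinate
`x`. -/
structure IsBiaxial (γ : TwoTensor 3 B) (C : ℝ) (x : B → ℝ) : Prop where
  smooth : IsSmoothTensor γ
  symm : ∀ b v w, γ b v w = γ b w v
  pos : ∀ b (v : TangentSpace (𝓡 3) b), v ≠ 0 → 0 < γ b v v
  invariant : IsInvariant γ
  action : IsSmoothAction 3 B
  faithful : FaithfulSMul Torus B
  orbit : IsOrbitCoordinate γ C x

namespace IsBiaxial

lemma x_smul (h : IsBiaxial γ C x) (t : Torus) (b : B) : x (t • b) = x b :=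
  ((h.orbit.eq_iff b (t • b)).2 ⟨t, rfl⟩).symm

lemma x_mem (h : IsBiaxial γ C x) (b : B) : x b ∈ Icc (-1 : ℝ) 1 :=
  h.orbit.range_eq ▸ Set.mem_range_self b

lemma dfun_generator (h : IsBiaxial γ C x) (b : B) (i : Fin 2) :
    modelDiff (n := 3) x b (modelGen i b) = 0 := by
  obtain ⟨vol, -, hvol⟩ := h.orbit.differential
  refine (hvol b (generator i b)).trans ?_
  have : vol b ![generator 0 b, generator 1 b, generator i b] = 0 := by
    fin_cases i
    · exact (vol b).map_eq_zero_of_eq _ (i := 0) (j := 2) rfl (by decide)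
    · exact (vol b).map_eq_zero_of_eq _ (i := 1) (j := 2) rfl (by decide)
  rw [this, mul_zero]

lemma smul_lincomb_eq_zero (h : IsBiaxial γ C x) {b : B} {a : Fin 2 → ℝ}
    (ha : ∑ i, a i • modelGen (n := 3) i b = 0) (t : Torus) :
    ∑ i, a i • modelGen (n := 3) i (t • b) = 0 := by
  simp only [← actDeriv_modelGen h.action, ← map_smul, ← map_sum]
  rw [ha, map_zero]

lemma mem_closure_of_interior [ConnectedSpace B] (h : IsBiaxial γ C x) {b : B}
    (f : ℝ → ℝ) (hf : Continuous f)
    (hf0 : ∀ s, f s = f (x b) → s = x b) (hex : ∃ b', f (x b) < f (x b'))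
    (hex' : ∃ b', f (x b') < f (x b)) :
    b ∈ closure {b' | f (x b) < f (x b')} := by
  by_contra hb
  have hxc : Continuous fun b' => f (x b') := hf.comp h.orbit.smooth.continuous
  have hno : ∀ b' ∈ closure {b' | f (x b) < f (x b')}, x b' ≠ x b := by
    intro b' hb' hx
    obtain ⟨t, rfl⟩ := (h.orbit.eq_iff b' b).1 hx
    apply hb
    have hc : Continuous fun b'' : B => t • b'' := (h.action.contMDiff_smul t).continuous
    refine map_mem_closure hc hb' fun b'' hb'' => ?_
    change f (x (t • b')) < f (x (t • b''))
    rw [h.x_smul t b'']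
    exact hb''
  have hclosed : IsClosed {b' | f (x b) < f (x b')} := by
    rw [← closure_subset_iff_isClosed]
    intro b' hb'
    have h1 : f (x b) ≤ f (x b') := by
      have hcl : IsClosed {b' | f (x b) ≤ f (x b')} := isClosed_le continuous_const hxc
      exact closure_minimal (fun b'' (hb'' : f (x b) < f (x b'')) => hb''.le) hcl hb'
    exact lt_of_le_of_ne h1 fun he => hno b' hb' (hf0 _ he.symm)
  have hopen : IsOpen {b' | f (x b) < f (x b')} := isOpen_lt continuous_const hxc
  have huniv := IsClopen.eq_univ ⟨hclosed, hopen⟩ hex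
  obtain ⟨b', hb'⟩ := hex'
  have : b' ∈ {b' | f (x b) < f (x b')} := huniv ▸ Set.mem_univ b'
  exact absurd (lt_trans hb' this) (lt_irrefl _)

/-- The generators are linearly independent away from the axes. -/
lemma generators_independent [IsManifold (𝓡 3) ∞ B] [ConnectedSpace B]
    (h : IsBiaxial γ C x) {b : B} (hb1 : -1 < x b) (hb2 : x b < 1) {a : Fin 2 → ℝ}
    (ha : ∑ i, a i • modelGen (n := 3) i b = 0) : a = 0 := by
  by_contra hane
  obtain ⟨σ, V, hσ, hinj, h0V, hσ0⟩ := exists_isLocalCoord (n := 3) b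
  obtain ⟨δ, hδ, hball⟩ := Metric.isOpen_iff.1 hσ.isOpen 0 h0V
  have hσ' : IsLocalCoord σ (Metric.ball 0 δ) :=
    ⟨Metric.isOpen_ball, hσ.smooth.mono hball, fun y hy => hσ.bijective y (hball hy)⟩
  have hinj' : InjOn σ (Metric.ball 0 δ) := hinj.mono hball
  have h0 : (0 : Fin 3 → ℝ) ∈ Metric.ball (0 : Fin 3 → ℝ) δ := Metric.mem_ball_self hδ
  have hnhds : σ '' Metric.ball 0 δ ∈ 𝓝 b := by
    rw [← hσ0]; exact hσ'.image_mem_nhds h0 (Metric.ball_mem_nhds 0 hδ)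
  obtain ⟨b₁, hb₁⟩ : ∃ b', x b' = 1 := by
    have : (1 : ℝ) ∈ Set.range x := by rw [h.orbit.range_eq]; norm_num
    exact this
  obtain ⟨b₂, hb₂⟩ : ∃ b', x b' = -1 := by
    have : (-1 : ℝ) ∈ Set.range x := by rw [h.orbit.range_eq]; norm_num
    exact this
  obtain ⟨_, ⟨p, hp, rfl⟩, hpx⟩ := mem_closure_iff_nhds.1
    (h.mem_closure_of_interior (b := b) id continuous_id (fun s hs => hs)
      ⟨b₁, by simpa [hb₁] using hb2⟩ ⟨b₂, by simpa [hb₂] using hb1⟩) _ hnhds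
  obtain ⟨_, ⟨q, hq, rfl⟩, hqx⟩ := mem_closure_iff_nhds.1
    (h.mem_closure_of_interior (b := b) (fun s => -s) continuous_neg (fun s hs => neg_injective hs)
      ⟨b₂, by simpa [hb₂] using neg_lt.1 hb1⟩ ⟨b₁, by simpa [hb₁] using hb2⟩) _ hnhds
  replace hpx : x b < x (σ p) := hpx
  replace hqx : x (σ q) < x b := neg_lt_neg_iff.1 hqx
  have hxσ : ContinuousOn (fun y => x (σ y)) (Metric.ball 0 δ) :=
    h.orbit.smooth.continuous.comp_continuousOn hσ'.smooth.continuousOn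
  let P : Set (Fin 3 → ℝ) := Metric.ball 0 δ ∩ (fun y => x (σ y)) ⁻¹' Set.Ioi (x b)
  have hP : IsOpen P := hxσ.isOpen_inter_preimage Metric.isOpen_ball isOpen_Ioi
  let pr : (Fin 3 → ℝ) →L[ℝ] (Fin 2 → ℝ) :=
    ContinuousLinearMap.pi ![proj 0, proj 1]
  let o : (Fin 3 → ℝ) → B := fun w => torusExp (pr w) • b
  have ho : ∀ w, ContMDiffAt 𝓘(ℝ, Fin 3 → ℝ) (𝓡 3) ∞ o w := fun w =>
    ((h.action.contMDiff_orbit b).comp (contMDiff_iff_contDiff.2 pr.contDiff)).contMDiffAt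
  let W : Set (Fin 3 → ℝ) := {w | o w ∈ σ '' Metric.ball 0 δ}
  let f : (Fin 3 → ℝ) → Fin 3 → ℝ := fun w => invFunOn σ (Metric.ball 0 δ) (o w)
  let F : (Fin 3 → ℝ) → Fin 3 → ℝ := fun w => q + w 2 • (f w - q)
  let p₂ : (Fin 3 → ℝ) →L[ℝ] ℝ := proj 2
  have hfd : ∀ w ∈ W, HasFDerivAt f (fderiv ℝ f w) w := fun w hw =>
    ((hσ'.contDiffAt_invFunOn hinj' (ho w) hw).1.differentiableAt (by simp)).hasFDerivAt
  let a' : Fin 3 → ℝ := ![a 0, a 1, 0]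
  have hπa : pr a' = a := by ext i; fin_cases i <;> rfl
  have hfa : ∀ w ∈ W, fderiv ℝ f w a' = 0 := by
    intro w hw
    have hl := modelDeriv_lift hσ' (hfd w hw).differentiableAt (invFunOn_mem hw)
      ((hσ'.contDiffAt_invFunOn hinj' (ho w) hw).2.mono fun z hz => invFunOn_eq hz) a'
    have ho' : modelDeriv (n := 3) o w a' = 0 := by
      have h2 := mfderiv_comp_apply (I := 𝓘(ℝ, Fin 3 → ℝ)) (I' := 𝓘(ℝ, Fin 2 → ℝ)) (I'' := 𝓡 3) w
        (f := fun w => pr w) (h.action.mdifferentiable_orbit b (pr w))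
        pr.differentiableAt.mdifferentiableAt a'
      refine h2.trans ?_
      rw [mfderiv_eq_fderiv, pr.fderiv]
      refine (modelDeriv_orbit h.action b (pr w) (pr a')).trans ?_
      rw [hπa]
      exact h.smul_lincomb_eq_zero ha _
    rw [ho'] at hl
    have hinjd := (hσ'.bijective_modelDeriv (invFunOn_mem hw)).1
    exact hinjd (hl.symm.trans (map_zero _).symm)
  have hF : ∀ w ∈ W, HasFDerivWithinAt F (w 2 • fderiv ℝ f w +
      p₂.smulRight (f w - q)) W w := by
    intro w hw
    have h1 : HasFDerivAt (fun w : Fin 3 → ℝ => w 2)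
        p₂ w :=
      p₂.hasFDerivAt
    exact ((h1.smul ((hfd w hw).sub_const q)).const_add q).hasFDerivWithinAt
  have hdet : ∀ w ∈ W, (w 2 • fderiv ℝ f w +
      p₂.smulRight (f w - q)).det = 0 := by
    intro w hw
    by_contra hne
    set L := w 2 • fderiv ℝ f w + p₂.smulRight (f w - q) with hL
    have hLa : L.toLinearMap a' = 0 := by
      simp [hL, hfa w hw, a', p₂]
    have hinjL : Function.Injective L.toLinearMap := by
      have hu : IsUnit (LinearMap.det L.toLinearMap) := isUnit_iff_ne_zero.2 hne
      exact ((Module.End.isUnit_iff _).1 ((LinearMap.isUnit_iff_isUnit_det _).2 hu)).1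
    have : a' = 0 := hinjL (hLa.trans (map_zero _).symm)
    apply hane
    rw [← hπa, this, map_zero]
  have hnull : MeasureTheory.volume (F '' W) = 0 :=
    MeasureTheory.addHaar_image_eq_zero_of_det_fderivWithin_eq_zero _ hF hdet
  have hPF : P ⊆ F '' W := by
    rintro z ⟨hz, hzx⟩
    have hseg : ∀ s ∈ Icc (0 : ℝ) 1, q + s • (z - q) ∈ Metric.ball (0 : Fin 3 → ℝ) δ := by
      intro s hs
      exact (convex_ball _ _).add_smul_sub_mem hq hz hs
    have hcont : ContinuousOn (fun s : ℝ => x (σ (q + s • (z - q)))) (Icc 0 1) :=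
      hxσ.comp (by fun_prop) hseg
    have hivt := intermediate_value_Icc (zero_le_one' ℝ) hcont
    have hmem : x b ∈ Icc (x (σ (q + (0 : ℝ) • (z - q)))) (x (σ (q + (1 : ℝ) • (z - q)))) := by
      simp only [zero_smul, add_zero, one_smul, add_sub_cancel]
      exact ⟨hqx.le, le_of_lt hzx⟩
    obtain ⟨s, hs, hsx⟩ := hivt hmem
    have hs0 : s ≠ 0 := by
      rintro rfl
      simp only [zero_smul, add_zero] at hsx
      exact hqx.ne hsx
    obtain ⟨t, ht⟩ := (h.orbit.eq_iff b (σ (q + s • (z - q)))).1 hsx.symm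
    obtain ⟨φ, rfl⟩ := torusExp_surjective t
    have hπw : pr ![φ 0, φ 1, s⁻¹] = φ := by ext i; fin_cases i <;> rfl
    have how : o ![φ 0, φ 1, s⁻¹] = σ (q + s • (z - q)) := by
      change torusExp (pr ![φ 0, φ 1, s⁻¹]) • b = _
      rw [hπw, ht]
    refine ⟨![φ 0, φ 1, s⁻¹], ⟨_, hseg s hs, how.symm⟩, ?_⟩
    have hfw : f ![φ 0, φ 1, s⁻¹] = q + s • (z - q) := by
      change invFunOn σ (Metric.ball 0 δ) (o ![φ 0, φ 1, s⁻¹]) = _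
      rw [how]
      exact hinj'.leftInvOn_invFunOn (hseg s hs)
    change q + s⁻¹ • (f ![φ 0, φ 1, s⁻¹] - q) = z
    rw [hfw, add_sub_cancel_left, smul_smul, inv_mul_cancel₀ hs0, one_smul, add_sub_cancel]
  have := MeasureTheory.measure_mono_null hPF hnull
  exact (hP.measure_pos _ ⟨p, hp, hpx⟩).ne' this

end IsBiaxial

section TorusTranslates

variable {n : ℕ} {N : Type*} [TopologicalSpace N] [ChartedSpace (𝔼 n) N]
  {E : Type*} [NormedAddCommGroup E] [NormedSpace ℝ E] [MulAction Torus N]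

/-- The derivative of `torusExp (φ z) • c z`. -/
lemma modelDeriv_torusExp_smul (hN : IsSmoothAction n N) {φ : E → Fin 2 → ℝ} {c : E → N} {z : E}
    (hφ : DifferentiableAt ℝ φ z) (hc : MDifferentiableAt 𝓘(ℝ, E) (𝓡 n) c z) (v : E) :
    modelDeriv (n := n) (fun w => torusExp (φ w) • c w) z v =
      ∑ i, fderiv ℝ φ z v i • modelGen i (torusExp (φ z) • c z) +
        actDeriv (torusExp (φ z)) (c z) (modelDeriv c z v) := by
  let F : (Fin 2 → ℝ) × N → N := fun w => torusExp w.1 • w.2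
  let L : (Fin 2 → ℝ) × 𝔼 n →L[ℝ] 𝔼 n := mfderiv (𝓘(ℝ, Fin 2 → ℝ).prod (𝓡 n)) (𝓡 n) F (φ z, c z)
  have hF : HasMFDerivAt (𝓘(ℝ, Fin 2 → ℝ).prod (𝓡 n)) (𝓡 n) F (φ z, c z) L :=
    (hN.contMDiff_torusExp_smul.mdifferentiable (by simp) (φ z, c z)).hasMFDerivAt
  have h1 : HasMFDerivAt 𝓘(ℝ, E) (𝓘(ℝ, Fin 2 → ℝ).prod (𝓡 n)) (fun w => (φ w, c w)) z _ :=
    hφ.hasFDerivAt.hasMFDerivAt.prodMk hc.hasMFDerivAt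
  have h2 : modelDeriv (n := n) (fun w => torusExp (φ w) • c w) z v =
      L (fderiv ℝ φ z v, modelDeriv c z v) := by
    have h0 := (HasMFDerivAt.comp z (g := F) hF h1).mfderiv
    exact congrArg (fun L : E →L[ℝ] 𝔼 n => L v) h0
  have h3 : ∀ w : Fin 2 → ℝ, L (w, 0) = ∑ i, w i • modelGen i (torusExp (φ z) • c z) := by
    intro w
    rw [← modelDeriv_orbit hN]
    have h4 : HasMFDerivAt 𝓘(ℝ, Fin 2 → ℝ) (𝓘(ℝ, Fin 2 → ℝ).prod (𝓡 n))
        (fun w : Fin 2 → ℝ => (w, c z)) (φ z) _ :=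
      (hasMFDerivAt_id (I := 𝓘(ℝ, Fin 2 → ℝ)) (φ z)).prodMk
        (hasMFDerivAt_const (I := 𝓘(ℝ, Fin 2 → ℝ)) (I' := 𝓡 n) (c z) (φ z))
    exact (congrArg (fun L : (Fin 2 → ℝ) →L[ℝ] 𝔼 n => L w)
      (HasMFDerivAt.comp (φ z) hF h4).mfderiv).symm
  have h5 : ∀ w : 𝔼 n, L (0, w) = actDeriv (torusExp (φ z)) (c z) w := by
    intro w
    have h4 : HasMFDerivAt (𝓡 n) (𝓘(ℝ, Fin 2 → ℝ).prod (𝓡 n))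
        (fun b : N => (φ z, b)) (c z) _ :=
      (hasMFDerivAt_const (I := 𝓡 n) (I' := 𝓘(ℝ, Fin 2 → ℝ)) (φ z) (c z)).prodMk
        (hasMFDerivAt_id (I := 𝓡 n) (c z))
    exact (congrArg (fun L : 𝔼 n →L[ℝ] 𝔼 n => L w)
      (HasMFDerivAt.comp (c z) hF h4).mfderiv).symm
  rw [h2, ← h3, ← h5, ← map_add]
  simp

end TorusTranslates

section Sections

/-- The Gram matrix of the generators, with tangent spaces identified with their models. -/
def gram (γ : TwoTensor 3 B) (b : B) (i j : Fin 2) : ℝ :=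
  modelForm γ b (modelGen i b) (modelGen j b)

/-- The determinant of the Gram matrix of the generators. -/
def gramDet (γ : TwoTensor 3 B) (b : B) : ℝ :=
  gram γ b 0 0 * gram γ b 1 1 - gram γ b 0 1 ^ 2

namespace IsBiaxial

lemma form_symm (h : IsBiaxial γ C x) (b : B) (v w : 𝔼 3) :
    modelForm γ b v w = modelForm γ b w v := h.symm b v w

lemma form_pos (h : IsBiaxial γ C x) (b : B) {v : 𝔼 3}
    (hv : v ≠ 0) : 0 < modelForm γ b v v := h.pos b v hv

lemma form_self_eq_zero (h : IsBiaxial γ C x) {b : B} {v : 𝔼 3}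
    (hv : modelForm γ b v v = 0) : v = 0 := by
  by_contra hne
  exact (h.form_pos b hne).ne' hv

lemma gram_symm (h : IsBiaxial γ C x) (b : B) (i j : Fin 2) :
    gram γ b i j = gram γ b j i := h.form_symm b _ _

lemma gram_smul (h : IsBiaxial γ C x) (t : Torus) (b : B) (i j : Fin 2) :
    gram γ (t • b) i j = gram γ b i j := by
  unfold gram
  rw [← actDeriv_modelGen h.action, ← actDeriv_modelGen h.action, modelForm_smul h.invariant]

lemma gram_eq_of_x_eq (h : IsBiaxial γ C x) {b b' : B} (hb : x b = x b') (i j : Fin 2) :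
    gram γ b i j = gram γ b' i j := by
  obtain ⟨t, rfl⟩ := (h.orbit.eq_iff b b').1 hb
  rw [h.gram_smul]

lemma mdifferentiable_x (h : IsBiaxial γ C x) : MDifferentiable (𝓡 3) 𝓘(ℝ, ℝ) x :=
  h.orbit.smooth.mdifferentiable (by simp)

lemma modelDiff_actDeriv (h : IsBiaxial γ C x) (t : Torus) (b : B) (v : 𝔼 3) :
    modelDiff x (t • b) (actDeriv t b v) = modelDiff x b v := by
  have h1 := mfderiv_comp_apply (I := 𝓡 3) (I' := 𝓡 3) (I'' := 𝓘(ℝ, ℝ)) b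
    (f := fun m : B => t • m) (g := x) (h.mdifferentiable_x (t • b))
    (h.action.mdifferentiable_smul t b) v
  refine h1.symm.trans ?_
  have h2 : x ∘ (fun m : B => t • m) = x := funext fun m => h.x_smul t m
  exact mfderiv_congr_base (I := 𝓡 3) (I' := 𝓘(ℝ, ℝ)) h2 rfl v

/-- The square of the differential of the orbit coordinate as a Gram determinant. -/
lemma modelDiff_sq (h : IsBiaxial γ C x) (b : B) (v : 𝔼 3) :
    modelDiff x b v ^ 2 = C ^ 2 * |gramDet γ b * modelForm γ b v v -
      (gram γ b 1 1 * modelForm γ b v (modelGen 0 b) ^ 2 -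
        2 * gram γ b 0 1 * modelForm γ b v (modelGen 0 b) * modelForm γ b v (modelGen 1 b) +
        gram γ b 0 0 * modelForm γ b v (modelGen 1 b) ^ 2)| := by
  obtain ⟨vol, hvol, hdx⟩ := h.orbit.differential
  have h1 : modelDiff x b v = C * vol b ![generator 0 b, generator 1 b, v] := hdx b v
  rw [h1, mul_pow, hvol.sq_eq]
  congr 2
  rw [Matrix.det_fin_three]
  simp only [Matrix.of_apply, Matrix.cons_val]
  change gram γ b 0 0 * gram γ b 1 1 * modelForm γ b v v -
    gram γ b 0 0 * modelForm γ b (modelGen 1 b) v * modelForm γ b v (modelGen 1 b) -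
    gram γ b 0 1 * gram γ b 1 0 * modelForm γ b v v +
    gram γ b 0 1 * modelForm γ b (modelGen 1 b) v * modelForm γ b v (modelGen 0 b) +
    modelForm γ b (modelGen 0 b) v * gram γ b 1 0 * modelForm γ b v (modelGen 1 b) -
    modelForm γ b (modelGen 0 b) v * gram γ b 1 1 * modelForm γ b v (modelGen 0 b) = _
  rw [h.form_symm b (modelGen 0 b) v, h.form_symm b (modelGen 1 b) v, h.gram_symm b 1 0, gramDet]
  ring

variable [IsManifold (𝓡 3) ∞ B] [ConnectedSpace B]

lemma gram_diag_pos (h : IsBiaxial γ C x) {b : B} (hb1 : -1 < x b) (hb2 : x b < 1)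
    (i : Fin 2) : 0 < gram γ b i i := by
  refine h.form_pos b fun h0 => ?_
  have := h.generators_independent hb1 hb2 (a := Pi.single i 1) (by
    fin_cases i <;> simp_all)
  have h2 := congrFun this i
  simp at h2

lemma gramDet_pos (h : IsBiaxial γ C x) {b : B} (hb1 : -1 < x b) (hb2 : x b < 1) :
    0 < gramDet γ b := by
  have h11 := h.gram_diag_pos hb1 hb2 1
  have hne : ∑ i, (![gram γ b 1 1, -gram γ b 0 1] : Fin 2 → ℝ) i • modelGen (n := 3) i b ≠ 0 := by
    intro h0
    have := congrFun (h.generators_independent hb1 hb2 h0) 0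
    simp only [Matrix.cons_val_zero, Pi.zero_apply] at this
    exact h11.ne' this
  have h2 := h.form_pos b hne
  have h3 : modelForm γ b (∑ i, (![gram γ b 1 1, -gram γ b 0 1] : Fin 2 → ℝ) i • modelGen i b)
      (∑ i, (![gram γ b 1 1, -gram γ b 0 1] : Fin 2 → ℝ) i • modelGen i b) =
      gram γ b 1 1 * gramDet γ b := by
    simp only [sum_univ_two, Matrix.cons_val, map_add, map_smul, LinearMap.add_apply,
      LinearMap.smul_apply, smul_eq_mul]
    change gram γ b 1 1 * (gram γ b 1 1 * gram γ b 0 0 + -gram γ b 0 1 * gram γ b 1 0) +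
      -gram γ b 0 1 * (gram γ b 1 1 * gram γ b 0 1 + -gram γ b 0 1 * gram γ b 1 1) = _
    rw [h.gram_symm b 1 0, gramDet]; ring
  rw [h3] at h2
  exact pos_of_mul_pos_right h2 h11.le

lemma eq_zero_of_orthogonal (h : IsBiaxial γ C x) {b : B} (hb1 : -1 < x b)
    (hb2 : x b < 1) {v : 𝔼 3} (hv : ∀ i, modelForm γ b v (modelGen i b) = 0)
    (hx : modelDiff x b v = 0) : v = 0 := by
  have h1 := h.modelDiff_sq b v
  rw [hx, hv, hv] at h1
  have hD := h.gramDet_pos hb1 hb2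
  have hC : C ^ 2 ≠ 0 := pow_ne_zero 2 h.orbit.pos.ne'
  have h2 : |gramDet γ b * modelForm γ b v v| = 0 := by
    have : C ^ 2 * |gramDet γ b * modelForm γ b v v| = 0 := by simpa using h1.symm
    exact (mul_eq_zero.1 this).resolve_left hC
  exact h.form_self_eq_zero ((mul_eq_zero.1 (abs_eq_zero.1 h2)).resolve_left hD.ne')

/-- The unit normal to the orbits, normalized by the orbit coordinate. -/
lemma exists_normal (h : IsBiaxial γ C x) {b : B} (hb1 : -1 < x b) (hb2 : x b < 1) :
    ∃ v : 𝔼 3, (∀ i, modelForm γ b v (modelGen i b) = 0) ∧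
      modelDiff x b v = 1 := by
  let L : 𝔼 3 →ₗ[ℝ] (Fin 2 → ℝ) := LinearMap.pi fun i => (modelForm γ b).flip (modelGen i b)
  have hker : LinearMap.ker L ≠ ⊥ := LinearMap.ker_ne_bot_of_finrank_lt (by simp)
  obtain ⟨v, hv, hv0⟩ := (Submodule.ne_bot_iff _).1 hker
  have hv' : ∀ i, modelForm γ b v (modelGen i b) = 0 := fun i => congrFun (LinearMap.mem_ker.1 hv) i
  have hx : modelDiff x b v ≠ 0 := fun h0 => hv0 (h.eq_zero_of_orthogonal hb1 hb2 hv' h0)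
  refine ⟨(modelDiff x b v)⁻¹ • v, fun i => by simp [hv'], ?_⟩
  rw [map_smul, smul_eq_mul, inv_mul_cancel₀ hx]

lemma normal_sq (h : IsBiaxial γ C x) {b : B} (hb1 : -1 < x b) (hb2 : x b < 1)
    {v : 𝔼 3} (hv : ∀ i, modelForm γ b v (modelGen i b) = 0) :
    modelDiff x b v ^ 2 = C ^ 2 * (gramDet γ b * modelForm γ b v v) := by
  have h1 := h.modelDiff_sq b v
  rw [hv, hv] at h1
  have h0 : 0 ≤ modelForm γ b v v := by
    rcases eq_or_ne v 0 with rfl | hne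
    · simp
    · exact (h.form_pos b hne).le
  have h2 : 0 ≤ gramDet γ b * modelForm γ b v v := mul_nonneg (h.gramDet_pos hb1 hb2).le h0
  rw [h1]
  congr 1
  simpa using abs_of_nonneg h2

lemma exists_decomposition (h : IsBiaxial γ C x) {b : B} (hb1 : -1 < x b) (hb2 : x b < 1)
    {v : 𝔼 3} (hx : modelDiff x b v = 1) (w : 𝔼 3) :
    ∃ a : Fin 2 → ℝ, w = modelDiff x b w • v + ∑ i, a i • modelGen i b := by
  set w' := w - modelDiff x b w • v with hw'
  have hD := (h.gramDet_pos hb1 hb2).ne'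
  let p0 := modelForm γ b w' (modelGen 0 b)
  let p1 := modelForm γ b w' (modelGen 1 b)
  let a : Fin 2 → ℝ := ![(gram γ b 1 1 * p0 - gram γ b 0 1 * p1) / gramDet γ b,
    (gram γ b 0 0 * p1 - gram γ b 0 1 * p0) / gramDet γ b]
  have hx' : modelDiff x b w' = 0 := by rw [hw', map_sub, map_smul, hx]; simp
  have hz : w' - ∑ i, a i • modelGen i b = 0 := by
    refine h.eq_zero_of_orthogonal hb1 hb2 (fun i => ?_) ?_
    · simp only [sum_univ_two, map_sub, map_add, map_smul, LinearMap.sub_apply,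
        LinearMap.add_apply, LinearMap.smul_apply, smul_eq_mul]
      change modelForm γ b w' (modelGen i b) - (a 0 * gram γ b 0 i + a 1 * gram γ b 1 i) = 0
      fin_cases i
      · change p0 - ((gram γ b 1 1 * p0 - gram γ b 0 1 * p1) / gramDet γ b * gram γ b 0 0 +
          (gram γ b 0 0 * p1 - gram γ b 0 1 * p0) / gramDet γ b * gram γ b 1 0) = 0
        rw [h.gram_symm b 1 0]
        field_simp
        rw [gramDet]; ring
      · change p1 - ((gram γ b 1 1 * p0 - gram γ b 0 1 * p1) / gramDet γ b * gram γ b 0 1 +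
          (gram γ b 0 0 * p1 - gram γ b 0 1 * p0) / gramDet γ b * gram γ b 1 1) = 0
        field_simp
        rw [gramDet]; ring
    · rw [map_sub, map_sum, hx']
      simp [h.dfun_generator]
  refine ⟨a, ?_⟩
  rw [← sub_eq_zero.1 hz, hw']
  abel

end IsBiaxial

end Sections

variable [IsManifold (𝓡 3) ∞ B] [ConnectedSpace B]

/-- The torus angle of a point with coordinates `(t, φ₁, φ₂)`, for the frame `P` of angles. -/
def orbitAngle (P : Matrix (Fin 2) (Fin 2) ℝ) : (Fin 3 → ℝ) →L[ℝ] (Fin 2 → ℝ) :=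
  ContinuousLinearMap.pi fun i =>
    P i 0 • proj 1 + P i 1 • proj 2

lemma orbitAngle_apply (P : Matrix (Fin 2) (Fin 2) ℝ) (y : Fin 3 → ℝ) (i : Fin 2) :
    orbitAngle P y i = P i 0 * y 1 + P i 1 * y 2 := by simp [orbitAngle]

/-- The parametrization `(t, φ) ↦ exp (P φ) • c t` of a neighbourhood of a curve of orbits. -/
def orbitCoord (P : Matrix (Fin 2) (Fin 2) ℝ) (c : ℝ → B) (y : Fin 3 → ℝ) : B :=
  torusExp (orbitAngle P y) • c (y 0)

/-- A smooth curve, defined on the open set `J`, which avoids the axes and is transversal to the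
orbits. -/
structure IsTransversal (x : B → ℝ) (c : ℝ → B) (J : Set ℝ) : Prop where
  isOpen : IsOpen J
  smooth : ContMDiffOn 𝓘(ℝ, ℝ) (𝓡 3) ∞ c J
  interior : ∀ t ∈ J, -1 < x (c t) ∧ x (c t) < 1
  transverse : ∀ t ∈ J, modelDiff (n := 3) x (c t) (modelDeriv c t 1) ≠ 0

lemma IsTransversal.mdifferentiableAt (hc : IsTransversal x c J) {t : ℝ} (ht : t ∈ J) :
    MDifferentiableAt 𝓘(ℝ, ℝ) (𝓡 3) c t :=
  (hc.smooth.contMDiffAt (hc.isOpen.mem_nhds ht)).mdifferentiableAt (by simp)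

/-- The velocity of a curve. -/
def velocity (c : ℝ → B) (t : ℝ) : 𝔼 3 := modelDeriv c t 1

lemma modelDeriv_orbitCoord (h : IsBiaxial γ C x) (hc : IsTransversal x c J)
    {y : Fin 3 → ℝ} (hy : y 0 ∈ J) (v : Fin 3 → ℝ) :
    modelDeriv (orbitCoord P c) y v = ∑ i, orbitAngle P v i • modelGen i (orbitCoord P c y) +
      v 0 • actDeriv (torusExp (orbitAngle P y)) (c (y 0)) (velocity c (y 0)) := by
  have h0 : HasMFDerivAt 𝓘(ℝ, Fin 3 → ℝ) 𝓘(ℝ, ℝ) (fun y : Fin 3 → ℝ => y 0) y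
      (proj 0 : (Fin 3 → ℝ) →L[ℝ] ℝ) :=
    (proj 0 : (Fin 3 → ℝ) →L[ℝ] ℝ).hasFDerivAt.hasMFDerivAt
  have h1 : HasMFDerivAt 𝓘(ℝ, Fin 3 → ℝ) (𝓡 3) (fun y : Fin 3 → ℝ => c (y 0)) y _ :=
    HasMFDerivAt.comp y (hc.mdifferentiableAt hy).hasMFDerivAt h0
  have h2 := modelDeriv_torusExp_smul h.action (orbitAngle P).differentiableAt
    h1.mdifferentiableAt (z := y) v
  refine h2.trans ?_
  rw [(orbitAngle P).fderiv]
  congr 1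
  have h3 : modelDeriv (n := 3) (fun y : Fin 3 → ℝ => c (y 0)) y v = v 0 • velocity c (y 0) := by
    refine (congrArg (fun L : (Fin 3 → ℝ) →L[ℝ] 𝔼 3 => L v) h1.mfderiv).trans ?_
    change modelDeriv c (y 0) (v 0) = v 0 • modelDeriv c (y 0) 1
    rw [← map_smul]; simp
  rw [h3, map_smul]

lemma contMDiffOn_orbitCoord (h : IsBiaxial γ C x) (hc : IsTransversal x c J) :
    ContMDiffOn 𝓘(ℝ, Fin 3 → ℝ) (𝓡 3) ∞ (orbitCoord P c) {y | y 0 ∈ J} := by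
  have h0 : ContMDiff 𝓘(ℝ, Fin 3 → ℝ) 𝓘(ℝ, ℝ) ∞ (fun y : Fin 3 → ℝ => y 0) :=
    contMDiff_iff_contDiff.2 (contDiff_apply ℝ ℝ 0)
  have h1 : ContMDiffOn 𝓘(ℝ, Fin 3 → ℝ) (𝓡 3) ∞ (fun y : Fin 3 → ℝ => c (y 0)) {y | y 0 ∈ J} :=
    hc.smooth.comp h0.contMDiffOn fun y hy => hy
  have h2 : ContMDiff 𝓘(ℝ, Fin 3 → ℝ) 𝓘(ℝ, Fin 2 → ℝ) ∞ (orbitAngle P) :=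
    contMDiff_iff_contDiff.2 (orbitAngle P).contDiff
  exact h.action.contMDiff_torusExp_smul.comp_contMDiffOn (h2.contMDiffOn.prodMk h1)

lemma x_orbitCoord (h : IsBiaxial γ C x) (y : Fin 3 → ℝ) :
    x (orbitCoord P c y) = x (c (y 0)) := h.x_smul _ _

lemma isLocalCoord_orbitCoord (h : IsBiaxial γ C x) (hc : IsTransversal x c J)
    (hP : P.det ≠ 0) : IsLocalCoord (orbitCoord P c) {y | y 0 ∈ J} where
  isOpen := hc.isOpen.preimage (continuous_apply 0)
  smooth := contMDiffOn_orbitCoord h hc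
  bijective := by
    intro y hy
    change Function.Bijective (modelDeriv (n := 3) (orbitCoord P c) y)
    have hinj : Function.Injective (modelDeriv (n := 3) (orbitCoord P c) y).toLinearMap := by
      rw [injective_iff_map_eq_zero]
      intro v hv
      have hv' : modelDeriv (n := 3) (orbitCoord P c) y v = 0 := hv
      rw [modelDeriv_orbitCoord h hc hy] at hv'
      have hx1 : -1 < x (orbitCoord P c y) := by
        rw [x_orbitCoord h]; exact (hc.interior _ hy).1
      have hx2 : x (orbitCoord P c y) < 1 := by
        rw [x_orbitCoord h]; exact (hc.interior _ hy).2
      have h1 := congrArg (modelDiff (n := 3) x (orbitCoord P c y)) hv'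
      rw [map_add, map_sum, map_zero, map_smul] at h1
      simp only [map_smul, h.dfun_generator, smul_zero, Finset.sum_const_zero, zero_add] at h1
      have h2 := h.modelDiff_actDeriv (torusExp (orbitAngle P y)) (c (y 0)) (velocity c (y 0))
      have h3 : modelDiff (n := 3) x (orbitCoord P c y) (actDeriv (torusExp (orbitAngle P y)) (c (y 0))
          (velocity c (y 0))) ≠ 0 := h2.trans_ne (hc.transverse _ hy)
      have hv0 : v 0 = 0 := (mul_eq_zero.1 h1).resolve_right h3
      rw [hv0, zero_smul, add_zero] at hv'
      have h4 := h.generators_independent hx1 hx2 hv'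
      have e0 := congrFun h4 0
      have e1 := congrFun h4 1
      simp only [orbitAngle_apply, Pi.zero_apply] at e0 e1
      rw [Matrix.det_fin_two] at hP
      have hv1 : v 1 = 0 := by
        have : (P 0 0 * P 1 1 - P 0 1 * P 1 0) * v 1 = 0 := by linear_combination P 1 1 * e0 - P 0 1 * e1
        exact (mul_eq_zero.1 this).resolve_left hP
      have hv2 : v 2 = 0 := by
        have : (P 0 0 * P 1 1 - P 0 1 * P 1 0) * v 2 = 0 := by linear_combination P 0 0 * e1 - P 1 0 * e0
        exact (mul_eq_zero.1 this).resolve_left hP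
      ext i; fin_cases i
      exacts [hv0, hv1, hv2]
    exact ⟨hinj, (LinearMap.injective_iff_surjective_of_finrank_eq_finrank (by simp)).1 hinj⟩

lemma modelCoord_orbitCoord_zero (h : IsBiaxial γ C x) (hc : IsTransversal x c J)
    {y : Fin 3 → ℝ} (hy : y 0 ∈ J) :
    modelCoord (orbitCoord P c) y 0 =
      actDeriv (torusExp (orbitAngle P y)) (c (y 0)) (velocity c (y 0)) := by
  have h1 := modelDeriv_orbitCoord (P := P) h hc hy (Pi.single 0 1)
  have h2 : orbitAngle P (Pi.single 0 1) = 0 := by ext i; simp [orbitAngle_apply]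
  simp only [h2, Pi.zero_apply, zero_smul, Finset.sum_const_zero, zero_add, Pi.single_eq_same,
    one_smul] at h1
  exact h1

lemma modelCoord_orbitCoord_succ (h : IsBiaxial γ C x) (hc : IsTransversal x c J)
    {y : Fin 3 → ℝ} (hy : y 0 ∈ J) (j : Fin 2) :
    modelCoord (orbitCoord P c) y j.succ =
      ∑ i, P i j • modelGen i (orbitCoord P c y) := by
  have h1 := modelDeriv_orbitCoord (P := P) h hc hy (Pi.single j.succ 1)
  have h2 : ∀ i, orbitAngle P (Pi.single j.succ 1) i = P i j := by
    intro i; fin_cases j <;> simp [orbitAngle_apply]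
  simp only [h2, Pi.single_eq_of_ne (Fin.succ_ne_zero j).symm, zero_smul, add_zero] at h1
  exact h1

lemma comp_orbitCoord_zero_zero (h : IsBiaxial γ C x) (hc : IsTransversal x c J)
    {y : Fin 3 → ℝ} (hy : y 0 ∈ J) :
    comp γ (orbitCoord P c) y 0 0 =
      modelForm γ (c (y 0)) (velocity c (y 0)) (velocity c (y 0)) := by
  rw [comp_eq_modelForm, modelCoord_orbitCoord_zero h hc hy]
  exact modelForm_smul h.invariant _ _ _ _

lemma comp_orbitCoord_zero_succ (h : IsBiaxial γ C x) (hc : IsTransversal x c J)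
    {y : Fin 3 → ℝ} (hy : y 0 ∈ J) (j : Fin 2) :
    comp γ (orbitCoord P c) y 0 j.succ =
      ∑ i, P i j * modelForm γ (c (y 0)) (velocity c (y 0)) (modelGen i (c (y 0))) := by
  rw [comp_eq_modelForm, modelCoord_orbitCoord_zero h hc hy, modelCoord_orbitCoord_succ h hc hy, map_sum]
  refine sum_congr rfl fun i _ => ?_
  rw [map_smul, smul_eq_mul]
  congr 1
  rw [← modelForm_smul h.invariant (torusExp (orbitAngle P y)) (c (y 0)) (velocity c (y 0)),
    actDeriv_modelGen h.action]
  rfl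

lemma comp_orbitCoord_succ_succ (h : IsBiaxial γ C x) (hc : IsTransversal x c J)
    {y : Fin 3 → ℝ} (hy : y 0 ∈ J) (i j : Fin 2) :
    comp γ (orbitCoord P c) y i.succ j.succ =
      ∑ k, ∑ l, P k i * P l j * gram γ (c (y 0)) k l := by
  have hg : ∀ k l, modelForm γ (orbitCoord P c y) (modelGen k (orbitCoord P c y))
      (modelGen l (orbitCoord P c y)) = gram γ (c (y 0)) k l := fun k l =>
    h.gram_smul (torusExp (orbitAngle P y)) (c (y 0)) k l
  rw [comp_eq_modelForm, modelCoord_orbitCoord_succ h hc hy, modelCoord_orbitCoord_succ h hc hy]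
  simp only [sum_univ_two, map_add, map_smul, LinearMap.add_apply, LinearMap.smul_apply,
    smul_eq_mul, hg]
  ring

/-- A smooth section `c` of the orbit coordinate over the open set `J`. -/
structure IsOrbitSection (x : B → ℝ) (c : ℝ → B) (J : Set ℝ) : Prop where
  isOpen : IsOpen J
  subset : J ⊆ 𝕀
  smooth : ContMDiffOn 𝓘(ℝ, ℝ) (𝓡 3) ∞ c J
  x_eq : ∀ t ∈ J, x (c t) = t

lemma IsOrbitSection.modelDiff_velocity {c : ℝ → B} {J : Set ℝ} (hc : IsOrbitSection x c J)
    (h : IsBiaxial γ C x) {t : ℝ} (ht : t ∈ J) :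
    modelDiff (n := 3) x (c t) (velocity c t) = 1 := by
  have hd : MDifferentiableAt 𝓘(ℝ, ℝ) (𝓡 3) c t :=
    (hc.smooth.contMDiffAt (hc.isOpen.mem_nhds ht)).mdifferentiableAt (by simp)
  have h1 := (fderiv_comp_modelDeriv (h.mdifferentiable_x (c t)) hd).hasDerivAt
  have h2 : HasDerivAt (fun s => x (c s)) 1 t := by
    refine (hasDerivAt_id t).congr_of_eventuallyEq ?_
    filter_upwards [hc.isOpen.mem_nhds ht] with s hs using hc.x_eq s hs
  exact h1.unique h2

lemma IsOrbitSection.isTransversal {c : ℝ → B} {J : Set ℝ} (hc : IsOrbitSection x c J)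
    (h : IsBiaxial γ C x) : IsTransversal x c J where
  isOpen := hc.isOpen
  smooth := hc.smooth
  interior t ht := by rw [hc.x_eq t ht]; exact hc.subset ht
  transverse t ht := by
    have := hc.modelDiff_velocity h ht
    rw [velocity] at this
    rw [this]
    exact one_ne_zero

lemma IsBiaxial.exists_section (h : IsBiaxial γ C x) {b : B} (hb1 : -1 < x b)
    (hb2 : x b < 1) : ∃ (δ : ℝ) (c : ℝ → B), 0 < δ ∧
      IsOrbitSection x c (Ioo (x b - δ) (x b + δ)) ∧ c (x b) = b := by
  obtain ⟨v, -, hv⟩ := h.exists_normal hb1 hb2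
  obtain ⟨σ, V, hσ, -, h0V, rfl⟩ := exists_isLocalCoord (n := 3) b
  obtain ⟨w, hw⟩ := (hσ.bijective_modelDeriv h0V).2 v
  let l : ℝ →L[ℝ] (Fin 3 → ℝ) := (ContinuousLinearMap.id ℝ ℝ).smulRight w
  have hl0 : l 0 = 0 := map_zero l
  have hl1 : l 1 = w := by simp [l]
  let S : Set ℝ := l ⁻¹' V
  have hS : IsOpen S := hσ.isOpen.preimage l.continuous
  have h0S : (0 : ℝ) ∈ S := by change l 0 ∈ V; rw [hl0]; exact h0V
  let ρ : ℝ → B := fun s => σ (l s)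
  have hρ : ContMDiffOn 𝓘(ℝ, ℝ) (𝓡 3) ∞ ρ S :=
    hσ.smooth.comp (contMDiff_iff_contDiff.2 l.contDiff).contMDiffOn fun s hs => hs
  let k : ℝ → ℝ := fun s => x (ρ s)
  have hk : ContDiffOn ℝ ∞ k S := (h.orbit.smooth.comp_contMDiffOn hρ).contDiffOn
  have hk0 : k 0 = x (σ 0) := by simp only [k, ρ, hl0]
  have hkc : ∀ s ∈ S, ContDiffAt ℝ ∞ k s := fun s hs => hk.contDiffAt (hS.mem_nhds hs)
  have hd0 : HasDerivAt k 1 0 := by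
    have h1 : HasFDerivAt (fun y => x (σ y)) _ (l 0) :=
      fderiv_comp_modelDeriv (h.mdifferentiable_x _) (hσ.mdifferentiableAt (by rw [hl0]; exact h0V))
    have h2 := (h1.comp 0 l.hasFDerivAt).hasDerivAt
    have h3 : (((modelDiff (n := 3) x (σ (l 0))).comp (modelDeriv σ (l 0))).comp l) 1 = 1 := by
      simp only [ContinuousLinearMap.comp_apply, hl1, hl0]
      rw [hw, hv]
    rw [h3] at h2
    exact h2
  have hs0 : HasStrictDerivAt k 1 0 := (hkc 0 h0S).hasStrictDerivAt' hd0 (by simp)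
  let e := (hs0.hasStrictFDerivAt_equiv one_ne_zero).toOpenPartialHomeomorph k
  have hek : ∀ s, e s = k s := fun s => rfl
  have he0 : (0 : ℝ) ∈ e.source := HasStrictFDerivAt.mem_toOpenPartialHomeomorph_source _
  let S' : Set ℝ := S ∩ (deriv k) ⁻¹' {0}ᶜ
  have hS' : IsOpen S' := (hk.continuousOn_deriv_of_isOpen hS (by simp)).isOpen_inter_preimage hS
      isOpen_compl_singleton
  have h0S' : (0 : ℝ) ∈ S' := ⟨h0S, by simp [hd0.deriv]⟩
  have hT : IsOpen (e.target ∩ e.symm ⁻¹' S') := e.isOpen_inter_preimage_symm hS'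
  have hxT : x (σ 0) ∈ e.target ∩ e.symm ⁻¹' S' := by
    have h1 : e 0 = x (σ 0) := hk0
    refine ⟨h1 ▸ e.map_source he0, ?_⟩
    change e.symm (x (σ 0)) ∈ S'
    rw [← h1, e.left_inv he0]
    exact h0S'
  obtain ⟨δ, hδ, hball⟩ := Metric.isOpen_iff.1 (hT.inter (isOpen_Ioo (a := (-1 : ℝ)) (b := 1)))
    (x (σ 0)) ⟨hxT, hb1, hb2⟩
  rw [Real.ball_eq_Ioo] at hball
  refine ⟨δ, fun t => ρ (e.symm t), hδ, ⟨isOpen_Ioo, fun t ht => (hball ht).2, ?_, ?_⟩, ?_⟩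
  · have hes : ContDiffOn ℝ ∞ e.symm (Ioo (x (σ 0) - δ) (x (σ 0) + δ)) := by
      intro t ht
      obtain ⟨⟨ht1, ht2⟩, -⟩ := hball ht
      have hd : HasDerivAt k (deriv k (e.symm t)) (e.symm t) :=
        ((hkc _ ht2.1).differentiableAt (by simp)).hasDerivAt
      exact (e.contDiffAt_symm_deriv ht2.2 ht1 hd (hkc _ ht2.1)).contDiffWithinAt
    exact hρ.comp (contMDiffOn_iff_contDiffOn.2 hes) fun t ht => (hball ht).1.2.1
  · intro t ht
    exact e.right_inv (hball ht).1.1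
  · have h1 : e 0 = x (σ 0) := hk0
    change ρ (e.symm (x (σ 0))) = σ 0
    rw [← h1, e.left_inv he0]
    simp only [ρ, hl0]

/-- Orbit sections orthogonal to the orbits. -/
def IsOrthogonalCurve (γ : TwoTensor 3 B) (c : ℝ → B) (J : Set ℝ) : Prop :=
  ∀ t ∈ J, ∀ i, modelForm γ (c t) (velocity c t) (modelGen i (c t)) = 0

lemma IsOrbitSection.comp_smooth {c : ℝ → B} {J : Set ℝ} (hc : IsOrbitSection x c J)
    (h : IsBiaxial γ C x) (a b : Fin 3) :
    ContDiffOn ℝ ∞ (fun t => comp γ (orbitCoord 1 c) ![t, 0, 0] a b) J := by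
  have hloc := isLocalCoord_orbitCoord h (hc.isTransversal h) (P := 1) (by simp)
  refine (h.smooth _ _ hloc a b).comp (g := fun y => comp γ (orbitCoord 1 c) y a b)
    (f := fun t : ℝ => (![t, 0, 0] : Fin 3 → ℝ)) ?_ fun t ht => ht
  exact (contDiff_pi.2 fun i => by fin_cases i <;> simp <;> fun_prop).contDiffOn

lemma IsOrbitSection.gram_smooth {c : ℝ → B} {J : Set ℝ} (hc : IsOrbitSection x c J)
    (h : IsBiaxial γ C x) (i j : Fin 2) :
    ContDiffOn ℝ ∞ (fun t => gram γ (c t) i j) J := by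
  refine (hc.comp_smooth h i.succ j.succ).congr fun t ht => ?_
  rw [comp_orbitCoord_succ_succ h (hc.isTransversal h) (y := ![t, 0, 0]) ht]
  simp [Matrix.one_apply]

lemma IsOrbitSection.shift_smooth {c : ℝ → B} {J : Set ℝ} (hc : IsOrbitSection x c J)
    (h : IsBiaxial γ C x) (j : Fin 2) :
    ContDiffOn ℝ ∞ (fun t => modelForm γ (c t) (velocity c t) (modelGen j (c t))) J := by
  refine (hc.comp_smooth h 0 j.succ).congr fun t ht => ?_
  rw [comp_orbitCoord_zero_succ h (hc.isTransversal h) (y := ![t, 0, 0]) ht]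
  simp [Matrix.one_apply]

lemma exists_primitive {a : ℝ → ℝ} {s δ : ℝ} (hδ : 0 < δ)
    (ha : ContDiffOn ℝ ∞ a (Ioo (s - δ) (s + δ))) :
    ∃ φ : ℝ → ℝ, φ s = 0 ∧ (∀ t ∈ Ioo (s - δ) (s + δ), HasDerivAt φ (a t) t) ∧
      ContDiffOn ℝ ∞ φ (Ioo (s - δ) (s + δ)) := by
  have hs : s ∈ Ioo (s - δ) (s + δ) := ⟨by linarith, by linarith⟩
  have hder : ∀ t ∈ Ioo (s - δ) (s + δ), HasDerivAt (fun t => ∫ r in s..t, a r) (a t) t := by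
    intro t ht
    have hsub : Set.uIcc s t ⊆ Ioo (s - δ) (s + δ) := by
      exact (Set.ordConnected_Ioo).uIcc_subset hs ht
    refine intervalIntegral.integral_hasDerivAt_right
      ((ha.continuousOn.mono hsub).intervalIntegrable) ?_
      (ha.continuousOn.continuousAt (isOpen_Ioo.mem_nhds ht))
    exact ContinuousOn.stronglyMeasurableAtFilter isOpen_Ioo ha.continuousOn t ht
  refine ⟨fun t => ∫ r in s..t, a r, by simp, hder, ?_⟩
  rw [contDiffOn_infty_iff_deriv_of_isOpen isOpen_Ioo]
  refine ⟨fun t ht => (hder t ht).differentiableAt.differentiableWithinAt, ?_⟩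
  exact ha.congr fun t ht => (hder t ht).deriv

lemma IsBiaxial.exists_orthogonal_section (h : IsBiaxial γ C x) {b : B}
    (hb1 : -1 < x b) (hb2 : x b < 1) : ∃ (δ : ℝ) (c : ℝ → B), 0 < δ ∧
      IsOrbitSection x c (Ioo (x b - δ) (x b + δ)) ∧
      IsOrthogonalCurve γ c (Ioo (x b - δ) (x b + δ)) ∧ c (x b) = b := by
  obtain ⟨δ, c, hδ, hc, hcb⟩ := h.exists_section hb1 hb2
  let D : ℝ → ℝ := fun t => gramDet γ (c t)
  have hDpos : ∀ t ∈ Ioo (x b - δ) (x b + δ), 0 < D t := fun t ht =>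
    h.gramDet_pos ((hc.isTransversal h).interior t ht).1 ((hc.isTransversal h).interior t ht).2
  have hg := hc.gram_smooth h
  have hp := hc.shift_smooth h
  have hD : ContDiffOn ℝ ∞ D (Ioo (x b - δ) (x b + δ)) :=
    ((hg 0 0).mul (hg 1 1)).sub ((hg 0 1).pow 2)
  let p : Fin 2 → ℝ → ℝ := fun i t => modelForm γ (c t) (velocity c t) (modelGen i (c t))
  obtain ⟨φ0, h00, h01, h02⟩ := exists_primitive (a := fun t =>
    -((gram γ (c t) 1 1 * p 0 t - gram γ (c t) 0 1 * p 1 t) / D t)) hδ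
    ((((hg 1 1).mul (hp 0)).sub ((hg 0 1).mul (hp 1))).div hD fun t ht => (hDpos t ht).ne').neg
  obtain ⟨φ1, h10, h11, h12⟩ := exists_primitive (a := fun t =>
    -((gram γ (c t) 0 0 * p 1 t - gram γ (c t) 0 1 * p 0 t) / D t)) hδ
    ((((hg 0 0).mul (hp 1)).sub ((hg 0 1).mul (hp 0))).div hD fun t ht => (hDpos t ht).ne').neg
  let φ : ℝ → Fin 2 → ℝ := fun t => ![φ0 t, φ1 t]
  have hφ : ContDiffOn ℝ ∞ φ (Ioo (x b - δ) (x b + δ)) :=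
    contDiffOn_pi.2 fun i => by fin_cases i; exacts [h02, h12]
  have hφd : ∀ t ∈ Ioo (x b - δ) (x b + δ), HasDerivAt φ
      ![-((gram γ (c t) 1 1 * p 0 t - gram γ (c t) 0 1 * p 1 t) / D t),
        -((gram γ (c t) 0 0 * p 1 t - gram γ (c t) 0 1 * p 0 t) / D t)] t := fun t ht =>
    hasDerivAt_pi.2 fun i => by fin_cases i; exacts [h01 t ht, h11 t ht]
  refine ⟨δ, fun t => torusExp (φ t) • c t, hδ, ⟨isOpen_Ioo, hc.subset, ?_, ?_⟩, ?_, ?_⟩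
  · exact h.action.contMDiff_torusExp_smul.comp_contMDiffOn
      ((contMDiffOn_iff_contDiffOn.2 hφ).prodMk hc.smooth)
  · intro t ht
    rw [h.x_smul, hc.x_eq t ht]
  · intro t ht i
    have hd : MDifferentiableAt 𝓘(ℝ, ℝ) (𝓡 3) c t :=
      (hc.smooth.contMDiffAt (isOpen_Ioo.mem_nhds ht)).mdifferentiableAt (by simp)
    have hv : velocity (fun t => torusExp (φ t) • c t) t = _ :=
      modelDeriv_torusExp_smul h.action (hφd t ht).differentiableAt hd 1
    have hf : fderiv ℝ φ t 1 = _ := (hφd t ht).deriv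
    rw [hf] at hv
    have h1 : modelForm γ (torusExp (φ t) • c t) (actDeriv (torusExp (φ t)) (c t) (velocity c t))
        (modelGen i (torusExp (φ t) • c t)) = p i t := by
      rw [← actDeriv_modelGen h.action, modelForm_smul h.invariant]
    have hgs : ∀ k l, modelForm γ (torusExp (φ t) • c t) (modelGen k (torusExp (φ t) • c t))
        (modelGen l (torusExp (φ t) • c t)) = gram γ (c t) k l := fun k l =>
      h.gram_smul (torusExp (φ t)) (c t) k l
    have hDt : D t = gram γ (c t) 0 0 * gram γ (c t) 1 1 - gram γ (c t) 0 1 ^ 2 := rfl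
    have hD0 := (hDpos t ht).ne'
    rw [hv]
    change modelForm γ (torusExp (φ t) • c t) (_ + actDeriv (torusExp (φ t)) (c t) (velocity c t))
        (modelGen i (torusExp (φ t) • c t)) = 0
    rw [map_add, LinearMap.add_apply, h1]
    simp only [sum_univ_two, map_add, map_smul, LinearMap.add_apply, LinearMap.smul_apply,
      smul_eq_mul, hgs, Matrix.cons_val]
    fin_cases i
    · simp only [Fin.zero_eta, Fin.isValue]
      rw [h.gram_symm (c t) 1 0]
      field_simp
      rw [hDt]; ring
    · simp only [Fin.mk_one, Fin.isValue]
      field_simp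
      rw [hDt]; ring
  · change torusExp ![φ0 (x b), φ1 (x b)] • c (x b) = b
    have h0 : (![φ0 (x b), φ1 (x b)] : Fin 2 → ℝ) = 0 := by
      rw [h00, h10]; ext i; fin_cases i <;> rfl
    rw [h0, torusExp_zero, one_smul, hcb]

lemma IsLocalCoord.exists_injOn {n : ℕ} {N : Type*} [TopologicalSpace N]
    [ChartedSpace (𝔼 n) N] {σ : (Fin n → ℝ) → N} {V : Set (Fin n → ℝ)}
    (hσ : IsLocalCoord σ V) {y : Fin n → ℝ} (hy : y ∈ V) : ∃ W ∈ 𝓝 y, InjOn σ W := by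
  have hs := hσ.hasStrictFDerivAt_chart hy
  let e := hs.toOpenPartialHomeomorph _
  refine ⟨e.source, e.open_source.mem_nhds hs.mem_toOpenPartialHomeomorph_source, ?_⟩
  intro a ha b hb hab
  refine e.injOn ha hb ?_
  change extChartAt (𝓡 n) (σ y) (σ a) = extChartAt (𝓡 n) (σ y) (σ b)
  rw [hab]

/-- Every torus element has powers which are exponentials of arbitrarily small angles. -/
lemma exists_pow_eq_torusExp (t : Torus) {W : Set (Fin 2 → ℝ)} (hW : W ∈ 𝓝 0) :
    ∃ k : ℕ, 0 < k ∧ ∃ φ ∈ W, t ^ k = torusExp φ := by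
  let f : Torus → Fin 2 → ℝ := fun z => ![Complex.arg z.1, Complex.arg z.2]
  have hf : ContinuousAt f 1 := by
    refine continuousAt_pi.2 fun i => ?_
    have harg : ContinuousAt Complex.arg ((1 : Circle) : ℂ) :=
      Complex.continuousAt_arg (by simp [Complex.mem_slitPlane_iff])
    fin_cases i
    · exact ContinuousAt.comp (x := (1 : Torus)) (f := fun z : Torus => (z.1 : ℂ)) harg
        (continuous_subtype_val.comp continuous_fst).continuousAt
    · exact ContinuousAt.comp (x := (1 : Torus)) (f := fun z : Torus => (z.2 : ℂ)) harg
        (continuous_subtype_val.comp continuous_snd).continuousAt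
  have hf1 : f 1 = 0 := by ext i; fin_cases i <;> simp [f]
  have hfe : ∀ z, torusExp (f z) = z := fun z => by simp [torusExp, f]
  have hmem : f ⁻¹' W ∈ 𝓝 (1 : Torus) := hf (by rwa [hf1])
  have hfreq := (mapClusterPt_iff_frequently.1 (mapClusterPt_one_atTop_pow t)) _ hmem
  obtain ⟨k, hk, hk0⟩ := (hfreq.and_eventually (eventually_gt_atTop 0)).exists
  exact ⟨k, hk0, f (t ^ k), hk, (hfe _).symm⟩

lemma modelForm_fixed {n : ℕ} {N : Type*} [TopologicalSpace N]
    [ChartedSpace (𝔼 n) N] [MulAction Torus N] {h : TwoTensor n N}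
    (hh : IsInvariant h) {t : Torus} {m : N} (hm : t • m = m) (v w : 𝔼 n) :
    modelForm h m (actDeriv t m v) (actDeriv t m w) = modelForm h m v w := by
  have h1 := modelForm_smul hh t m v w
  rwa [hm] at h1

/-- The action is free away from the axes. -/
lemma IsBiaxial.eq_one_of_smul_eq [T2Space B] (h : IsBiaxial γ C x) {b : B}
    (hb1 : -1 < x b) (hb2 : x b < 1) {t : Torus} (ht : t • b = b) : t = 1 := by
  obtain ⟨k, hk, htk⟩ : ∃ k : ℕ, 0 < k ∧ t ^ k = 1 := by
    obtain ⟨δ, c, hδ, hc, hcb⟩ := h.exists_section hb1 hb2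
    have hloc := isLocalCoord_orbitCoord h (hc.isTransversal h) (P := 1) (by simp)
    let l : (Fin 2 → ℝ) → Fin 3 → ℝ := fun φ => ![x b, φ 0, φ 1]
    have hl : Continuous l := by
      refine continuous_pi fun i => ?_
      fin_cases i <;> simp [l] <;> fun_prop
    have hlφ : ∀ φ, orbitCoord 1 c (l φ) = torusExp φ • b := by
      intro φ
      have : orbitAngle 1 (l φ) = φ := by
        ext i; fin_cases i <;> simp [orbitAngle_apply, l]
      rw [orbitCoord, this]
      change torusExp φ • c (x b) = _
      rw [hcb]
    obtain ⟨W, hW, hinj⟩ := hloc.exists_injOn (y := l 0) ⟨by simp [l, hδ], by simp [l, hδ]⟩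
    obtain ⟨k, hk, φ, hφ, htφ⟩ := exists_pow_eq_torusExp t (hl.continuousAt hW)
    refine ⟨k, hk, ?_⟩
    have hfix : ∀ j : ℕ, t ^ j • b = b := fun j => by
      induction j with
      | zero => simp
      | succ j ih => rw [pow_succ, mul_smul, ht, ih]
    have h1 : l φ = l 0 := by
      refine hinj hφ (mem_of_mem_nhds hW) ?_
      rw [hlφ, hlφ, ← htφ, hfix, torusExp_zero, one_smul]
    have h2 : φ = 0 := by
      ext i; fin_cases i
      exacts [congrFun h1 1, congrFun h1 2]
    rw [htφ, h2, torusExp_zero]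
  refine eq_one_of_fixed h.action h.faithful hk htk ht fun w => ?_
  have hgen : ∀ i, actDeriv (n := 3) t b (modelGen i b) = modelGen i b := fun i => by
    rw [actDeriv_modelGen h.action, ht]
  obtain ⟨v, hv, hv1⟩ := h.exists_normal hb1 hb2
  have hdx : ∀ w, modelDiff (n := 3) x b (actDeriv t b w) = modelDiff x b w := fun w => by
    have := h.modelDiff_actDeriv t b w
    rwa [ht] at this
  have hnorm : actDeriv (n := 3) t b v - v = 0 := by
    refine h.eq_zero_of_orthogonal hb1 hb2 (fun i => ?_) (by rw [map_sub, hdx, sub_self])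
    rw [map_sub, LinearMap.sub_apply, hv, sub_zero, ← hgen i, modelForm_fixed h.invariant ht, hv]
  obtain ⟨a, ha⟩ := h.exists_decomposition hb1 hb2 hv1 w
  rw [ha, map_add, map_smul, map_sum, sub_eq_zero.1 hnorm]
  simp only [map_smul, hgen]

lemma two_le_smooth : (2 : WithTop ℕ∞) ≤ (⊤ : ℕ∞) := WithTop.coe_le_coe.2 le_top

lemma one_add_one_le_smooth : (1 + 1 : WithTop ℕ∞) ≤ (⊤ : ℕ∞) :=
  WithTop.coe_le_coe.2 (le_top (a := (1 + 1 : ℕ∞)))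

section Linearization

variable {n : ℕ} {N : Type*} [TopologicalSpace N] [ChartedSpace (𝔼 n) N]
  [MulAction Torus N]

/-- The torus action in local coordinates. -/
def coordAction (σ : (Fin n → ℝ) → N) (V : Set (Fin n → ℝ)) (z : (Fin 2 → ℝ) × (Fin n → ℝ)) :
    Fin n → ℝ :=
  invFunOn σ V (torusExp z.1 • σ z.2)

/-- The generator `∑ aᵢ ηᵢ` in local coordinates. -/
def coordField (σ : (Fin n → ℝ) → N) (V : Set (Fin n → ℝ)) (a : Fin 2 → ℝ) (y : Fin n → ℝ) :
    Fin n → ℝ :=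
  fderiv ℝ (coordAction σ V) (0, y) (a, 0)

/-- The differential at the origin of `torusExp φ` in local coordinates. -/
def coordIsotropy (σ : (Fin n → ℝ) → N) (V : Set (Fin n → ℝ)) (φ : Fin 2 → ℝ) :
    (Fin n → ℝ) →L[ℝ] (Fin n → ℝ) :=
  (fderiv ℝ (coordAction σ V) (φ, 0)).comp (ContinuousLinearMap.inr ℝ (Fin 2 → ℝ) (Fin n → ℝ))

/-- The linearization at the origin of the generator `∑ aᵢ ηᵢ` in local coordinates. -/
def coordLinear (σ : (Fin n → ℝ) → N) (V : Set (Fin n → ℝ)) (a : Fin 2 → ℝ) :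
    (Fin n → ℝ) →L[ℝ] (Fin n → ℝ) :=
  (ContinuousLinearMap.apply ℝ (Fin n → ℝ) ((a, 0) : (Fin 2 → ℝ) × (Fin n → ℝ))).comp
    ((fderiv ℝ (fderiv ℝ (coordAction σ V)) (0, 0)).comp
      (ContinuousLinearMap.inr ℝ (Fin 2 → ℝ) (Fin n → ℝ)))

variable {σ : (Fin n → ℝ) → N} {V : Set (Fin n → ℝ)}

lemma contDiffAt_coordAction (hN : IsSmoothAction n N) (hσ : IsLocalCoord σ V)
    (hinj : InjOn σ V) {z : (Fin 2 → ℝ) × (Fin n → ℝ)} (hz : z.2 ∈ V)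
    (hz' : torusExp z.1 • σ z.2 ∈ σ '' V) :
    ContDiffAt ℝ ∞ (coordAction σ V) z ∧
      ∀ᶠ w in 𝓝 z, σ (coordAction σ V w) = torusExp w.1 • σ w.2 := by
  have h2 : ContMDiffAt 𝓘(ℝ, (Fin 2 → ℝ) × (Fin n → ℝ)) (𝓡 n) ∞
      (fun w : (Fin 2 → ℝ) × (Fin n → ℝ) => σ w.2) z :=
    (hσ.contMDiffAt hz).comp z (contMDiff_iff_contDiff.2 contDiff_snd).contMDiffAt
  have h1 : ContMDiffAt 𝓘(ℝ, (Fin 2 → ℝ) × (Fin n → ℝ)) 𝓘(ℝ, Fin 2 → ℝ) ∞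
      (fun w : (Fin 2 → ℝ) × (Fin n → ℝ) => w.1) z :=
    (contMDiff_iff_contDiff.2 contDiff_fst).contMDiffAt
  have hs : ContMDiffAt 𝓘(ℝ, (Fin 2 → ℝ) × (Fin n → ℝ)) (𝓡 n) ∞
      (fun w : (Fin 2 → ℝ) × (Fin n → ℝ) => torusExp w.1 • σ w.2) z :=
    hN.contMDiff_torusExp_smul.contMDiffAt.comp z (h1.prodMk h2)
  obtain ⟨h3, h4⟩ := hσ.contDiffAt_invFunOn hinj hs hz'
  exact ⟨h3, h4.mono fun w hw => invFunOn_eq hw⟩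

lemma modelDeriv_coordAction (hN : IsSmoothAction n N) (hσ : IsLocalCoord σ V)
    (hinj : InjOn σ V) {z : (Fin 2 → ℝ) × (Fin n → ℝ)} (hz : z.2 ∈ V)
    (hz' : torusExp z.1 • σ z.2 ∈ σ '' V) (a : Fin 2 → ℝ) (v : Fin n → ℝ) :
    modelDeriv (n := n) σ (coordAction σ V z) (fderiv ℝ (coordAction σ V) z (a, v)) =
      ∑ i, a i • modelGen (n := n) i (torusExp z.1 • σ z.2) +
        actDeriv (torusExp z.1) (σ z.2) (modelDeriv σ z.2 v) := by
  obtain ⟨h1, h2⟩ := contDiffAt_coordAction hN hσ hinj hz hz'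
  have h3 := modelDeriv_lift hσ (h1.differentiableAt (by simp)) (invFunOn_mem hz') h2 (a, v)
  rw [← h3]
  have hs : HasMFDerivAt 𝓘(ℝ, (Fin 2 → ℝ) × (Fin n → ℝ)) 𝓘(ℝ, Fin n → ℝ)
      (fun w : (Fin 2 → ℝ) × (Fin n → ℝ) => w.2) z
      (ContinuousLinearMap.snd ℝ (Fin 2 → ℝ) (Fin n → ℝ)) :=
    (hasFDerivAt_snd (𝕜 := ℝ) (p := z)).hasMFDerivAt
  have hd : HasMFDerivAt 𝓘(ℝ, (Fin 2 → ℝ) × (Fin n → ℝ)) (𝓡 n)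
      (fun w : (Fin 2 → ℝ) × (Fin n → ℝ) => σ w.2) z _ :=
    HasMFDerivAt.comp z (hσ.mdifferentiableAt hz).hasMFDerivAt hs
  refine (modelDeriv_torusExp_smul hN (φ := Prod.fst) (c := fun w => σ w.2) differentiableAt_fst
    hd.mdifferentiableAt (a, v)).trans ?_
  rw [fderiv_fst]
  congr 2
  exact congrArg (fun L : (Fin 2 → ℝ) × (Fin n → ℝ) →L[ℝ] 𝔼 n => L (a, v))
    hd.mfderiv

lemma coordAction_zero (hinj : InjOn σ V) {y : Fin n → ℝ} (hy : y ∈ V) :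
    coordAction σ V (0, y) = y := by
  simp only [coordAction, torusExp_zero, one_smul]
  exact hinj.leftInvOn_invFunOn hy

lemma modelDeriv_coordField (hN : IsSmoothAction n N) (hσ : IsLocalCoord σ V)
    (hinj : InjOn σ V) {y : Fin n → ℝ} (hy : y ∈ V) (a : Fin 2 → ℝ) :
    modelDeriv (n := n) σ y (coordField σ V a y) = ∑ i, a i • modelGen i (σ y) := by
  have := modelDeriv_coordAction hN hσ hinj (z := (0, y)) hy
    (by simpa using ⟨y, hy, rfl⟩) a 0
  simpa [coordField, coordAction_zero hinj hy] using this

lemma coordAction_fixed (hinj : InjOn σ V) (h0 : 0 ∈ V) {φ : Fin 2 → ℝ}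
    (hφ : torusExp φ • σ 0 = σ 0) : coordAction σ V (φ, 0) = 0 := by
  simp only [coordAction, hφ]
  exact hinj.leftInvOn_invFunOn h0

lemma modelDeriv_coordIsotropy (hN : IsSmoothAction n N) (hσ : IsLocalCoord σ V)
    (hinj : InjOn σ V) (h0 : 0 ∈ V) {φ : Fin 2 → ℝ} (hφ : torusExp φ • σ 0 = σ 0) (v : Fin n → ℝ) :
    modelDeriv (n := n) σ 0 (coordIsotropy σ V φ v) =
      actDeriv (n := n) (torusExp φ) (σ 0) (modelDeriv σ 0 v) := by
  have := modelDeriv_coordAction hN hσ hinj (z := (φ, 0)) h0 (by simpa [hφ] using ⟨0, h0, rfl⟩) 0 v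
  simpa [coordIsotropy, coordAction_fixed hinj h0 hφ] using this

lemma hasFDerivAt_coordField (hN : IsSmoothAction n N) (hσ : IsLocalCoord σ V)
    (hinj : InjOn σ V) (h0 : 0 ∈ V) (a : Fin 2 → ℝ) :
    HasFDerivAt (coordField σ V a) (coordLinear σ V a) 0 := by
  have h1 := (contDiffAt_coordAction hN hσ hinj (z := (0, 0)) h0
    (by simpa using ⟨0, h0, rfl⟩)).1
  have h2 : HasFDerivAt (fderiv ℝ (coordAction σ V))
      (fderiv ℝ (fderiv ℝ (coordAction σ V)) (0, 0)) ((0 : Fin 2 → ℝ), (0 : Fin n → ℝ)) :=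
    ((h1.fderiv_right (m := 1) one_add_one_le_smooth).differentiableAt (by simp)).hasFDerivAt
  have h3 : HasFDerivAt (fun y : Fin n → ℝ => ((0 : Fin 2 → ℝ), y))
      (ContinuousLinearMap.inr ℝ (Fin 2 → ℝ) (Fin n → ℝ)) 0 := hasFDerivAt_prodMk_right _ _
  exact (ContinuousLinearMap.apply ℝ (Fin n → ℝ)
    ((a, 0) : (Fin 2 → ℝ) × (Fin n → ℝ))).hasFDerivAt.comp 0 (HasFDerivAt.comp 0 h2 h3)

lemma hasDerivAt_coordIsotropy (hN : IsSmoothAction n N) (hσ : IsLocalCoord σ V)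
    (hinj : InjOn σ V) (h0 : 0 ∈ V) (a : Fin 2 → ℝ) (v : Fin n → ℝ) :
    HasDerivAt (fun s : ℝ => coordIsotropy σ V (s • a) v) (coordLinear σ V a v) 0 := by
  have h1 := (contDiffAt_coordAction hN hσ hinj (z := (0, 0)) h0
    (by simpa using ⟨0, h0, rfl⟩)).1
  have h2 : HasFDerivAt (fderiv ℝ (coordAction σ V))
      (fderiv ℝ (fderiv ℝ (coordAction σ V)) (0, 0)) ((0 : ℝ) • a, (0 : Fin n → ℝ)) := by
    rw [zero_smul]
    exact ((h1.fderiv_right (m := 1) one_add_one_le_smooth).differentiableAt (by simp)).hasFDerivAt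
  have h3 : HasDerivAt (fun s : ℝ => (s • a, (0 : Fin n → ℝ))) (a, 0) 0 := by
    have := ((hasDerivAt_id (0 : ℝ)).smul_const a).prodMk (hasDerivAt_const (0 : ℝ) (0 : Fin n → ℝ))
    simpa using this
  have h4 := h2.comp_hasDerivAt (0 : ℝ) h3
  have h5 := (ContinuousLinearMap.apply ℝ (Fin n → ℝ)
    ((0, v) : (Fin 2 → ℝ) × (Fin n → ℝ))).hasFDerivAt.comp_hasDerivAt (0 : ℝ) h4
  have hsym : IsSymmSndFDerivAt ℝ (coordAction σ V) (0, 0) :=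
    h1.isSymmSndFDerivAt (by simp only [minSmoothness_of_isRCLikeNormedField]; exact two_le_smooth)
  have h6 : coordLinear σ V a v =
      (fderiv ℝ (fderiv ℝ (coordAction σ V)) (0, 0)) (a, 0) (0, v) := hsym _ _
  rw [h6]
  exact h5

/-- A point at which a combination of the generators vanishes is fixed by its flow. -/
lemma torusExp_smul_eq_of_field_eq_zero (hN : IsSmoothAction n N) (hσ : IsLocalCoord σ V)
    (hinj : InjOn σ V) (h0 : 0 ∈ V) {a : Fin 2 → ℝ}
    (ha : ∑ i, a i • modelGen (n := n) i (σ 0) = 0) (s : ℝ) : torusExp (s • a) • σ 0 = σ 0 := by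
  let f : ℝ → Fin n → ℝ := fun s => coordAction σ V (s • a, 0)
  have hline : Continuous fun s : ℝ => (s • a, (0 : Fin n → ℝ)) := by fun_prop
  have hev : ∀ᶠ s in 𝓝 (0 : ℝ), torusExp (s • a) • σ 0 ∈ σ '' V := by
    have hc : Continuous fun s : ℝ => torusExp (s • a) • σ 0 :=
      (hN.contMDiff_orbit (σ 0)).continuous.comp (f := fun s : ℝ => s • a) (by fun_prop)
    exact hc.continuousAt.preimage_mem_nhds
      ((hσ.isOpen_image hσ.isOpen subset_rfl).mem_nhds (by simpa using ⟨0, h0, rfl⟩))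
  have hder : ∀ s, torusExp (s • a) • σ 0 ∈ σ '' V → HasDerivAt f 0 s := by
    intro s hs
    have h1 := (contDiffAt_coordAction hN hσ hinj (z := (s • a, 0)) h0 hs).1
    have h2 : HasDerivAt (fun s : ℝ => (s • a, (0 : Fin n → ℝ))) (a, 0) s := by
      have := ((hasDerivAt_id s).smul_const a).prodMk (hasDerivAt_const s (0 : Fin n → ℝ))
      simpa using this
    have h3 := (h1.differentiableAt (by simp)).hasFDerivAt.comp_hasDerivAt s h2
    have h4 := modelDeriv_coordAction hN hσ hinj (z := (s • a, 0)) h0 hs a 0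
    rw [map_zero, map_zero, add_zero] at h4
    have h5 : ∑ i, a i • modelGen (n := n) i (torusExp (s • a) • σ 0) = 0 := by
      simp only [← actDeriv_modelGen hN, ← map_smul, ← map_sum]
      rw [ha, map_zero]
    rw [h5] at h4
    have h6 := (hσ.bijective_modelDeriv (invFunOn_mem hs)).1 (h4.trans (map_zero _).symm)
    rw [h6] at h3
    exact h3
  obtain ⟨δ, hδ, hball⟩ := Metric.eventually_nhds_iff_ball.1 hev
  have hsmall : ∀ s ∈ Metric.ball (0 : ℝ) δ, torusExp (s • a) • σ 0 = σ 0 := by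
    intro s hs
    have hf0 : f 0 = 0 := by
      simp only [f, zero_smul]; exact coordAction_zero hinj h0
    have hfs : f s = f 0 :=
      Metric.isOpen_ball.is_const_of_deriv_eq_zero (convex_ball _ _).isPreconnected
        (fun r hr => (hder r (hball r hr)).differentiableAt.differentiableWithinAt)
        (fun r hr => (hder r (hball r hr)).deriv) hs (Metric.mem_ball_self hδ)
    have h1 : σ (f s) = torusExp (s • a) • σ 0 := invFunOn_eq (hball s hs)
    rw [← h1, hfs, hf0]
  obtain ⟨k, hk⟩ := exists_nat_gt (|s| / δ)
  have hk0 : (0 : ℝ) < k := lt_of_le_of_lt (by positivity) hk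
  have hs' : s / k ∈ Metric.ball (0 : ℝ) δ := by
    rw [mem_ball_zero_iff, Real.norm_eq_abs, abs_div, abs_of_pos hk0, div_lt_iff₀ hk0]
    rwa [div_lt_iff₀ hδ, mul_comm] at hk
  have hind : ∀ j : ℕ, torusExp ((j * (s / k)) • a) • σ 0 = σ 0 := by
    intro j
    induction j with
    | zero => simp
    | succ j ih =>
      have : ((j + 1 : ℕ) * (s / k) : ℝ) • a = (j * (s / k)) • a + (s / k) • a := by
        rw [← add_smul]; push_cast; ring_nf
      rw [this, torusExp_add, mul_smul, hsmall _ hs', ih]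
  have := hind k
  rwa [mul_div_cancel₀ _ hk0.ne'] at this

end Linearization

section SkewRotations

variable {G : LinearMap.BilinForm ℝ (Fin 3 → ℝ)}

/-- An orthonormal frame of the orthogonal complement of a vector in three dimensions. -/
lemma exists_adapted_frame (hsymm : ∀ v w, G v w = G w v) (hpos : ∀ v, v ≠ 0 → 0 < G v v)
    {k : Fin 3 → ℝ} (hk : k ≠ 0) : ∃ e₁ e₂ : Fin 3 → ℝ, G e₁ k = 0 ∧ G e₂ k = 0 ∧ G e₁ e₂ = 0 ∧
      G e₁ e₁ = 1 ∧ G e₂ e₂ = 1 ∧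
      ∀ v, v = (G v k / G k k) • k + G v e₁ • e₁ + G v e₂ • e₂ := by
  have hnorm : ∀ v, v ≠ 0 → G ((sqrt (G v v))⁻¹ • v) ((sqrt (G v v))⁻¹ • v) = 1 := by
    intro v hv
    have h := hpos v hv
    simp only [map_smul, LinearMap.smul_apply, smul_eq_mul]
    have h2 := Real.mul_self_sqrt h.le
    have h3 : sqrt (G v v) ≠ 0 := (sqrt_pos.2 h).ne'
    field_simp
    nlinarith [h2]
  have hexists : ∀ u₁ u₂ : Fin 3 → ℝ, ∃ e, G e u₁ = 0 ∧ G e u₂ = 0 ∧ G e e = 1 := by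
    intro u₁ u₂
    let T : (Fin 3 → ℝ) →ₗ[ℝ] (Fin 2 → ℝ) := LinearMap.pi ![G.flip u₁, G.flip u₂]
    have hker : LinearMap.ker T ≠ ⊥ := LinearMap.ker_ne_bot_of_finrank_lt (by simp)
    obtain ⟨v, hv, hv0⟩ := (Submodule.ne_bot_iff _).1 hker
    have h1 : G v u₁ = 0 := congrFun (LinearMap.mem_ker.1 hv) 0
    have h2 : G v u₂ = 0 := congrFun (LinearMap.mem_ker.1 hv) 1
    exact ⟨(sqrt (G v v))⁻¹ • v, by simp [h1], by simp [h2], hnorm v hv0⟩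
  obtain ⟨e₁, h1k, -, h11⟩ := hexists k 0
  obtain ⟨e₂, h2k, h21, h22⟩ := hexists k e₁
  have h12 : G e₁ e₂ = 0 := by rw [hsymm, h21]
  have hkk := (hpos k hk).ne'
  refine ⟨e₁, e₂, h1k, h2k, h12, h11, h22, ?_⟩
  have hind : LinearIndependent ℝ ![k, e₁, e₂] := by
    rw [Fintype.linearIndependent_iff]
    intro g hg
    simp only [Fin.sum_univ_three, Matrix.cons_val] at hg
    have e0 := congrArg (fun v => G v k) hg
    have e1 := congrArg (fun v => G v e₁) hg
    have e2 := congrArg (fun v => G v e₂) hg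
    simp only [map_add, map_smul, LinearMap.add_apply, LinearMap.smul_apply, smul_eq_mul, h1k, h2k,
      h12, h21, h11, h22, hsymm k e₁, hsymm k e₂, map_zero, LinearMap.zero_apply] at e0 e1 e2
    have e0' : g 0 = 0 := by
      have : g 0 * G k k = 0 := by linarith
      exact (mul_eq_zero.1 this).resolve_right hkk
    intro i; fin_cases i
    · exact e0'
    · change g 1 = 0; linarith
    · change g 2 = 0; linarith
  intro v
  have hspan := hind.span_eq_top_of_card_eq_finrank (by simp)
  have hv : v ∈ Submodule.span ℝ (Set.range ![k, e₁, e₂]) := hspan ▸ Submodule.mem_top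
  obtain ⟨c, hc⟩ := (Submodule.mem_span_range_iff_exists_fun ℝ).1 hv
  simp only [Fin.sum_univ_three, Matrix.cons_val] at hc
  have e0 : G v k = c 0 * G k k := by
    rw [← hc]; simp [h1k, h2k]
  have e1 : G v e₁ = c 1 := by
    rw [← hc]; simp [h11, h21, hsymm k e₁, h1k]
  have e2 : G v e₂ = c 2 := by
    rw [← hc]; simp [h22, h12, hsymm k e₂, h2k]
  rw [e0, e1, e2, mul_div_cancel_right₀ _ hkk]
  exact hc.symm

lemma exists_kernel_of_skew (hpos : ∀ v, v ≠ 0 → 0 < G v v)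
    {L : (Fin 3 → ℝ) →ₗ[ℝ] (Fin 3 → ℝ)} (hL : ∀ v w, G (L v) w = -G v (L w)) :
    ∃ k, k ≠ 0 ∧ L k = 0 := by
  have hmat : ∀ v w, G v w = v ⬝ᵥ (LinearMap.BilinForm.toMatrix' G).mulVec w := by
    intro v w
    rw [← Matrix.toBilin'_apply', Matrix.toBilin'_toMatrix']
  have hdet : (LinearMap.BilinForm.toMatrix' G).det ≠ 0 := by
    intro h0
    obtain ⟨v, hv0, hv⟩ := Matrix.exists_mulVec_eq_zero_iff.2 h0
    have := hpos v hv0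
    rw [hmat, hv, dotProduct_zero] at this
    exact lt_irrefl _ this
  have h1 : (LinearMap.toMatrix' L).transpose * LinearMap.BilinForm.toMatrix' G =
      -(LinearMap.BilinForm.toMatrix' G * LinearMap.toMatrix' L) := by
    rw [← Matrix.toBilin'.injective.eq_iff]
    refine LinearMap.ext fun v => LinearMap.ext fun w => ?_
    have := hL v w
    rw [hmat, hmat] at this
    rw [Matrix.toBilin'_apply', Matrix.toBilin'_apply', ← Matrix.mulVec_mulVec,
      Matrix.dotProduct_mulVec, Matrix.vecMul_transpose, Matrix.neg_mulVec, dotProduct_neg,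
      ← Matrix.mulVec_mulVec, LinearMap.toMatrix'_mulVec, LinearMap.toMatrix'_mulVec]
    exact this
  have h2 := congrArg Matrix.det h1
  rw [Matrix.det_mul, Matrix.det_transpose, Matrix.det_neg, Matrix.det_mul] at h2
  have h3 : (LinearMap.toMatrix' L).det = 0 := by
    have : 2 * ((LinearMap.BilinForm.toMatrix' G).det * (LinearMap.toMatrix' L).det) = 0 := by
      simp only [Fintype.card_fin] at h2
      linear_combination h2
    rcases mul_eq_zero.1 this with h | h
    · norm_num at h
    · exact (mul_eq_zero.1 h).resolve_left hdet
  obtain ⟨k, hk, hk0⟩ := Matrix.exists_mulVec_eq_zero_iff.2 h3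
  exact ⟨k, hk, by rwa [LinearMap.toMatrix'_mulVec] at hk0⟩

/-- A skew map in three dimensions acts on the orthogonal complement of its kernel as a multiple
of a quarter turn. -/
lemma skew_frame (hsymm : ∀ v w, G v w = G w v)
    {L : (Fin 3 → ℝ) →ₗ[ℝ] (Fin 3 → ℝ)} (hL : ∀ v w, G (L v) w = -G v (L w)) {k e₁ e₂ : Fin 3 → ℝ}
    (hk : L k = 0) (hdec : ∀ v, v = (G v k / G k k) • k + G v e₁ • e₁ + G v e₂ • e₂) :
    L e₁ = G (L e₁) e₂ • e₂ ∧ L e₂ = -G (L e₁) e₂ • e₁ := by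
  have hz : ∀ v, G (L v) v = 0 := fun v => by
    have h1 := hL v v
    rw [hsymm v (L v)] at h1
    linarith
  have hkz : ∀ v, G (L v) k = 0 := fun v => by rw [hL, hk, map_zero, neg_zero]
  constructor
  · have h1 := hdec (L e₁)
    rwa [hkz, hz, zero_div, zero_smul, zero_smul, zero_add, zero_add] at h1
  · have h1 := hdec (L e₂)
    rw [hkz, hz, zero_div, zero_smul, zero_smul, zero_add, add_zero, hL, hsymm e₂] at h1
    exact h1

/-- A one-parameter group whose derivative at zero is a multiple of a quarter turn consists of
rotations. -/
lemma rotation_of_hasDerivAt {E : Type*} [NormedAddCommGroup E] [NormedSpace ℝ E]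
    {D : ℝ → E →L[ℝ] E} {L : E →L[ℝ] E} (hadd : ∀ s t v, D (s + t) v = D s (D t v))
    (h0 : ∀ v, D 0 v = v) (hd : ∀ v, HasDerivAt (fun s => D s v) (L v) 0) {e₁ e₂ : E} {κ : ℝ}
    (h1 : L e₁ = κ • e₂) (h2 : L e₂ = -κ • e₁) (s : ℝ) :
    D s (cos (κ * s) • e₁ - sin (κ * s) • e₂) = e₁ := by
  have hd' : ∀ s v, HasDerivAt (fun s => D s v) (D s (L v)) s := by
    intro s v
    have h3 : HasDerivAt (fun r : ℝ => D s (D (r - s) v)) (D s (L v)) s := by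
      have h4 : HasDerivAt (fun r => D r v) (L v) (s - s) := by rw [sub_self]; exact hd v
      have h5 := HasDerivAt.scomp (h := fun r : ℝ => r - s) s h4 ((hasDerivAt_id s).sub_const s)
      have h6 := (D s).hasFDerivAt.comp_hasDerivAt s h5
      rw [one_smul] at h6
      exact h6
    refine h3.congr_of_eventuallyEq (Filter.Eventually.of_forall fun r => ?_)
    change D r v = D s (D (r - s) v)
    rw [← hadd]; congr 2; ring
  let f : ℝ → E := fun s => cos (κ * s) • D s e₁ - sin (κ * s) • D s e₂
  have hf : ∀ s, HasDerivAt f 0 s := by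
    intro s
    have hk : HasDerivAt (fun s => κ * s) κ s := by simpa using (hasDerivAt_id s).const_mul κ
    have h3 := (hk.cos.smul (hd' s e₁)).sub (hk.sin.smul (hd' s e₂))
    have h4 : cos (κ * s) • D s (L e₁) + (-sin (κ * s) * κ) • D s e₁ -
        (sin (κ * s) • D s (L e₂) + (cos (κ * s) * κ) • D s e₂) = 0 := by
      rw [h1, h2, map_smul, map_smul]
      module
    rw [h4] at h3
    exact h3
  have hconst : f s = f 0 := is_const_of_deriv_eq_zero (fun s => (hf s).differentiableAt)
    (fun s => (hf s).deriv) s 0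
  have hf0 : f 0 = e₁ := by simp [f, h0]
  rw [map_sub, map_smul, map_smul]
  exact hconst.trans hf0

end SkewRotations

section Weights

variable {n : ℕ} {N : Type*} [TopologicalSpace N] [ChartedSpace (𝔼 n) N]

/-- A bilinear form field in local coordinates. -/
def coordForm (h : TwoTensor n N) (σ : (Fin n → ℝ) → N) (y : Fin n → ℝ) :
    LinearMap.BilinForm ℝ (Fin n → ℝ) :=
  (modelForm h (σ y)).comp (modelDeriv σ y).toLinearMap (modelDeriv σ y).toLinearMap

lemma coordForm_apply (h : TwoTensor n N) (σ : (Fin n → ℝ) → N) (y v w : Fin n → ℝ) :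
    coordForm h σ y v w = modelForm h (σ y) (modelDeriv σ y v) (modelDeriv σ y w) := rfl

variable [MulAction Torus N] {σ : (Fin n → ℝ) → N} {V : Set (Fin n → ℝ)}

lemma torusExp_nsmul (k : ℕ) (φ : Fin 2 → ℝ) : torusExp ((k : ℝ) • φ) = torusExp φ ^ k := by
  induction k with
  | zero => simp
  | succ k ih =>
    rw [pow_succ, ← ih, ← torusExp_add]
    congr 1
    push_cast
    rw [add_smul, one_smul]

lemma coordIsotropy_add (hN : IsSmoothAction n N) (hσ : IsLocalCoord σ V)
    (hinj : InjOn σ V) (h0 : 0 ∈ V) {φ ψ : Fin 2 → ℝ} (hφ : torusExp φ • σ 0 = σ 0)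
    (hψ : torusExp ψ • σ 0 = σ 0) (v : Fin n → ℝ) :
    coordIsotropy σ V (φ + ψ) v = coordIsotropy σ V φ (coordIsotropy σ V ψ v) := by
  have hφψ : torusExp (φ + ψ) • σ 0 = σ 0 := by rw [torusExp_add, mul_smul, hψ, hφ]
  apply (hσ.bijective_modelDeriv h0).1
  rw [modelDeriv_coordIsotropy hN hσ hinj h0 hφψ, modelDeriv_coordIsotropy hN hσ hinj h0 hφ,
    modelDeriv_coordIsotropy hN hσ hinj h0 hψ, torusExp_add, actDeriv_mul hN, actDeriv_congr hψ]

lemma coordIsotropy_eq_self (hN : IsSmoothAction n N) (hσ : IsLocalCoord σ V)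
    (hinj : InjOn σ V) (h0 : 0 ∈ V) {φ : Fin 2 → ℝ} (hφ : torusExp φ = 1) (v : Fin n → ℝ) :
    coordIsotropy σ V φ v = v := by
  apply (hσ.bijective_modelDeriv h0).1
  rw [modelDeriv_coordIsotropy hN hσ hinj h0 (by rw [hφ, one_smul]), hφ]
  exact actDeriv_one _ _

lemma coordForm_isotropy {h : TwoTensor n N} (hh : IsInvariant h) (hN : IsSmoothAction n N)
    (hσ : IsLocalCoord σ V) (hinj : InjOn σ V) (h0 : 0 ∈ V) {φ : Fin 2 → ℝ}
    (hφ : torusExp φ • σ 0 = σ 0) (v w : Fin n → ℝ) :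
    coordForm h σ 0 (coordIsotropy σ V φ v) (coordIsotropy σ V φ w) = coordForm h σ 0 v w := by
  simp only [coordForm_apply, modelDeriv_coordIsotropy hN hσ hinj h0 hφ]
  exact modelForm_fixed hh hφ _ _

/-- The linearization of a Killing field at a zero is skew. -/
lemma coordLinear_skew {h : TwoTensor n N} (hh : IsInvariant h) (hN : IsSmoothAction n N)
    (hσ : IsLocalCoord σ V) (hinj : InjOn σ V) (h0 : 0 ∈ V) {a : Fin 2 → ℝ}
    (ha : ∑ i, a i • modelGen (n := n) i (σ 0) = 0) (v w : Fin n → ℝ) :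
    coordForm h σ 0 (coordLinear σ V a v) w = -coordForm h σ 0 v (coordLinear σ V a w) := by
  have hfix := torusExp_smul_eq_of_field_eq_zero hN hσ hinj h0 ha
  have h1 : HasDerivAt (fun s : ℝ => coordForm h σ 0 (coordIsotropy σ V (s • a) v) w)
      (coordForm h σ 0 (coordLinear σ V a v) w) 0 :=
    (((coordForm h σ 0).flip w).toContinuousLinearMap.hasFDerivAt).comp_hasDerivAt (0 : ℝ)
      (hasDerivAt_coordIsotropy hN hσ hinj h0 a v)
  have h2 : HasDerivAt (fun s : ℝ => coordForm h σ 0 v (coordIsotropy σ V ((-s) • a) w))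
      (-coordForm h σ 0 v (coordLinear σ V a w)) 0 := by
    have h3 : HasDerivAt (fun s : ℝ => coordIsotropy σ V (s • a) w) (coordLinear σ V a w) (-0) := by
      rw [neg_zero]; exact hasDerivAt_coordIsotropy hN hσ hinj h0 a w
    have h4 := HasDerivAt.scomp (h := fun s : ℝ => -s) (0 : ℝ) h3 (hasDerivAt_neg (0 : ℝ))
    have h5 := ((coordForm h σ 0 v).toContinuousLinearMap.hasFDerivAt).comp_hasDerivAt (0 : ℝ) h4
    have h6 : (coordForm h σ 0 v).toContinuousLinearMap ((-1 : ℝ) • coordLinear σ V a w) =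
        -coordForm h σ 0 v (coordLinear σ V a w) := by simp
    rw [h6] at h5
    exact h5
  refine h1.unique (h2.congr_of_eventuallyEq (Eventually.of_forall fun s => ?_))
  change coordForm h σ 0 (coordIsotropy σ V (s • a) v) w =
    coordForm h σ 0 v (coordIsotropy σ V ((-s) • a) w)
  rw [← coordForm_isotropy hh hN hσ hinj h0 (hfix s) v ((coordIsotropy σ V ((-s) • a)) w),
    ← coordIsotropy_add hN hσ hinj h0 (hfix s) (hfix (-s)),
    coordIsotropy_eq_self hN hσ hinj h0 (φ := s • a + (-s) • a) (by rw [← add_smul]; simp)]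

lemma coordLinear_add (σ : (Fin n → ℝ) → N) (V : Set (Fin n → ℝ)) (a b : Fin 2 → ℝ)
    (v : Fin n → ℝ) :
    coordLinear σ V (a + b) v = coordLinear σ V a v + coordLinear σ V b v := by
  have h : ((a + b, 0) : (Fin 2 → ℝ) × (Fin n → ℝ)) = (a, 0) + (b, 0) := by simp
  simp only [coordLinear, ContinuousLinearMap.comp_apply, ContinuousLinearMap.apply_apply]
  rw [h, map_add]

lemma coordLinear_comm (hN : IsSmoothAction n N) (hσ : IsLocalCoord σ V)
    (hinj : InjOn σ V) (h0 : 0 ∈ V) {a b : Fin 2 → ℝ}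
    (ha : ∑ i, a i • modelGen (n := n) i (σ 0) = 0) (hb : ∑ i, b i • modelGen (n := n) i (σ 0) = 0)
    (v : Fin n → ℝ) :
    coordLinear σ V a (coordLinear σ V b v) = coordLinear σ V b (coordLinear σ V a v) := by
  have hfa := torusExp_smul_eq_of_field_eq_zero hN hσ hinj h0 ha
  have hfb := torusExp_smul_eq_of_field_eq_zero hN hσ hinj h0 hb
  have h1 : ∀ s : ℝ, coordIsotropy σ V (s • a) (coordLinear σ V b v) =
      coordLinear σ V b (coordIsotropy σ V (s • a) v) := by
    intro s
    have h2 : HasDerivAt (fun t : ℝ => coordIsotropy σ V (s • a) (coordIsotropy σ V (t • b) v))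
        (coordIsotropy σ V (s • a) (coordLinear σ V b v)) 0 :=
      (coordIsotropy σ V (s • a)).hasFDerivAt.comp_hasDerivAt (0 : ℝ)
        (hasDerivAt_coordIsotropy hN hσ hinj h0 b v)
    refine h2.unique ((hasDerivAt_coordIsotropy hN hσ hinj h0 b
      (coordIsotropy σ V (s • a) v)).congr_of_eventuallyEq (Eventually.of_forall fun t => ?_))
    change coordIsotropy σ V (s • a) (coordIsotropy σ V (t • b) v) =
      coordIsotropy σ V (t • b) (coordIsotropy σ V (s • a) v)
    rw [← coordIsotropy_add hN hσ hinj h0 (hfa s) (hfb t), add_comm,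
      coordIsotropy_add hN hσ hinj h0 (hfb t) (hfa s)]
  have h3 := (coordLinear σ V b).hasFDerivAt.comp_hasDerivAt (0 : ℝ)
    (hasDerivAt_coordIsotropy hN hσ hinj h0 a v)
  refine (hasDerivAt_coordIsotropy hN hσ hinj h0 a (coordLinear σ V b v)).unique
    (h3.congr_of_eventuallyEq (Eventually.of_forall fun s => h1 s))

end Weights

section AxisWeights

variable {σ : (Fin 3 → ℝ) → B} {V : Set (Fin 3 → ℝ)}

lemma IsBiaxial.coordForm_symm (h : IsBiaxial γ C x) (y v w : Fin 3 → ℝ) :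
    coordForm γ σ y v w = coordForm γ σ y w v := h.form_symm _ _ _

lemma IsBiaxial.coordForm_pos (h : IsBiaxial γ C x) (hσ : IsLocalCoord σ V)
    {y : Fin 3 → ℝ} (hy : y ∈ V) (v : Fin 3 → ℝ) (hv : v ≠ 0) : 0 < coordForm γ σ y v v :=
  h.form_pos _ fun h0 => hv ((hσ.bijective_modelDeriv hy).1 (h0.trans (map_zero _).symm))

/-- The real vector of weights of an integer combination of the generators. -/
def realWeight (w : Fin 2 → ℤ) : Fin 2 → ℝ := fun i => w i

/-- The isotropy of a point at which an integer combination of the generators vanishes is a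
rotation of integer speed. -/
lemma IsBiaxial.exists_weight (h : IsBiaxial γ C x) (hσ : IsLocalCoord σ V)
    (hinj : InjOn σ V) (h0 : 0 ∈ V) {w : Fin 2 → ℤ}
    (hw : ∑ i, realWeight w i • modelGen (n := 3) i (σ 0) = 0) {k e₁ e₂ : Fin 3 → ℝ}
    (h12 : coordForm γ σ 0 e₁ e₂ = 0) (h11 : coordForm γ σ 0 e₁ e₁ = 1)
    (hdec : ∀ v, v = (coordForm γ σ 0 v k / coordForm γ σ 0 k k) • k +
      coordForm γ σ 0 v e₁ • e₁ + coordForm γ σ 0 v e₂ • e₂)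
    (hk : coordLinear σ V (realWeight w) k = 0) :
    ∃ κ : ℤ, coordLinear σ V (realWeight w) e₁ = (κ : ℝ) • e₂ ∧
      coordLinear σ V (realWeight w) e₂ = -(κ : ℝ) • e₁ ∧
      ∀ s : ℝ, (∃ m : ℤ, (κ : ℝ) * s = m * (2 * π)) →
        ∀ v, actDeriv (n := 3) (torusExp (s • realWeight w)) (σ 0) v = v := by
  set L := coordLinear σ V (realWeight w)
  have hfix := torusExp_smul_eq_of_field_eq_zero h.action hσ hinj h0 hw
  have hskew := coordLinear_skew h.invariant h.action hσ hinj h0 hw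
  obtain ⟨h1, h2⟩ := skew_frame (L := L.toLinearMap) (h.coordForm_symm 0) hskew hk hdec
  have hadd : ∀ (s t : ℝ) (v : Fin 3 → ℝ), coordIsotropy σ V ((s + t) • realWeight w) v =
      coordIsotropy σ V (s • realWeight w) (coordIsotropy σ V (t • realWeight w) v) := by
    intro s t v
    rw [add_smul, coordIsotropy_add h.action hσ hinj h0 (hfix s) (hfix t)]
  have hzero : ∀ v, coordIsotropy σ V ((0 : ℝ) • realWeight w) v = v := fun v =>
    coordIsotropy_eq_self h.action hσ hinj h0 (by simp) v
  have hd := hasDerivAt_coordIsotropy h.action hσ hinj h0 (realWeight w)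
  have hrot : ∀ {u₁ u₂ : Fin 3 → ℝ} {κ : ℝ}, L u₁ = κ • u₂ → L u₂ = -κ • u₁ → ∀ s : ℝ,
      coordIsotropy σ V (s • realWeight w)
        (cos (κ * s) • u₁ - sin (κ * s) • u₂) = u₁ := fun h1 h2 s =>
    rotation_of_hasDerivAt (D := fun s => coordIsotropy σ V (s • realWeight w)) hadd hzero hd h1 h2 s
  have hone : torusExp ((2 * π) • realWeight w) = 1 :=
    (torusExp_eq_one_iff _).2 fun i => ⟨w i, by simp [realWeight, mul_comm]⟩
  obtain ⟨κ, hκ⟩ : ∃ κ : ℤ, (κ : ℝ) = coordForm γ σ 0 (L e₁) e₂ := by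
    have h3 := hrot h1 h2 (2 * π)
    rw [coordIsotropy_eq_self h.action hσ hinj h0 hone] at h3
    have h4 := congrArg (fun u => coordForm γ σ 0 u e₁) h3
    simp only [map_sub, map_smul, LinearMap.sub_apply, LinearMap.smul_apply, smul_eq_mul, h11,
      h.coordForm_symm 0 e₂ e₁, h12, mul_zero, sub_zero, mul_one] at h4
    obtain ⟨κ, hκ⟩ := (Real.cos_eq_one_iff _).1 h4
    exact ⟨κ, mul_right_cancel₀ Real.two_pi_pos.ne' hκ⟩
  have h1' : L e₁ = (κ : ℝ) • e₂ := by rw [hκ]; exact h1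
  have h2' : L e₂ = -(κ : ℝ) • e₁ := by rw [hκ]; exact h2
  refine ⟨κ, h1', h2', ?_⟩
  rintro s ⟨m, hm⟩ v
  have hcos : cos (κ * s) = 1 := by rw [hm]; exact Real.cos_int_mul_two_pi m
  have hsin : sin (κ * s) = 0 := by
    rw [hm, ← zero_add ((m : ℝ) * (2 * π)), Real.sin_add_int_mul_two_pi, Real.sin_zero]
  have hD1 : coordIsotropy σ V (s • realWeight w) e₁ = e₁ := by
    have := hrot h1' h2' s
    rwa [hcos, hsin, one_smul, zero_smul, sub_zero] at this
  have hD2 : coordIsotropy σ V (s • realWeight w) e₂ = e₂ := by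
    have := hrot (u₁ := e₂) (u₂ := -e₁) (κ := κ) (by rw [h2']; simp) (by rw [map_neg, h1']; simp) s
    rwa [hcos, hsin, one_smul, zero_smul, sub_zero] at this
  have hDk : coordIsotropy σ V (s • realWeight w) k = k := by
    have := hrot (u₁ := k) (u₂ := 0) (κ := 0) (by rw [hk]; simp) (by simp) s
    simpa using this
  obtain ⟨u, rfl⟩ := (hσ.bijective_modelDeriv h0).2 v
  rw [← modelDeriv_coordIsotropy h.action hσ hinj h0 (hfix s)]
  congr 1
  rw [hdec u, map_add, map_add, map_smul, map_smul, map_smul, hD1, hD2, hDk]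

variable [T2Space B]

/-- Primitive combinations of the generators rotate with unit speed around their zeros. -/
lemma IsBiaxial.weight_sq (h : IsBiaxial γ C x) {w : Fin 2 → ℤ}
    (hw : IsCoprime (w 0) (w 1)) {b : B} (hfix : ∀ s : ℝ, torusExp (s • realWeight w) • b = b)
    {κ : ℤ} (hκ : ∀ s : ℝ, (∃ m : ℤ, (κ : ℝ) * s = m * (2 * π)) →
      ∀ v, actDeriv (n := 3) (torusExp (s • realWeight w)) b v = v) : κ ^ 2 = 1 := by
  have hpi := Real.pi_pos
  have hunit : ∀ d : ℤ, d ∣ w 0 → d ∣ w 1 → IsUnit d := fun d h0 h1 => hw.isUnit_of_dvd' h0 h1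
  rcases eq_or_ne κ 0 with rfl | hne
  · have h1 : torusExp (π • realWeight w) = 1 := by
      refine eq_one_of_fixed h.action h.faithful (k := 2) (by norm_num) ?_ (hfix _)
        (hκ π ⟨0, by simp⟩)
      rw [← torusExp_nsmul, torusExp_eq_one_iff]
      refine fun i => ⟨w i, ?_⟩
      simp [realWeight]; ring
    rw [torusExp_eq_one_iff] at h1
    have h2 : ∀ i, (2 : ℤ) ∣ w i := by
      intro i
      obtain ⟨m, hm⟩ := h1 i
      refine ⟨m, ?_⟩
      have : (w i : ℝ) = 2 * m := by
        simp only [realWeight, Pi.smul_apply, smul_eq_mul] at hm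
        exact mul_left_cancel₀ hpi.ne' (by linarith)
      exact_mod_cast this
    have := hunit 2 (h2 0) (h2 1)
    rw [Int.isUnit_iff] at this
    omega
  · have hκr : (κ : ℝ) ≠ 0 := by exact_mod_cast hne
    have h1 : torusExp ((2 * π / κ) • realWeight w) = 1 := by
      refine eq_one_of_fixed h.action h.faithful (k := κ.natAbs) (Int.natAbs_pos.2 hne) ?_ (hfix _)
        (hκ (2 * π / κ) ⟨1, by field_simp; simp⟩)
      rw [← torusExp_nsmul, torusExp_eq_one_iff]
      refine fun i => ⟨(κ.natAbs / κ) * w i, ?_⟩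
      have hdiv : ((κ.natAbs / κ : ℤ) : ℝ) * κ = (κ.natAbs : ℝ) := by
        have : (κ.natAbs / κ : ℤ) * κ = (κ.natAbs : ℤ) :=
          Int.ediv_mul_cancel (by rw [Int.natCast_natAbs]; exact (dvd_abs κ κ).2 dvd_rfl)
        have h3 := congrArg (Int.cast : ℤ → ℝ) this
        rwa [Int.cast_mul, Int.cast_natCast] at h3
      simp only [realWeight, Pi.smul_apply, smul_eq_mul, Int.cast_mul]
      rw [← hdiv]
      field_simp
    rw [torusExp_eq_one_iff] at h1
    have h2 : ∀ i, κ ∣ w i := by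
      intro i
      obtain ⟨m, hm⟩ := h1 i
      refine ⟨m, ?_⟩
      have : (w i : ℝ) = κ * m := by
        simp only [realWeight, Pi.smul_apply, smul_eq_mul] at hm
        field_simp at hm
        linarith
      exact_mod_cast this
    have := hunit κ (h2 0) (h2 1)
    rcases Int.isUnit_iff.1 this with h3 | h3 <;> rw [h3] <;> norm_num

/-- The generators do not vanish simultaneously. -/
lemma IsBiaxial.exists_generator_ne_zero (h : IsBiaxial γ C x) (b : B) :
    ∃ i, modelGen (n := 3) i b ≠ 0 := by
  by_contra hcon
  push Not at hcon
  obtain ⟨σ, V, hσ, hinj, h0, rfl⟩ := exists_isLocalCoord (n := 3) b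
  have hz : ∀ a : Fin 2 → ℝ, ∑ i, a i • modelGen (n := 3) i (σ 0) = 0 := fun a => by simp [hcon]
  have hskew := fun a => coordLinear_skew h.invariant h.action hσ hinj h0 (hz a)
  have hpos := h.coordForm_pos hσ h0
  obtain ⟨k, hk, hk0, hk1⟩ : ∃ k, k ≠ 0 ∧ coordLinear σ V (realWeight ![1, 0]) k = 0 ∧
      coordLinear σ V (realWeight ![0, 1]) k = 0 := by
    by_cases hL : ∀ v, coordLinear σ V (realWeight ![1, 0]) v = 0
    · obtain ⟨k, hk, hk'⟩ := exists_kernel_of_skew hpos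
        (L := (coordLinear σ V (realWeight ![0, 1])).toLinearMap) (hskew _)
      exact ⟨k, hk, hL k, hk'⟩
    · obtain ⟨k, hk, hk'⟩ := exists_kernel_of_skew hpos
        (L := (coordLinear σ V (realWeight ![1, 0])).toLinearMap) (hskew _)
      refine ⟨k, hk, hk', ?_⟩
      obtain ⟨e₁, e₂, h1k, h2k, h12, h11, h22, hdec⟩ := exists_adapted_frame (h.coordForm_symm 0) hpos hk
      obtain ⟨h1, h2⟩ := skew_frame (L := (coordLinear σ V (realWeight ![1, 0])).toLinearMap)
        (h.coordForm_symm 0) (hskew _) hk' hdec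
      set κ := coordForm γ σ 0 (coordLinear σ V (realWeight ![1, 0]) e₁) e₂ with hκ
      have h1' : coordLinear σ V (realWeight ![1, 0]) e₁ = κ • e₂ := h1
      have h2' : coordLinear σ V (realWeight ![1, 0]) e₂ = -κ • e₁ := h2
      have hκ0 : κ ≠ 0 := by
        intro h0
        apply hL
        intro v
        rw [hdec v, map_add, map_add, map_smul, map_smul, map_smul, h1', h2',
          show coordLinear σ V (realWeight ![1, 0]) k = 0 from hk', h0]
        simp
      have hcomm := coordLinear_comm h.action hσ hinj h0 (hz (realWeight ![1, 0]))
        (hz (realWeight ![0, 1])) k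
      rw [show coordLinear σ V (realWeight ![1, 0]) k = 0 from hk', map_zero] at hcomm
      set u := coordLinear σ V (realWeight ![0, 1]) k with hu
      have huk : coordForm γ σ 0 u k = 0 := by
        have h3 := hskew (realWeight ![0, 1]) k k
        rw [h.coordForm_symm 0 k] at h3
        linarith
      have hu1 : coordForm γ σ 0 u e₁ = 0 := by
        have h3 := hskew (realWeight ![1, 0]) u e₂
        rw [hcomm, map_zero, LinearMap.zero_apply, h2', map_smul, smul_eq_mul] at h3
        have : κ * coordForm γ σ 0 u e₁ = 0 := by linarith
        exact (mul_eq_zero.1 this).resolve_left hκ0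
      have hu2 : coordForm γ σ 0 u e₂ = 0 := by
        have h3 := hskew (realWeight ![1, 0]) u e₁
        rw [hcomm, map_zero, LinearMap.zero_apply, h1', map_smul, smul_eq_mul] at h3
        have : κ * coordForm γ σ 0 u e₂ = 0 := by linarith
        exact (mul_eq_zero.1 this).resolve_left hκ0
      rw [hdec u, huk, hu1, hu2]
      simp
  obtain ⟨e₁, e₂, h1k, h2k, h12, h11, h22, hdec⟩ := exists_adapted_frame (h.coordForm_symm 0) hpos hk
  have hsum : realWeight ![1, 1] = realWeight ![1, 0] + realWeight ![0, 1] := by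
    ext i; fin_cases i <;> simp [realWeight]
  have hw := fun w (hk : coordLinear σ V (realWeight w) k = 0) =>
    h.exists_weight hσ hinj h0 (hz (realWeight w)) h12 h11 hdec hk
  obtain ⟨κ₀, ha₀, -, hκ₀⟩ := hw ![1, 0] hk0
  obtain ⟨κ₁, ha₁, -, hκ₁⟩ := hw ![0, 1] hk1
  obtain ⟨κ₂, ha₂, -, hκ₂⟩ := hw ![1, 1] (by rw [hsum, coordLinear_add, hk0, hk1, add_zero])
  have hκ : κ₂ = κ₀ + κ₁ := by
    rw [hsum, coordLinear_add, ha₀, ha₁, ← add_smul] at ha₂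
    have h3 := congrArg (fun v => coordForm γ σ 0 v e₂) ha₂
    simp only [map_smul, LinearMap.smul_apply, h22, smul_eq_mul, mul_one] at h3
    exact_mod_cast h3.symm
  have hodd : ∀ (w : Fin 2 → ℤ) (κ : ℤ), IsCoprime (w 0) (w 1) →
      (∀ s : ℝ, (∃ m : ℤ, (κ : ℝ) * s = m * (2 * π)) →
        ∀ v, actDeriv (n := 3) (torusExp (s • realWeight w)) (σ 0) v = v) → κ ^ 2 = 1 :=
    fun w κ hcop hκ => h.weight_sq hcop
      (torusExp_smul_eq_of_field_eq_zero h.action hσ hinj h0 (hz _)) hκ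
  have e0 := hodd ![1, 0] κ₀ isCoprime_one_left hκ₀
  have e1 := hodd ![0, 1] κ₁ isCoprime_one_right hκ₁
  have e2 := hodd ![1, 1] κ₂ isCoprime_one_left hκ₂
  rw [hκ] at e2
  have e3 : 2 * (κ₀ * κ₁) = -1 := by linear_combination e2 - e0 - e1
  omega

end AxisWeights

section AxisLimits

/-- A limit at an end of `(-1, 1)` may be computed along a curve. -/
lemma tendsto_of_tendsto_comp {X F : ℝ → ℝ} {l : Filter ℝ} {e δ : ℝ} (he : e ^ 2 = 1)
    (hδ : 0 < δ) (hX : ContinuousOn X (Icc 0 δ)) (hX0 : X 0 = e) (hXI : ∀ t ∈ Ioc 0 δ, X t ∈ 𝕀)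
    (hF : Tendsto (fun t => F (X t)) (𝓝[>] 0) l) : Tendsto F (𝓝[𝕀] e) l := by
  have heI : ∀ y ∈ 𝕀, e * y < 1 := by
    rintro y ⟨hy1, hy2⟩
    rcases sq_eq_sq_iff_eq_or_eq_neg.1 (he.trans (one_pow 2).symm) with rfl | rfl <;> linarith
  intro s hs
  obtain ⟨ε, hε, hεs⟩ := mem_nhdsGT_iff_exists_Ioo_subset.1 (hF hs)
  have hε0 : 0 < ε := hε
  set m := min (ε / 2) δ with hm
  have hm0 : 0 < m := lt_min (by linarith) hδ
  have hmδ : m ≤ δ := min_le_right _ _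
  have hmε : m < ε := lt_of_le_of_lt (min_le_left _ _) (by linarith)
  have hr := hXI m ⟨hm0, hmδ⟩
  have hnear : {y : ℝ | e * X m < e * y} ∈ 𝓝 e := by
    refine (isOpen_lt continuous_const (by fun_prop)).mem_nhds ?_
    change e * X m < e * e
    rw [← sq, he]
    exact heI _ hr
  rw [mem_map, mem_nhdsWithin_iff_exists_mem_nhds_inter]
  refine ⟨_, hnear, ?_⟩
  rintro y ⟨hy1, hy2⟩
  have hy1' : e * X m < e * y := hy1
  have hmem : y ∈ Set.uIcc (X 0) (X m) := by
    have h3 := heI y hy2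
    rw [hX0, Set.mem_uIcc]
    rcases sq_eq_sq_iff_eq_or_eq_neg.1 (he.trans (one_pow 2).symm) with rfl | rfl
    · right; constructor <;> linarith
    · left; constructor <;> linarith
  obtain ⟨t, ht, rfl⟩ := intermediate_value_uIcc
    (hX.mono (by rw [Set.uIcc_of_le hm0.le]; exact Set.Icc_subset_Icc_right hmδ)) hmem
  rw [Set.uIcc_of_le hm0.le] at ht
  have ht0 : t ≠ 0 := by
    rintro rfl
    have := heI _ hy2
    rw [hX0, ← sq, he] at this
    exact lt_irrefl _ this
  exact hεs ⟨lt_of_le_of_ne ht.1 ht0.symm, lt_of_le_of_lt ht.2 hmε⟩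

/-- The second order behaviour of a function at a critical point, from that of its derivative. -/
lemma tendsto_div_sq_of_deriv {X : ℝ → ℝ} {K : ℝ} (hX : ContDiffAt ℝ ∞ X 0)
    (hK : Tendsto (fun t => deriv X t ^ 2 / t ^ 2) (𝓝[>] 0) (𝓝 (K ^ 2))) (hK0 : 0 ≤ K)
    {e : ℝ} (he : e ^ 2 = 1) (hX0 : X 0 = e) (hle : ∀ t, e * X t ≤ 1) :
    Tendsto (fun t => (1 - e * X t) / t ^ 2) (𝓝[>] 0) (𝓝 (K / 2)) := by
  have hdX : ContDiffAt ℝ 1 (deriv X) 0 := by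
    have := (hX.fderiv_right (m := 1) one_add_one_le_smooth)
    exact (ContDiffAt.clm_apply this contDiffAt_const)
  have hX'0 : deriv X 0 = 0 := by
    have h1 : Tendsto (fun t => deriv X t ^ 2) (𝓝[>] 0) (𝓝 (deriv X 0 ^ 2)) :=
      (hdX.continuousAt.pow 2).mono_left nhdsWithin_le_nhds
    have h2 : Tendsto (fun t : ℝ => deriv X t ^ 2 / t ^ 2 * t ^ 2) (𝓝[>] 0) (𝓝 (K ^ 2 * 0 ^ 2)) :=
      hK.mul (((continuous_pow 2).tendsto (0 : ℝ)).mono_left nhdsWithin_le_nhds)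
    have h3 : deriv X 0 ^ 2 = K ^ 2 * 0 ^ 2 := by
      refine tendsto_nhds_unique h1 (h2.congr' ?_)
      filter_upwards [self_mem_nhdsWithin] with t ht
      have : t ≠ 0 := ne_of_gt ht
      field_simp
    simpa using h3
  have hsl : Tendsto (fun t => deriv X t / t) (𝓝[>] 0) (𝓝 (deriv (deriv X) 0)) := by
    have h1 := ((hdX.differentiableAt (by simp)).hasDerivAt.tendsto_slope_zero_right)
    refine h1.congr fun t => ?_
    simp [hX'0, div_eq_inv_mul]
  have hsq : deriv (deriv X) 0 ^ 2 = K ^ 2 := by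
    refine tendsto_nhds_unique (hsl.pow 2) (hK.congr fun t => ?_)
    rw [div_pow]
  have hlim : Tendsto (fun t => (1 - e * X t) / t ^ 2) (𝓝[>] 0)
      (𝓝 (-e * deriv (deriv X) 0 / 2)) := by
    have hev : ∀ᶠ t in 𝓝 (0 : ℝ), ContDiffAt ℝ 1 X t :=
      (hX.of_le (by simp) : ContDiffAt ℝ 1 X 0).eventually (by simp)
    refine HasDerivAt.lhopital_zero_nhdsGT (f' := fun t => -(e * deriv X t))
      (g' := fun t => 2 * t) ?_ ?_ ?_ ?_ ?_ ?_
    · filter_upwards [nhdsWithin_le_nhds hev] with t ht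
      exact (((ht.differentiableAt (by simp)).hasDerivAt).const_mul e).const_sub 1
    · refine Eventually.of_forall fun t => ?_
      simpa using hasDerivAt_pow 2 t
    · filter_upwards [self_mem_nhdsWithin] with t ht
      exact mul_ne_zero two_ne_zero (ne_of_gt ht)
    · have h1 : Tendsto (fun t => 1 - e * X t) (𝓝 0) (𝓝 (1 - e * X 0)) :=
        (hX.continuousAt.const_mul e).const_sub 1
      rw [hX0, ← sq, he, sub_self] at h1
      exact h1.mono_left nhdsWithin_le_nhds
    · have h1 : Tendsto (fun t : ℝ => t ^ 2) (𝓝 0) (𝓝 (0 ^ 2)) := (continuous_pow 2).tendsto 0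
      rw [zero_pow two_ne_zero] at h1
      exact h1.mono_left nhdsWithin_le_nhds
    · refine ((hsl.const_mul (-e)).div_const 2).congr' ?_
      filter_upwards [self_mem_nhdsWithin] with t ht
      have : t ≠ 0 := ne_of_gt ht
      field_simp
  have hnn : 0 ≤ -e * deriv (deriv X) 0 / 2 := by
    refine ge_of_tendsto hlim (Eventually.of_forall fun t => ?_)
    exact div_nonneg (by linarith [hle t]) (sq_nonneg t)
  have heq : -e * deriv (deriv X) 0 = K := by
    have h1 : (-e * deriv (deriv X) 0) ^ 2 = K ^ 2 := by
      rw [mul_pow, neg_sq, he, one_mul, hsq]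
    exact (pow_left_inj₀ (by linarith) hK0 two_ne_zero).1 h1
  rwa [heq] at hlim

variable {σ : (Fin 3 → ℝ) → B} {V : Set (Fin 3 → ℝ)}

/-- The vector field `∑ aᵢ ηᵢ`. -/
def genComb (a : Fin 2 → ℝ) (b : B) : 𝔼 3 := ∑ i, a i • modelGen i b

open Classical in
/-- The Gram matrix of the generators as a function of the orbit coordinate. -/
def orbitGram (γ : TwoTensor 3 B) (x : B → ℝ) (t : ℝ) (i j : Fin 2) : ℝ :=
  if h : ∃ b, x b = t then gram γ h.choose i j else 0

/-- The quadratic form of the Gram matrix of the generators. -/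
def orbitForm (γ : TwoTensor 3 B) (x : B → ℝ) (a a' : Fin 2 → ℝ) (t : ℝ) : ℝ :=
  ∑ i, ∑ j, a i * a' j * orbitGram γ x t i j

lemma IsBiaxial.orbitGram_eq (h : IsBiaxial γ C x) (b : B) (i j : Fin 2) :
    orbitGram γ x (x b) i j = gram γ b i j := by
  have hex : ∃ b', x b' = x b := ⟨b, rfl⟩
  rw [orbitGram, dif_pos hex]
  exact h.gram_eq_of_x_eq hex.choose_spec i j

lemma IsBiaxial.orbitForm_eq (h : IsBiaxial γ C x) (b : B) (a a' : Fin 2 → ℝ) :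
    orbitForm γ x a a' (x b) = modelForm γ b (genComb a b) (genComb a' b) := by
  simp only [orbitForm, h.orbitGram_eq, genComb, sum_univ_two, map_add, map_smul,
    LinearMap.add_apply, LinearMap.smul_apply, smul_eq_mul, gram]
  ring

lemma coordForm_eq_sum {n : ℕ} {N : Type*} [TopologicalSpace N]
    [ChartedSpace (𝔼 n) N] (h : TwoTensor n N) (σ : (Fin n → ℝ) → N)
    (y v w : Fin n → ℝ) : coordForm h σ y v w = ∑ a, ∑ b, v a * w b * comp h σ y a b := by
  conv_lhs => rw [← (Pi.basisFun ℝ (Fin n)).sum_repr v, ← (Pi.basisFun ℝ (Fin n)).sum_repr w]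
  simp only [map_sum, map_smul, LinearMap.sum_apply, LinearMap.smul_apply, Pi.basisFun_repr,
    Pi.basisFun_apply, smul_eq_mul, mul_sum]
  rw [Finset.sum_comm]
  refine sum_congr rfl fun a _ => sum_congr rfl fun b _ => ?_
  rw [coordForm_apply, comp_eq_modelForm, modelCoord, modelCoord]
  ring

lemma tendsto_coordForm {n : ℕ} {N ι : Type*} [TopologicalSpace N]
    [ChartedSpace (𝔼 n) N] {h : TwoTensor n N} (hh : IsSmoothTensor h)
    {σ : (Fin n → ℝ) → N} {V : Set (Fin n → ℝ)} (hσ : IsLocalCoord σ V) {l : Filter ι}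
    {y v w : ι → Fin n → ℝ} {y₀ v₀ w₀ : Fin n → ℝ} (hy₀ : y₀ ∈ V) (hy : Tendsto y l (𝓝 y₀))
    (hv : Tendsto v l (𝓝 v₀)) (hw : Tendsto w l (𝓝 w₀)) :
    Tendsto (fun i => coordForm h σ (y i) (v i) (w i)) l (𝓝 (coordForm h σ y₀ v₀ w₀)) := by
  simp only [coordForm_eq_sum]
  refine tendsto_finsetSum _ fun a _ => tendsto_finsetSum _ fun b _ => ?_
  refine ((tendsto_pi_nhds.1 hv a).mul (tendsto_pi_nhds.1 hw b)).mul ?_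
  exact (((hh σ V hσ a b).contDiffAt (hσ.isOpen.mem_nhds hy₀)).continuousAt.tendsto).comp hy

/-- `modelDiff_sq` in terms of two independent combinations of the generators. -/
lemma IsBiaxial.modelDiff_sq_genComb (h : IsBiaxial γ C x) (b : B) (v : 𝔼 3) (a a' : Fin 2 → ℝ) :
    (a 0 * a' 1 - a 1 * a' 0) ^ 2 * modelDiff x b v ^ 2 = C ^ 2 *
      |(modelForm γ b (genComb a b) (genComb a b) * modelForm γ b (genComb a' b) (genComb a' b) -
          modelForm γ b (genComb a b) (genComb a' b) ^ 2) * modelForm γ b v v -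
        (modelForm γ b (genComb a' b) (genComb a' b) * modelForm γ b v (genComb a b) ^ 2 -
          2 * modelForm γ b (genComb a b) (genComb a' b) * modelForm γ b v (genComb a b) *
            modelForm γ b v (genComb a' b) +
          modelForm γ b (genComb a b) (genComb a b) * modelForm γ b v (genComb a' b) ^ 2)| := by
  rw [h.modelDiff_sq, ← mul_assoc, mul_comm _ (C ^ 2), mul_assoc]
  congr 1
  rw [← abs_of_nonneg (sq_nonneg (a 0 * a' 1 - a 1 * a' 0)), ← abs_mul]
  congr 1
  have hs := h.gram_symm b 1 0
  simp only [gramDet, gram] at hs ⊢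
  simp only [genComb, sum_univ_two, map_add, map_smul,
    LinearMap.add_apply, LinearMap.smul_apply, smul_eq_mul, hs]
  ring

lemma IsBiaxial.mul_x_le (h : IsBiaxial γ C x) {e : ℝ} (he : e ^ 2 = 1) (b : B) :
    e * x b ≤ 1 := by
  have := h.x_mem b
  rcases sq_eq_sq_iff_eq_or_eq_neg.1 (he.trans (one_pow 2).symm) with rfl | rfl <;>
    linarith [this.1, this.2]

variable [T2Space B]

/-- The behaviour of the Gram matrix of the generators at an axis. -/
lemma IsBiaxial.axis_limits (h : IsBiaxial γ C x) {w w' : Fin 2 → ℤ}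
    (hw : IsCoprime (w 0) (w 1)) (hd : w 0 * w' 1 - w 1 * w' 0 ≠ 0) {e : ℝ} (he : e ^ 2 = 1)
    (hvan : ∀ b, x b = e → genComb (realWeight w) b = 0) :
    ∃ a β : ℝ, 0 < a ∧ 0 < β ∧
      a ^ 2 * β = 4 * ((w 0 * w' 1 - w 1 * w' 0 : ℤ) : ℝ) ^ 2 / C ^ 2 ∧
      Tendsto (fun t => orbitForm γ x (realWeight w) (realWeight w) t / (1 - e * t))
        (𝓝[𝕀] e) (𝓝 a) ∧
      Tendsto (orbitForm γ x (realWeight w') (realWeight w')) (𝓝[𝕀] e) (𝓝 β) ∧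
      Tendsto (fun t => orbitForm γ x (realWeight w) (realWeight w') t ^ 2 / (1 - e * t))
        (𝓝[𝕀] e) (𝓝 0) := by
  obtain ⟨b₀, hb₀⟩ : ∃ b, x b = e := by
    have : e ∈ Set.range x := by
      rw [h.orbit.range_eq]
      rcases sq_eq_sq_iff_eq_or_eq_neg.1 (he.trans (one_pow 2).symm) with rfl | rfl <;> norm_num
    exact this
  have hC := h.orbit.pos
  set a := realWeight w with ha
  set a' := realWeight w' with ha'
  obtain ⟨σ, V, hσ, hinj, h0, rfl⟩ := exists_isLocalCoord (n := 3) b₀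
  have hz : genComb a (σ 0) = 0 := hvan _ hb₀
  have hfix := torusExp_smul_eq_of_field_eq_zero h.action hσ hinj h0 hz
  have hpos := h.coordForm_pos hσ h0
  have hfield : ∀ c : Fin 2 → ℝ, ∀ y ∈ V, modelDeriv σ y (coordField σ V c y) = genComb c (σ y) :=
    fun c y hy => modelDeriv_coordField h.action hσ hinj hy c
  set d : ℝ := a 0 * a' 1 - a 1 * a' 0 with hdef
  have hd0 : d ≠ 0 := by
    have : d = ((w 0 * w' 1 - w 1 * w' 0 : ℤ) : ℝ) := by
      rw [hdef, ha, ha']; simp [realWeight]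
    rw [this]; exact_mod_cast hd
  have hdcast : ((w 0 * w' 1 - w 1 * w' 0 : ℤ) : ℝ) = d := by
    rw [hdef, ha, ha']; simp [realWeight]
  -- the second combination does not vanish
  set k := coordField σ V a' 0 with hk
  have hk0 : k ≠ 0 := by
    intro hk0
    have h1 : genComb a' (σ 0) = 0 := by rw [← hfield a' 0 h0, ← hk, hk0, map_zero]
    obtain ⟨i, hi⟩ := h.exists_generator_ne_zero (σ 0)
    simp only [genComb, sum_univ_two] at h1 hz
    have e0 : d • modelGen (n := 3) 0 (σ 0) = 0 := by
      have : d • modelGen (n := 3) 0 (σ 0) =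
          a' 1 • (a 0 • modelGen 0 (σ 0) + a 1 • modelGen 1 (σ 0)) -
          a 1 • (a' 0 • modelGen 0 (σ 0) + a' 1 • modelGen 1 (σ 0)) := by rw [hdef]; module
      rw [this, h1, hz]; simp
    have e1 : d • modelGen (n := 3) 1 (σ 0) = 0 := by
      have : d • modelGen (n := 3) 1 (σ 0) =
          a 0 • (a' 0 • modelGen 0 (σ 0) + a' 1 • modelGen 1 (σ 0)) -
          a' 0 • (a 0 • modelGen 0 (σ 0) + a 1 • modelGen 1 (σ 0)) := by rw [hdef]; module
      rw [this, h1, hz]; simp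
    apply hi
    fin_cases i
    exacts [(smul_eq_zero.1 e0).resolve_left hd0, (smul_eq_zero.1 e1).resolve_left hd0]
  set L := coordLinear σ V a with hL
  have hLk : L k = 0 := by
    have h1 := hasDerivAt_coordIsotropy h.action hσ hinj h0 a k
    refine h1.unique ((hasDerivAt_const (0 : ℝ) k).congr_of_eventuallyEq
      (Eventually.of_forall fun s => ?_))
    change coordIsotropy σ V (s • a) k = k
    apply (hσ.bijective_modelDeriv h0).1
    rw [modelDeriv_coordIsotropy h.action hσ hinj h0 (hfix s), hk, hfield a' 0 h0, genComb, map_sum]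
    refine sum_congr rfl fun i _ => ?_
    rw [map_smul, actDeriv_modelGen h.action, hfix s]
  obtain ⟨e₁, e₂, h1k, h2k, h12, h11, h22, hdec⟩ := exists_adapted_frame (h.coordForm_symm 0) hpos hk0
  obtain ⟨κ, hκ1, -, hκ⟩ := h.exists_weight hσ hinj h0 hz h12 h11 hdec hLk
  have hκsq : (κ : ℝ) ^ 2 = 1 := by exact_mod_cast h.weight_sq hw hfix hκ
  have hLL : coordForm γ σ 0 (L e₁) (L e₁) = 1 := by
    rw [hL, hκ1]
    simp only [map_smul, LinearMap.smul_apply, h22, smul_eq_mul, mul_one]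
    rw [← sq, hκsq]
  have hLk' : coordForm γ σ 0 (L e₁) k = 0 := by
    rw [hL, hκ1]; simp [h2k]
  have hL1 : coordForm γ σ 0 e₁ (L e₁) = 0 := by
    rw [hL, hκ1]; simp [h12]
  set β := coordForm γ σ 0 k k with hβ
  have hβ0 : 0 < β := hpos k hk0
  -- the curve `t ↦ σ (t e₁)`
  have hline : Tendsto (fun t : ℝ => t • e₁) (𝓝 0) (𝓝 0) := by
    have : Continuous fun t : ℝ => t • e₁ := by fun_prop
    simpa using this.tendsto 0
  have hline' := hline.mono_left (nhdsWithin_le_nhds (s := Set.Ioi (0 : ℝ)))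
  have hV : ∀ᶠ t in 𝓝 (0 : ℝ), t • e₁ ∈ V := hline.eventually (hσ.isOpen.mem_nhds h0)
  have hV' : ∀ᶠ t in 𝓝[>] (0 : ℝ), t • e₁ ∈ V := nhdsWithin_le_nhds hV
  let S : Set ℝ := {t : ℝ | t • e₁ ∈ V}
  have hS : IsOpen S := hσ.isOpen.preimage (f := fun t : ℝ => t • e₁) (by fun_prop)
  have h0S : (0 : ℝ) ∈ S := by change (0 : ℝ) • e₁ ∈ V; rw [zero_smul]; exact h0
  let X : ℝ → ℝ := fun t => x (σ (t • e₁))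
  have hX0 : X 0 = e := by simp only [X, zero_smul]; exact hb₀
  have hXs : ContDiffOn ℝ ∞ X S := by
    have h1 : ContMDiffOn 𝓘(ℝ, ℝ) (𝓡 3) ∞ (fun t : ℝ => σ (t • e₁)) S := by
      refine hσ.smooth.comp (ContDiff.contMDiff ?_).contMDiffOn fun t ht => ht
      fun_prop
    exact (h.orbit.smooth.comp_contMDiffOn h1).contDiffOn
  have hXd : ∀ t ∈ S, HasDerivAt X (modelDiff (n := 3) x (σ (t • e₁)) (modelDeriv σ (t • e₁) e₁)) t := by
    intro t ht
    have h1 : HasFDerivAt (fun y => x (σ y)) _ (t • e₁) :=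
      fderiv_comp_modelDeriv (h.mdifferentiable_x _) (hσ.mdifferentiableAt ht)
    have h2 : HasDerivAt (fun t : ℝ => t • e₁) e₁ t := by
      simpa using (hasDerivAt_id t).smul_const e₁
    exact h1.comp_hasDerivAt t h2
  -- limits of the components
  have hY : Tendsto (fun t : ℝ => t⁻¹ • coordField σ V a (t • e₁)) (𝓝[>] 0) (𝓝 (L e₁)) := by
    have h1 : HasFDerivAt (coordField σ V a) L ((0 : ℝ) • e₁) := by
      rw [zero_smul]; exact hasFDerivAt_coordField h.action hσ hinj h0 a
    have h2 : HasDerivAt (fun t : ℝ => t • e₁) e₁ 0 := by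
      simpa using (hasDerivAt_id (0 : ℝ)).smul_const e₁
    have h3 := (h1.comp_hasDerivAt (0 : ℝ) h2).tendsto_slope_zero_right
    have h4 : coordField σ V a 0 = 0 :=
      (hσ.bijective_modelDeriv h0).1 ((hfield a 0 h0).trans (hz.trans (map_zero _).symm))
    refine h3.congr fun t => ?_
    simp [h4]
  have hY' : Tendsto (fun t : ℝ => coordField σ V a' (t • e₁)) (𝓝[>] 0) (𝓝 k) :=
    (hasFDerivAt_coordField h.action hσ hinj h0 a').continuousAt.tendsto.comp hline'
  have hlim := fun {v u : ℝ → Fin 3 → ℝ} {v₀ u₀ : Fin 3 → ℝ} =>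
    tendsto_coordForm (v := v) (w := u) (v₀ := v₀) (w₀ := u₀) h.smooth hσ h0 hline'
  have c1 := hlim hY hY
  have c2 := hlim hY hY'
  have c3 := hlim hY' hY'
  have c4 := hlim (tendsto_const_nhds (x := e₁)) hY
  have c5 := hlim (tendsto_const_nhds (x := e₁)) hY'
  have c6 := hlim (tendsto_const_nhds (x := e₁)) (tendsto_const_nhds (x := e₁))
  rw [hLL] at c1
  rw [hLk'] at c2
  rw [hL1] at c4
  rw [h1k] at c5
  rw [h11] at c6
  simp only [map_smul, LinearMap.smul_apply, smul_eq_mul] at c1 c2 c4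
  have hQ : ∀ c c' : Fin 2 → ℝ, ∀ t ∈ S, orbitForm γ x c c' (X t) =
      coordForm γ σ (t • e₁) (coordField σ V c (t • e₁)) (coordField σ V c' (t • e₁)) := by
    intro c c' t ht
    rw [h.orbitForm_eq, coordForm_apply, hfield c _ ht, hfield c' _ ht]
  have hS' : ∀ᶠ t in 𝓝[>] (0 : ℝ), t ∈ S ∧ 0 < t := by
    filter_upwards [hV', self_mem_nhdsWithin] with t h1 h2 using ⟨h1, h2⟩
  set K := C * sqrt β / |d| with hK
  have hK0 : 0 < K := by positivity
  have hK2 : K ^ 2 = C ^ 2 * β / d ^ 2 := by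
    rw [hK, div_pow, mul_pow, sq_sqrt hβ0.le, sq_abs]
  have hXlim : Tendsto (fun t => deriv X t ^ 2 / t ^ 2) (𝓝[>] 0) (𝓝 (K ^ 2)) := by
    have h1 := (((((c1.mul c3).sub (c2.pow 2)).mul c6).sub
      (((c3.mul (c4.pow 2)).sub (((c2.mul c4).mul c5).const_mul 2)).add
        (c1.mul (c5.pow 2)))).abs.const_mul (C ^ 2)).div_const (d ^ 2)
    have h2 : K ^ 2 = C ^ 2 * |(1 * β - 0 ^ 2) * 1 - (β * 0 ^ 2 - 2 * (0 * 0 * 0) + 1 * 0 ^ 2)| /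
        d ^ 2 := by
      rw [hK2]; simp [abs_of_pos hβ0]
    rw [h2]
    refine h1.congr' ?_
    filter_upwards [hS'] with t ⟨htS, ht⟩
    rw [(hXd t htS).deriv]
    have h3 := h.modelDiff_sq_genComb (σ (t • e₁)) (modelDeriv σ (t • e₁) e₁) a a'
    rw [← hfield a _ htS, ← hfield a' _ htS] at h3
    simp only [← coordForm_apply] at h3
    rw [← hdef] at h3
    rw [div_eq_div_iff (pow_ne_zero 2 hd0) (pow_ne_zero 2 ht.ne'), mul_comm _ (d ^ 2), h3,
      mul_assoc]
    congr 1
    rw [← abs_of_nonneg (sq_nonneg t), ← abs_mul]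
    congr 1
    field_simp
  have hXe := tendsto_div_sq_of_deriv (hXs.contDiffAt (hS.mem_nhds h0S)) hXlim hK0.le he hX0
    fun t => h.mul_x_le he _
  have hXlt : ∀ᶠ t in 𝓝[>] (0 : ℝ), e * X t < 1 ∧ -1 < e * X t := by
    have h1 : ∀ᶠ t in 𝓝[>] (0 : ℝ), 0 < (1 - e * X t) / t ^ 2 :=
      hXe.eventually (lt_mem_nhds (by positivity))
    have h2 : Tendsto (fun t => e * X t) (𝓝 0) (𝓝 (e * X 0)) :=
      ((hXs.contDiffAt (hS.mem_nhds h0S)).continuousAt).const_mul e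
    rw [hX0, ← sq, he] at h2
    filter_upwards [h1, nhdsWithin_le_nhds (h2.eventually (lt_mem_nhds (show (-1 : ℝ) < 1 by norm_num))),
      self_mem_nhdsWithin] with t h3 h4 h5
    refine ⟨?_, h4⟩
    have := (div_pos_iff_of_pos_right (by have : (0 : ℝ) < t := h5; positivity)).1 h3
    linarith
  have hXI : ∀ᶠ t in 𝓝[>] (0 : ℝ), X t ∈ 𝕀 := by
    filter_upwards [hXlt] with t ⟨h1, h2⟩
    rcases sq_eq_sq_iff_eq_or_eq_neg.1 (he.trans (one_pow 2).symm) with rfl | rfl <;>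
      constructor <;> linarith
  obtain ⟨δ, hδ, hδs⟩ := mem_nhdsGT_iff_exists_Ioc_subset.1 (hXI.and hV')
  have htrans : ∀ {F : ℝ → ℝ} {l : Filter ℝ}, Tendsto (fun t => F (X t)) (𝓝[>] 0) l →
      Tendsto F (𝓝[𝕀] e) l := by
    intro F l hF
    refine tendsto_of_tendsto_comp he hδ (hXs.continuousOn.mono ?_) hX0
      (fun t ht => (hδs ht).1) hF
    intro t ht
    rcases eq_or_lt_of_le ht.1 with h1 | h1
    · rw [← h1]; exact h0S
    · exact (hδs ⟨h1, ht.2⟩).2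
  refine ⟨1 / (K / 2), β, by positivity, hβ0, ?_, htrans ?_, htrans ?_, htrans ?_⟩
  · rw [hdcast]
    have h1 : (1 / (K / 2)) ^ 2 * β = 4 * β / K ^ 2 := by field_simp; ring
    rw [h1, hK2]
    field_simp
  · refine (c1.div hXe (by positivity)).congr' ?_
    filter_upwards [hS', hXlt] with t ⟨htS, ht⟩ ⟨h1, _⟩
    rw [Pi.div_apply, hQ a a t htS]
    have : 1 - e * X t ≠ 0 := by linarith
    field_simp
  · refine c3.congr' ?_
    filter_upwards [hS'] with t ⟨htS, ht⟩
    rw [hQ a' a' t htS]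
  · have h1 := ((c2.pow 2).div hXe (by positivity))
    rw [zero_pow two_ne_zero, zero_div] at h1
    refine h1.congr' ?_
    filter_upwards [hS', hXlt] with t ⟨htS, ht⟩ ⟨h1, _⟩
    rw [Pi.div_apply, hQ a a' t htS]
    have : 1 - e * X t ≠ 0 := by linarith
    field_simp

end AxisLimits

section VolumeDensity

variable {n : ℕ} {N : Type*} [TopologicalSpace N] [ChartedSpace (𝔼 n) N]

lemma comp_eq_toMatrix (h : TwoTensor n N) (σ : (Fin n → ℝ) → N) (y : Fin n → ℝ) :
    comp h σ y = LinearMap.BilinForm.toMatrix' (coordForm h σ y) := by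
  ext a b
  rw [LinearMap.BilinForm.toMatrix'_apply]
  rfl

/-- The determinant of the components of a bilinear form under a change of coordinates. -/
lemma det_comp_lift (h : TwoTensor n N) {σ τ : (Fin n → ℝ) → N} {V : Set (Fin n → ℝ)}
    (hσ : IsLocalCoord σ V) {f : (Fin n → ℝ) → Fin n → ℝ} {z : Fin n → ℝ}
    (hf : DifferentiableAt ℝ f z) (hfz : f z ∈ V) (hfτ : ∀ᶠ w in 𝓝 z, σ (f w) = τ w) :
    (comp h τ z).det = (fderiv ℝ f z).det ^ 2 * (comp h σ (f z)).det := by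
  have hz : σ (f z) = τ z := hfτ.self_of_nhds
  have h1 : coordForm h τ z = (coordForm h σ (f z)).comp (fderiv ℝ f z).toLinearMap
      (fderiv ℝ f z).toLinearMap := by
    refine LinearMap.ext fun u => LinearMap.ext fun v => ?_
    rw [LinearMap.BilinForm.comp_apply]
    change modelForm h (τ z) _ _ = modelForm h (σ (f z)) _ _
    rw [hz]
    have hu := fun v => modelDeriv_lift hσ hf hfz hfτ v
    change modelForm h (τ z) (modelDeriv τ z u) (modelDeriv τ z v) = _
    rw [hu, hu]
    rfl
  rw [comp_eq_toMatrix, h1, LinearMap.BilinForm.toMatrix'_comp, Matrix.det_mul, Matrix.det_mul,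
    Matrix.det_transpose, LinearMap.det_toMatrix', ← comp_eq_toMatrix]
  change (fderiv ℝ f z).det * _ * (fderiv ℝ f z).det = _
  ring

end VolumeDensity

section OrbitPartition

variable {σ : (Fin 3 → ℝ) → B} {V : Set (Fin 3 → ℝ)}

lemma IsOrbitSection.mono {c : ℝ → B} {J J' : Set ℝ} (hc : IsOrbitSection x c J)
    (hJ' : IsOpen J') (h : J' ⊆ J) : IsOrbitSection x c J' :=
  ⟨hJ', h.trans hc.subset, hc.smooth.mono h, fun t ht => hc.x_eq t (h ht)⟩

lemma IsBiaxial.exists_x_eq (h : IsBiaxial γ C x) {t : ℝ}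
    (ht : t ∈ Icc (-1 : ℝ) 1) : ∃ b, x b = t := by
  rw [← h.orbit.range_eq] at ht
  exact ht

/-- A set of points with coordinates in finitely or countably many orbits is a null set. -/
lemma IsBiaxial.volume_preimage_orbits (h : IsBiaxial γ C x)
    (hσ : IsLocalCoord σ V) (hinj : InjOn σ V) {S : Set ℝ} (hS : S.Countable) :
    volume {y | y ∈ V ∧ x (σ y) ∈ S} = 0 := by
  have hunion : {y | y ∈ V ∧ x (σ y) ∈ S} = ⋃ t ∈ S, {y | y ∈ V ∧ x (σ y) = t} := by
    ext y; simp
  rw [hunion, measure_biUnion_null_iff hS]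
  intro t _
  by_cases hb : ∃ b, x b = t
  swap
  · have : {y | y ∈ V ∧ x (σ y) = t} = ∅ :=
      Set.eq_empty_of_forall_notMem fun y hy => hb ⟨_, hy.2⟩
    rw [this, measure_empty]
  obtain ⟨b, rfl⟩ := hb
  let pr : (Fin 3 → ℝ) →L[ℝ] (Fin 2 → ℝ) :=
    ContinuousLinearMap.pi ![proj 0, proj 1]
  let o : (Fin 3 → ℝ) → B := fun w => torusExp (pr w) • b
  have ho : ∀ w, ContMDiffAt 𝓘(ℝ, Fin 3 → ℝ) (𝓡 3) ∞ o w := fun w =>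
    ((h.action.contMDiff_orbit b).comp (contMDiff_iff_contDiff.2 pr.contDiff)).contMDiffAt
  let W : Set (Fin 3 → ℝ) := {w | o w ∈ σ '' V}
  let f : (Fin 3 → ℝ) → Fin 3 → ℝ := fun w => invFunOn σ V (o w)
  have hfd : ∀ w ∈ W, HasFDerivAt f (fderiv ℝ f w) w := fun w hw =>
    ((hσ.contDiffAt_invFunOn hinj (ho w) hw).1.differentiableAt (by simp)).hasFDerivAt
  have hf2 : ∀ w ∈ W, fderiv ℝ f w (Pi.single 2 1) = 0 := by
    intro w hw
    have h1 : HasDerivAt (fun s : ℝ => w + s • (Pi.single 2 1 : Fin 3 → ℝ)) (Pi.single 2 1) 0 := by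
      simpa using ((hasDerivAt_id (0 : ℝ)).smul_const (Pi.single 2 1 : Fin 3 → ℝ)).const_add w
    have h2 : HasFDerivAt f (fderiv ℝ f w) (w + (0 : ℝ) • (Pi.single 2 1 : Fin 3 → ℝ)) := by
      rw [zero_smul, add_zero]; exact hfd w hw
    have h3 := h2.comp_hasDerivAt (0 : ℝ) h1
    refine h3.unique ((hasDerivAt_const (0 : ℝ) (f w)).congr_of_eventuallyEq
      (Eventually.of_forall fun s => ?_))
    have h4 : pr (w + s • (Pi.single 2 1 : Fin 3 → ℝ)) = pr w := by
      ext i; fin_cases i <;> simp [pr]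
    change invFunOn σ V (torusExp (pr (w + s • _)) • b) = f w
    rw [h4]
  have hdet : ∀ w ∈ W, (fderiv ℝ f w).det = 0 := by
    intro w hw
    by_contra hne
    have hu : IsUnit (LinearMap.det (fderiv ℝ f w).toLinearMap) := isUnit_iff_ne_zero.2 hne
    have hinjL := ((Module.End.isUnit_iff _).1 ((LinearMap.isUnit_iff_isUnit_det _).2 hu)).1
    have h1 : (Pi.single 2 1 : Fin 3 → ℝ) = 0 := hinjL ((hf2 w hw).trans (map_zero _).symm)
    have := congrFun h1 2
    simp at this
  refine measure_mono_null ?_ (addHaar_image_eq_zero_of_det_fderivWithin_eq_zero volume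
    (fun w hw => (hfd w hw).hasFDerivWithinAt) hdet)
  rintro y ⟨hy, hxy⟩
  obtain ⟨t, ht⟩ := (h.orbit.eq_iff b (σ y)).1 hxy.symm
  obtain ⟨φ, rfl⟩ := torusExp_surjective t
  have hπ : pr ![φ 0, φ 1, 0] = φ := by ext i; fin_cases i <;> rfl
  have ho' : o ![φ 0, φ 1, 0] = σ y := by
    change torusExp (pr ![φ 0, φ 1, 0]) • b = _
    rw [hπ, ht]
  refine ⟨![φ 0, φ 1, 0], ⟨y, hy, ho'.symm⟩, ?_⟩
  change invFunOn σ V (o ![φ 0, φ 1, 0]) = y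
  rw [ho']
  exact hinj.leftInvOn_invFunOn hy

/-- The orbit space is covered, up to countably many points, by disjoint open sets over which
there are sections. -/
lemma IsBiaxial.exists_partition (h : IsBiaxial γ C x) :
    ∃ (J : ℕ → Set ℝ) (c : ℕ → ℝ → B), (∀ n, IsOrbitSection x (c n) (J n)) ∧
      Pairwise (Function.onFun Disjoint J) ∧ (Icc (-1) 1 \ ⋃ n, J n).Countable := by
  have hex : ∀ t : 𝕀, ∃ (δ : ℝ) (c : ℝ → B), 0 < δ ∧
      IsOrbitSection x c (Ioo (t - δ) (t + δ)) := by
    rintro ⟨t, ht⟩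
    obtain ⟨b, rfl⟩ := h.exists_x_eq (Ioo_subset_Icc_self ht)
    obtain ⟨δ, c, hδ, hc, -⟩ := h.exists_section ht.1 ht.2
    exact ⟨δ, c, hδ, hc⟩
  choose δ c hδ hc using hex
  obtain ⟨T, hT, hTu⟩ := TopologicalSpace.isOpen_iUnion_countable
    (fun t : 𝕀 => Ioo ((t : ℝ) - δ t) (t + δ t)) fun t => isOpen_Ioo
  have hcover : ∀ t : 𝕀, ∃ r ∈ T, (t : ℝ) ∈ Ioo ((r : ℝ) - δ r) (r + δ r) := by
    intro t
    have : (t : ℝ) ∈ ⋃ i ∈ T, Ioo ((i : ℝ) - δ i) (i + δ i) := by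
      rw [hTu]
      exact Set.mem_iUnion.2 ⟨t, by simp [hδ t]⟩
    simpa only [Set.mem_iUnion, exists_prop] using this
  have hTne : T.Nonempty := by
    obtain ⟨r, hr, -⟩ := hcover ⟨0, by norm_num⟩
    exact ⟨r, hr⟩
  obtain ⟨f, hf⟩ := hT.exists_eq_range hTne
  let J : ℕ → Set ℝ := fun n => Ioo ((f n : ℝ) - δ (f n)) (f n + δ (f n)) \
    ⋃ m ∈ Finset.range n, Icc ((f m : ℝ) - δ (f m)) (f m + δ (f m))
  have hJo : ∀ n, IsOpen (J n) := fun n =>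
    isOpen_Ioo.sdiff (isClosed_biUnion_finset fun m _ => isClosed_Icc)
  refine ⟨J, fun n => c (f n), fun n => (hc (f n)).mono (hJo n) Set.sdiff_subset, ?_, ?_⟩
  · have hlt : ∀ m n, m < n → Disjoint (J m) (J n) := by
      intro m n hmn
      rw [Set.disjoint_left]
      intro t htm htn
      exact htn.2 (Set.mem_biUnion (Finset.mem_coe.2 (Finset.mem_range.2 hmn))
        (Ioo_subset_Icc_self htm.1))
    intro m n hmn
    rcases lt_or_gt_of_ne hmn with h1 | h1
    · exact hlt m n h1
    · exact (hlt n m h1).symm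
  · refine Set.Countable.mono (s₂ := (Set.range fun n => (f n : ℝ) - δ (f n)) ∪
      (Set.range fun n => (f n : ℝ) + δ (f n)) ∪ {-1, 1}) ?_
      (((Set.countable_range _).union (Set.countable_range _)).union
        ((Set.finite_singleton _).insert _).countable)
    rintro t ⟨ht, htJ⟩
    by_contra hcon
    simp only [Set.mem_union, Set.mem_range, Set.mem_insert_iff, Set.mem_singleton_iff, not_or,
      not_exists] at hcon
    obtain ⟨⟨h1, h2⟩, h3, h4⟩ := hcon
    have htI : t ∈ 𝕀 := ⟨lt_of_le_of_ne ht.1 (Ne.symm h3), lt_of_le_of_ne ht.2 h4⟩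
    obtain ⟨r, hr, htr⟩ := hcover ⟨t, htI⟩
    rw [hf] at hr
    obtain ⟨n₀, rfl⟩ := hr
    classical
    have hex : ∃ n, t ∈ Ioo ((f n : ℝ) - δ (f n)) (f n + δ (f n)) := ⟨n₀, htr⟩
    apply htJ
    refine Set.mem_iUnion.2 ⟨Nat.find hex, Nat.find_spec hex, ?_⟩
    intro hmem
    simp only [Finset.mem_range, Set.mem_iUnion, exists_prop] at hmem
    obtain ⟨m, hm, hmI⟩ := hmem
    exact Nat.find_min hex hm ⟨lt_of_le_of_ne hmI.1 (h1 m), lt_of_le_of_ne hmI.2 (Ne.symm (h2 m))⟩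

end OrbitPartition

section Area

variable {σ : (Fin 3 → ℝ) → B} {V : Set (Fin 3 → ℝ)}

/-- The box of orbit coordinates with angles in the interval `I`. -/
def angleBox (J I : Set ℝ) : Set (Fin 3 → ℝ) := Set.univ.pi ![J, I, I]

lemma mem_angleBox {J I : Set ℝ} {y : Fin 3 → ℝ} :
    y ∈ angleBox J I ↔ y 0 ∈ J ∧ y 1 ∈ I ∧ y 2 ∈ I := by
  simp [angleBox, Fin.forall_fin_succ]

lemma volume_angleBox (J I : Set ℝ) : volume (angleBox J I) = volume J * volume I ^ 2 := by
  rw [angleBox, volume_pi_pi, Fin.prod_univ_three]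
  simp [mul_assoc, sq]

lemma circleExp_inj_of_mem_Ico {s t : ℝ} (hs : s ∈ Ico 0 (2 * π))
    (ht : t ∈ Ico 0 (2 * π)) (h : Circle.exp s = Circle.exp t) : s = t := by
  obtain ⟨k, hk⟩ := Circle.exp_eq_exp.1 h
  have hpi := Real.two_pi_pos
  have h1 : (k : ℝ) < 1 := by
    by_contra hcon
    push Not at hcon
    nlinarith [hs.2, ht.1]
  have h2 : (-1 : ℝ) < k := by
    by_contra hcon
    push Not at hcon
    nlinarith [hs.1, ht.2]
  have h3 : k = 0 := by
    have h1' : k < 1 := by exact_mod_cast h1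
    have h2' : -1 < k := by exact_mod_cast h2
    omega
  rw [hk, h3]; simp

lemma orbitAngle_one (y : Fin 3 → ℝ) : orbitAngle 1 y = ![y 1, y 2] := by
  ext i; fin_cases i <;> simp [orbitAngle_apply]

/-- The volume density of orbit coordinates. -/
lemma IsOrbitSection.sqrt_det_comp (hc : IsOrbitSection x c J) (h : IsBiaxial γ C x)
    {y : Fin 3 → ℝ} (hy : y 0 ∈ J) :
    sqrt (comp γ (orbitCoord 1 c) y).det = 1 / C := by
  have hC := h.orbit.pos
  have ht := hc.isTransversal h
  have h1 := h.modelDiff_sq (c (y 0)) (velocity c (y 0))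
  rw [hc.modelDiff_velocity h hy] at h1
  have e00 := comp_orbitCoord_zero_zero (P := 1) h ht hy
  have e0 := comp_orbitCoord_zero_succ (P := 1) h ht hy
  have e := comp_orbitCoord_succ_succ (P := 1) h ht hy
  simp only [sum_univ_two, Matrix.one_apply] at e0 e
  have a01 := e0 0; have a02 := e0 1
  have a11 := e 0 0; have a12 := e 0 1; have a21 := e 1 0; have a22 := e 1 1
  simp at a01 a02 a11 a12 a21 a22
  have hs : ∀ a b, comp γ (orbitCoord 1 c) y a b = comp γ (orbitCoord 1 c) y b a := fun a b =>
    h.form_symm _ _ _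
  have hdet : (comp γ (orbitCoord 1 c) y).det = gramDet γ (c (y 0)) *
      modelForm γ (c (y 0)) (velocity c (y 0)) (velocity c (y 0)) -
      (gram γ (c (y 0)) 1 1 * modelForm γ (c (y 0)) (velocity c (y 0)) (modelGen 0 (c (y 0))) ^ 2 -
        2 * gram γ (c (y 0)) 0 1 * modelForm γ (c (y 0)) (velocity c (y 0)) (modelGen 0 (c (y 0))) *
          modelForm γ (c (y 0)) (velocity c (y 0)) (modelGen 1 (c (y 0))) +
        gram γ (c (y 0)) 0 0 *
          modelForm γ (c (y 0)) (velocity c (y 0)) (modelGen 1 (c (y 0))) ^ 2) := by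
    rw [Matrix.det_fin_three, hs 1 0, hs 2 0, e00, a01, a02, a11, a12, a21, a22,
      h.gram_symm _ 1 0, gramDet]
    ring
  rw [← hdet] at h1
  have hpos : 0 ≤ (comp γ (orbitCoord 1 c) y).det := by
    obtain ⟨b1, b2⟩ := ht.interior _ hy
    have hloc := isLocalCoord_orbitCoord h ht (P := 1) (by simp)
    rw [comp_eq_toMatrix]
    have hpd : (LinearMap.BilinForm.toMatrix' (coordForm γ (orbitCoord 1 c) y)).PosSemidef := by
      refine Matrix.PosSemidef.of_dotProduct_mulVec_nonneg ?_ fun v => ?_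
      · ext a b
        simp only [Matrix.conjTranspose_apply, star_trivial, LinearMap.BilinForm.toMatrix'_apply]
        exact h.form_symm _ _ _
      · have h2 : coordForm γ (orbitCoord 1 c) y v v =
            v ⬝ᵥ (LinearMap.BilinForm.toMatrix' (coordForm γ (orbitCoord 1 c) y)).mulVec v := by
          rw [← Matrix.toBilin'_apply', Matrix.toBilin'_toMatrix']
        rw [star_trivial, ← h2]
        rcases eq_or_ne v 0 with rfl | hv
        · simp
        · exact (h.coordForm_pos hloc hy v hv).le
    exact hpd.det_nonneg
  rw [abs_of_nonneg hpos] at h1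
  have h3 : (comp γ (orbitCoord 1 c) y).det = (1 / C) ^ 2 := by
    field_simp
    linarith
  rw [h3, Real.sqrt_sq (by positivity)]

lemma IsBiaxial.eq_of_orbitCoord_eq [T2Space B] (h : IsBiaxial γ C x)
    (hc : IsOrbitSection x c J) {y z : Fin 3 → ℝ}
    (hy : y ∈ angleBox J (Ico 0 (2 * π))) (hz : z ∈ angleBox J (Ico 0 (2 * π)))
    (hyz : orbitCoord 1 c y = orbitCoord 1 c z) : y = z := by
  rw [mem_angleBox] at hy hz
  have hx := congrArg x hyz
  rw [x_orbitCoord h, x_orbitCoord h, hc.x_eq _ hy.1, hc.x_eq _ hz.1] at hx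
  have hint := (hc.isTransversal h).interior _ hz.1
  rw [orbitCoord, orbitCoord, hx] at hyz
  have h1 : (torusExp (orbitAngle 1 z))⁻¹ * torusExp (orbitAngle 1 y) = 1 := by
    refine h.eq_one_of_smul_eq hint.1 hint.2 ?_
    rw [mul_smul, hyz, inv_smul_smul]
  have h2 : torusExp (orbitAngle 1 y) = torusExp (orbitAngle 1 z) := (inv_mul_eq_one.1 h1).symm
  rw [orbitAngle_one, orbitAngle_one] at h2
  have h3 : Circle.exp (y 1) = Circle.exp (z 1) := congrArg Prod.fst h2
  have h4 : Circle.exp (y 2) = Circle.exp (z 2) := congrArg Prod.snd h2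
  ext i; fin_cases i
  exacts [hx, circleExp_inj_of_mem_Ico hy.2.1 hz.2.1 h3, circleExp_inj_of_mem_Ico hy.2.2 hz.2.2 h4]

lemma exists_torusExp_Ico (t : Torus) :
    ∃ s r : ℝ, s ∈ Ico 0 (2 * π) ∧ r ∈ Ico 0 (2 * π) ∧ t = torusExp ![s, r] := by
  have key : ∀ z : Circle, ∃ s ∈ Ico 0 (2 * π), Circle.exp s = z := by
    intro z
    have hp := Real.two_pi_pos
    refine ⟨toIcoMod hp 0 (Complex.arg z), by simpa using toIcoMod_mem_Ico hp 0 (Complex.arg z), ?_⟩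
    rw [toIcoMod, Circle.exp_sub]
    have : Circle.exp (toIcoDiv hp 0 (Complex.arg z) • (2 * π)) = 1 :=
      Circle.exp_eq_one.2 ⟨_, by rw [zsmul_eq_mul]⟩
    rw [this, div_one, Circle.exp_arg]
  obtain ⟨s, hs, hs'⟩ := key t.1
  obtain ⟨r, hr, hr'⟩ := key t.2
  exact ⟨s, r, hs, hr, Prod.ext hs'.symm hr'.symm⟩

lemma IsBiaxial.measurableSet_patch (h : IsBiaxial γ C x)
    (hσ : IsLocalCoord σ V) (hc : IsOrbitSection x c J) :
    MeasurableSet (angleBox J (Ico 0 (2 * π)) ∩ orbitCoord 1 c ⁻¹' (σ '' V)) := by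
  have hloc := isLocalCoord_orbitCoord h (hc.isTransversal h) (P := 1) (by simp)
  have h1 : IsOpen ({y : Fin 3 → ℝ | y 0 ∈ J} ∩ orbitCoord 1 c ⁻¹' (σ '' V)) :=
    hloc.smooth.continuousOn.isOpen_inter_preimage hloc.isOpen
      (hσ.isOpen_image hσ.isOpen subset_rfl)
  have h2 : MeasurableSet (angleBox J (Ico 0 (2 * π))) := by
    refine MeasurableSet.univ_pi fun i => ?_
    fin_cases i
    exacts [hc.isOpen.measurableSet, measurableSet_Ico, measurableSet_Ico]
  have h3 : (angleBox J (Ico 0 (2 * π)) ∩ orbitCoord 1 c ⁻¹' (σ '' V)) = angleBox J (Ico 0 (2 * π)) ∩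
      ({y : Fin 3 → ℝ | y 0 ∈ J} ∩ orbitCoord 1 c ⁻¹' (σ '' V)) := by
    ext w
    constructor
    · rintro ⟨h4, h5⟩
      exact ⟨h4, (mem_angleBox.1 h4).1, h5⟩
    · rintro ⟨h4, -, h5⟩
      exact ⟨h4, h5⟩
  rw [h3]
  exact h2.inter h1.measurableSet

/-- The part of a coordinate patch over which there is a section has the volume of the
corresponding set of orbit coordinates. -/
lemma IsBiaxial.lintegral_patch [T2Space B] (h : IsBiaxial γ C x)
    (hσ : IsLocalCoord σ V) (hinj : InjOn σ V) (hc : IsOrbitSection x c J) :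
    ∫⁻ y in {y | y ∈ V ∧ x (σ y) ∈ J}, ENNReal.ofReal (sqrt (comp γ σ y).det) =
      ENNReal.ofReal (1 / C) *
        volume (angleBox J (Ico 0 (2 * π)) ∩ orbitCoord 1 c ⁻¹' (σ '' V)) := by
  have ht := hc.isTransversal h
  have hloc := isLocalCoord_orbitCoord h ht (P := 1) (by simp)
  set W := angleBox J (Ico 0 (2 * π)) ∩ orbitCoord 1 c ⁻¹' (σ '' V) with hW
  let f : (Fin 3 → ℝ) → Fin 3 → ℝ := fun w => invFunOn σ V (orbitCoord 1 c w)
  have hWJ : ∀ w ∈ W, w 0 ∈ J := fun w hw => (mem_angleBox.1 hw.1).1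
  have hsm : ∀ w ∈ W, ContDiffAt ℝ ∞ f w ∧ ∀ᶠ z in 𝓝 w, orbitCoord 1 c z ∈ σ '' V :=
    fun w hw => hσ.contDiffAt_invFunOn hinj (hloc.contMDiffAt (hWJ w hw)) hw.2
  have hfd : ∀ w ∈ W, DifferentiableAt ℝ f w := fun w hw => (hsm w hw).1.differentiableAt (by simp)
  have hσf : ∀ w ∈ W, σ (f w) = orbitCoord 1 c w := fun w hw => invFunOn_eq hw.2
  have hfV : ∀ w ∈ W, f w ∈ V := fun w hw => invFunOn_mem hw.2
  have himage : {y | y ∈ V ∧ x (σ y) ∈ J} = f '' W := by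
    ext y
    constructor
    · rintro ⟨hy, hyJ⟩
      have hxc : x (c (x (σ y))) = x (σ y) := hc.x_eq _ hyJ
      obtain ⟨t, ht⟩ := (h.orbit.eq_iff _ _).1 hxc
      obtain ⟨s, r, hs, hr, rfl⟩ := exists_torusExp_Ico t
      have ho : orbitCoord 1 c ![x (σ y), s, r] = σ y := by
        rw [orbitCoord, orbitAngle_one]; exact ht.symm
      refine ⟨![x (σ y), s, r], ⟨mem_angleBox.2 ⟨hyJ, hs, hr⟩, ⟨y, hy, ho.symm⟩⟩, ?_⟩
      change invFunOn σ V (orbitCoord 1 c ![x (σ y), s, r]) = y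
      rw [ho]
      exact hinj.leftInvOn_invFunOn hy
    · rintro ⟨w, hw, rfl⟩
      refine ⟨hfV w hw, ?_⟩
      rw [hσf w hw, x_orbitCoord h, hc.x_eq _ (hWJ w hw)]
      exact hWJ w hw
  have hfinj : InjOn f W := by
    intro w hw z hz hwz
    refine h.eq_of_orbitCoord_eq hc hw.1 hz.1 ?_
    rw [← hσf w hw, ← hσf z hz, hwz]
  have hmeas : MeasurableSet W := h.measurableSet_patch hσ hc
  rw [himage, lintegral_image_eq_lintegral_abs_det_fderiv_mul volume hmeas
    (fun w hw => (hfd w hw).hasFDerivAt.hasFDerivWithinAt) hfinj]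
  have hcongr : ∀ w ∈ W, ENNReal.ofReal |(fderiv ℝ f w).det| *
      ENNReal.ofReal (sqrt (comp γ σ (f w)).det) = ENNReal.ofReal (1 / C) := by
    intro w hw
    rw [← ENNReal.ofReal_mul (abs_nonneg _), ← hc.sqrt_det_comp h (hWJ w hw),
      det_comp_lift γ hσ (hfd w hw) (hfV w hw) ((hsm w hw).2.mono fun z hz => invFunOn_eq hz),
      Real.sqrt_mul (sq_nonneg _), Real.sqrt_sq_eq_abs]
  rw [setLIntegral_congr_fun hmeas hcongr, setLIntegral_const]

lemma IsLocalCoord.mono {n : ℕ} {N : Type*} [TopologicalSpace N]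
    [ChartedSpace (𝔼 n) N] {σ : (Fin n → ℝ) → N} {V V' : Set (Fin n → ℝ)}
    (hσ : IsLocalCoord σ V) (hV' : IsOpen V') (h : V' ⊆ V) : IsLocalCoord σ V' :=
  ⟨hV', hσ.smooth.mono h, fun y hy => hσ.bijective y (h hy)⟩

/-- The volume of a bi-axisymmetric three-manifold in terms of the normalization of its orbit
coordinate. -/
lemma IsBiaxial.riemannianVolume_eq [T2Space B] (h : IsBiaxial γ C x) :
    riemannianVolume γ = ENNReal.ofReal (8 * π ^ 2 / C) := by
  have hC := h.orbit.pos
  have hpi := Real.pi_pos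
  obtain ⟨J, c, hc, hdisj, hcount⟩ := h.exists_partition
  have hvolJ : ∑' n, volume (J n) = 2 := by
    rw [← measure_iUnion hdisj fun n => (hc n).isOpen.measurableSet]
    have h1 : volume (Icc (-1 : ℝ) 1) = 2 := by
      rw [Real.volume_Icc]; norm_num
    rw [← h1]
    refine le_antisymm (measure_mono (Set.iUnion_subset fun n =>
      (hc n).subset.trans Ioo_subset_Icc_self)) ?_
    calc volume (Icc (-1 : ℝ) 1) ≤ volume ((Icc (-1) 1 \ ⋃ n, J n) ∪ ⋃ n, J n) :=
          measure_mono fun t ht => by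
            by_cases htJ : t ∈ ⋃ n, J n
            · exact Or.inr htJ
            · exact Or.inl ⟨ht, htJ⟩
      _ ≤ volume (Icc (-1) 1 \ ⋃ n, J n) + volume (⋃ n, J n) := measure_union_le _ _
      _ = volume (⋃ n, J n) := by rw [hcount.measure_zero, zero_add]
  have htotal : ∑' n, ENNReal.ofReal (1 / C) * (volume (J n) * ENNReal.ofReal (2 * π) ^ 2) =
      ENNReal.ofReal (8 * π ^ 2 / C) := by
    rw [ENNReal.tsum_mul_left, ENNReal.tsum_mul_right, hvolJ, ← ENNReal.ofReal_pow (by positivity),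
      ← ENNReal.ofReal_ofNat 2, ← ENNReal.ofReal_mul (by norm_num),
      ← ENNReal.ofReal_mul (by positivity)]
    congr 1
    ring
  apply le_antisymm
  · rw [riemannianVolume]
    refine iSup_le fun k => iSup_le fun σ => iSup_le fun V => iSup_le fun hσV => ?_
    obtain ⟨hσ, hpair⟩ := hσV
    have hW : ∀ j, ∫⁻ y in V j, ENNReal.ofReal (sqrt (comp γ (σ j) y).det) ≤
        ∑' n, ENNReal.ofReal (1 / C) * volume (angleBox (J n) (Ico 0 (2 * π)) ∩
          orbitCoord 1 (c n) ⁻¹' (σ j '' V j)) := by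
      intro j
      have hsub : V j ⊆ {y | y ∈ V j ∧ x (σ j y) ∈ Icc (-1) 1 \ ⋃ n, J n} ∪
          ⋃ n, {y | y ∈ V j ∧ x (σ j y) ∈ J n} := by
        intro y hy
        by_cases hyJ : x (σ j y) ∈ ⋃ n, J n
        · obtain ⟨n, hn⟩ := Set.mem_iUnion.1 hyJ
          exact Or.inr (Set.mem_iUnion.2 ⟨n, hy, hn⟩)
        · exact Or.inl ⟨hy, h.x_mem _, hyJ⟩
      refine (lintegral_mono_set hsub).trans ((lintegral_union_le _ _ _).trans ?_)
      rw [setLIntegral_measure_zero _ _ (h.volume_preimage_orbits (hσ j).1 (hσ j).2 hcount), zero_add]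
      refine (lintegral_iUnion_le _ _).trans (ENNReal.tsum_le_tsum fun n => ?_)
      rw [h.lintegral_patch (hσ j).1 (hσ j).2 (hc n)]
    refine (Finset.sum_le_sum fun j _ => hW j).trans ?_
    rw [← htotal, ← Summable.tsum_finsetSum fun j _ => ENNReal.summable]
    refine ENNReal.tsum_le_tsum fun n => ?_
    rw [← mul_sum]
    gcongr
    rw [← measure_biUnion_finset]
    · refine (measure_mono (t := angleBox (J n) (Ico 0 (2 * π))) ?_).trans ?_
      · exact Set.iUnion₂_subset fun j _ => Set.inter_subset_left
      · rw [volume_angleBox, Real.volume_Ico, sub_zero]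
    · intro i _ j _ hij
      refine (Set.disjoint_left.2 ?_)
      rintro w ⟨-, h1⟩ ⟨-, h2⟩
      exact Set.disjoint_left.1 (hpair hij) h1 h2
    · exact fun j _ => h.measurableSet_patch (hσ j).1 (hc n)
  · rw [← htotal, ENNReal.tsum_eq_iSup_nat]
    refine iSup_le fun k => ?_
    rw [Finset.sum_range]
    have hopen : ∀ n, IsOpen (angleBox (J n) (Ioo 0 (2 * π))) := fun n => by
      refine isOpen_set_pi Set.finite_univ fun i _ => ?_
      fin_cases i
      exacts [(hc n).isOpen, isOpen_Ioo, isOpen_Ioo]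
    have hfam : (∀ j : Fin k, IsLocalCoord (orbitCoord 1 (c j)) (angleBox (J j)
          (Ioo 0 (2 * π))) ∧
          InjOn (orbitCoord 1 (c j)) (angleBox (J j) (Ioo 0 (2 * π)))) ∧
        Pairwise fun i j : Fin k => Disjoint
          (orbitCoord 1 (c i) '' angleBox (J i) (Ioo 0 (2 * π)))
          (orbitCoord 1 (c j) '' angleBox (J j) (Ioo 0 (2 * π))) := by
      refine ⟨fun j => ⟨?_, ?_⟩, ?_⟩
      · exact (isLocalCoord_orbitCoord h ((hc j).isTransversal h) (P := 1) (by simp)).mono (hopen j)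
          fun y hy => (mem_angleBox.1 hy).1
      · intro y hy z hz hyz
        have hsub : angleBox (J j) (Ioo 0 (2 * π)) ⊆
            angleBox (J j) (Ico 0 (2 * π)) := fun y hy => by
          rw [mem_angleBox] at hy ⊢
          exact ⟨hy.1, Set.Ioo_subset_Ico_self hy.2.1, Set.Ioo_subset_Ico_self hy.2.2⟩
        exact h.eq_of_orbitCoord_eq (hc j) (hsub hy) (hsub hz) hyz
      · intro i j hij
        rw [Set.disjoint_left]
        rintro _ ⟨y, hy, rfl⟩ ⟨z, hz, hyz⟩
        have hx := congrArg x hyz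
        have hy' := (mem_angleBox.1 hy).1
        have hz' := (mem_angleBox.1 hz).1
        rw [x_orbitCoord h, x_orbitCoord h, (hc i).x_eq _ hy', (hc j).x_eq _ hz'] at hx
        rw [hx] at hz'
        exact Set.disjoint_left.1 (hdisj (fun hh => hij (Fin.ext hh))) hy' hz'
    rw [riemannianVolume]
    refine le_iSup_of_le k (le_iSup_of_le (fun j => orbitCoord 1 (c j)) (le_iSup_of_le
      (fun j => angleBox (J j) (Ioo 0 (2 * π))) (le_iSup_of_le hfam
        (Finset.sum_le_sum fun j _ => ?_))))
    rw [setLIntegral_congr_fun (g := fun _ => ENNReal.ofReal (1 / C)) (hopen j).measurableSet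
      fun y hy => by simp only [(hc j).sqrt_det_comp h (mem_angleBox.1 hy).1], setLIntegral_const, volume_angleBox,
      Real.volume_Ioo, sub_zero]

end Area

section InducedGeometry

variable {τ : (Fin 3 → ℝ) → B} {V : Set (Fin 3 → ℝ)}

lemma IsLorentzianMetric.form_symm (hg : IsLorentzianMetric g) (m : M)
    (v w : 𝔼 5) : modelForm g m v w = modelForm g m w v := by
  obtain ⟨e, he⟩ := hg.signature m
  have h1 : g m = (g m).flip := by
    refine e.ext fun i => e.ext fun j => ?_
    change g m (e i) (e j) = g m (e j) (e i)
    rw [he, he]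
    by_cases hij : i = j
    · subst hij; rfl
    · rw [if_neg hij, if_neg (Ne.symm hij)]
  exact congrArg (fun L : LinearMap.BilinForm ℝ (𝔼 5) => L v w) h1

/-- The pullback of a bilinear form field on `M` under a parametrization by `ℝ × ℝ × B`. -/
def pullForm (h : TwoTensor 5 M) (Φ : ℝ × ℝ × B → M) (z : ℝ × ℝ × B) (v w : ℝ × ℝ × 𝔼 3) : ℝ :=
  modelForm h (Φ z) (gaussDeriv Φ z v) (gaussDeriv Φ z w)

/-- The `a`-th coordinate direction of `gaussLift Φ τ`, in the parameter space `ℝ × ℝ × B`. -/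
def liftVec (τ : (Fin 3 → ℝ) → B) (y : Fin 3 → ℝ) :
    Fin 5 → ℝ × ℝ × 𝔼 3 :=
  ![(1, 0, 0), (0, 1, 0), (0, 0, modelCoord τ y 0), (0, 0, modelCoord τ y 1),
    (0, 0, modelCoord τ y 2)]

lemma liftVec_tailIdx (τ : (Fin 3 → ℝ) → B) (y : Fin 3 → ℝ) (i : Fin 3) :
    liftVec τ y (tailIdx i) = (0, 0, modelCoord τ y i) := by
  fin_cases i <;> rfl

lemma modelCoord_gaussLift (hΦ : IsGaussianNull g ι ε Φ) (hτ : IsLocalCoord τ V)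
    {y : Fin 5 → ℝ} (hy : y ∈ gaussDomain ε V) (a : Fin 5) :
    modelCoord (gaussLift Φ τ) y a =
      gaussDeriv Φ (y 0, y 1, τ (tail3 y)) (liftVec τ (tail3 y) a) := by
  have h3 (i : Fin 3) : modelCoord (gaussLift Φ τ) y (tailIdx i) =
      gaussDeriv Φ (y 0, y 1, τ (tail3 y)) (0, 0, modelCoord τ (tail3 y) i) :=
    (coordVec_gaussLift_tail hΦ hτ hy i).trans
      (vecB_eq hΦ (mem_nullDomain_of_mem_gaussDomain hy) (modelCoord τ (tail3 y) i))
  fin_cases a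
  · exact (coordVec_gaussLift_zero hΦ hτ hy).trans
      (vecU_eq hΦ (mem_nullDomain_of_mem_gaussDomain hy))
  · exact (coordVec_gaussLift_one hΦ hτ hy).trans
      (vecR_eq hΦ (mem_nullDomain_of_mem_gaussDomain hy))
  · exact h3 0
  · exact h3 1
  · exact h3 2

lemma comp_gaussLift (h : TwoTensor 5 M) (hΦ : IsGaussianNull g ι ε Φ) (hτ : IsLocalCoord τ V)
    {y : Fin 5 → ℝ} (hy : y ∈ gaussDomain ε V) (a b : Fin 5) :
    comp h (gaussLift Φ τ) y a b =
      pullForm h Φ (y 0, y 1, τ (tail3 y)) (liftVec τ (tail3 y) a) (liftVec τ (tail3 y) b) := by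
  rw [comp_eq_modelForm, modelCoord_gaussLift hΦ hτ hy, modelCoord_gaussLift hΦ hτ hy]
  rfl

section Metric

variable {u r : ℝ}

lemma IsGaussianNull.pullForm_rr (hΦ : IsGaussianNull g ι ε Φ) (hu : u ∈ Ioo (-ε) ε)
    (hr : r ∈ Ioo (-ε) ε) (b : B) : pullForm g Φ (u, r, b) (0, 1, 0) (0, 1, 0) = 0 := by
  rw [pullForm, ← vecR_eq hΦ (mem_nullDomain hu hr b)]
  exact hΦ.metric_rr u hu r hr b

lemma IsGaussianNull.pullForm_ur (hΦ : IsGaussianNull g ι ε Φ) (hu : u ∈ Ioo (-ε) ε)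
    (hr : r ∈ Ioo (-ε) ε) (b : B) : pullForm g Φ (u, r, b) (1, 0, 0) (0, 1, 0) = -1 := by
  rw [pullForm, ← vecR_eq hΦ (mem_nullDomain hu hr b),
    ← vecU_eq hΦ (mem_nullDomain hu hr b)]
  exact hΦ.metric_ur u hu r hr b

lemma IsGaussianNull.pullForm_rm (hΦ : IsGaussianNull g ι ε Φ) (hu : u ∈ Ioo (-ε) ε)
    (hr : r ∈ Ioo (-ε) ε) (b : B) (v : 𝔼 3) :
    pullForm g Φ (u, r, b) (0, 1, 0) (0, 0, v) = 0 := by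
  rw [pullForm, ← vecR_eq hΦ (mem_nullDomain hu hr b),
    ← vecB_eq hΦ (mem_nullDomain hu hr b)]
  exact hΦ.metric_rm u hu r hr b v

lemma IsGaussianNull.pullForm_um (hΦ : IsGaussianNull g ι ε Φ) (hu : u ∈ Ioo (-ε) ε)
    (b : B) (v : 𝔼 3) :
    pullForm g Φ (u, 0, b) (1, 0, 0) (0, 0, v) = 0 := by
  rw [pullForm, ← vecU_eq hΦ (mem_nullDomain hu hΦ.zero_mem b),
    ← vecB_eq hΦ (mem_nullDomain hu hΦ.zero_mem b)]
  exact hΦ.metric_um u hu b v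

lemma IsGaussianNull.pullForm_uu (hΦ : IsGaussianNull g ι ε Φ) (hu : u ∈ Ioo (-ε) ε)
    (b : B) : pullForm g Φ (u, 0, b) (1, 0, 0) (1, 0, 0) = 0 := by
  rw [pullForm, ← vecU_eq hΦ (mem_nullDomain hu hΦ.zero_mem b)]
  exact hΦ.metric_uu u hu b

lemma IsGaussianNull.deriv_pullForm_uu (hΦ : IsGaussianNull g ι ε Φ) (hu : u ∈ Ioo (-ε) ε)
    (b : B) : deriv (fun r => pullForm g Φ (u, r, b) (1, 0, 0) (1, 0, 0)) 0 = 0 := by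
  refine Eq.trans (Filter.EventuallyEq.deriv_eq ?_) (hΦ.metric_uu_deriv u hu b)
  filter_upwards [isOpen_Ioo.mem_nhds hΦ.zero_mem] with r hr
  rw [pullForm, ← vecU_eq hΦ (mem_nullDomain hu hr b)]
  rfl

end Metric

lemma pullForm_symm (hg : IsLorentzianMetric g) (z : ℝ × ℝ × B)
    (v w : ℝ × ℝ × 𝔼 3) : pullForm g Φ z v w = pullForm g Φ z w v :=
  hg.form_symm _ _ _

lemma gaussDeriv_smul (hM : IsSmoothAction 5 M) (hB : IsSmoothAction 3 B)
    (hΦ : IsGaussianNull g ι ε Φ) {u r : ℝ} (hu : u ∈ Ioo (-ε) ε) (hr : r ∈ Ioo (-ε) ε)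
    (t : Torus) (b : B) (a a' : ℝ) (v : 𝔼 3) :
    gaussDeriv Φ (u, r, t • b) (a, a', actDeriv t b v) =
      actDeriv t (Φ (u, r, b)) (gaussDeriv Φ (u, r, b) (a, a', v)) := by
  have h1 : HasMFDerivAt (𝓘(ℝ, ℝ).prod (𝓘(ℝ, ℝ).prod (𝓡 3))) (𝓡 5)
      (fun z : ℝ × ℝ × B => t • Φ z) (u, r, b)
      ((actDeriv (n := 5) t (Φ (u, r, b))).comp (gaussDeriv Φ (u, r, b))) :=
    HasMFDerivAt.comp (g := fun m : M => t • m) (u, r, b)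
      ((hM.mdifferentiable_smul t) (Φ (u, r, b))).hasMFDerivAt
      (hΦ.hasMFDerivAt (mem_nullDomain hu hr b))
  have hs := hasMFDerivAt_snd (I := 𝓘(ℝ, ℝ)) (I' := 𝓘(ℝ, ℝ).prod (𝓡 3)) ((u, r, b) : ℝ × ℝ × B)
  have hr' := HasMFDerivAt.comp (g := fun z : ℝ × B => z.1) ((u, r, b) : ℝ × ℝ × B)
    (hasMFDerivAt_fst (I := 𝓘(ℝ, ℝ)) (I' := 𝓡 3) ((r, b) : ℝ × B)) hs
  have hb' := HasMFDerivAt.comp (g := fun z : ℝ × B => z.2) ((u, r, b) : ℝ × ℝ × B)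
    (hasMFDerivAt_snd (I := 𝓘(ℝ, ℝ)) (I' := 𝓡 3) ((r, b) : ℝ × B)) hs
  have htb := HasMFDerivAt.comp (g := fun b' : B => t • b') ((u, r, b) : ℝ × ℝ × B)
    ((hB.mdifferentiable_smul t) b).hasMFDerivAt hb'
  have h2 := (hasMFDerivAt_fst (I := 𝓘(ℝ, ℝ)) (I' := 𝓘(ℝ, ℝ).prod (𝓡 3))
    ((u, r, b) : ℝ × ℝ × B)).prodMk (hr'.prodMk htb)
  have h3 := HasMFDerivAt.comp (g := Φ) ((u, r, b) : ℝ × ℝ × B)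
    (hΦ.hasMFDerivAt (mem_nullDomain hu hr (t • b))) h2
  have h4 : (Φ ∘ fun z : ℝ × ℝ × B => (z.1, z.2.1, t • z.2.2)) =ᶠ[𝓝 (u, r, b)]
      fun z => t • Φ z := by
    filter_upwards [isOpen_nullDomain.mem_nhds (mem_nullDomain hu hr b)]
      with z hz
    exact hΦ.equivariant z.1 hz.1 z.2.1 hz.2.1 t z.2.2
  have h5 := hasMFDerivAt_unique (h3.congr_of_eventuallyEq h4.symm) h1
  exact congrArg (fun L : (ℝ × ℝ × 𝔼 3) →L[ℝ] 𝔼 5 => L (a, a', v)) h5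

lemma pullForm_smul {h : TwoTensor 5 M} (hh : IsInvariant h) (hM : IsSmoothAction 5 M)
    (hB : IsSmoothAction 3 B) (hΦ : IsGaussianNull g ι ε Φ) {u r : ℝ} (hu : u ∈ Ioo (-ε) ε)
    (hr : r ∈ Ioo (-ε) ε) (t : Torus) (b : B) (v w : ℝ × ℝ × 𝔼 3) :
    pullForm h Φ (u, r, t • b) (v.1, v.2.1, actDeriv t b v.2.2)
      (w.1, w.2.1, actDeriv t b w.2.2) = pullForm h Φ (u, r, b) v w := by
  rw [pullForm, gaussDeriv_smul hM hB hΦ hu hr, gaussDeriv_smul hM hB hΦ hu hr,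
    hΦ.equivariant u hu r hr, modelForm_smul hh]
  rfl

lemma gaussDeriv_modelGen (hB : IsSmoothAction 3 B)
    (hΦ : IsGaussianNull g ι ε Φ) {u r : ℝ} (hu : u ∈ Ioo (-ε) ε) (hr : r ∈ Ioo (-ε) ε)
    (i : Fin 2) (b : B) :
    gaussDeriv Φ (u, r, b) (0, 0, modelGen i b) = modelGen i (Φ (u, r, b)) := by
  have h0 : rotation i 0 • b = b := by rw [rotation_eq_torusExp, Pi.single_zero, (torusExp_eq_one_iff 0).2 fun _ => ⟨0, by simp⟩,
      one_smul]
  have hd : MDifferentiableAt 𝓘(ℝ, ℝ) (𝓡 3) (fun t : ℝ => rotation i t • b) 0 := by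
    have := (hB.mdifferentiable_orbit b (Pi.single i 0)).comp (0 : ℝ)
      (f := fun t : ℝ => (Pi.single i t : Fin 2 → ℝ))
      (DifferentiableAt.mdifferentiableAt
        ((ContinuousLinearMap.single ℝ (fun _ : Fin 2 => ℝ) i).differentiableAt))
    refine this.congr_of_eventuallyEq (Filter.Eventually.of_forall fun t => ?_)
    simp only [rotation_eq_torusExp, Function.comp_apply]
  have h1 : HasMFDerivAt 𝓘(ℝ, ℝ) (𝓘(ℝ, ℝ).prod (𝓘(ℝ, ℝ).prod (𝓡 3)))
      (fun t : ℝ => ((u, r, rotation i t • b) : ℝ × ℝ × B)) 0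
      ((0 : ℝ →L[ℝ] ℝ).prod ((0 : ℝ →L[ℝ] ℝ).prod
        (modelDeriv (n := 3) (fun t : ℝ => rotation i t • b) 0))) :=
    (hasMFDerivAt_const u (0 : ℝ)).prodMk ((hasMFDerivAt_const r (0 : ℝ)).prodMk hd.hasMFDerivAt)
  have h2 : HasMFDerivAt (𝓘(ℝ, ℝ).prod (𝓘(ℝ, ℝ).prod (𝓡 3))) (𝓡 5) Φ
      (u, r, rotation i 0 • b) (gaussDeriv Φ (u, r, rotation i 0 • b)) :=
    hΦ.hasMFDerivAt (mem_nullDomain hu hr _)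
  have h3 := HasMFDerivAt.comp (g := Φ) (0 : ℝ) h2 h1
  have h4 : (Φ ∘ fun t : ℝ => ((u, r, rotation i t • b) : ℝ × ℝ × B)) =
      fun t : ℝ => rotation i t • Φ (u, r, b) :=
    funext fun t => hΦ.equivariant u hu r hr _ b
  rw [h4] at h3
  have h5 := congrArg (fun L : ℝ →L[ℝ] 𝔼 5 => L 1) h3.mfderiv
  refine Eq.trans ?_ h5.symm
  change _ = gaussDeriv Φ (u, r, rotation i 0 • b) (0, 0, modelGen i b)
  rw [h0]

/-- The inclusion of `{u = r = 0}`. -/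
def inclusion5 (y : Fin 3 → ℝ) : Fin 5 → ℝ := ![0, 0, y 0, y 1, y 2]

lemma tail3_inclusion5 (y : Fin 3 → ℝ) : tail3 (inclusion5 y) = y := by
  rw [tail3_eq]
  funext i
  fin_cases i <;> rfl

lemma contDiff_inclusion5 : ContDiff ℝ ∞ inclusion5 := by
  rw [contDiff_pi]
  intro i
  fin_cases i
  · exact contDiff_const
  · exact contDiff_const
  · exact contDiff_apply ℝ ℝ (0 : Fin 3)
  · exact contDiff_apply ℝ ℝ (1 : Fin 3)
  · exact contDiff_apply ℝ ℝ (2 : Fin 3)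

lemma inclusion5_mem (hε : 0 < ε) {y : Fin 3 → ℝ} (hy : y ∈ V) :
    inclusion5 y ∈ gaussDomain ε V := by
  refine ⟨?_, ?_, ?_⟩
  · exact ⟨neg_lt_zero.2 hε, hε⟩
  · exact ⟨neg_lt_zero.2 hε, hε⟩
  · rw [tail3_inclusion5]; exact hy

lemma modelForm_induced (hΦ : IsGaussianNull g ι ε Φ) (b : B) (v w : 𝔼 3) :
    modelForm (induced g ι) b v w = pullForm g Φ (0, 0, b) (0, 0, v) (0, 0, w) := by
  have hι : ι = fun b => Φ (0, 0, b) := funext fun b => (hΦ.base b).symm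
  have hz := mem_nullDomain hΦ.zero_mem hΦ.zero_mem b
  rw [pullForm, ← vecB_eq hΦ hz, ← vecB_eq hΦ hz]
  subst hι
  rfl

lemma comp_induced (hΦ : IsGaussianNull g ι ε Φ) (hτ : IsLocalCoord τ V)
    {y : Fin 3 → ℝ} (hy : y ∈ V) (i j : Fin 3) :
    comp (induced g ι) τ y i j =
      comp g (gaussLift Φ τ) (inclusion5 y) (tailIdx i) (tailIdx j) := by
  rw [comp_gaussLift g hΦ hτ (inclusion5_mem hΦ.pos hy), liftVec_tailIdx, liftVec_tailIdx,
    tail3_inclusion5, comp_eq_modelForm, modelForm_induced hΦ]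
  rfl

lemma isBiaxialGeometry_induced (hg : IsLorentzianMetric g) (hgi : IsInvariant g)
    (hM : IsSmoothAction 5 M) (hS : IsBiaxisymmetricSurface g ι) (hΦ : IsGaussianNull g ι ε Φ)
    {C : ℝ} {x : B → ℝ} (hx : IsOrbitCoordinate (induced g ι) C x) :
    IsBiaxial (induced g ι) C x where
  smooth := by
    intro τ V hτ i j
    have h1 := (hg.smooth _ _ (hΦ.isLocalCoord hτ) (tailIdx i) (tailIdx j)).comp
      contDiff_inclusion5.contDiffOn (s := V) fun y hy => inclusion5_mem hΦ.pos hy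
    exact h1.congr fun y hy => comp_induced hΦ hτ hy i j
  symm := by
    intro b v w
    exact (modelForm_induced hΦ b v w).trans
      ((pullForm_symm hg _ _ _).trans (modelForm_induced hΦ b w v).symm)
  pos := hS.spacelike
  invariant := by
    intro t b v w
    have h1 := modelForm_induced hΦ (t • b) (actDeriv t b v) (actDeriv t b w)
    have h2 := pullForm_smul hgi hM hS.action hΦ hΦ.zero_mem hΦ.zero_mem t b (0, 0, v) (0, 0, w)
    exact h1.trans (h2.trans (modelForm_induced hΦ b v w).symm)
  action := hS.action
  faithful := hS.faithful
  orbit := hx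

end InducedGeometry

lemma hasDerivAt_comp_line {n : ℕ} {f : (Fin n → ℝ) → ℝ} {ℓ : ℝ → Fin n → ℝ} {s : ℝ} {a : Fin n}
    (hf : DifferentiableAt ℝ f (ℓ s)) (hℓ : HasDerivAt ℓ (Pi.single a 1) s) :
    HasDerivAt (fun s => f (ℓ s)) (pd a f (ℓ s)) s :=
  HasFDerivAt.comp_hasDerivAt (f := ℓ) s hf.hasFDerivAt hℓ

lemma pd_eq_zero_of_eventually_const {n : ℕ} {f : (Fin n → ℝ) → ℝ} {y : Fin n → ℝ} {a : Fin n}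
    (h : ∀ᶠ s in 𝓝 (0 : ℝ), f (y + s • Pi.single a 1) = f y) : pd a f y = 0 := by
  by_cases hf : DifferentiableAt ℝ f y
  · have h1 : HasLineDerivAt ℝ f (pd a f y) y (Pi.single a 1) :=
      hf.hasFDerivAt.hasLineDerivAt (Pi.single a 1)
    have h2 : HasDerivAt (fun s : ℝ => f (y + s • Pi.single a 1)) 0 0 :=
      (hasDerivAt_const (0 : ℝ) (f y)).congr_of_eventuallyEq h
    exact HasDerivAt.unique h1 h2
  · rw [pd, fderiv_zero_of_not_differentiableAt hf]; rfl

lemma pd_eq_zero_of_eventuallyEq_const {n : ℕ} {f : (Fin n → ℝ) → ℝ} {y : Fin n → ℝ} {k : ℝ}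
    (h : ∀ᶠ z in 𝓝 y, f z = k) (a : Fin n) : pd a f y = 0 := by
  have h1 : f =ᶠ[𝓝 y] fun _ => k := h
  rw [pd, h1.fderiv_eq]
  simp

lemma contDiffOn_pd {n : ℕ} {f : (Fin n → ℝ) → ℝ} {Ω : Set (Fin n → ℝ)} (hΩ : IsOpen Ω)
    (hf : ContDiffOn ℝ ∞ f Ω) (a : Fin n) : ContDiffOn ℝ ∞ (pd a f) Ω :=
  (hf.fderiv_of_isOpen hΩ (m := ∞) (by simp)).clm_apply contDiffOn_const

/-- The point with coordinates `(u, r, t, 0, 0)`. -/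
def linePoint (u r t : ℝ) : Fin 5 → ℝ := ![u, r, t, 0, 0]

lemma linePoint_zero : linePoint 0 0 0 = 0 := by
  funext i; fin_cases i <;> rfl

lemma hasDerivAt_linePoint_zero (u r t : ℝ) :
    HasDerivAt (fun s => linePoint s r t) (Pi.single 0 1) u := by
  rw [hasDerivAt_pi]
  intro i
  fin_cases i
  · exact hasDerivAt_id u
  all_goals exact hasDerivAt_const u _

lemma hasDerivAt_linePoint_one (u r t : ℝ) :
    HasDerivAt (fun s => linePoint u s t) (Pi.single 1 1) r := by
  rw [hasDerivAt_pi]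
  intro i
  fin_cases i
  · exact hasDerivAt_const r _
  · exact hasDerivAt_id r
  all_goals exact hasDerivAt_const r _

lemma hasDerivAt_linePoint_two (u r t : ℝ) :
    HasDerivAt (fun s => linePoint u r s) (Pi.single 2 1) t := by
  rw [hasDerivAt_pi]
  intro i
  fin_cases i
  · exact hasDerivAt_const t _
  · exact hasDerivAt_const t _
  · exact hasDerivAt_id t
  all_goals exact hasDerivAt_const t _

lemma hasDerivAt_line_zero {f : (Fin 5 → ℝ) → ℝ} {u r t : ℝ}
    (hf : DifferentiableAt ℝ f (linePoint u r t)) :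
    HasDerivAt (fun s => f (linePoint s r t)) (pd 0 f (linePoint u r t)) u :=
  hasDerivAt_comp_line (ℓ := fun s => linePoint s r t) hf (hasDerivAt_linePoint_zero u r t)

lemma hasDerivAt_line_one {f : (Fin 5 → ℝ) → ℝ} {u r t : ℝ}
    (hf : DifferentiableAt ℝ f (linePoint u r t)) :
    HasDerivAt (fun s => f (linePoint u s t)) (pd 1 f (linePoint u r t)) r :=
  hasDerivAt_comp_line (ℓ := fun s => linePoint u s t) hf (hasDerivAt_linePoint_one u r t)

lemma hasDerivAt_line_two {f : (Fin 5 → ℝ) → ℝ} {u r t : ℝ}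
    (hf : DifferentiableAt ℝ f (linePoint u r t)) :
    HasDerivAt (fun s => f (linePoint u r s)) (pd 2 f (linePoint u r t)) t :=
  hasDerivAt_comp_line (ℓ := fun s => linePoint u r s) hf (hasDerivAt_linePoint_two u r t)

section Patch

variable {h : TwoTensor 5 M}

/-- The local parametrization of `M` by `u`, `r`, a transversal curve and the two angles. -/
abbrev patch (Φ : ℝ × ℝ × B → M) (P : Matrix (Fin 2) (Fin 2) ℝ) (c : ℝ → B) :
    (Fin 5 → ℝ) → M := gaussLift Φ (orbitCoord P c)

/-- The domain of `patch`. -/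
abbrev patchDomain (ε : ℝ) (J : Set ℝ) : Set (Fin 5 → ℝ) := gaussDomain ε {y | y 0 ∈ J}

lemma mem_patchDomain {y : Fin 5 → ℝ} : y ∈ patchDomain ε J ↔
    y 0 ∈ Ioo (-ε) ε ∧ y 1 ∈ Ioo (-ε) ε ∧ y 2 ∈ J := Iff.rfl

/-- The coordinate directions of `patch` along the transversal curve. -/
def patchVec (P : Matrix (Fin 2) (Fin 2) ℝ) (c : ℝ → B) (t : ℝ) :
    Fin 5 → ℝ × ℝ × 𝔼 3 :=
  ![(1, 0, 0), (0, 1, 0), (0, 0, velocity c t), (0, 0, ∑ i, P i 0 • modelGen i (c t)),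
    (0, 0, ∑ i, P i 1 • modelGen i (c t))]

lemma patch_linePoint (u r t : ℝ) : patch Φ P c (linePoint u r t) = Φ (u, r, c t) := by
  have h1 : orbitAngle P ![t, 0, 0] = 0 := by
    funext i; rw [orbitAngle_apply]; simp
  have h2 : torusExp 0 = 1 := (torusExp_eq_one_iff 0).2 fun _ => ⟨0, by simp⟩
  change Φ (u, r, torusExp (orbitAngle P (tail3 (linePoint u r t))) • c t) = _
  rw [tail3_eq]
  change Φ (u, r, torusExp (orbitAngle P ![t, 0, 0]) • c t) = _
  rw [h1, h2, one_smul]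

lemma liftVec_orbitCoord (hB : IsBiaxial γ C x) (hc : IsTransversal x c J)
    {y : Fin 3 → ℝ} (hy : y 0 ∈ J) (a : Fin 5) :
    liftVec (orbitCoord P c) y a = ((patchVec P c (y 0) a).1, (patchVec P c (y 0) a).2.1,
      actDeriv (torusExp (orbitAngle P y)) (c (y 0)) (patchVec P c (y 0) a).2.2) := by
  have h0 := modelCoord_orbitCoord_zero (P := P) hB hc hy
  have hs (j : Fin 2) : modelCoord (orbitCoord P c) y j.succ =
      actDeriv (torusExp (orbitAngle P y)) (c (y 0)) (∑ i, P i j • modelGen i (c (y 0))) := by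
    rw [modelCoord_orbitCoord_succ hB hc hy, map_sum]
    refine sum_congr rfl fun i _ => ?_
    rw [map_smul, actDeriv_modelGen hB.action]
    rfl
  fin_cases a
  · simp [liftVec, patchVec]
  · simp [liftVec, patchVec]
  · simpa [liftVec, patchVec] using h0
  · simpa [liftVec, patchVec] using hs 0
  · simpa [liftVec, patchVec] using hs 1

lemma comp_patch (hh : IsInvariant h) (hM : IsSmoothAction 5 M) (hΦ : IsGaussianNull g ι ε Φ)
    (hB : IsBiaxial γ C x) (hc : IsTransversal x c J) (hP : P.det ≠ 0) {y : Fin 5 → ℝ}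
    (hy : y ∈ patchDomain ε J) (a b : Fin 5) :
    comp h (patch Φ P c) y a b =
      pullForm h Φ (y 0, y 1, c (y 2)) (patchVec P c (y 2) a) (patchVec P c (y 2) b) := by
  have hy2 : tail3 y 0 = y 2 := rfl
  have h2 : tail3 y 0 ∈ J := hy.2.2
  rw [comp_gaussLift h hΦ (isLocalCoord_orbitCoord hB hc hP) hy,
    liftVec_orbitCoord hB hc h2, liftVec_orbitCoord hB hc h2, hy2]
  exact pullForm_smul hh hM hB.action hΦ hy.1 hy.2.1 _ _ _ _

end Patch

section PatchMetric

lemma hasDerivAt_trace_inv_mul {n : ℕ} {K N : ℝ → Matrix (Fin n) (Fin n) ℝ}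
    {K' N' : Matrix (Fin n) (Fin n) ℝ} (hK0 : K 0 = 1)
    (hK : ∀ i j, HasDerivAt (fun r => K r i j) (K' i j) 0)
    (hN : ∀ i j, HasDerivAt (fun r => N r i j) (N' i j) 0) :
    HasDerivAt (fun r => ((K r)⁻¹ * N r).trace) (N'.trace - (K' * N 0).trace) 0 := by
  have hdet : (K 0).det ≠ 0 := by rw [hK0, Matrix.det_one]; exact one_ne_zero
  have hinv (i j : Fin n) : HasDerivAt (fun r => (K r)⁻¹ i j) (-K' i j) 0 := by
    obtain ⟨h1, h2⟩ := hasFDerivAt_matrix_inv (fun a b => (hK a b).differentiableAt) hdet i j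
    have h3 := h1.hasDerivAt
    have h4 : deriv (fun r => (K r)⁻¹ i j) 0 = -K' i j := by
      rw [← fderiv_apply_one_eq_deriv, h2 1, hK0, inv_one]
      congr 1
      have h5 (d e : Fin n) : fderiv ℝ (fun z => K z d e) 0 1 = K' d e := by
        rw [fderiv_apply_one_eq_deriv]; exact (hK d e).deriv
      simp only [h5, Matrix.one_apply, ite_mul, one_mul, zero_mul, mul_ite, mul_one, mul_zero,
        Finset.sum_ite_eq, Finset.sum_ite_eq', Finset.mem_univ, if_true]
    rwa [h4] at h3
  have h1 : HasDerivAt (fun r => ∑ i, ∑ j, (K r)⁻¹ i j * N r j i)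
      (∑ i, ∑ j, (-K' i j * N 0 j i + (K 0)⁻¹ i j * N' j i)) 0 :=
    HasDerivAt.fun_sum fun i _ => HasDerivAt.fun_sum fun j _ => (hinv i j).mul (hN j i)
  convert h1 using 1
  · funext r
    simp only [Matrix.trace, Matrix.diag, Matrix.mul_apply]
  rw [hK0, inv_one]
  simp only [Finset.sum_add_distrib, Matrix.one_apply, ite_mul, one_mul, zero_mul,
    Finset.sum_ite_eq, Finset.mem_univ, if_true, Matrix.trace, Matrix.diag, Matrix.mul_apply,
    neg_mul, Finset.sum_neg_distrib]
  ring

variable {h : TwoTensor 5 M}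

lemma linePoint_mem {u r t : ℝ} (hu : u ∈ Ioo (-ε) ε) (hr : r ∈ Ioo (-ε) ε)
    (ht : t ∈ J) : linePoint u r t ∈ patchDomain ε J := ⟨hu, hr, ht⟩

lemma isLocalCoord_patch (hΦ : IsGaussianNull g ι ε Φ) (hB : IsBiaxial γ C x)
    (hc : IsTransversal x c J) (hP : P.det ≠ 0) :
    IsLocalCoord (patch Φ P c) (patchDomain ε J) :=
  hΦ.isLocalCoord (isLocalCoord_orbitCoord hB hc hP)

lemma comp_patch_line (hh : IsInvariant h) (hM : IsSmoothAction 5 M)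
    (hΦ : IsGaussianNull g ι ε Φ) (hB : IsBiaxial γ C x) (hc : IsTransversal x c J)
    (hP : P.det ≠ 0) {u r t : ℝ} (hu : u ∈ Ioo (-ε) ε) (hr : r ∈ Ioo (-ε) ε)
    (ht : t ∈ J) (a b : Fin 5) :
    comp h (patch Φ P c) (linePoint u r t) a b =
      pullForm h Φ (u, r, c t) (patchVec P c t a) (patchVec P c t b) :=
  comp_patch hh hM hΦ hB hc hP (linePoint_mem hu hr ht) a b

lemma pd_comp_patch_angle (hh : IsInvariant h) (hM : IsSmoothAction 5 M)
    (hΦ : IsGaussianNull g ι ε Φ) (hB : IsBiaxial γ C x) (hc : IsTransversal x c J)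
    (hP : P.det ≠ 0) {i : Fin 5} (hi : i = 3 ∨ i = 4) {y : Fin 5 → ℝ} (hy : y ∈ patchDomain ε J)
    (a b : Fin 5) : pd i (fun z => comp h (patch Φ P c) z a b) y = 0 := by
  refine pd_eq_zero_of_eventually_const (Eventually.of_forall fun s => ?_)
  have hs (k : Fin 5) (hk : k = 0 ∨ k = 1 ∨ k = 2) :
      (y + s • (Pi.single i 1 : Fin 5 → ℝ)) k = y k := by
    have : k ≠ i := by rcases hi with rfl | rfl <;> rcases hk with rfl | rfl | rfl <;> decide
    simp [Pi.single_eq_of_ne this]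
  have hy' : y + s • (Pi.single i 1 : Fin 5 → ℝ) ∈ patchDomain ε J := by
    rw [mem_patchDomain, hs 0 (by simp), hs 1 (by simp), hs 2 (by simp)]
    exact mem_patchDomain.1 hy
  rw [comp_patch hh hM hΦ hB hc hP hy', comp_patch hh hM hΦ hB hc hP hy, hs 0 (by simp),
    hs 1 (by simp), hs 2 (by simp)]

lemma comp_patch_one (hg : IsLorentzianMetric g) (hgi : IsInvariant g) (hM : IsSmoothAction 5 M)
    (hΦ : IsGaussianNull g ι ε Φ) (hB : IsBiaxial γ C x) (hc : IsTransversal x c J)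
    (hP : P.det ≠ 0) {y : Fin 5 → ℝ} (hy : y ∈ patchDomain ε J) (b : Fin 5) :
    comp g (patch Φ P c) y b 1 = nullFrame b 1 := by
  rw [comp_patch hgi hM hΦ hB hc hP hy]
  fin_cases b
  · exact (hΦ.pullForm_ur hy.1 hy.2.1 _).trans (by simp [nullFrame, nullPartner, nullSign])
  · exact (hΦ.pullForm_rr hy.1 hy.2.1 _).trans (by simp [nullFrame, nullPartner, nullSign])
  all_goals
    rw [pullForm_symm hg]
    exact (hΦ.pullForm_rm hy.1 hy.2.1 _ _).trans (by simp [nullFrame, nullPartner, nullSign])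

/-- On `r = 0` the components `g_{ub}` with `b ≠ r` vanish. -/
lemma comp_patch_zero (hgi : IsInvariant g) (hM : IsSmoothAction 5 M)
    (hΦ : IsGaussianNull g ι ε Φ) (hB : IsBiaxial γ C x) (hc : IsTransversal x c J)
    (hP : P.det ≠ 0) {y : Fin 5 → ℝ} (hy : y ∈ patchDomain ε J) (hy1 : y 1 = 0) {b : Fin 5}
    (hb : b ≠ 1) : comp g (patch Φ P c) y 0 b = 0 := by
  rw [comp_patch hgi hM hΦ hB hc hP hy, hy1]
  fin_cases b
  · exact hΦ.pullForm_uu hy.1 _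
  · exact absurd rfl hb
  all_goals exact hΦ.pullForm_um hy.1 _ _

lemma pd_comp_patch_zero (hgi : IsInvariant g) (hM : IsSmoothAction 5 M)
    (hΦ : IsGaussianNull g ι ε Φ) (hB : IsBiaxial γ C x) (hc : IsTransversal x c J)
    (hP : P.det ≠ 0) {y : Fin 5 → ℝ} (hy : y ∈ patchDomain ε J) (hy1 : y 1 = 0) {b : Fin 5}
    (hb : b ≠ 1) {a : Fin 5} (ha : a ≠ 1) :
    pd a (fun z => comp g (patch Φ P c) z 0 b) y = 0 := by
  refine pd_eq_zero_of_eventually_const ?_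
  have h1 : Tendsto (fun s : ℝ => y + s • (Pi.single a 1 : Fin 5 → ℝ)) (𝓝 0) (𝓝 y) := by
    have : Continuous fun s : ℝ => y + s • (Pi.single a 1 : Fin 5 → ℝ) := by fun_prop
    simpa using this.tendsto 0
  filter_upwards [h1.eventually ((isLocalCoord_patch hΦ hB hc hP).isOpen.mem_nhds hy)] with s hs
  rw [comp_patch_zero hgi hM hΦ hB hc hP hy hy1 hb, comp_patch_zero hgi hM hΦ hB hc hP hs _ hb]
  simp [Pi.single_eq_of_ne (Ne.symm ha), hy1]

lemma contDiffOn_comp_patch (hh : IsSmoothTensor h) (hΦ : IsGaussianNull g ι ε Φ)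
    (hB : IsBiaxial γ C x) (hc : IsTransversal x c J) (hP : P.det ≠ 0) (a b : Fin 5) :
    ContDiffOn ℝ ∞ (fun z => comp h (patch Φ P c) z a b) (patchDomain ε J) :=
  hh _ _ (isLocalCoord_patch hΦ hB hc hP) a b

lemma pd_one_comp_patch_zero_zero (hg : IsLorentzianMetric g) (hgi : IsInvariant g)
    (hM : IsSmoothAction 5 M) (hΦ : IsGaussianNull g ι ε Φ) (hB : IsBiaxial γ C x)
    (hc : IsTransversal x c J) (hP : P.det ≠ 0) {t : ℝ} (ht : t ∈ J) :
    pd 1 (fun z => comp g (patch Φ P c) z 0 0) (linePoint 0 0 t) = 0 := by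
  have hm := linePoint_mem hΦ.zero_mem hΦ.zero_mem ht
  have hf := (contDiffOn_comp_patch hg.smooth hΦ hB hc hP 0 0).contDiffAt
    ((isLocalCoord_patch hΦ hB hc hP).isOpen.mem_nhds hm)
  have h1 := hasDerivAt_line_one (hf.differentiableAt (by simp))
  refine h1.deriv.symm.trans (Eq.trans (Filter.EventuallyEq.deriv_eq ?_)
    (hΦ.deriv_pullForm_uu hΦ.zero_mem (c t)))
  filter_upwards [isOpen_Ioo.mem_nhds hΦ.zero_mem] with r hr
  exact comp_patch_line hgi hM hΦ hB hc hP hΦ.zero_mem hr ht 0 0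

/-- The spacelike block of the metric in a patch, in terms of the expansion of the leaves. -/
lemma expansion_patch (hg : IsLorentzianMetric g) (hgi : IsInvariant g) (hM : IsSmoothAction 5 M)
    (hΦ : IsGaussianNull g ι ε Φ) (hB : IsBiaxial γ C x) (hc : IsTransversal x c J)
    (hP : P.det ≠ 0) (h0 : 0 ∈ J) (hG : comp g (patch Φ P c) 0 = nullFrame) {r : ℝ}
    (hr : r ∈ Ioo (-ε) ε) :
    expansion g Φ 0 r (c 0) = 1 / 2 *
      ((Matrix.of fun i j => comp g (patch Φ P c) (linePoint 0 r 0) (tailIdx i) (tailIdx j))⁻¹ *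
        Matrix.of fun i j => pd 0 (fun z => comp g (patch Φ P c) z (tailIdx i) (tailIdx j))
          (linePoint 0 r 0)).trace := by
  set K : ℝ → ℝ → Matrix (Fin 3) (Fin 3) ℝ := fun u r => Matrix.of fun i j =>
    comp g (patch Φ P c) (linePoint u r 0) (tailIdx i) (tailIdx j) with hK
  set K' : Matrix (Fin 3) (Fin 3) ℝ := Matrix.of fun i j =>
    pd 0 (fun z => comp g (patch Φ P c) z (tailIdx i) (tailIdx j)) (linePoint 0 r 0) with hK'
  set A : Matrix (Fin 3) (Fin 3) ℝ := Matrix.of fun m j =>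
    (patchVec P c 0 (tailIdx j)).2.2 m with hA
  have hvec (j : Fin 3) : patchVec P c 0 (tailIdx j) =
      ∑ m, A m j • ((0, 0, EuclideanSpace.single m 1) : ℝ × ℝ × 𝔼 3) := by
    have h1 : patchVec P c 0 (tailIdx j) = (0, 0, (patchVec P c 0 (tailIdx j)).2.2) := by
      fin_cases j <;> rfl
    rw [h1]
    refine Prod.ext ?_ (Prod.ext ?_ ?_)
    · simp [Prod.fst_sum]
    · simp [Prod.fst_sum, Prod.snd_sum]
    · simp only [Prod.snd_sum, Prod.smul_snd]
      ext k
      simp [hA, Fin.sum_univ_three]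
      fin_cases k <;> simp
  have hKL (u r : ℝ) (hu : u ∈ Ioo (-ε) ε) (hr : r ∈ Ioo (-ε) ε) :
      K u r = A.transpose * leafGram g Φ u r (c 0) * A := by
    have hz := mem_nullDomain hu hr (c 0)
    have hL (m k : Fin 3) : leafGram g Φ u r (c 0) m k =
        pullForm g Φ (u, r, c 0) (0, 0, EuclideanSpace.single m 1)
          (0, 0, EuclideanSpace.single k 1) := by
      rw [pullForm, ← vecB_eq hΦ hz, ← vecB_eq hΦ hz]; rfl
    ext i j
    simp only [hK, Matrix.of_apply]
    rw [comp_patch_line hgi hM hΦ hB hc hP hu hr h0, hvec, hvec, pullForm]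
    simp only [map_sum, map_smul, LinearMap.sum_apply, LinearMap.smul_apply, smul_eq_mul,
      Matrix.mul_apply, Matrix.transpose_apply, hL, pullForm, Finset.sum_mul]
    refine sum_congr rfl fun k _ => ?_
    rw [mul_sum]
    refine sum_congr rfl fun m _ => ?_
    ring
  have hK0 : K 0 0 = 1 := by
    ext i j
    simp only [hK, Matrix.of_apply, linePoint_zero, hG]
    fin_cases i <;> fin_cases j <;> simp [nullFrame, nullPartner, nullSign, tailIdx]
  have hAu : IsUnit A.det := by
    have h1 := congrArg Matrix.det (hKL 0 0 hΦ.zero_mem hΦ.zero_mem)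
    rw [hK0, Matrix.det_mul, Matrix.det_one] at h1
    refine isUnit_iff_ne_zero.2 fun h => ?_
    rw [h, mul_zero] at h1
    exact one_ne_zero h1
  have hAt : IsUnit A.transpose.det := by rwa [Matrix.det_transpose]
  have hLK (u : ℝ) (hu : u ∈ Ioo (-ε) ε) :
      leafGram g Φ u r (c 0) = (A⁻¹).transpose * K u r * A⁻¹ := by
    rw [hKL u r hu hr, Matrix.transpose_nonsing_inv]
    rw [Matrix.mul_assoc A.transpose, ← Matrix.mul_assoc _ A.transpose,
      Matrix.nonsing_inv_mul _ hAt, Matrix.one_mul, Matrix.mul_assoc,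
      Matrix.mul_nonsing_inv _ hAu, Matrix.mul_one]
  have hKd (i j : Fin 3) : HasDerivAt (fun u => K u r i j) (K' i j) 0 := by
    have hm := linePoint_mem hΦ.zero_mem hr h0
    have hf := (contDiffOn_comp_patch hg.smooth hΦ hB hc hP (tailIdx i) (tailIdx j)).contDiffAt
      ((isLocalCoord_patch hΦ hB hc hP).isOpen.mem_nhds hm)
    exact hasDerivAt_line_zero (hf.differentiableAt (by simp))
  have hLd : (Matrix.of fun m k => deriv (fun u => leafGram g Φ u r (c 0) m k) 0) =
      (A⁻¹).transpose * K' * A⁻¹ := by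
    ext m k
    rw [Matrix.of_apply]
    have h1 : HasDerivAt (fun u => ((A⁻¹).transpose * K u r * A⁻¹) m k)
        (((A⁻¹).transpose * K' * A⁻¹) m k) 0 := by
      simp only [Matrix.mul_apply]
      exact HasDerivAt.fun_sum fun j _ => HasDerivAt.mul_const
        (HasDerivAt.fun_sum fun i _ => HasDerivAt.const_mul _ (hKd i j)) _
    refine (h1.congr_of_eventuallyEq ?_).deriv
    filter_upwards [isOpen_Ioo.mem_nhds hΦ.zero_mem] with u hu
    rw [hLK u hu]
  rw [expansion, hLd, hLK 0 hΦ.zero_mem]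
  congr 1
  rw [Matrix.mul_inv_rev, Matrix.mul_inv_rev, Matrix.nonsing_inv_nonsing_inv _ hAu,
    Matrix.transpose_nonsing_inv, Matrix.nonsing_inv_nonsing_inv _ hAt]
  have h2 : A * ((K 0 r)⁻¹ * A.transpose) * (A.transpose⁻¹ * K' * A⁻¹) =
      A * ((K 0 r)⁻¹ * K') * A⁻¹ := by
    simp only [Matrix.mul_assoc]
    rw [← Matrix.mul_assoc A.transpose, Matrix.mul_nonsing_inv _ hAt, Matrix.one_mul]
  rw [h2, Matrix.trace_mul_comm, ← Matrix.mul_assoc, Matrix.nonsing_inv_mul _ hAu, Matrix.one_mul]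

end PatchMetric

/-- The Gram matrix of the generators along a curve, in the basis given by `P`. -/
def curveGram (γ : TwoTensor 3 B) (P : Matrix (Fin 2) (Fin 2) ℝ) (c : ℝ → B) (i j : Fin 2)
    (t : ℝ) : ℝ := ∑ k, ∑ l, P k i * P l j * gram γ (c t) k l

lemma hasDerivAt_deriv_line_two {f : (Fin 5 → ℝ) → ℝ} {Ω : Set (Fin 5 → ℝ)} (hΩ : IsOpen Ω)
    (hf : ContDiffOn ℝ ∞ f Ω) {t : ℝ} (ht : linePoint 0 0 t ∈ Ω) :
    HasDerivAt (deriv fun s => f (linePoint 0 0 s)) (pd 2 (pd 2 f) (linePoint 0 0 t)) t := by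
  have h1 := hasDerivAt_line_two (f := pd 2 f) (u := 0) (r := 0) (t := t)
    (((contDiffOn_pd hΩ hf 2).contDiffAt (hΩ.mem_nhds ht)).differentiableAt (by simp))
  refine h1.congr_of_eventuallyEq ?_
  have h2 : ContinuousAt (fun s => linePoint 0 0 s) t :=
    (hasDerivAt_linePoint_two 0 0 t).continuousAt
  filter_upwards [h2.eventually (hΩ.mem_nhds ht)] with s hs
  exact (hasDerivAt_line_two ((hf.contDiffAt (hΩ.mem_nhds hs)).differentiableAt (by simp))).deriv

lemma comp_patch_base (hΦ : IsGaussianNull g ι ε Φ) (hB : IsBiaxial (induced g ι) C x)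
    (hc : IsTransversal x c J) (hP : P.det ≠ 0) {t : ℝ} (ht : t ∈ J) (i j : Fin 3) :
    comp g (patch Φ P c) (linePoint 0 0 t) (tailIdx i) (tailIdx j) =
      comp (induced g ι) (orbitCoord P c) ![t, 0, 0] i j := by
  rw [comp_induced hΦ (isLocalCoord_orbitCoord hB hc hP) (y := ![t, 0, 0]) ht]
  rfl

lemma comp_patch_angle_angle (hΦ : IsGaussianNull g ι ε Φ)
    (hB : IsBiaxial (induced g ι) C x) (hc : IsTransversal x c J) (hP : P.det ≠ 0)
    {t : ℝ} (ht : t ∈ J) (i j : Fin 2) :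
    comp g (patch Φ P c) (linePoint 0 0 t) (tailIdx i.succ) (tailIdx j.succ) =
      curveGram (induced g ι) P c i j t :=
  (comp_patch_base hΦ hB hc hP ht _ _).trans (comp_orbitCoord_succ_succ hB hc ht i j)

lemma comp_patch_zero_frame (hg : IsLorentzianMetric g) (hgi : IsInvariant g)
    (hM : IsSmoothAction 5 M) (hΦ : IsGaussianNull g ι ε Φ)
    (hB : IsBiaxial (induced g ι) C x) (hc : IsTransversal x c J) (hP : P.det ≠ 0)
    (h0 : 0 ∈ J) (horth : IsOrthogonalCurve (induced g ι) c J)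
    (hvel : modelForm (induced g ι) (c 0) (velocity c 0) (velocity c 0) = 1)
    (hμ : ∀ i j, curveGram (induced g ι) P c i j 0 = if i = j then 1 else 0) :
    comp g (patch Φ P c) 0 = nullFrame := by
  have hm := linePoint_mem hΦ.zero_mem hΦ.zero_mem h0
  have hsym (a b : Fin 5) : comp g (patch Φ P c) (linePoint 0 0 0) a b =
      comp g (patch Φ P c) (linePoint 0 0 0) b a := hg.form_symm _ _ _
  have h1 := comp_patch_one hg hgi hM hΦ hB hc hP hm
  have h2 (b : Fin 5) (hb : b ≠ 1) := comp_patch_zero hgi hM hΦ hB hc hP hm rfl hb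
  have h22 : comp g (patch Φ P c) (linePoint 0 0 0) 2 2 = 1 :=
    (comp_patch_base hΦ hB hc hP h0 0 0).trans ((comp_orbitCoord_zero_zero hB hc h0).trans hvel)
  have h2s (j : Fin 2) : comp g (patch Φ P c) (linePoint 0 0 0) 2 (tailIdx j.succ) = 0 := by
    refine (comp_patch_base hΦ hB hc hP h0 0 j.succ).trans
      ((comp_orbitCoord_zero_succ hB hc h0 j).trans ?_)
    exact Finset.sum_eq_zero fun i _ => by
      rw [show (![(0 : ℝ), 0, 0] : Fin 3 → ℝ) 0 = 0 from rfl, horth 0 h0 i, mul_zero]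
  have hss (i j : Fin 2) := (comp_patch_angle_angle hΦ hB hc hP h0 i j).trans (hμ i j)
  have e23 : comp g (patch Φ P c) (linePoint 0 0 0) 2 3 = 0 := h2s 0
  have e24 : comp g (patch Φ P c) (linePoint 0 0 0) 2 4 = 0 := h2s 1
  have e33 : comp g (patch Φ P c) (linePoint 0 0 0) 3 3 = 1 := hss 0 0
  have e34 : comp g (patch Φ P c) (linePoint 0 0 0) 3 4 = 0 := hss 0 1
  have e43 : comp g (patch Φ P c) (linePoint 0 0 0) 4 3 = 0 := hss 1 0
  have e44 : comp g (patch Φ P c) (linePoint 0 0 0) 4 4 = 1 := hss 1 1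
  have h01 (b : Fin 5) := (hsym 1 b).trans (h1 b)
  have h20 (b : Fin 5) (hb : b ≠ 1) := (hsym b 0).trans (h2 b hb)
  rw [← linePoint_zero]
  ext a b
  fin_cases a <;> fin_cases b <;>
    simp only [Fin.zero_eta, Fin.mk_one, Fin.reduceFinMk] <;>
    first
    | exact h1 _
    | exact (h01 _).trans (by simp [nullFrame, nullPartner, nullSign])
    | exact (h2 _ (by decide)).trans (by simp [nullFrame, nullPartner])
    | exact (h20 _ (by decide)).trans (by simp [nullFrame, nullPartner])
    | simp [nullFrame, nullPartner, nullSign, h22, e23, e24, e33, e34, e43, e44, hsym 3 2, hsym 4 2]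

/-- The trace of the Einstein equation over a stable MOTS, in an adapted patch. -/
lemma patch_inequality (hM : IsBiaxisymmetricSolution Λ g F vol) (hΦ : IsGaussianNull g ι ε Φ)
    (hB : IsBiaxial (induced g ι) C x) (hc : IsTransversal x c J) (hP : P.det ≠ 0)
    (h0 : 0 ∈ J) (hexp : expansion g Φ 0 0 (c 0) = 0)
    (hst : deriv (fun r => expansion g Φ 0 r (c 0)) 0 ≤ 0)
    (horth : IsOrthogonalCurve (induced g ι) c J)
    (hμ : ∀ i j, curveGram (induced g ι) P c i j 0 = if i = j then 1 else 0)
    (hnorm : ∀ t ∈ J, modelForm (induced g ι) (c t) (velocity c t) (velocity c t) *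
      (curveGram (induced g ι) P c 0 0 t * curveGram (induced g ι) P c 1 1 t -
        curveGram (induced g ι) P c 0 1 t ^ 2) = 1) :
    1 / 2 * (comp F (patch Φ P c) 0 2 3 ^ 2 + comp F (patch Φ P c) 0 2 4 ^ 2) +
        1 / 2 * comp F (patch Φ P c) 0 0 1 ^ 2 + 12 * Λ +
        (deriv (fun t => pd 1 (fun z => comp g (patch Φ P c) z 0 2) (linePoint 0 0 t)) 0 +
          (deriv (curveGram (induced g ι) P c 0 0) 0 + deriv (curveGram (induced g ι) P c 1 1) 0) *
            pd 1 (fun z => comp g (patch Φ P c) z 0 2) 0) +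
        1 / 2 * (pd 1 (fun z => comp g (patch Φ P c) z 0 2) 0 ^ 2 +
          pd 1 (fun z => comp g (patch Φ P c) z 0 3) 0 ^ 2 +
          pd 1 (fun z => comp g (patch Φ P c) z 0 4) 0 ^ 2) ≤
      -(deriv (deriv (curveGram (induced g ι) P c 0 0)) 0 +
          deriv (deriv (curveGram (induced g ι) P c 1 1)) 0) -
        3 / 2 * (deriv (curveGram (induced g ι) P c 0 0) 0 *
          deriv (curveGram (induced g ι) P c 1 1) 0 -
          deriv (curveGram (induced g ι) P c 0 1) 0 ^ 2) := by
  have hg := hM.lorentzian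
  have hgi := hM.invariant_metric
  have hA := hM.action
  have hl := isLocalCoord_patch hΦ hB hc hP
  have hO : IsOpen (patchDomain ε J) := hl.isOpen
  have hm : linePoint 0 0 0 ∈ patchDomain ε J := linePoint_mem hΦ.zero_mem hΦ.zero_mem h0
  have hm0 : (0 : Fin 5 → ℝ) ∈ patchDomain ε J := by rw [← linePoint_zero]; exact hm
  have hmJ (t : ℝ) (ht : t ∈ J) : linePoint 0 0 t ∈ patchDomain ε J :=
    linePoint_mem hΦ.zero_mem hΦ.zero_mem ht
  have hJ : ∀ᶠ t in 𝓝 (0 : ℝ), t ∈ J := hc.isOpen.mem_nhds h0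
  have hs (a b : Fin 5) := contDiffOn_comp_patch hg.smooth hΦ hB hc hP a b
  have hd (a b : Fin 5) (y) (hy : y ∈ patchDomain ε J) :
      DifferentiableAt ℝ (fun z => comp g (patch Φ P c) z a b) y :=
    ((hs a b).contDiffAt (hO.mem_nhds hy)).differentiableAt (by simp)
  have hdd (k a b : Fin 5) (y) (hy : y ∈ patchDomain ε J) :
      DifferentiableAt ℝ (pd k fun z => comp g (patch Φ P c) z a b) y :=
    ((contDiffOn_pd hO (hs a b) k).contDiffAt (hO.mem_nhds hy)).differentiableAt (by simp)
  have hvel : modelForm (induced g ι) (c 0) (velocity c 0) (velocity c 0) = 1 := by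
    have := hnorm 0 h0
    simpa [hμ] using this
  have hG0 := comp_patch_zero_frame hg hgi hA hΦ hB hc hP h0 horth hvel hμ
  -- the angular block along the curve
  have hblock (i j : Fin 2) : ∀ᶠ t in 𝓝 (0 : ℝ), curveGram (induced g ι) P c i j t =
      comp g (patch Φ P c) (linePoint 0 0 t) (tailIdx i.succ) (tailIdx j.succ) := by
    filter_upwards [hJ] with t ht
    exact (comp_patch_angle_angle hΦ hB hc hP ht i j).symm
  have hb1 (i j : Fin 2) : HasDerivAt (curveGram (induced g ι) P c i j)
      (pd 2 (fun z => comp g (patch Φ P c) z (tailIdx i.succ) (tailIdx j.succ)) 0) 0 := by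
    have := hasDerivAt_line_two (hd (tailIdx i.succ) (tailIdx j.succ) _ hm)
    rw [linePoint_zero] at this
    exact this.congr_of_eventuallyEq (hblock i j)
  have hb2 (i j : Fin 2) : deriv (deriv (curveGram (induced g ι) P c i j)) 0 =
      pd 2 (pd 2 fun z => comp g (patch Φ P c) z (tailIdx i.succ) (tailIdx j.succ)) 0 := by
    have h1 := hasDerivAt_deriv_line_two hO (hs (tailIdx i.succ) (tailIdx j.succ)) hm
    rw [linePoint_zero] at h1
    have h2 : curveGram (induced g ι) P c i j =ᶠ[𝓝 0] fun t =>
      comp g (patch Φ P c) (linePoint 0 0 t) (tailIdx i.succ) (tailIdx j.succ) := hblock i j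
    exact (h2.deriv.deriv_eq).trans h1.deriv
  have hb3 : deriv (fun t => pd 1 (fun z => comp g (patch Φ P c) z 0 2) (linePoint 0 0 t)) 0 =
      pd 2 (pd 1 fun z => comp g (patch Φ P c) z 0 2) 0 := by
    have := (hasDerivAt_line_two (hdd 1 0 2 _ hm)).deriv
    rwa [linePoint_zero] at this
  have hx : ∀ b : Fin 5, b = 3 ∨ b = 4 → pd 2 (fun z => comp g (patch Φ P c) z 2 b) 0 = 0 := by
    intro b hb
    obtain ⟨j, rfl⟩ : ∃ j : Fin 2, b = tailIdx j.succ := by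
      rcases hb with rfl | rfl
      exacts [⟨0, rfl⟩, ⟨1, rfl⟩]
    have h1 := hasDerivAt_line_two (hd 2 (tailIdx j.succ) _ hm)
    rw [linePoint_zero] at h1
    refine h1.unique ((hasDerivAt_const (0 : ℝ) (0 : ℝ)).congr_of_eventuallyEq ?_)
    filter_upwards [hJ] with t ht
    refine (comp_patch_base hΦ hB hc hP ht 0 j.succ).trans
      ((comp_orbitCoord_zero_succ hB hc ht j).trans ?_)
    exact Finset.sum_eq_zero fun i _ => by
      rw [show (![t, 0, 0] : Fin 3 → ℝ) 0 = t from rfl, horth t ht i, mul_zero]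
  have hD : pd 2 (fun z => comp g (patch Φ P c) z 2 2) 0 =
      -(pd 2 (fun z => comp g (patch Φ P c) z 3 3) 0 +
        pd 2 (fun z => comp g (patch Φ P c) z 4 4) 0) := by
    have h1 := hasDerivAt_line_two (hd 2 2 _ hm)
    rw [linePoint_zero] at h1
    have h2 := h1.mul (((hb1 0 0).mul (hb1 1 1)).sub ((hb1 0 1).pow 2))
    have h3 : HasDerivAt (fun _ : ℝ => (1 : ℝ)) 0 0 := hasDerivAt_const _ _
    have h4 := h2.unique (h3.congr_of_eventuallyEq (by
      filter_upwards [hJ] with t ht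
      refine Eq.trans ?_ (hnorm t ht)
      have h22 := (comp_patch_base hΦ hB hc hP ht 0 0).trans (comp_orbitCoord_zero_zero hB hc ht)
      exact congrArg (· * _) h22))
    simp only [hμ, Pi.mul_apply, Pi.sub_apply, Pi.pow_apply, if_true, linePoint_zero, hG0,
      show ((0 : Fin 2) = 1) = False by simp, if_false] at h4
    have e1 : nullFrame 2 2 = 1 := by simp [nullFrame, nullPartner, nullSign]
    rw [e1] at h4
    change pd 2 (fun z => comp g (patch Φ P c) z 2 2) 0 * _ + 1 *
      (pd 2 (fun z => comp g (patch Φ P c) z 3 3) 0 * 1 +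
        1 * pd 2 (fun z => comp g (patch Φ P c) z 4 4) 0 - _) = 0 at h4
    norm_num at h4
    linarith
  -- expansion
  set K : ℝ → Matrix (Fin 3) (Fin 3) ℝ := fun r => Matrix.of fun i j =>
    comp g (patch Φ P c) (linePoint 0 r 0) (tailIdx i) (tailIdx j) with hK
  set N : ℝ → Matrix (Fin 3) (Fin 3) ℝ := fun r => Matrix.of fun i j =>
    pd 0 (fun z => comp g (patch Φ P c) z (tailIdx i) (tailIdx j)) (linePoint 0 r 0) with hN
  have hK0 : K 0 = 1 := by
    ext i j
    simp only [hK, Matrix.of_apply, linePoint_zero, hG0]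
    fin_cases i <;> fin_cases j <;> simp [nullFrame, nullPartner, nullSign, tailIdx]
  have hexp' (r : ℝ) (hr : r ∈ Ioo (-ε) ε) :
      expansion g Φ 0 r (c 0) = 1 / 2 * ((K r)⁻¹ * N r).trace :=
    expansion_patch hg hgi hA hΦ hB hc hP h0 hG0 hr
  have hder : HasDerivAt (fun r => ((K r)⁻¹ * N r).trace) _ 0 :=
    hasDerivAt_trace_inv_mul (K' := Matrix.of fun i j =>
        pd 1 (fun z => comp g (patch Φ P c) z (tailIdx i) (tailIdx j)) (linePoint 0 0 0))
      (N' := Matrix.of fun i j =>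
        pd 1 (pd 0 fun z => comp g (patch Φ P c) z (tailIdx i) (tailIdx j)) (linePoint 0 0 0)) hK0
      (fun i j => hasDerivAt_line_one (hd _ _ _ hm))
      (fun i j => hasDerivAt_line_one (hdd 0 _ _ _ hm))
  have hstab : (Matrix.trace (Matrix.of fun i j : Fin 3 =>
        pd 1 (pd 0 fun z => comp g (patch Φ P c) z (tailIdx i) (tailIdx j)) (linePoint 0 0 0)) -
      Matrix.trace (Matrix.of (fun i j : Fin 3 =>
        pd 1 (fun z => comp g (patch Φ P c) z (tailIdx i) (tailIdx j)) (linePoint 0 0 0)) *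
          N 0)) ≤ 0 := by
    have h1 : deriv (fun r => expansion g Φ 0 r (c 0)) 0 = 1 / 2 * _ :=
      ((hder.const_mul (1 / 2)).congr_of_eventuallyEq (by
        filter_upwards [isOpen_Ioo.mem_nhds hΦ.zero_mem] with r hr using hexp' r hr)).deriv
    rw [h1] at hst
    linarith
  have hsym : ∀ z a b, comp g (patch Φ P c) z a b = comp g (patch Φ P c) z b a :=
    fun z a b => hg.form_symm _ _ _
  have hsymf (a b : Fin 5) : (fun z => comp g (patch Φ P c) z a b) =
      fun z => comp g (patch Φ P c) z b a := funext fun z => hsym z a b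
  have htr : pd 0 (fun z => comp g (patch Φ P c) z 2 2) 0 +
      pd 0 (fun z => comp g (patch Φ P c) z 3 3) 0 +
      pd 0 (fun z => comp g (patch Φ P c) z 4 4) 0 = 0 := by
    have h1 := hexp' 0 hΦ.zero_mem
    rw [hexp, hK0, inv_one, one_mul, Matrix.trace_fin_three] at h1
    simp only [hN, Matrix.of_apply, linePoint_zero] at h1
    change 0 = 1 / 2 * (pd 0 (fun z => comp g (patch Φ P c) z 2 2) 0 +
      pd 0 (fun z => comp g (patch Φ P c) z 3 3) 0 +
      pd 0 (fun z => comp g (patch Φ P c) z 4 4) 0) at h1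
    linarith
  have hev : ∀ᶠ y in 𝓝 (0 : Fin 5 → ℝ), y ∈ patchDomain ε J := hO.mem_nhds hm0
  have hu : ∀ a, pd a (fun z => comp g (patch Φ P c) z 0 0) 0 = 0 := by
    intro a
    by_cases ha : a = 1
    · subst ha
      have := pd_one_comp_patch_zero_zero hg hgi hA hΦ hB hc hP h0
      rwa [linePoint_zero] at this
    · exact pd_comp_patch_zero hgi hA hΦ hB hc hP hm0 rfl (by decide) ha
  have hR := ricci_nullFrame_trace (G := comp g (patch Φ P c)) (y := 0)
    (fun a b => ((hs a b).contDiffAt (hO.mem_nhds hm0)).of_le two_le_smooth) hG0 hsym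
    (fun a b => by
      filter_upwards [hev] with y hy
      exact pd_comp_patch_angle hgi hA hΦ hB hc hP (Or.inl rfl) hy a b)
    (fun a b => by
      filter_upwards [hev] with y hy
      exact pd_comp_patch_angle hgi hA hΦ hB hc hP (Or.inr rfl) hy a b)
    (fun a b => by
      filter_upwards [hev] with y hy
      refine pd_eq_zero_of_eventuallyEq_const (k := nullFrame b 1) ?_ a
      filter_upwards [hO.mem_nhds hy] with z hz
      exact comp_patch_one hg hgi hA hΦ hB hc hP hz b)
    hu
    (fun b _ hb => ⟨pd_comp_patch_zero hgi hA hΦ hB hc hP hm0 rfl hb (by decide),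
      pd_comp_patch_zero hgi hA hΦ hB hc hP hm0 rfl hb (by decide)⟩)
    hx hD htr
  have hF : ∀ a b, comp F (patch Φ P c) 0 a b = -comp F (patch Φ P c) 0 b a := by
    intro a b
    have h1 := hM.alternating (patch Φ P c 0)
      (coordVec (patch Φ P c) 0 a + coordVec (patch Φ P c) 0 b)
    simp only [map_add, LinearMap.add_apply, hM.alternating] at h1
    change F _ _ _ = -F _ _ _
    linarith
  have hE := (hM.field_equations _ _ hl 0 hm0).einstein
  have hmat := matter_nullFrame_trace Λ hF
  rw [← hG0] at hmat
  rw [hE 2 2, hE 3 3, hE 4 4, hmat] at hR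
  rw [Matrix.trace_fin_three, Matrix.trace_fin_three] at hstab
  simp only [hN, Matrix.mul_apply, Fin.sum_univ_three, Matrix.of_apply, linePoint_zero] at hstab
  rw [show tailIdx 0 = 2 from rfl, show tailIdx 1 = 3 from rfl, show tailIdx 2 = 4 from rfl,
    hsymf 3 2, hsymf 4 2, hsymf 4 3] at hstab
  rw [(hb1 0 0).deriv, (hb1 1 1).deriv, (hb1 0 1).deriv, hb2 0 0, hb2 1 1, hb3,
    show tailIdx (Fin.succ 0) = 3 from rfl, show tailIdx (Fin.succ 1) = 4 from rfl]
  linarith [sq_nonneg (comp F (patch Φ P c) 0 3 4)]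

section NormalConnection

variable {τ : (Fin 3 → ℝ) → B} {V : Set (Fin 3 → ℝ)}

/-- The one-form `β = ∂_r g_{u m} dy^m` on the surface. -/
def betaForm (g : TwoTensor 5 M) (Φ : ℝ × ℝ × B → M) (b : B) (v : 𝔼 3) : ℝ :=
  deriv (fun r => pullForm g Φ (0, r, b) (1, 0, 0) (0, 0, v)) 0

lemma modelDeriv_eq_sum {n : ℕ} {N : Type*} [TopologicalSpace N]
    [ChartedSpace (𝔼 n) N] (σ : (Fin n → ℝ) → N) (y u : Fin n → ℝ) :
    modelDeriv σ y u = ∑ a, u a • modelCoord σ y a := by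
  conv_lhs => rw [pi_eq_sum_univ' u]
  rw [map_sum]
  refine sum_congr rfl fun a _ => ?_
  rw [map_smul]
  rfl

lemma hasDerivAt_pullForm_um (hg : IsLorentzianMetric g) (hΦ : IsGaussianNull g ι ε Φ)
    (hτ : IsLocalCoord τ V) {y : Fin 3 → ℝ} (hy : y ∈ V) (u : Fin 3 → ℝ) :
    HasDerivAt (fun r => pullForm g Φ (0, r, τ y) (1, 0, 0) (0, 0, modelDeriv τ y u))
      (∑ a, u a * pd 1 (fun z => comp g (gaussLift Φ τ) z 0 (tailIdx a)) (inclusion5 y)) 0 := by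
  have hm := inclusion5_mem hΦ.pos hy
  have hl := hΦ.isLocalCoord hτ
  let ℓ : ℝ → Fin 5 → ℝ := fun s => ![0, s, y 0, y 1, y 2]
  have hℓ : HasDerivAt ℓ (Pi.single 1 1) 0 := by
    rw [hasDerivAt_pi]
    intro i
    fin_cases i
    · exact hasDerivAt_const (0 : ℝ) _
    · exact hasDerivAt_id (0 : ℝ)
    all_goals exact hasDerivAt_const (0 : ℝ) _
  have h1 (a : Fin 3) : HasDerivAt (fun s => comp g (gaussLift Φ τ) (ℓ s) 0 (tailIdx a))
      (pd 1 (fun z => comp g (gaussLift Φ τ) z 0 (tailIdx a)) (inclusion5 y)) 0 :=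
    hasDerivAt_comp_line (ℓ := ℓ) (((hg.smooth _ _ hl 0 (tailIdx a)).contDiffAt
      (hl.isOpen.mem_nhds hm)).differentiableAt (by simp)) hℓ
  have h2 : HasDerivAt (fun s => ∑ a, u a * comp g (gaussLift Φ τ) (ℓ s) 0 (tailIdx a))
      (∑ a, u a * pd 1 (fun z => comp g (gaussLift Φ τ) z 0 (tailIdx a)) (inclusion5 y)) 0 :=
    HasDerivAt.fun_sum fun a _ => (h1 a).const_mul (u a)
  refine h2.congr_of_eventuallyEq ?_
  filter_upwards [isOpen_Ioo.mem_nhds hΦ.zero_mem] with s hs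
  have ht : tail3 (ℓ s) = y := by
    rw [tail3_eq]; funext i; fin_cases i <;> rfl
  have hd : ℓ s ∈ gaussDomain ε V := ⟨hΦ.zero_mem, hs, by rw [ht]; exact hy⟩
  have h3 : ((0, 0, modelDeriv τ y u) : ℝ × ℝ × 𝔼 3) =
      ∑ a, u a • (0, 0, modelCoord τ y a) := by
    rw [modelDeriv_eq_sum]
    refine Prod.ext ?_ (Prod.ext ?_ ?_)
    · simp [Prod.fst_sum]
    · simp [Prod.fst_sum, Prod.snd_sum]
    · simp [Prod.snd_sum]
  rw [h3, pullForm]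
  simp only [map_sum, map_smul, smul_eq_mul]
  refine sum_congr rfl fun a _ => ?_
  rw [comp_gaussLift g hΦ hτ hd, liftVec_tailIdx, ht]
  rfl

lemma betaForm_smul_vec (a : ℝ) (b : B) (v : 𝔼 3) :
    betaForm g Φ b (a • v) = a * betaForm g Φ b v := by
  rw [betaForm, betaForm, ← deriv_const_mul_field]
  congr 1
  funext r
  have : ((0, 0, a • v) : ℝ × ℝ × 𝔼 3) = a • (0, 0, v) := by simp
  rw [this, pullForm, map_smul, map_smul]
  rfl

lemma betaForm_smul (hgi : IsInvariant g) (hM : IsSmoothAction 5 M) (hB : IsSmoothAction 3 B)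
    (hΦ : IsGaussianNull g ι ε Φ) (t : Torus) (b : B) (v : 𝔼 3) :
    betaForm g Φ (t • b) (actDeriv t b v) = betaForm g Φ b v := by
  refine Filter.EventuallyEq.deriv_eq ?_
  filter_upwards [isOpen_Ioo.mem_nhds hΦ.zero_mem] with r hr
  have := pullForm_smul hgi hM hB hΦ hΦ.zero_mem hr t b (1, 0, 0) (0, 0, v)
  simpa using this

lemma pd_one_comp_patch (hg : IsLorentzianMetric g)
    (hgi : IsInvariant g) (hM : IsSmoothAction 5 M) (hΦ : IsGaussianNull g ι ε Φ)
    (hB : IsBiaxial γ C x) (hc : IsTransversal x c J) (hP : P.det ≠ 0) {t : ℝ}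
    (ht : t ∈ J) {a : Fin 5} {v : 𝔼 3} (hv : patchVec P c t a = (0, 0, v)) :
    pd 1 (fun z => comp g (patch Φ P c) z 0 a) (linePoint 0 0 t) = betaForm g Φ (c t) v := by
  have hm := linePoint_mem hΦ.zero_mem hΦ.zero_mem ht
  have hf := (contDiffOn_comp_patch hg.smooth hΦ hB hc hP 0 a).contDiffAt
    ((isLocalCoord_patch hΦ hB hc hP).isOpen.mem_nhds hm)
  have h1 := hasDerivAt_line_one (hf.differentiableAt (by simp))
  refine h1.deriv.symm.trans (Filter.EventuallyEq.deriv_eq ?_)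
  filter_upwards [isOpen_Ioo.mem_nhds hΦ.zero_mem] with r hr
  rw [comp_patch_line hgi hM hΦ hB hc hP hΦ.zero_mem hr ht, hv]
  rfl

end NormalConnection

section Gradient

open Matrix

variable {σ : (Fin 3 → ℝ) → B} {V : Set (Fin 3 → ℝ)}

/-- The gradient of the orbit coordinate. -/
def orbitGradient (γ : TwoTensor 3 B) (x : B → ℝ) (b : B) : 𝔼 3 :=
  Classical.epsilon fun v => ∀ w, modelForm γ b v w = modelDiff x b w

lemma IsBiaxial.det_comp_ne_zero (h : IsBiaxial γ C x) (hσ : IsLocalCoord σ V)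
    {y : Fin 3 → ℝ} (hy : y ∈ V) : (comp γ σ y).det ≠ 0 := by
  intro h0
  obtain ⟨u, hu, hu0⟩ := Matrix.exists_mulVec_eq_zero_iff.2 h0
  have h1 : coordForm γ σ y u u = 0 := by
    rw [coordForm_eq_sum]
    have : ∑ a, ∑ b, u a * u b * comp γ σ y a b = ∑ a, u a * (comp γ σ y *ᵥ u) a := by
      refine sum_congr rfl fun a _ => ?_
      rw [Matrix.mulVec, dotProduct, mul_sum]
      exact sum_congr rfl fun b _ => by ring
    rw [this, hu0]
    simp
  rw [coordForm_apply] at h1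
  have h2 := h.form_self_eq_zero h1
  rw [← map_zero (modelDeriv σ y)] at h2
  exact hu ((hσ.bijective_modelDeriv hy).1 h2)

lemma IsBiaxial.modelForm_chartGradient (h : IsBiaxial γ C x)
    (hσ : IsLocalCoord σ V) {y : Fin 3 → ℝ} (hy : y ∈ V) (w : 𝔼 3) :
    modelForm γ (σ y) (modelDeriv σ y ((comp γ σ y)⁻¹ *ᵥ fun a => pd a (fun z => x (σ z)) y)) w =
      modelDiff x (σ y) w := by
  obtain ⟨w, rfl⟩ := (hσ.bijective_modelDeriv hy).2 w
  set d : Fin 3 → ℝ := fun a => pd a (fun z => x (σ z)) y with hd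
  have hsymm : (comp γ σ y).transpose = comp γ σ y := by
    ext a b; exact h.symm _ _ _
  have h1 : modelDiff (n := 3) x (σ y) (modelDeriv σ y w) = w ⬝ᵥ d := by
    have h2 := fderiv_comp_modelDeriv (n := 3) (f := x) (h.mdifferentiable_x (σ y))
      (hσ.mdifferentiableAt hy)
    rw [modelDeriv_eq_sum, map_sum, dotProduct]
    refine sum_congr rfl fun a _ => ?_
    rw [map_smul, smul_eq_mul]
    exact congrArg (w a * ·) (congrArg (fun L : (Fin 3 → ℝ) →L[ℝ] ℝ => L (Pi.single a 1))
      h2.fderiv).symm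
  rw [h1, ← coordForm_apply, coordForm_eq_sum]
  have h3 : ∑ a, ∑ b, ((comp γ σ y)⁻¹ *ᵥ d) a * w b * comp γ σ y a b =
      w ⬝ᵥ (comp γ σ y *ᵥ ((comp γ σ y)⁻¹ *ᵥ d)) := by
    rw [dotProduct, Finset.sum_comm]
    refine sum_congr rfl fun b _ => ?_
    conv_rhs => rw [← hsymm]
    rw [Matrix.mulVec, dotProduct, mul_sum]
    refine sum_congr rfl fun a _ => ?_
    rw [Matrix.transpose_apply, hsymm]
    ring
  rw [h3, Matrix.mulVec_mulVec, Matrix.mul_nonsing_inv _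
    (isUnit_iff_ne_zero.2 (h.det_comp_ne_zero hσ hy)), Matrix.one_mulVec]

lemma IsBiaxial.orbitGradient_spec (h : IsBiaxial γ C x) (b : B)
    (w : 𝔼 3) : modelForm γ b (orbitGradient γ x b) w = modelDiff x b w := by
  have hex : ∃ v, ∀ w, modelForm γ b v w = modelDiff x b w := by
    obtain ⟨σ, V, hσ, -, h0, rfl⟩ := exists_isLocalCoord (n := 3) b
    exact ⟨_, h.modelForm_chartGradient hσ h0⟩
  exact Classical.epsilon_spec hex w

lemma IsBiaxial.orbitGradient_unique (h : IsBiaxial γ C x) {b : B}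
    {v : 𝔼 3} (hv : ∀ w, modelForm γ b v w = modelDiff x b w) :
    orbitGradient γ x b = v := by
  rw [← sub_eq_zero]
  refine h.form_self_eq_zero (b := b) ?_
  rw [LinearMap.map_sub₂, h.orbitGradient_spec, hv, sub_self]

lemma IsBiaxial.orbitGradient_smul (h : IsBiaxial γ C x) (t : Torus) (b : B) :
    orbitGradient γ x (t • b) = actDeriv t b (orbitGradient γ x b) := by
  refine h.orbitGradient_unique fun w => ?_
  have hw : w = actDeriv t b (actDeriv t⁻¹ (t • b) w) := by
    have h1 := actDeriv_mul h.action t t⁻¹ (t • b) w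
    rw [mul_inv_cancel, actDeriv_one, actDeriv_congr (inv_smul_smul t b)] at h1
    exact h1
  rw [hw, modelForm_smul h.invariant, h.modelDiff_actDeriv, h.orbitGradient_spec]

lemma IsBiaxial.orbitGradient_eq_zero (h : IsBiaxial γ C x) {e : ℝ}
    (he : e ^ 2 = 1) {b : B} (hb : x b = e) : orbitGradient γ x b = 0 := by
  refine h.orbitGradient_unique fun w => ?_
  obtain ⟨σ, V, hσ, -, h0, rfl⟩ := exists_isLocalCoord (n := 3) b
  obtain ⟨w, rfl⟩ := (hσ.bijective_modelDeriv h0).2 w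
  have h2 := fderiv_comp_modelDeriv (n := 3) (f := x) (h.mdifferentiable_x (σ 0))
    (hσ.mdifferentiableAt h0)
  have h3 : IsLocalMax (fun z => e * x (σ z)) 0 := by
    refine Filter.Eventually.of_forall fun z => ?_
    change e * x (σ z) ≤ e * x (σ 0)
    rw [hb, ← sq, he]
    exact h.mul_x_le he _
  have h4 := h3.fderiv_eq_zero
  rw [(h2.const_mul e).fderiv] at h4
  have h5 := congrArg (fun L : (Fin 3 → ℝ) →L[ℝ] ℝ => L w) h4
  have he0 : e ≠ 0 := by rintro rfl; norm_num at he
  change e * modelDiff (n := 3) x (σ 0) (modelDeriv σ 0 w) = 0 at h5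
  rw [map_zero, LinearMap.zero_apply]
  exact ((mul_eq_zero.1 h5).resolve_left he0).symm

lemma IsBiaxial.orbitGradient_normal (h : IsBiaxial γ C x)
    {b : B} (hb1 : -1 < x b) (hb2 : x b < 1) {v : 𝔼 3}
    (hv : ∀ i, modelForm γ b v (modelGen i b) = 0) :
    modelForm γ b v v • orbitGradient γ x b = modelDiff x b v • v := by
  set G := orbitGradient γ x b with hG
  have hGg (i : Fin 2) : modelForm γ b G (modelGen i b) = 0 := by
    rw [h.orbitGradient_spec]; exact h.dfun_generator b i
  have h1 := h.normal_sq hb1 hb2 hGg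
  rw [← h.orbitGradient_spec] at h1
  have h2 := h.normal_sq hb1 hb2 hv
  have hq : modelForm γ b G G ≠ 0 := by
    intro h0
    obtain ⟨w, -, hw⟩ := h.exists_normal hb1 hb2
    rw [← h.orbitGradient_spec, ← hG, h.form_self_eq_zero h0, map_zero, LinearMap.zero_apply] at hw
    exact zero_ne_one hw
  have h3 : modelForm γ b G G = C ^ 2 * gramDet γ b := by
    refine mul_right_cancel₀ hq ?_
    rw [← sq, h1]; ring
  rw [← sub_eq_zero]
  refine h.eq_zero_of_orthogonal hb1 hb2 (fun i => ?_) ?_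
  · simp only [map_sub, map_smul, LinearMap.sub_apply, LinearMap.smul_apply, hGg, hv]
    simp
  · have h4 : modelDiff x b G = C ^ 2 * gramDet γ b := by rw [← h.orbitGradient_spec, ← hG, h3]
    rw [map_sub, map_smul, map_smul, h4, smul_eq_mul, smul_eq_mul, ← sq, h2]
    ring

end Gradient

section Flux

open Matrix

/-- The component `β(∇x)` of the one-form `β`. -/
def orbitFlux (g : TwoTensor 5 M) (Φ : ℝ × ℝ × B → M) (γ : TwoTensor 3 B) (x : B → ℝ)
    (b : B) : ℝ := betaForm g Φ b (orbitGradient γ x b)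

open Classical in
/-- The component `β(∇x)` as a function of the orbit coordinate. -/
def fluxFun (g : TwoTensor 5 M) (Φ : ℝ × ℝ × B → M) (γ : TwoTensor 3 B) (x : B → ℝ)
    (t : ℝ) : ℝ := if h : ∃ b, x b = t then orbitFlux g Φ γ x h.choose else 0

lemma fluxFun_eq (hgi : IsInvariant g) (hM : IsSmoothAction 5 M) (hΦ : IsGaussianNull g ι ε Φ)
    (hB : IsBiaxial γ C x) (b : B) : fluxFun g Φ γ x (x b) = orbitFlux g Φ γ x b := by
  have h : ∃ b', x b' = x b := ⟨b, rfl⟩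
  rw [fluxFun, dif_pos h]
  obtain ⟨t, ht⟩ := (hB.orbit.eq_iff _ _).1 h.choose_spec
  conv_rhs => rw [ht]
  rw [orbitFlux, orbitFlux, hB.orbitGradient_smul, betaForm_smul hgi hM hB.action hΦ]

lemma continuous_orbitFlux (hg : IsLorentzianMetric g) (hΦ : IsGaussianNull g ι ε Φ)
    (hB : IsBiaxial γ C x) : Continuous (orbitFlux g Φ γ x) := by
  rw [continuous_iff_continuousAt]
  intro b
  obtain ⟨σ, V, hσ, -, h0, rfl⟩ := exists_isLocalCoord (n := 3) b
  have hchart : ∀ y ∈ V, orbitFlux g Φ γ x (σ y) =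
      ∑ a, ((comp γ σ y)⁻¹ *ᵥ fun a => pd a (fun z => x (σ z)) y) a *
        pd 1 (fun z => comp g (gaussLift Φ σ) z 0 (tailIdx a)) (inclusion5 y) := by
    intro y hy
    rw [orbitFlux, hB.orbitGradient_unique (hB.modelForm_chartGradient hσ hy)]
    exact (hasDerivAt_pullForm_um hg hΦ hσ hy _).deriv
  have hxs : ContDiffOn ℝ ∞ (fun z => x (σ z)) V :=
    contMDiffOn_iff_contDiffOn.1 (hB.orbit.smooth.comp_contMDiffOn hσ.smooth)
  have hVn : V ∈ 𝓝 (0 : Fin 3 → ℝ) := hσ.isOpen.mem_nhds h0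
  have hcomp : ContinuousAt (comp γ σ) 0 := by
    refine continuousAt_pi.2 fun a => continuousAt_pi.2 fun b => ?_
    exact (hB.smooth σ V hσ a b).continuousOn.continuousAt hVn
  have hinv : ContinuousAt (fun y => (comp γ σ y)⁻¹) 0 := by
    have h1 : ContinuousAt (fun y => (comp γ σ y).det) 0 :=
      (continuous_id.matrix_det).continuousAt.comp hcomp
    have h2 : ContinuousAt (fun y => (comp γ σ y).adjugate) 0 :=
      (continuous_id.matrix_adjugate).continuousAt.comp hcomp
    have h3 := (h1.inv₀ (hB.det_comp_ne_zero hσ h0)).smul h2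
    refine h3.congr (Eventually.of_forall fun y => ?_)
    change _ = (comp γ σ y)⁻¹
    rw [Matrix.inv_def, Ring.inverse_eq_inv]
    rfl
  have hinc : ContinuousAt inclusion5 0 := contDiff_inclusion5.continuous.continuousAt
  have hl := hΦ.isLocalCoord hσ
  have hcont : ContinuousAt (fun y => orbitFlux g Φ γ x (σ y)) 0 := by
    have h1 : ContinuousAt (fun y => ∑ a, ((comp γ σ y)⁻¹ *ᵥ fun a => pd a (fun z => x (σ z)) y) a *
        pd 1 (fun z => comp g (gaussLift Φ σ) z 0 (tailIdx a)) (inclusion5 y)) 0 := by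
      refine tendsto_finsetSum _ fun a _ => Tendsto.mul ?_ ?_
      · change ContinuousAt (fun y => ∑ b, (comp γ σ y)⁻¹ a b * pd b (fun z => x (σ z)) y) 0
        refine tendsto_finsetSum _ fun b _ => Tendsto.mul ?_ ?_
        · exact (continuousAt_pi.1 (continuousAt_pi.1 hinv a) b)
        · exact ((contDiffOn_pd hσ.isOpen hxs b).continuousOn.continuousAt hVn)
      · have h2 := contDiffOn_pd hl.isOpen (hg.smooth _ _ hl 0 (tailIdx a)) 1
        have h3 : ContinuousAt (pd 1 fun z => comp g (gaussLift Φ σ) z 0 (tailIdx a))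
            (inclusion5 0) :=
          h2.continuousOn.continuousAt (hl.isOpen.mem_nhds (inclusion5_mem hΦ.pos h0))
        exact ContinuousAt.comp (f := inclusion5) h3 hinc
    refine h1.congr ?_
    filter_upwards [hVn] with y hy using (hchart y hy).symm
  intro S hS
  have h4 := hσ.image_mem_nhds h0 (hcont hS)
  change orbitFlux g Φ γ x ⁻¹' S ∈ 𝓝 (σ 0)
  refine mem_of_superset h4 ?_
  rintro _ ⟨y, hy, rfl⟩
  exact hy

lemma orbitFlux_eq_zero (hB : IsBiaxial γ C x) {e : ℝ} (he : e ^ 2 = 1) {b : B}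
    (hb : x b = e) : orbitFlux g Φ γ x b = 0 := by
  have := betaForm_smul_vec (g := g) (Φ := Φ) 0 b 0
  rw [orbitFlux, hB.orbitGradient_eq_zero he hb]
  simpa using this

lemma tendsto_fluxFun [CompactSpace B] (hg : IsLorentzianMetric g) (hgi : IsInvariant g)
    (hM : IsSmoothAction 5 M) (hΦ : IsGaussianNull g ι ε Φ) (hB : IsBiaxial γ C x) {e : ℝ}
    (he : e ^ 2 = 1) : Tendsto (fluxFun g Φ γ x) (𝓝[𝕀] e) (𝓝 0) := by
  rw [Metric.tendsto_nhds]
  intro δ hδ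
  have hcl : IsClosed {b | δ ≤ |orbitFlux g Φ γ x b|} :=
    isClosed_le continuous_const (continuous_orbitFlux hg hΦ hB).abs
  have himg : IsClosed (x '' {b | δ ≤ |orbitFlux g Φ γ x b|}) :=
    (hcl.isCompact.image hB.orbit.smooth.continuous).isClosed
  have hne : e ∈ (x '' {b | δ ≤ |orbitFlux g Φ γ x b|})ᶜ := by
    rintro ⟨b, hb, hbe⟩
    rw [Set.mem_ofPred_eq, orbitFlux_eq_zero hB he hbe, abs_zero] at hb
    exact absurd hb (not_le.2 hδ)
  filter_upwards [self_mem_nhdsWithin,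
    mem_nhdsWithin_of_mem_nhds (himg.isOpen_compl.mem_nhds hne)] with t ht ht'
  obtain ⟨b, rfl⟩ := hB.exists_x_eq (Ioo_subset_Icc_self ht)
  rw [fluxFun_eq hgi hM hΦ hB, Real.dist_eq, sub_zero]
  by_contra hcon
  exact ht' ⟨b, not_lt.1 hcon, rfl⟩

end Flux

section FrameContraction

variable {E : Type*} [AddCommGroup E] [Module ℝ E] (ν : E [⋀^Fin 5]→ₗ[ℝ] ℝ) {e : Fin 5 → E}
  {η : Fin 2 → E} {P : Matrix (Fin 2) (Fin 2) ℝ}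

lemma map_eq_zero_of_relation (v : Fin 5 → E) (k : Fin 5 → ℝ) (hk : ∃ i, k i ≠ 0)
    (h : ∑ i, k i • v i = 0) : ν v = 0 :=
  ν.map_linearDependent v (Fintype.not_linearIndependent_iff.2 ⟨k, h, hk⟩)

/-- In a frame whose last two vectors span the same plane as `η`, the contraction of a two-tensor
with a volume form evaluated on `η` and `e 2` only involves the first two frame vectors. -/
lemma sum_mul_volume_first (h3 : e 3 = ∑ i, P i 0 • η i) (h4 : e 4 = ∑ i, P i 1 • η i)
    (T : Matrix (Fin 5) (Fin 5) ℝ) :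
    ∑ a, ∑ b, T a b * ν ![e a, e b, η 1, η 0, e 2] =
      (T 0 1 - T 1 0) * ν ![e 0, e 1, η 1, η 0, e 2] := by
  have hrel (a : Fin 5) (ha : a = 2 ∨ a = 3 ∨ a = 4) : ∃ k1 k0 k2 : ℝ,
      e a = k1 • η 1 + k0 • η 0 + k2 • e 2 := by
    rcases ha with rfl | rfl | rfl
    · exact ⟨0, 0, 1, by simp⟩
    · exact ⟨P 1 0, P 0 0, 0, by rw [h3, sum_univ_two]; module⟩
    · exact ⟨P 1 1, P 0 1, 0, by rw [h4, sum_univ_two]; module⟩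
  have hl (a : Fin 5) (ha : a = 2 ∨ a = 3 ∨ a = 4) (z : E) :
      ν ![e a, z, η 1, η 0, e 2] = 0 := by
    obtain ⟨k1, k0, k2, hk⟩ := hrel a ha
    refine map_eq_zero_of_relation ν _ ![1, 0, -k1, -k0, -k2] ⟨0, by simp⟩ ?_
    rw [Fin.sum_univ_five]
    simp only [Matrix.cons_val]
    rw [hk]
    module
  have hr (a : Fin 5) (ha : a = 2 ∨ a = 3 ∨ a = 4) (z : E) :
      ν ![z, e a, η 1, η 0, e 2] = 0 := by
    obtain ⟨k1, k0, k2, hk⟩ := hrel a ha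
    refine map_eq_zero_of_relation ν _ ![0, 1, -k1, -k0, -k2] ⟨1, by simp⟩ ?_
    rw [Fin.sum_univ_five]
    simp only [Matrix.cons_val]
    rw [hk]
    module
  have hd (z : E) : ν ![z, z, η 1, η 0, e 2] = 0 :=
    ν.map_eq_zero_of_eq _ (i := 0) (j := 1) rfl (by decide)
  have hs : ν ![e 1, e 0, η 1, η 0, e 2] = -ν ![e 0, e 1, η 1, η 0, e 2] := by
    rw [← ν.map_swap _ (show (0 : Fin 5) ≠ 1 by decide)]
    congr 1
    funext i
    fin_cases i <;> rfl
  simp only [Fin.sum_univ_five, hl 2 (by simp), hl 3 (by simp), hl 4 (by simp), hr 2 (by simp),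
    hr 3 (by simp), hr 4 (by simp), hd, hs]
  ring

lemma sum_mul_volume_middle (h3 : e 3 = ∑ i, P i 0 • η i) (h4 : e 4 = ∑ i, P i 1 • η i)
    (T : Matrix (Fin 5) (Fin 5) ℝ) :
    ∑ a, ∑ b, T a b * ν ![η 0, η 1, e a, e b, e 2] =
      -(T 0 1 - T 1 0) * ν ![e 0, e 1, η 1, η 0, e 2] := by
  have hs (z w : E) : ν ![η 0, η 1, z, w, e 2] = -ν ![z, w, η 1, η 0, e 2] := by
    have h1 : ν ![w, z, η 1, η 0, e 2] = -ν ![z, w, η 1, η 0, e 2] := by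
      rw [← ν.map_swap _ (show (0 : Fin 5) ≠ 1 by decide)]
      congr 1
      funext i
      fin_cases i <;> rfl
    have h2 : ν ![η 0, z, η 1, w, e 2] = -ν ![w, z, η 1, η 0, e 2] := by
      rw [← ν.map_swap _ (show (0 : Fin 5) ≠ 3 by decide)]
      congr 1
      funext i
      fin_cases i <;> rfl
    have h3 : ν ![η 0, η 1, z, w, e 2] = -ν ![η 0, z, η 1, w, e 2] := by
      rw [← ν.map_swap _ (show (1 : Fin 5) ≠ 2 by decide)]
      congr 1
      funext i
      fin_cases i <;> rfl
    rw [h3, h2, h1, neg_neg]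
  simp only [hs, mul_neg, Finset.sum_neg_distrib]
  rw [sum_mul_volume_first ν h3 h4, neg_mul]

end FrameContraction

lemma IsBiaxial.differentiableAt_of_comp (h : IsBiaxial γ C x) {b : B}
    (hb1 : -1 < x b) (hb2 : x b < 1) {f : ℝ → ℝ}
    (hf : MDifferentiableAt (𝓡 3) 𝓘(ℝ, ℝ) (fun b' => f (x b')) b) :
    DifferentiableAt ℝ f (x b) ∧
      ∀ v, modelDiff (n := 3) (fun b' => f (x b')) b v = deriv f (x b) * modelDiff (n := 3) x b v := by
  obtain ⟨δ, c, hδ, hc, hcb⟩ := h.exists_section hb1 hb2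
  have hmem : x b ∈ Ioo (x b - δ) (x b + δ) := ⟨by linarith, by linarith⟩
  have hcd : MDifferentiableAt 𝓘(ℝ, ℝ) (𝓡 3) c (x b) := (hc.isTransversal h).mdifferentiableAt hmem
  have h1 := fderiv_comp_modelDeriv (n := 3) (f := fun b' => f (x b')) (c := c) (z := x b)
    (by rw [hcb]; exact hf) hcd
  have hd : DifferentiableAt ℝ f (x b) := by
    refine h1.differentiableAt.congr_of_eventuallyEq ?_
    filter_upwards [isOpen_Ioo.mem_nhds hmem] with t ht
    rw [hc.x_eq t ht]
  refine ⟨hd, fun v => ?_⟩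
  have h2 := HasMFDerivAt.comp (g := f) b hd.hasFDerivAt.hasMFDerivAt
    (h.mdifferentiable_x b).hasMFDerivAt
  have h3 := congrArg (fun L : 𝔼 3 →L[ℝ] ℝ => L v) h2.mfderiv
  refine h3.trans ?_
  change fderiv ℝ f (x b) (modelDiff x b v) = _
  rw [fderiv_eq_smul_deriv, smul_eq_mul, mul_comm]

/-- `Υ_x = ∂_x χ + (1/√3)(ψ¹ ∂_x ψ² - ψ² ∂_x ψ¹)`, with `x = cos θ`. -/
def MapData.Υx (Ψ : MapData) (t : ℝ) : ℝ :=
  deriv (fun t => Ψ.χ (arccos t)) t + 1 / sqrt 3 *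
    (Ψ.ψ 0 (arccos t) * deriv (fun t => Ψ.ψ 1 (arccos t)) t -
      Ψ.ψ 1 (arccos t) * deriv (fun t => Ψ.ψ 0 (arccos t)) t)

/-- `Θ^i_x = ∂_x ζ^i + ψ^i (∂_x χ + (1/(3√3))(ψ¹ ∂_x ψ² - ψ² ∂_x ψ¹))`, with `x = cos θ`. -/
def MapData.Θx (Ψ : MapData) (i : Fin 2) (t : ℝ) : ℝ :=
  deriv (fun t => Ψ.ζ i (arccos t)) t + Ψ.ψ i (arccos t) *
    (deriv (fun t => Ψ.χ (arccos t)) t + 1 / (3 * sqrt 3) *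
      (Ψ.ψ 0 (arccos t) * deriv (fun t => Ψ.ψ 1 (arccos t)) t -
        Ψ.ψ 1 (arccos t) * deriv (fun t => Ψ.ψ 0 (arccos t)) t))

lemma mfderiv_surface (hΦ : IsGaussianNull g ι ε Φ) (b : B) (v : 𝔼 3) :
    (mfderiv (𝓡 3) (𝓡 5) ι b v : 𝔼 5) = gaussDeriv Φ (0, 0, b) (0, 0, v) := by
  have hι : ι = fun b => Φ (0, 0, b) := funext fun b => (hΦ.base b).symm
  have hz := mem_nullDomain hΦ.zero_mem hΦ.zero_mem b
  rw [← vecB_eq hΦ hz]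
  subst hι
  rfl

lemma patch_zero (hΦ : IsGaussianNull g ι ε Φ) : patch Φ P c 0 = ι (c 0) := by
  rw [← linePoint_zero, patch_linePoint, hΦ.base]

lemma modelCoord_patch_zero (hΦ : IsGaussianNull g ι ε Φ)
    (hB : IsBiaxial (induced g ι) C x) (hc : IsTransversal x c J) (hP : P.det ≠ 0)
    (h0 : 0 ∈ J) (a : Fin 5) :
    modelCoord (patch Φ P c) 0 a = gaussDeriv Φ (0, 0, c 0) (patchVec P c 0 a) := by
  have hm := linePoint_mem hΦ.zero_mem hΦ.zero_mem h0
  have h2 : tail3 (linePoint 0 0 0) = ![0, 0, 0] := tail3_eq _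
  have h3 : torusExp (orbitAngle P ![0, 0, 0]) = 1 :=
    (torusExp_eq_one_iff _).2 fun i => ⟨0, by rw [orbitAngle_apply]; simp⟩
  have h4 : orbitCoord P c ![0, 0, 0] = c 0 := by
    change torusExp (orbitAngle P ![0, 0, 0]) • c 0 = c 0
    rw [h3, one_smul]
  have h1 := modelCoord_gaussLift hΦ (isLocalCoord_orbitCoord hB hc hP) hm a
  rw [liftVec_orbitCoord hB hc (y := tail3 (linePoint 0 0 0)) h0, h2, h3, h4, actDeriv_one] at h1
  rw [linePoint_zero] at h1
  exact h1

/-- A top form, with values on vectors of the model space. -/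
def modelTop (vol : TopForm 5 M) (m : M) : 𝔼 5 [⋀^Fin 5]→ₗ[ℝ] ℝ := vol m

lemma electricForm_eq (σ : (Fin 5 → ℝ) → M) (y : Fin 5 → ℝ) (v : 𝔼 5) :
    electricForm g F vol σ y v =
      -(1 / 2 * ∑ a, ∑ b, raise (comp g σ y) (comp F σ y) a b *
        modelTop vol (σ y) ![modelCoord σ y a, modelCoord σ y b, modelGen 1 (σ y),
          modelGen 0 (σ y), v]) := rfl

lemma twistForm_eq (σ : (Fin 5 → ℝ) → M) (i : Fin 2) (y : Fin 5 → ℝ) (v : 𝔼 5) :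
    twistForm g vol σ i y v =
      1 / 2 * ∑ a, ∑ b, raise (comp g σ y) (dGeneratorFlat g σ i y) a b *
        modelTop vol (σ y) ![modelGen 0 (σ y), modelGen 1 (σ y), modelCoord σ y a,
          modelCoord σ y b, v] := rfl

lemma modelCoord_patch_angle (hΦ : IsGaussianNull g ι ε Φ)
    (hB : IsBiaxial (induced g ι) C x) (hc : IsTransversal x c J) (hP : P.det ≠ 0)
    {y : Fin 5 → ℝ} (hy : y ∈ patchDomain ε J) (j : Fin 2) :
    modelCoord (patch Φ P c) y (tailIdx j.succ) =
      ∑ k, P k j • modelGen k (patch Φ P c y) := by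
  rw [modelCoord_gaussLift hΦ (isLocalCoord_orbitCoord hB hc hP) hy, liftVec_tailIdx,
    modelCoord_orbitCoord_succ hB hc (y := tail3 y) hy.2.2]
  have h1 : ((0, 0, ∑ i, P i j • modelGen i (orbitCoord P c (tail3 y))) :
      ℝ × ℝ × 𝔼 3) =
      ∑ i, P i j • (0, 0, modelGen i (orbitCoord P c (tail3 y))) := by
    simp [sum_univ_two]
  rw [h1, map_sum]
  refine sum_congr rfl fun i _ => ?_
  rw [map_smul, gaussDeriv_modelGen hB.action hΦ hy.1 hy.2.1]
  rfl

lemma modelGen_patch (hΦ : IsGaussianNull g ι ε Φ)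
    (hB : IsBiaxial (induced g ι) C x) (hc : IsTransversal x c J) (hP : P.det ≠ 0)
    {y : Fin 5 → ℝ} (hy : y ∈ patchDomain ε J) (i : Fin 2) :
    modelGen i (patch Φ P c y) =
      ∑ j, P⁻¹ j i • modelCoord (patch Φ P c) y (tailIdx j.succ) := by
  have h1 : P * P⁻¹ = 1 := Matrix.mul_nonsing_inv _ (isUnit_iff_ne_zero.2 hP)
  have h2 (k : Fin 2) : P k 0 * P⁻¹ 0 i + P k 1 * P⁻¹ 1 i = (1 : Matrix (Fin 2) (Fin 2) ℝ) k i := by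
    rw [← h1, Matrix.mul_apply, sum_univ_two]
  simp only [modelCoord_patch_angle hΦ hB hc hP hy, sum_univ_two]
  have e0 := h2 0
  have e1 := h2 1
  have h3 : P⁻¹ 0 i • (P 0 0 • modelGen 0 (patch Φ P c y) + P 1 0 • modelGen 1 (patch Φ P c y)) +
      P⁻¹ 1 i • (P 0 1 • modelGen 0 (patch Φ P c y) + P 1 1 • modelGen 1 (patch Φ P c y)) =
      (P 0 0 * P⁻¹ 0 i + P 0 1 * P⁻¹ 1 i) • modelGen (n := 5) 0 (patch Φ P c y) +
      (P 1 0 * P⁻¹ 0 i + P 1 1 * P⁻¹ 1 i) • modelGen (n := 5) 1 (patch Φ P c y) := by module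
  rw [h3, e0, e1]
  obtain rfl | rfl : i = 0 ∨ i = 1 := by fin_cases i <;> simp
  · simp
  · simp

lemma generatorFlat_patch (hΦ : IsGaussianNull g ι ε Φ)
    (hB : IsBiaxial (induced g ι) C x) (hc : IsTransversal x c J) (hP : P.det ≠ 0)
    {y : Fin 5 → ℝ} (hy : y ∈ patchDomain ε J) (i : Fin 2) (a : Fin 5) :
    generatorFlat g (patch Φ P c) i a y =
      ∑ j, P⁻¹ j i * comp g (patch Φ P c) y (tailIdx j.succ) a := by
  change modelForm g (patch Φ P c y) (modelGen i (patch Φ P c y)) (modelCoord (patch Φ P c) y a) = _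
  rw [modelGen_patch hΦ hB hc hP hy]
  simp only [map_sum, LinearMap.sum_apply, map_smul, LinearMap.smul_apply, smul_eq_mul]
  rfl

lemma dGeneratorFlat_patch (hg : IsLorentzianMetric g) (hgi : IsInvariant g)
    (hM : IsSmoothAction 5 M) (hΦ : IsGaussianNull g ι ε Φ)
    (hB : IsBiaxial (induced g ι) C x) (hc : IsTransversal x c J) (hP : P.det ≠ 0)
    {y : Fin 5 → ℝ} (hy : y ∈ patchDomain ε J) (i : Fin 2) :
    dGeneratorFlat g (patch Φ P c) i y 1 0 =
      ∑ j, P⁻¹ j i * pd 1 (fun z => comp g (patch Φ P c) z 0 (tailIdx j.succ)) y := by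
  have hO := (isLocalCoord_patch hΦ hB hc hP).isOpen
  have h1 : pd 0 (generatorFlat g (patch Φ P c) i 1) y = 0 := by
    refine pd_eq_zero_of_eventuallyEq_const (k := 0) ?_ 0
    filter_upwards [hO.mem_nhds hy] with z hz
    rw [generatorFlat_patch hΦ hB hc hP hz]
    refine Finset.sum_eq_zero fun j _ => ?_
    rw [comp_patch_one hg hgi hM hΦ hB hc hP hz]
    fin_cases j <;> simp [nullFrame, nullPartner, tailIdx]
  have h2 : generatorFlat g (patch Φ P c) i 0 =ᶠ[𝓝 y]
      fun z => ∑ j, P⁻¹ j i * comp g (patch Φ P c) z 0 (tailIdx j.succ) := by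
    filter_upwards [hO.mem_nhds hy] with z hz
    rw [generatorFlat_patch hΦ hB hc hP hz]
    exact sum_congr rfl fun j _ => congrArg _ (hg.form_symm _ _ _)
  have hd (j : Fin 2) : DifferentiableAt ℝ
      (fun z => comp g (patch Φ P c) z 0 (tailIdx j.succ)) y :=
    ((contDiffOn_comp_patch hg.smooth hΦ hB hc hP _ _).contDiffAt (hO.mem_nhds hy)).differentiableAt
      (by simp)
  rw [dGeneratorFlat, Matrix.of_apply, h1, sub_zero, pd, h2.fderiv_eq,
    fderiv_fun_sum fun j _ => (hd j).const_mul _, _root_.sum_apply]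
  refine sum_congr rfl fun j _ => ?_
  rw [fderiv_const_mul (hd j)]
  rfl

/-- The square of the volume of the frame formed by the null vectors, the generators and the
velocity of the transversal curve. -/
lemma volume_patch_sq (hM : IsBiaxisymmetricSolution Λ g F vol) (hΦ : IsGaussianNull g ι ε Φ)
    (hB : IsBiaxial (induced g ι) C x) (hc : IsTransversal x c J) (hP : P.det ≠ 0)
    (h0 : 0 ∈ J) (horth : IsOrthogonalCurve (induced g ι) c J)
    (hvel : modelForm (induced g ι) (c 0) (velocity c 0) (velocity c 0) = 1) :
    modelTop vol (patch Φ P c 0) ![modelCoord (patch Φ P c) 0 0, modelCoord (patch Φ P c) 0 1,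
      modelGen 1 (patch Φ P c 0), modelGen 0 (patch Φ P c 0), modelCoord (patch Φ P c) 0 2] ^ 2 =
      gramDet (induced g ι) (c 0) := by
  have hg := hM.lorentzian
  have hpt : patch Φ P c 0 = Φ (0, 0, c 0) := (patch_zero hΦ).trans (hΦ.base _).symm
  have hz := hΦ.zero_mem
  have hv := modelCoord_patch_zero hΦ hB hc hP h0
  have hG (i : Fin 2) := gaussDeriv_modelGen hB.action hΦ hz hz i (c 0)
  rw [hv, hv, hv, hpt, ← hG, ← hG]
  refine (hM.oriented.sq_eq _ _).trans ?_
  have hm : (Matrix.of fun i j => g (Φ (0, 0, c 0))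
      ((![gaussDeriv Φ (0, 0, c 0) (patchVec P c 0 0), gaussDeriv Φ (0, 0, c 0) (patchVec P c 0 1),
        gaussDeriv Φ (0, 0, c 0) (0, 0, modelGen 1 (c 0)),
        gaussDeriv Φ (0, 0, c 0) (0, 0, modelGen 0 (c 0)),
        gaussDeriv Φ (0, 0, c 0) (patchVec P c 0 2)] : Fin 5 → 𝔼 5) i)
      ((![gaussDeriv Φ (0, 0, c 0) (patchVec P c 0 0), gaussDeriv Φ (0, 0, c 0) (patchVec P c 0 1),
        gaussDeriv Φ (0, 0, c 0) (0, 0, modelGen 1 (c 0)),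
        gaussDeriv Φ (0, 0, c 0) (0, 0, modelGen 0 (c 0)),
        gaussDeriv Φ (0, 0, c 0) (patchVec P c 0 2)] : Fin 5 → 𝔼 5) j)) =
      !![0, -1, 0, 0, 0; -1, 0, 0, 0, 0;
        0, 0, gram (induced g ι) (c 0) 1 1, gram (induced g ι) (c 0) 0 1, 0;
        0, 0, gram (induced g ι) (c 0) 0 1, gram (induced g ι) (c 0) 0 0, 0; 0, 0, 0, 0, 1] := by
    have hu := hΦ.pullForm_uu hz (c 0)
    have hur := hΦ.pullForm_ur hz hz (c 0)
    have hrr := hΦ.pullForm_rr hz hz (c 0)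
    have hum := hΦ.pullForm_um hz (c 0)
    have hrm := hΦ.pullForm_rm hz hz (c 0)
    have hbb (v w : 𝔼 3) := (modelForm_induced hΦ (c 0) v w).symm
    have hs := pullForm_symm (Φ := Φ) hg (0, 0, c 0)
    have hgs := hB.gram_symm (c 0)
    have horth' (i : Fin 2) := horth 0 h0 i
    have hfs := hB.form_symm (c 0)
    ext i j
    fin_cases i <;> fin_cases j
    · exact hu
    · exact hur
    · exact hum _
    · exact hum _
    · exact hum _
    · exact (hs _ _).trans hur
    · exact hrr
    · exact hrm _
    · exact hrm _
    · exact hrm _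
    · exact (hs _ _).trans (hum _)
    · exact (hs _ _).trans (hrm _)
    · exact hbb _ _
    · exact (hbb _ _).trans (hgs 1 0)
    · exact (hbb _ _).trans ((hfs _ _).trans (horth' 1))
    · exact (hs _ _).trans (hum _)
    · exact (hs _ _).trans (hrm _)
    · exact hbb _ _
    · exact hbb _ _
    · exact (hbb _ _).trans ((hfs _ _).trans (horth' 0))
    · exact (hs _ _).trans (hum _)
    · exact (hs _ _).trans (hrm _)
    · exact (hbb _ _).trans (horth' 1)
    · exact (hbb _ _).trans (horth' 0)
    · exact (hbb _ _).trans hvel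
  refine (congrArg (fun A : Matrix (Fin 5) (Fin 5) ℝ => |A.det|) hm).trans ?_
  have hpos := hB.gramDet_pos (hc.interior 0 h0).1 (hc.interior 0 h0).2
  have hdet : gramDet (induced g ι) (c 0) = gram (induced g ι) (c 0) 0 0 *
    gram (induced g ι) (c 0) 1 1 - gram (induced g ι) (c 0) 0 1 ^ 2 := by
    rw [gramDet]
  rw [← abs_of_pos hpos, ← abs_neg (gramDet _ _), hdet]
  congr 1
  simp [Matrix.det_succ_row_zero, Fin.sum_univ_succ, Fin.succAbove]
  ring

/-- The field strength and the normal connection on the surface, in terms of the potentials. -/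
lemma matter_patch (hM : IsBiaxisymmetricSolution Λ g F vol) (hΦ : IsGaussianNull g ι ε Φ)
    (hB : IsBiaxial (induced g ι) C x) (hc : IsTransversal x c J) (hP : P.det ≠ 0)
    (h0 : 0 ∈ J) (horth : IsOrthogonalCurve (induced g ι) c J)
    (hvel : modelForm (induced g ι) (c 0) (velocity c 0) (velocity c 0) = 1)
    (hG0 : comp g (patch Φ P c) 0 = nullFrame) (hΨ : IsInducedMap g F vol ι x p q Ψ) {κ : ℝ}
    (hκ : modelDiff (n := 3) x (c 0) (velocity c 0) = κ) :
    (∀ j : Fin 2, comp F (patch Φ P c) 0 2 (tailIdx j.succ) =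
      -(κ * ∑ i, P i j * deriv (fun t => Ψ.ψ i (arccos t)) (x (c 0)))) ∧
    ∃ (ν : ℝ) (a : Fin 2 → ℝ), ν ^ 2 = gramDet (induced g ι) (c 0) ∧
      κ * Ψ.Υx (x (c 0)) = comp F (patch Φ P c) 0 0 1 * ν ∧
      (∀ j : Fin 2, ∑ i, P i j * a i =
        pd 1 (fun z => comp g (patch Φ P c) z 0 (tailIdx j.succ)) 0) ∧
      ∀ i, κ * Ψ.Θx i (x (c 0)) = -(a i * ν) := by
  obtain ⟨hx1, hx2⟩ := hc.interior 0 h0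
  have hl := isLocalCoord_patch hΦ hB hc hP
  have hm0 : (0 : Fin 5 → ℝ) ∈ patchDomain ε J := by
    rw [← linePoint_zero]; exact linePoint_mem hΦ.zero_mem hΦ.zero_mem h0
  have hpt : patch Φ P c 0 = ι (c 0) := patch_zero hΦ
  have hv2 : (mfderiv (𝓡 3) (𝓡 5) ι (c 0) (velocity c 0) : 𝔼 5) =
      modelCoord (patch Φ P c) 0 2 := by
    rw [mfderiv_surface hΦ, modelCoord_patch_zero hΦ hB hc hP h0]
    rfl
  have hψ (i : Fin 2) := hB.differentiableAt_of_comp hx1 hx2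
    (f := fun t => Ψ.ψ i (arccos t)) (hΨ.magnetic_smooth i (c 0) hx1 hx2)
  have hχ := hB.differentiableAt_of_comp hx1 hx2
    (f := fun t => Ψ.χ (arccos t)) (hΨ.electric_smooth (c 0) hx1 hx2)
  have hζ (i : Fin 2) := hB.differentiableAt_of_comp hx1 hx2
    (f := fun t => Ψ.ζ i (arccos t)) (hΨ.twist_smooth i (c 0) hx1 hx2)
  have dψ (i : Fin 2) : dfun (n := 3) (fun b' => Ψ.ψ i (arccos (x b'))) (c 0) (velocity c 0) =
      deriv (fun t => Ψ.ψ i (arccos t)) (x (c 0)) * κ := ((hψ i).2 _).trans (by rw [hκ])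
  have dχ : dfun (n := 3) (fun b' => Ψ.χ (arccos (x b'))) (c 0) (velocity c 0) =
      deriv (fun t => Ψ.χ (arccos t)) (x (c 0)) * κ := (hχ.2 _).trans (by rw [hκ])
  have dζ (i : Fin 2) : dfun (n := 3) (fun b' => Ψ.ζ i (arccos (x b'))) (c 0) (velocity c 0) =
      deriv (fun t => Ψ.ζ i (arccos t)) (x (c 0)) * κ := ((hζ i).2 _).trans (by rw [hκ])
  have hFs (m : M) (v w : 𝔼 5) : modelForm F m v w = -modelForm F m w v := by
    have h1 : modelForm F m (v + w) (v + w) = 0 := hM.alternating m _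
    have h2 : modelForm F m v v = 0 := hM.alternating m _
    have h3 : modelForm F m w w = 0 := hM.alternating m _
    simp only [map_add, LinearMap.add_apply, h2, h3] at h1
    linarith
  have hmag (i : Fin 2) : modelForm F (patch Φ P c 0) (modelGen i (patch Φ P c 0))
      (modelCoord (patch Φ P c) 0 2) = deriv (fun t => Ψ.ψ i (arccos t)) (x (c 0)) * κ := by
    rw [← dψ, hpt, ← hv2]
    exact (hΨ.magnetic i (c 0) hx1 hx2 (velocity c 0)).symm
  refine ⟨fun j => ?_, ?_⟩
  · rw [comp_eq_modelForm, hFs, modelCoord_patch_angle hΦ hB hc hP hm0, map_sum,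
      LinearMap.sum_apply, mul_sum]
    congr 1
    refine sum_congr rfl fun i _ => ?_
    rw [map_smul, LinearMap.smul_apply, hmag, smul_eq_mul]
    ring
  · set ν : ℝ := modelTop vol (patch Φ P c 0) ![modelCoord (patch Φ P c) 0 0,
      modelCoord (patch Φ P c) 0 1, modelGen 1 (patch Φ P c 0), modelGen 0 (patch Φ P c 0),
      modelCoord (patch Φ P c) 0 2] with hν
    set a : Fin 2 → ℝ := fun i =>
      ∑ j, P⁻¹ j i * pd 1 (fun z => comp g (patch Φ P c) z 0 (tailIdx j.succ)) 0 with ha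
    have h3 : modelCoord (patch Φ P c) 0 3 = ∑ i, P i 0 • modelGen i (patch Φ P c 0) :=
      modelCoord_patch_angle hΦ hB hc hP hm0 0
    have h4 : modelCoord (patch Φ P c) 0 4 = ∑ i, P i 1 • modelGen i (patch Φ P c 0) :=
      modelCoord_patch_angle hΦ hB hc hP hm0 1
    have helec : electricForm g F vol (patch Φ P c) 0 (modelCoord (patch Φ P c) 0 2) =
        comp F (patch Φ P c) 0 0 1 * ν := by
      rw [electricForm_eq, sum_mul_volume_first (η := fun i => modelGen i (patch Φ P c 0))
        (modelTop vol (patch Φ P c 0)) h3 h4, hG0, raise_nullFrame, raise_nullFrame, ← hν]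
      have h5 : comp F (patch Φ P c) 0 1 0 = -comp F (patch Φ P c) 0 0 1 := hFs _ _ _
      simp only [nullSign, nullPartner, Matrix.cons_val_zero, Matrix.cons_val_one, h5]
      ring
    have htwist (i : Fin 2) : twistForm g vol (patch Φ P c) i 0 (modelCoord (patch Φ P c) 0 2) =
        -(a i * ν) := by
      rw [twistForm_eq, sum_mul_volume_middle (η := fun i => modelGen i (patch Φ P c 0))
        (modelTop vol (patch Φ P c 0)) h3 h4, hG0, raise_nullFrame, raise_nullFrame, ← hν]
      have h5 : dGeneratorFlat g (patch Φ P c) i 0 0 1 =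
          -dGeneratorFlat g (patch Φ P c) i 0 1 0 := by
        simp only [dGeneratorFlat, Matrix.of_apply]; ring
      simp only [nullSign, nullPartner, Matrix.cons_val_zero, Matrix.cons_val_one, h5]
      rw [dGeneratorFlat_patch hM.lorentzian hM.invariant_metric hM.action hΦ hB hc hP hm0]
      ring
    refine ⟨ν, a, volume_patch_sq hM hΦ hB hc hP h0 horth hvel, ?_, fun j => ?_, fun i => ?_⟩
    · have h5 := hΨ.electric _ _ hl 0 hm0 (c 0) hpt hx1 hx2 _ rfl (velocity c 0)
      rw [dχ, dψ, dψ] at h5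
      have h6 : deriv (fun t => Ψ.χ (arccos t)) (x (c 0)) * κ =
        electricForm g F vol (patch Φ P c) 0 (modelCoord (patch Φ P c) 0 2) - _ :=
        h5.trans (by rw [← hv2])
      rw [helec] at h6
      rw [MapData.Υx]
      linear_combination h6
    · have h5 : P⁻¹ * P = 1 := Matrix.nonsing_inv_mul _ (isUnit_iff_ne_zero.2 hP)
      have h6 (k : Fin 2) : P⁻¹ k 0 * P 0 j + P⁻¹ k 1 * P 1 j =
          (1 : Matrix (Fin 2) (Fin 2) ℝ) k j := by
        rw [← h5, Matrix.mul_apply, sum_univ_two]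
      have e0 := h6 0
      have e1 := h6 1
      simp only [ha, sum_univ_two]
      obtain rfl | rfl : j = 0 ∨ j = 1 := by fin_cases j <;> simp
      · simp only [Matrix.one_apply_eq, Matrix.one_apply_ne (one_ne_zero)] at e0 e1
        linear_combination
          (pd 1 (fun z => comp g (patch Φ P c) z 0 (tailIdx (Fin.succ 0))) 0) * e0 +
          (pd 1 (fun z => comp g (patch Φ P c) z 0 (tailIdx (Fin.succ 1))) 0) * e1
      · simp only [Matrix.one_apply_eq, Matrix.one_apply_ne (zero_ne_one)] at e0 e1
        linear_combination
          (pd 1 (fun z => comp g (patch Φ P c) z 0 (tailIdx (Fin.succ 0))) 0) * e0 +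
          (pd 1 (fun z => comp g (patch Φ P c) z 0 (tailIdx (Fin.succ 1))) 0) * e1
    · have h5 := hΨ.twist i _ _ hl 0 hm0 (c 0) hpt hx1 hx2 _ rfl (velocity c 0)
      rw [dζ, dχ, dψ, dψ] at h5
      have h6 : deriv (fun t => Ψ.ζ i (arccos t)) (x (c 0)) * κ =
        twistForm g vol (patch Φ P c) i 0 (modelCoord (patch Φ P c) 0 2) - _ :=
        h5.trans (by rw [← hv2])
      rw [htwist] at h6
      rw [MapData.Θx]
      linear_combination h6

/-- A basis which is orthonormal for a positive definite form on `ℝ²`. -/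
lemma exists_orthonormal_basis {a b d : ℝ} (ha : 0 < a) (hD : 0 < a * d - b ^ 2) :
    ∃ P : Matrix (Fin 2) (Fin 2) ℝ, P.det ^ 2 * (a * d - b ^ 2) = 1 ∧
      (∀ i j, P 0 i * P 0 j * a + P 0 i * P 1 j * b + (P 1 i * P 0 j * b + P 1 i * P 1 j * d) =
        if i = j then 1 else 0) ∧
      ∀ u v : ℝ, (P 0 0 * u + P 1 0 * v) ^ 2 + (P 0 1 * u + P 1 1 * v) ^ 2 =
        (d * u ^ 2 - 2 * b * u * v + a * v ^ 2) / (a * d - b ^ 2) := by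
  set s := sqrt a with hs
  set r := sqrt (a * d - b ^ 2) with hr
  have hs2 : s ^ 2 = a := sq_sqrt ha.le
  have hr2 : r ^ 2 = a * d - b ^ 2 := sq_sqrt hD.le
  have hs0 : s ≠ 0 := (sqrt_pos.2 ha).ne'
  have hr0 : r ≠ 0 := (sqrt_pos.2 hD).ne'
  have hd : d = (r ^ 2 + b ^ 2) / s ^ 2 := by
    rw [hr2, hs2]; field_simp; ring
  refine ⟨!![1 / s, -b / (s * r); 0, s / r], ?_, ?_, ?_⟩
  · rw [← hr2, Matrix.det_fin_two_of]
    field_simp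
    ring
  · intro i j
    rw [hd, ← hs2]
    fin_cases i <;> fin_cases j <;> simp <;> field_simp <;> ring
  · intro u v
    rw [← hr2, hd, ← hs2]
    simp
    field_simp
    ring

/-- The determinant of the Gram matrix of the generators, as a function of `x`. -/
def orbitDet (γ : TwoTensor 3 B) (x : B → ℝ) (t : ℝ) : ℝ :=
  orbitGram γ x t 0 0 * orbitGram γ x t 1 1 - orbitGram γ x t 0 1 ^ 2

lemma IsBiaxial.orbitDet_eq (h : IsBiaxial γ C x) (b : B) :
    orbitDet γ x (x b) = gramDet γ b := by
  rw [orbitDet, h.orbitGram_eq, h.orbitGram_eq, h.orbitGram_eq]; rfl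

lemma IsOrbitSection.reparam (hc : IsOrbitSection x c J) (h : IsBiaxial γ C x)
    (x₀ : ℝ) {κ : ℝ} (hκ : κ ≠ 0) :
    IsTransversal x (fun t => c (x₀ + κ * t)) {t | x₀ + κ * t ∈ J} ∧
      ∀ t, x₀ + κ * t ∈ J →
        velocity (fun t => c (x₀ + κ * t)) t = κ • velocity c (x₀ + κ * t) := by
  have hvel (t : ℝ) (ht : x₀ + κ * t ∈ J) :
      velocity (fun t => c (x₀ + κ * t)) t = κ • velocity c (x₀ + κ * t) := by
    have h1 : HasDerivAt (fun t : ℝ => x₀ + κ * t) κ t := by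
      simpa using ((hasDerivAt_id t).const_mul κ).const_add x₀
    have h2 := HasMFDerivAt.comp (g := c) t
      ((hc.isTransversal h).mdifferentiableAt ht).hasMFDerivAt h1.hasFDerivAt.hasMFDerivAt
    refine (congrArg (fun L : ℝ →L[ℝ] 𝔼 3 => L 1) h2.mfderiv).trans ?_
    change modelDeriv c (x₀ + κ * t) ((1 : ℝ) • κ) = κ • modelDeriv c (x₀ + κ * t) 1
    rw [← map_smul]
    simp
  refine ⟨⟨?_, ?_, ?_, ?_⟩, hvel⟩
  · exact hc.isOpen.preimage (by fun_prop)
  · refine hc.smooth.comp (ContDiff.contMDiff ?_).contMDiffOn fun t ht => ht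
    fun_prop
  · intro t ht
    rw [hc.x_eq _ ht]
    exact hc.subset ht
  · intro t ht
    change modelDiff (n := 3) x _ (velocity (fun t => c (x₀ + κ * t)) t) ≠ 0
    rw [hvel t ht, map_smul, hc.modelDiff_velocity h ht]
    simpa using hκ

lemma IsBiaxial.orbitGram_smooth (h : IsBiaxial γ C x) (i j : Fin 2) :
    ContDiffOn ℝ ∞ (fun t => orbitGram γ x t i j) (𝕀) := by
  intro t ht
  obtain ⟨b, rfl⟩ := h.exists_x_eq (Ioo_subset_Icc_self ht)
  obtain ⟨δ, c, hδ, hc, -⟩ := h.exists_section ht.1 ht.2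
  have hmem : x b ∈ Ioo (x b - δ) (x b + δ) := ⟨by linarith, by linarith⟩
  have h1 := (hc.gram_smooth h i j).contDiffAt (isOpen_Ioo.mem_nhds hmem)
  refine (h1.congr_of_eventuallyEq ?_).contDiffWithinAt
  filter_upwards [isOpen_Ioo.mem_nhds hmem] with s hs
  rw [← h.orbitGram_eq, hc.x_eq s hs]

lemma IsBiaxial.orbitDet_pos (h : IsBiaxial γ C x) {t : ℝ} (ht : t ∈ 𝕀) : 0 < orbitDet γ x t := by
  obtain ⟨b, rfl⟩ := h.exists_x_eq (Ioo_subset_Icc_self ht)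
  rw [h.orbitDet_eq]
  exact h.gramDet_pos ht.1 ht.2

lemma IsBiaxial.deriv_deriv_orbitDet (h : IsBiaxial γ C x) {t : ℝ} (ht : t ∈ 𝕀) :
    deriv (deriv (orbitDet γ x)) t =
      deriv (deriv fun t => orbitGram γ x t 0 0) t * orbitGram γ x t 1 1 +
        orbitGram γ x t 0 0 * deriv (deriv fun t => orbitGram γ x t 1 1) t -
        2 * orbitGram γ x t 0 1 * deriv (deriv fun t => orbitGram γ x t 0 1) t +
        2 * (deriv (fun t => orbitGram γ x t 0 0) t * deriv (fun t => orbitGram γ x t 1 1) t -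
          deriv (fun t => orbitGram γ x t 0 1) t ^ 2) := by
  have hs (i j : Fin 2) := h.orbitGram_smooth i j
  have hd1 (i j : Fin 2) (s : ℝ) (hs' : s ∈ 𝕀) :
      HasDerivAt (fun t => orbitGram γ x t i j) (deriv (fun t => orbitGram γ x t i j) s) s :=
    (((hs i j).contDiffAt (isOpen_Ioo.mem_nhds hs')).differentiableAt (by simp)).hasDerivAt
  have hd2 (i j : Fin 2) : HasDerivAt (deriv fun t => orbitGram γ x t i j)
      (deriv (deriv fun t => orbitGram γ x t i j) t) t :=
    ((((hs i j).deriv_of_isOpen (m := ∞) isOpen_Ioo (by simp)).contDiffAt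
      (isOpen_Ioo.mem_nhds ht)).differentiableAt (by simp)).hasDerivAt
  have h1 : deriv (orbitDet γ x) =ᶠ[𝓝 t] fun s =>
      deriv (fun t => orbitGram γ x t 0 0) s * orbitGram γ x s 1 1 +
        orbitGram γ x s 0 0 * deriv (fun t => orbitGram γ x t 1 1) s -
        2 * orbitGram γ x s 0 1 * deriv (fun t => orbitGram γ x t 0 1) s := by
    filter_upwards [isOpen_Ioo.mem_nhds ht] with s hs'
    refine ((((hd1 0 0 s hs').mul (hd1 1 1 s hs')).sub ((hd1 0 1 s hs').pow 2)).deriv).trans ?_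
    simp
  have h2 := (((hd2 0 0).mul (hd1 1 1 t ht)).add ((hd1 0 0 t ht).mul (hd2 1 1))).sub
    (((hd1 0 1 t ht).const_mul 2).mul (hd2 0 1))
  rw [h1.deriv_eq]
  refine h2.deriv.trans ?_
  ring

/-- The adjugate quadratic form `det λ · λ⁻¹(u, u)` of the Gram matrix of the generators. -/
def orbitAdj (γ : TwoTensor 3 B) (x : B → ℝ) (t : ℝ) (u : Fin 2 → ℝ) : ℝ :=
  orbitGram γ x t 1 1 * u 0 ^ 2 - 2 * orbitGram γ x t 0 1 * u 0 * u 1 +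
    orbitGram γ x t 0 0 * u 1 ^ 2

/-- The stability inequality on the orbit space. -/
lemma orbit_inequality (hM : IsBiaxisymmetricSolution Λ g F vol) (hΦ : IsGaussianNull g ι ε Φ)
    (hexp : ∀ b, expansion g Φ 0 0 b = 0) (hst : ∀ b, deriv (fun r => expansion g Φ 0 r b) 0 ≤ 0)
    (hB : IsBiaxial (induced g ι) C x) (hΨ : IsInducedMap g F vol ι x p q Ψ) {x₀ : ℝ}
    (hx₀ : x₀ ∈ 𝕀) :
    DifferentiableAt ℝ (fluxFun g Φ (induced g ι) x) x₀ ∧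
    deriv (fluxFun g Φ (induced g ι) x) x₀ +
        fluxFun g Φ (induced g ι) x x₀ ^ 2 / (2 * (C ^ 2 * orbitDet (induced g ι) x x₀)) +
        C ^ 2 / 2 * (orbitAdj (induced g ι) x x₀ (fun i => Ψ.Θx i x₀) /
          orbitDet (induced g ι) x x₀) +
        C ^ 2 / 2 * orbitAdj (induced g ι) x x₀
          (fun i => deriv (fun t => Ψ.ψ i (arccos t)) x₀) +
        C ^ 2 / 2 * Ψ.Υx x₀ ^ 2 + 12 * Λ ≤
      C ^ 2 * (1 / 2 * (deriv (fun t => orbitGram (induced g ι) x t 0 0) x₀ *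
          deriv (fun t => orbitGram (induced g ι) x t 1 1) x₀ -
          deriv (fun t => orbitGram (induced g ι) x t 0 1) x₀ ^ 2) -
        deriv (deriv (orbitDet (induced g ι) x)) x₀) := by
  set γ := induced g ι with hγ
  obtain ⟨b, hb⟩ := hB.exists_x_eq (Ioo_subset_Icc_self hx₀)
  obtain ⟨δ, c, hδ, hc, horth, hcb⟩ := hB.exists_orthogonal_section (b := b)
    (by rw [hb]; exact hx₀.1) (by rw [hb]; exact hx₀.2)
  rw [hb] at hc horth hcb
  set J₀ := Ioo (x₀ - δ) (x₀ + δ) with hJ₀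
  set D := orbitDet γ x x₀ with hD
  have hDpos : 0 < D := hB.orbitDet_pos hx₀
  have hC := hB.orbit.pos
  set κ := C * sqrt D with hκ
  have hκ2 : κ ^ 2 = C ^ 2 * D := by rw [hκ, mul_pow, sq_sqrt hDpos.le]
  have hκpos : 0 < κ := mul_pos hC (sqrt_pos.2 hDpos)
  obtain ⟨hct, hvel⟩ := hc.reparam hB x₀ hκpos.ne'
  set c' : ℝ → B := fun t => c (x₀ + κ * t) with hc'
  set J : Set ℝ := {t | x₀ + κ * t ∈ J₀} with hJ
  have h0 : (0 : ℝ) ∈ J := by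
    change x₀ + κ * 0 ∈ J₀
    rw [mul_zero, add_zero]
    exact ⟨by linarith, by linarith⟩
  have hc0 : c' 0 = b := by simp only [hc', mul_zero, add_zero]; exact hcb
  have hsub (t : ℝ) (ht : t ∈ J) : x₀ + κ * t ∈ 𝕀 := hc.subset ht
  have hxc (t : ℝ) (ht : t ∈ J) : x (c' t) = x₀ + κ * t := hc.x_eq _ ht
  have hgr (t : ℝ) (ht : t ∈ J) (i j : Fin 2) : gram γ (c' t) i j = orbitGram γ x (x₀ + κ * t) i j := by
    rw [← hxc t ht, hB.orbitGram_eq]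
  have hLs (t : ℝ) : orbitGram γ x t 1 0 = orbitGram γ x t 0 1 := by
    rw [orbitGram, orbitGram]
    split_ifs
    exacts [hB.gram_symm _ _ _, rfl]
  have hL00 : 0 < orbitGram γ x x₀ 0 0 := by
    rw [← hb, hB.orbitGram_eq]
    exact hB.gram_diag_pos (by rw [hb]; exact hx₀.1) (by rw [hb]; exact hx₀.2) 0
  obtain ⟨P, hP1, hP2, hP3⟩ := exists_orthonormal_basis hL00 hDpos
  change P.det ^ 2 * D = 1 at hP1
  have hPdet : P.det ≠ 0 := by
    intro h; rw [h] at hP1; norm_num at hP1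
  have hdet2 : P.det = P 0 0 * P 1 1 - P 0 1 * P 1 0 := Matrix.det_fin_two P
  have hμ (i j : Fin 2) (t : ℝ) (ht : t ∈ J) : curveGram γ P c' i j t =
      P 0 i * P 0 j * orbitGram γ x (x₀ + κ * t) 0 0 +
        (P 0 i * P 1 j + P 1 i * P 0 j) * orbitGram γ x (x₀ + κ * t) 0 1 +
        P 1 i * P 1 j * orbitGram γ x (x₀ + κ * t) 1 1 := by
    rw [curveGram]
    simp only [sum_univ_two, hgr t ht, hLs]
    ring
  have hμ0 (i j : Fin 2) : curveGram γ P c' i j 0 = if i = j then 1 else 0 := by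
    rw [hμ i j 0 h0, mul_zero, add_zero, ← hP2 i j]
    ring
  have horth' : IsOrthogonalCurve γ c' J := by
    intro t ht i
    rw [hvel t ht, map_smul, LinearMap.smul_apply, horth _ ht i, smul_zero]
  have hdx (t : ℝ) (ht : t ∈ J) : modelDiff (n := 3) x (c' t) (velocity c' t) = κ := by
    rw [hvel t ht, map_smul, hc.modelDiff_velocity hB ht, smul_eq_mul, mul_one]
  have hdetμ (t : ℝ) (ht : t ∈ J) : curveGram γ P c' 0 0 t * curveGram γ P c' 1 1 t -
      curveGram γ P c' 0 1 t ^ 2 = P.det ^ 2 * orbitDet γ x (x₀ + κ * t) := by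
    rw [hμ _ _ t ht, hμ _ _ t ht, hμ _ _ t ht, hdet2, orbitDet]
    ring
  have hnorm (t : ℝ) (ht : t ∈ J) : modelForm γ (c' t) (velocity c' t) (velocity c' t) *
      (curveGram γ P c' 0 0 t * curveGram γ P c' 1 1 t - curveGram γ P c' 0 1 t ^ 2) = 1 := by
    have h1 := hB.normal_sq (hct.interior t ht).1 (hct.interior t ht).2 (horth' t ht)
    rw [hdx t ht, ← hB.orbitDet_eq, hxc t ht, hκ2] at h1
    rw [hdetμ t ht]
    have h2 : D = orbitDet γ x (x₀ + κ * t) *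
        modelForm γ (c' t) (velocity c' t) (velocity c' t) :=
      mul_left_cancel₀ (pow_pos hC 2).ne' h1
    rw [← hP1]
    conv_rhs => rw [h2]
    ring
  have hvel0 : modelForm γ (c' 0) (velocity c' 0) (velocity c' 0) = 1 := by
    have := hnorm 0 h0
    simpa [hμ0] using this
  have hineq := patch_inequality hM hΦ hB hct hPdet h0 (hexp _) (hst _) horth' hμ0 hnorm
  have hG0 := comp_patch_zero_frame hM.lorentzian hM.invariant_metric hM.action hΦ hB hct hPdet h0
    horth' hvel0 hμ0
  obtain ⟨hF2, ν, a, hν, hΥ, ha, hΘ⟩ := matter_patch hM hΦ hB hct hPdet h0 horth' hvel0 hG0 hΨ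
    (hdx 0 h0)
  have hxc0 : x (c' 0) = x₀ := by rw [hxc 0 h0, mul_zero, add_zero]
  rw [← hB.orbitDet_eq, hxc0] at hν
  rw [hxc0] at hΥ hΘ
  simp only [hxc0] at hF2
  -- derivatives of the Gram matrix
  have hlin (t : ℝ) : HasDerivAt (fun t : ℝ => x₀ + κ * t) κ t := by
    simpa using ((hasDerivAt_id t).const_mul κ).const_add x₀
  have hd1 (i j : Fin 2) (t : ℝ) (ht : t ∈ J) :
      HasDerivAt (fun t => orbitGram γ x (x₀ + κ * t) i j)
        (deriv (fun t => orbitGram γ x t i j) (x₀ + κ * t) * κ) t :=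
    HasDerivAt.comp (h := fun t => x₀ + κ * t) (h₂ := fun t => orbitGram γ x t i j) t
      ((((hB.orbitGram_smooth i j).contDiffAt
        (isOpen_Ioo.mem_nhds (hsub t ht))).differentiableAt (by simp)).hasDerivAt) (hlin t)
  have hd2 (i j : Fin 2) :
      HasDerivAt (fun t => deriv (fun t => orbitGram γ x t i j) (x₀ + κ * t))
        (deriv (deriv fun t => orbitGram γ x t i j) (x₀ + κ * 0) * κ) 0 :=
    HasDerivAt.comp (h := fun t => x₀ + κ * t) (h₂ := deriv fun t => orbitGram γ x t i j) 0
      (((((hB.orbitGram_smooth i j).deriv_of_isOpen (m := ∞) isOpen_Ioo (by simp)).contDiffAt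
      (isOpen_Ioo.mem_nhds (hsub 0 h0))).differentiableAt (by simp)).hasDerivAt) (hlin 0)
  rw [mul_zero, add_zero] at hd2
  have hJn : J ∈ 𝓝 (0 : ℝ) := hct.isOpen.mem_nhds h0
  have hμ1 (i j : Fin 2) (t : ℝ) (ht : t ∈ J) : HasDerivAt (curveGram γ P c' i j)
      (κ * (P 0 i * P 0 j * deriv (fun t => orbitGram γ x t 0 0) (x₀ + κ * t) +
        (P 0 i * P 1 j + P 1 i * P 0 j) * deriv (fun t => orbitGram γ x t 0 1) (x₀ + κ * t) +
        P 1 i * P 1 j * deriv (fun t => orbitGram γ x t 1 1) (x₀ + κ * t))) t := by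
    have h1 := (((hd1 0 0 t ht).const_mul (P 0 i * P 0 j)).add
      ((hd1 0 1 t ht).const_mul (P 0 i * P 1 j + P 1 i * P 0 j))).add
      ((hd1 1 1 t ht).const_mul (P 1 i * P 1 j))
    refine (h1.congr_of_eventuallyEq (f₁ := curveGram γ P c' i j) ?_).congr_deriv (by ring)
    filter_upwards [hct.isOpen.mem_nhds ht] with s hs using hμ i j s hs
  have hμ2 (i j : Fin 2) : deriv (deriv (curveGram γ P c' i j)) 0 =
      κ ^ 2 * (P 0 i * P 0 j * deriv (deriv fun t => orbitGram γ x t 0 0) x₀ +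
        (P 0 i * P 1 j + P 1 i * P 0 j) * deriv (deriv fun t => orbitGram γ x t 0 1) x₀ +
        P 1 i * P 1 j * deriv (deriv fun t => orbitGram γ x t 1 1) x₀) := by
    have h1 := ((((hd2 0 0).const_mul (P 0 i * P 0 j)).add
      ((hd2 0 1).const_mul (P 0 i * P 1 j + P 1 i * P 0 j))).add
      ((hd2 1 1).const_mul (P 1 i * P 1 j))).const_mul κ
    refine (h1.congr_of_eventuallyEq (f₁ := deriv (curveGram γ P c' i j)) ?_).deriv.trans (by ring)
    filter_upwards [hJn] with s hs using (hμ1 i j s hs).deriv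
  have hμ1' (i j : Fin 2) : deriv (curveGram γ P c' i j) 0 =
      κ * (P 0 i * P 0 j * deriv (fun t => orbitGram γ x t 0 0) x₀ +
        (P 0 i * P 1 j + P 1 i * P 0 j) * deriv (fun t => orbitGram γ x t 0 1) x₀ +
        P 1 i * P 1 j * deriv (fun t => orbitGram γ x t 1 1) x₀) := by
    have := (hμ1 i j 0 h0).deriv
    rwa [mul_zero, add_zero] at this
  -- the flux
  set β : ℝ → ℝ := fun t => pd 1 (fun z => comp g (patch Φ P c') z 0 2) (linePoint 0 0 t) with hβ
  have hβ0 : pd 1 (fun z => comp g (patch Φ P c') z 0 2) 0 = β 0 := by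
    rw [hβ]; simp only [linePoint_zero]
  have hflux (t : ℝ) (ht : t ∈ J) : fluxFun g Φ γ x (x₀ + κ * t) =
      κ * ((curveGram γ P c' 0 0 t * curveGram γ P c' 1 1 t - curveGram γ P c' 0 1 t ^ 2) * β t) := by
    have h1 := pd_one_comp_patch hM.lorentzian hM.invariant_metric hM.action hΦ hB hct hPdet ht
      (a := 2) (v := velocity c' t) rfl
    have h2 := congrArg (betaForm g Φ (c' t))
      (hB.orbitGradient_normal (hct.interior t ht).1 (hct.interior t ht).2 (horth' t ht))
    rw [betaForm_smul_vec, betaForm_smul_vec, hdx t ht, ← h1] at h2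
    rw [← hxc t ht, fluxFun_eq hM.invariant_metric hM.action hΦ hB]
    have h3 := hnorm t ht
    change _ * orbitFlux g Φ γ x (c' t) = κ * β t at h2
    linear_combination (-orbitFlux g Φ γ x (c' t)) * h3 +
      (curveGram γ P c' 0 0 t * curveGram γ P c' 1 1 t - curveGram γ P c' 0 1 t ^ 2) * h2
  have hβd : HasDerivAt β (deriv β 0) 0 := by
    have hm : linePoint 0 0 0 ∈ patchDomain ε J := linePoint_mem hΦ.zero_mem hΦ.zero_mem h0
    have hO := (isLocalCoord_patch hΦ hB hct hPdet).isOpen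
    have h1 := contDiffOn_pd hO (contDiffOn_comp_patch hM.lorentzian.smooth hΦ hB hct hPdet 0 2) 1
    exact (hasDerivAt_line_two
      ((h1.contDiffAt (hO.mem_nhds hm)).differentiableAt (by simp))).differentiableAt.hasDerivAt
  have hk : HasDerivAt (fluxFun g Φ γ x) (deriv β 0 + (deriv (curveGram γ P c' 0 0) 0 +
      deriv (curveGram γ P c' 1 1) 0) * β 0) x₀ := by
    have e (i j : Fin 2) := (hμ1 i j 0 h0).differentiableAt.hasDerivAt
    have h1 := ((((e 0 0).mul (e 1 1)).sub ((e 0 1).pow 2)).mul hβd).const_mul κ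
    have h2 : HasDerivAt (fun s : ℝ => (s - x₀) / κ) (1 / κ) x₀ := by
      simpa using ((hasDerivAt_id x₀).sub_const x₀).div_const κ
    have h3 := HasDerivAt.comp_of_eq x₀ h1 h2 (by simp)
    refine (h3.congr_of_eventuallyEq (f₁ := fluxFun g Φ γ x) ?_).congr_deriv ?_
    rotate_left
    · simp only [hμ0, Pi.mul_apply, Pi.sub_apply, Pi.pow_apply]
      have : κ ≠ 0 := hκpos.ne'
      simp
      field_simp
      ring
    · have h4 : ContinuousAt (fun s : ℝ => (s - x₀) / κ) x₀ := h2.continuousAt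
      have h5 : J ∈ 𝓝 ((x₀ - x₀) / κ) := by simpa using hJn
      filter_upwards [h4.eventually h5] with s hs
      have h6 : x₀ + κ * ((s - x₀) / κ) = s := by field_simp; ring
      have h7 := hflux _ hs
      rw [h6] at h7
      exact h7
  have hk0 : fluxFun g Φ γ x x₀ = κ * β 0 := by
    have := hflux 0 h0
    rw [mul_zero, add_zero] at this
    simpa [hμ0] using this
  refine ⟨hk.differentiableAt, ?_⟩
  rw [hk.deriv, hk0, hB.deriv_deriv_orbitDet hx₀]
  rw [hβ0, hμ1', hμ1', hμ1', hμ2, hμ2] at hineq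
  have hF23 : comp F (patch Φ P c') 0 2 3 = _ := hF2 0
  have hF24 : comp F (patch Φ P c') 0 2 4 = _ := hF2 1
  have ha3 : pd 1 (fun z => comp g (patch Φ P c') z 0 3) 0 = _ := (ha 0).symm
  have ha4 : pd 1 (fun z => comp g (patch Φ P c') z 0 4) 0 = _ := (ha 1).symm
  rw [hF23, hF24, ha3, ha4] at hineq
  simp only [sum_univ_two] at hineq
  rw [hμ1', hμ1']
  set ψ0 := deriv (fun t => Ψ.ψ 0 (arccos t)) x₀
  set ψ1 := deriv (fun t => Ψ.ψ 1 (arccos t)) x₀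
  have q1 := hP3 ψ0 ψ1
  have q2 := hP3 (a 0) (a 1)
  have hqψ : orbitAdj γ x x₀ (fun i => deriv (fun t => Ψ.ψ i (arccos t)) x₀) =
      D * ((P 0 0 * ψ0 + P 1 0 * ψ1) ^ 2 + (P 0 1 * ψ0 + P 1 1 * ψ1) ^ 2) := by
    rw [q1]
    change _ = D * (_ / D)
    rw [mul_div_cancel₀ _ hDpos.ne', orbitAdj]
  have hν0 : ν ≠ 0 := by rintro rfl; rw [zero_pow two_ne_zero] at hν; exact hDpos.ne hν
  have hqΘ : C ^ 2 * (orbitAdj γ x x₀ (fun i => Ψ.Θx i x₀) / D) =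
      (P 0 0 * a 0 + P 1 0 * a 1) ^ 2 + (P 0 1 * a 0 + P 1 1 * a 1) ^ 2 := by
    rw [q2]
    change _ = _ / D
    rw [orbitAdj, ← mul_div_assoc]
    congr 1
    refine mul_left_cancel₀ hDpos.ne' ?_
    have e0 := hΘ 0
    have e1 := hΘ 1
    have h1 : D * (C ^ 2 * (orbitGram γ x x₀ 1 1 * Ψ.Θx 0 x₀ ^ 2 -
        2 * orbitGram γ x x₀ 0 1 * Ψ.Θx 0 x₀ * Ψ.Θx 1 x₀ +
        orbitGram γ x x₀ 0 0 * Ψ.Θx 1 x₀ ^ 2)) =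
        orbitGram γ x x₀ 1 1 * (κ * Ψ.Θx 0 x₀) ^ 2 -
        2 * orbitGram γ x x₀ 0 1 * (κ * Ψ.Θx 0 x₀) * (κ * Ψ.Θx 1 x₀) +
        orbitGram γ x x₀ 0 0 * (κ * Ψ.Θx 1 x₀) ^ 2 := by
      linear_combination (-(orbitGram γ x x₀ 1 1 * Ψ.Θx 0 x₀ ^ 2 -
        2 * orbitGram γ x x₀ 0 1 * Ψ.Θx 0 x₀ * Ψ.Θx 1 x₀ +
        orbitGram γ x x₀ 0 0 * Ψ.Θx 1 x₀ ^ 2)) * hκ2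
    rw [h1, e0, e1]
    linear_combination (orbitGram γ x x₀ 1 1 * a 0 ^ 2 - 2 * orbitGram γ x x₀ 0 1 * a 0 * a 1 +
      orbitGram γ x x₀ 0 0 * a 1 ^ 2) * hν
  have hqΥ : C ^ 2 * Ψ.Υx x₀ ^ 2 = comp F (patch Φ P c') 0 0 1 ^ 2 := by
    refine mul_left_cancel₀ hDpos.ne' ?_
    have h1 := congrArg (· ^ 2) hΥ
    simp only [mul_pow] at h1
    rw [hκ2, hν] at h1
    linear_combination h1
  have hkk : (κ * β 0) ^ 2 / (2 * (C ^ 2 * D)) = 1 / 2 * β 0 ^ 2 := by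
    rw [← hκ2]
    field_simp
  have hκP : κ ^ 2 * P.det ^ 2 = C ^ 2 := by rw [hκ2]; linear_combination C ^ 2 * hP1
  have t00 := hP2 0 0
  have t11 := hP2 1 1
  have t01 := hP2 0 1
  simp only [if_true, show ((0 : Fin 2) = 1) = False by simp, if_false] at t00 t11 t01
  rw [hkk, hqψ]
  set L00 := orbitGram γ x x₀ 0 0
  set L01 := orbitGram γ x x₀ 0 1
  set L11 := orbitGram γ x x₀ 1 1
  set L00' := deriv (fun t => orbitGram γ x t 0 0) x₀
  set L01' := deriv (fun t => orbitGram γ x t 0 1) x₀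
  set L11' := deriv (fun t => orbitGram γ x t 1 1) x₀
  set L00'' := deriv (deriv fun t => orbitGram γ x t 0 0) x₀
  set L01'' := deriv (deriv fun t => orbitGram γ x t 0 1) x₀
  set L11'' := deriv (deriv fun t => orbitGram γ x t 1 1) x₀
  have htr : P.det ^ 2 * (L00'' * L11 + L00 * L11'' - 2 * L01 * L01'') =
      (P 0 0 * P 0 0 * L00'' + (P 0 0 * P 1 0 + P 1 0 * P 0 0) * L01'' + P 1 0 * P 1 0 * L11'') +
      (P 0 1 * P 0 1 * L00'' + (P 0 1 * P 1 1 + P 1 1 * P 0 1) * L01'' + P 1 1 * P 1 1 * L11'') := by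
    rw [hdet2]
    linear_combination (P 0 0 * P 0 0 * L00'' + (P 0 0 * P 1 0 + P 1 0 * P 0 0) * L01'' +
      P 1 0 * P 1 0 * L11'') * t11 +
      (P 0 1 * P 0 1 * L00'' + (P 0 1 * P 1 1 + P 1 1 * P 0 1) * L01'' +
        P 1 1 * P 1 1 * L11'') * t00 -
      2 * (P 0 0 * P 0 1 * L00'' + (P 0 0 * P 1 1 + P 1 0 * P 0 1) * L01'' +
        P 1 0 * P 1 1 * L11'') * t01
  have hdd : P.det ^ 2 * (L00' * L11' - L01' ^ 2) =
      (P 0 0 * P 0 0 * L00' + (P 0 0 * P 1 0 + P 1 0 * P 0 0) * L01' + P 1 0 * P 1 0 * L11') *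
      (P 0 1 * P 0 1 * L00' + (P 0 1 * P 1 1 + P 1 1 * P 0 1) * L01' + P 1 1 * P 1 1 * L11') -
      (P 0 0 * P 0 1 * L00' + (P 0 0 * P 1 1 + P 1 0 * P 0 1) * L01' + P 1 0 * P 1 1 * L11') ^ 2 := by
    rw [hdet2]; ring
  have hR : C ^ 2 * (1 / 2 * (L00' * L11' - L01' ^ 2) - (L00'' * L11 + L00 * L11'' -
      2 * L01 * L01'' + 2 * (L00' * L11' - L01' ^ 2))) =
      -κ ^ 2 * (P.det ^ 2 * (L00'' * L11 + L00 * L11'' - 2 * L01 * L01'')) -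
        3 / 2 * κ ^ 2 * (P.det ^ 2 * (L00' * L11' - L01' ^ 2)) := by
    rw [← hκP]; ring
  have hψκ : κ ^ 2 * ((P 0 0 * ψ0 + P 1 0 * ψ1) ^ 2 + (P 0 1 * ψ0 + P 1 1 * ψ1) ^ 2) =
      C ^ 2 * (D * ((P 0 0 * ψ0 + P 1 0 * ψ1) ^ 2 + (P 0 1 * ψ0 + P 1 1 * ψ1) ^ 2)) := by
    rw [hκ2]; ring
  rw [hR, htr, hdd]
  linarith

/-- A measurable function which is bounded below and dominated by the derivative of `G` is
integrable if the increments of `G` converge along an exhausting sequence of intervals. -/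
lemma integrableOn_of_le_deriv {f G G' : ℝ → ℝ} {l r K L : ℝ}
    (hf : AEMeasurable f (volume.restrict (Ioo l r))) (hK : 0 ≤ K)
    (hfK : ∀ t ∈ Ioo l r, -K ≤ f t) (hG : ∀ t ∈ Ioo l r, HasDerivAt G (G' t) t)
    (hfG : ∀ t ∈ Ioo l r, f t ≤ G' t) {a b : ℕ → ℝ} (ha : ∀ n, a n ∈ Ioo l r)
    (hb : ∀ n, b n ∈ Ioo l r) (hal : Tendsto a atTop (𝓝 l)) (hbr : Tendsto b atTop (𝓝 r))
    (hL : Tendsto (fun n => G (b n) - G (a n)) atTop (𝓝 L)) (hlr : l < r) :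
    IntegrableOn f (Ioo l r) ∧ ∫ t in Ioo l r, f t ≤ L := by
  set μ := volume.restrict (Ioo l r) with hμ
  have hab : ∀ᶠ n in atTop, a n ≤ b n := by
    filter_upwards [hal.eventually_lt hbr hlr] with n hn using hn.le
  set φ : ℕ → ℝ → ℝ := fun n => (Ioc (a n) (b n)).indicator fun t => min (f t) n + K with hφ
  have hsub (n : ℕ) : Icc (a n) (b n) ⊆ Ioo l r := fun t ht =>
    ⟨(ha n).1.trans_le ht.1, ht.2.trans_lt (hb n).2⟩
  have hmeas (n : ℕ) : AEMeasurable (fun t => ENNReal.ofReal (φ n t)) μ :=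
    (((hf.min aemeasurable_const).add_const K).indicator measurableSet_Ioc).ennreal_ofReal
  have hint (n : ℕ) : IntegrableOn (fun t => min (f t) (n : ℝ)) (Icc (a n) (b n)) := by
    have h1 : AEStronglyMeasurable (fun t => min (f t) (n : ℝ))
        (volume.restrict (Icc (a n) (b n))) :=
      ((hf.min aemeasurable_const).mono_measure
        (Measure.restrict_mono (hsub n) le_rfl)).aestronglyMeasurable
    refine Integrable.of_bound (μ := volume.restrict (Icc (a n) (b n))) h1 (K + n) ?_
    filter_upwards [ae_restrict_mem measurableSet_Icc] with t ht
    have h2 := hfK t (hsub n ht)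
    have h3 : (0 : ℝ) ≤ n := Nat.cast_nonneg n
    rw [Real.norm_eq_abs, abs_le]
    exact ⟨le_min (by linarith) (by linarith), (min_le_right _ _).trans (by linarith)⟩
  have hFTC (n : ℕ) (hn : a n ≤ b n) :
      ∫ t in (a n)..(b n), min (f t) (n : ℝ) ≤ G (b n) - G (a n) :=
    intervalIntegral.integral_le_sub_of_hasDeriv_right_of_le hn
      (fun t ht => (hG t (hsub n ht)).continuousAt.continuousWithinAt)
      (fun t ht => (hG t (hsub n (Ioo_subset_Icc_self ht))).hasDerivWithinAt) (hint n)
      fun t ht => (min_le_left _ _).trans (hfG t (hsub n (Ioo_subset_Icc_self ht)))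
  have hbound (n : ℕ) (hn : a n ≤ b n) :
      ∫⁻ t, ENNReal.ofReal (φ n t) ∂μ ≤
        ENNReal.ofReal (G (b n) - G (a n) + K * (b n - a n)) := by
    have h1 := hFTC n hn
    have h2 : IntegrableOn (fun t => min (f t) (n : ℝ)) (Ioc (a n) (b n)) :=
      (hint n).mono_set Set.Ioc_subset_Icc_self
    have h3 : IntegrableOn (fun t => min (f t) (n : ℝ) + K) (Ioc (a n) (b n)) := h2.add (by simp)
    have h4 : ∫⁻ t, ENNReal.ofReal (φ n t) ∂μ =
        ∫⁻ t in Ioc (a n) (b n), ENNReal.ofReal (min (f t) n + K) := by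
      have h5 : (fun t => ENNReal.ofReal (φ n t)) =
          (Ioc (a n) (b n)).indicator fun t => ENNReal.ofReal (min (f t) n + K) := by
        funext t
        by_cases ht : t ∈ Ioc (a n) (b n) <;> simp [hφ, ht]
      rw [h5, lintegral_indicator measurableSet_Ioc, hμ,
        Measure.restrict_restrict measurableSet_Ioc,
        Set.inter_eq_left.2 (Set.Ioc_subset_Icc_self.trans (hsub n))]
    rw [h4, ← ofReal_integral_eq_lintegral_ofReal h3 ?_]
    · refine ENNReal.ofReal_le_ofReal ?_
      rw [integral_add h2 (by simp), ← intervalIntegral.integral_of_le hn,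
        setIntegral_const, Measure.real, Real.volume_Ioc, ENNReal.toReal_ofReal (by linarith)]
      simp only [smul_eq_mul]
      linarith
    · filter_upwards [ae_restrict_mem measurableSet_Ioc] with t ht
      have h6 := hfK t (hsub n (Set.Ioc_subset_Icc_self ht))
      have h7 : (0 : ℝ) ≤ n := Nat.cast_nonneg n
      have h8 : -K ≤ min (f t) n := le_min h6 (by linarith)
      change 0 ≤ min (f t) (n : ℝ) + K
      linarith
  have hfatou := lintegral_liminf_le' (μ := μ) (u := atTop) (f := fun n t => ENNReal.ofReal (φ n t)) hmeas
  have hlim : ∀ᵐ t ∂μ, ENNReal.ofReal (f t + K) =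
      liminf (fun n => ENNReal.ofReal (φ n t)) atTop := by
    filter_upwards [ae_restrict_mem measurableSet_Ioo] with t ht
    refine (Tendsto.liminf_eq (tendsto_const_nhds.congr' ?_)).symm
    filter_upwards [hal.eventually_lt_const ht.1, hbr.eventually_const_lt ht.2,
      eventually_ge_atTop ⌈f t⌉₊] with n h1 h2 h3
    have h4 : t ∈ Ioc (a n) (b n) := ⟨h1, h2.le⟩
    have h5 : f t ≤ n := (Nat.le_ceil _).trans (by exact_mod_cast h3)
    simp [hφ, h4, min_eq_left h5]
  have hupper : ∫⁻ t, ENNReal.ofReal (f t + K) ∂μ ≤ ENNReal.ofReal (L + K * (r - l)) := by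
    rw [lintegral_congr_ae hlim]
    refine hfatou.trans ?_
    have h1 : Tendsto (fun n => ENNReal.ofReal (G (b n) - G (a n) + K * (b n - a n))) atTop
        (𝓝 (ENNReal.ofReal (L + K * (r - l)))) :=
      ENNReal.tendsto_ofReal (hL.add ((hbr.sub hal).const_mul K))
    rw [← h1.liminf_eq]
    refine liminf_le_liminf ?_
    filter_upwards [hab] with n hn using hbound n hn
  have hnn : 0 ≤ᵐ[μ] fun t => f t + K := by
    filter_upwards [ae_restrict_mem measurableSet_Ioo] with t ht
    have := hfK t ht
    change 0 ≤ f t + K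
    linarith
  have hfK' : Integrable (fun t => f t + K) μ := by
    refine ⟨(hf.add_const K).aestronglyMeasurable, ?_⟩
    rw [hasFiniteIntegral_iff_ofReal hnn]
    exact hupper.trans_lt ENNReal.ofReal_lt_top
  have hc : Integrable (fun _ : ℝ => K) μ := by simp [hμ]
  have hfi : Integrable f μ := by
    have := hfK'.sub hc
    refine this.congr (Eventually.of_forall fun t => ?_)
    simp
  refine ⟨hfi, ?_⟩
  have h1 : ∫ t, (f t + K) ∂μ ≤ L + K * (r - l) := by
    rw [integral_eq_lintegral_of_nonneg_ae hnn hfK'.aestronglyMeasurable]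
    refine ENNReal.toReal_le_of_le_ofReal ?_ hupper
    refine ge_of_tendsto (hL.add ((hbr.sub hal).const_mul K)) ?_
    filter_upwards [hab] with n hn
    have h2 := hFTC n hn
    have h3 : ∫ t in (a n)..(b n), (-K) ≤ ∫ t in (a n)..(b n), min (f t) (n : ℝ) := by
      refine intervalIntegral.integral_mono_on hn (by simp) ?_ fun t ht => ?_
      · exact (intervalIntegrable_iff_integrableOn_Icc_of_le hn).2 (hint n)
      · exact le_min (hfK t (hsub n ht)) (by linarith [(Nat.cast_nonneg n : (0 : ℝ) ≤ n)])
    rw [intervalIntegral.integral_const, smul_eq_mul] at h3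
    linarith
  rw [integral_add hfi hc, hμ, setIntegral_const, Measure.real, Real.volume_Ioo,
    ENNReal.toReal_ofReal (by linarith)] at h1
  simp only [smul_eq_mul] at h1
  linarith

/-- If `u` has a finite limit at `e = ±1`, then `(1 - t²) u'(t)` tends to zero along a sequence. -/
lemma exists_seq_deriv_tendsto {u : ℝ → ℝ} {e l : ℝ} (he : e ^ 2 = 1)
    (hu : DifferentiableOn ℝ u (𝕀)) (hl : Tendsto u (𝓝[𝕀] e) (𝓝 l)) :
    ∃ c : ℕ → ℝ, (∀ n, c n ∈ 𝕀) ∧ Tendsto c atTop (𝓝 e) ∧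
      Tendsto (fun n => (1 - c n ^ 2) * deriv u (c n)) atTop (𝓝 0) := by
  set δ : ℕ → ℝ := fun n => 1 / ((n : ℝ) + 2) with hδ
  have hδ0 : Tendsto δ atTop (𝓝 0) := by
    have h1 : Tendsto (fun n : ℕ => (n : ℝ) + 2) atTop atTop :=
      tendsto_atTop_add_const_right _ _ tendsto_natCast_atTop_atTop
    exact (tendsto_inv_atTop_zero.comp h1).congr fun n => by simp [hδ]
  have hδpos (n : ℕ) : 0 < δ n := by positivity
  have hδ1 (n : ℕ) : δ n ≤ 1 / 2 := by
    rw [hδ]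
    exact one_div_le_one_div_of_le (by norm_num) (by linarith [(Nat.cast_nonneg n : (0 : ℝ) ≤ n)])
  have hee : e = 1 ∨ e = -1 := sq_eq_sq_iff_eq_or_eq_neg.1 (he.trans (one_pow 2).symm)
  have hmem {r : ℝ} (h0 : 0 < r) (h1 : r < 2) : e * (1 - r) ∈ 𝕀 := by
    rcases hee with rfl | rfl <;> constructor <;> linarith
  have hlim {r : ℕ → ℝ} (hr : ∀ n, r n ∈ Ioc 0 (δ n)) :
      Tendsto (fun n => e * (1 - r n)) atTop (𝓝[𝕀] e) := by
    have h1 : Tendsto r atTop (𝓝 0) := squeeze_zero (fun n => (hr n).1.le) (fun n => (hr n).2) hδ0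
    refine tendsto_nhdsWithin_iff.2 ⟨?_, Eventually.of_forall fun n =>
      hmem (hr n).1 ((hr n).2.trans_lt ((hδ1 n).trans_lt (by norm_num)))⟩
    simpa using (h1.const_sub 1).const_mul e
  have hmvt (n : ℕ) : ∃ c ∈ Ioo (δ n / 2) (δ n), -(e * deriv u (e * (1 - c))) =
        (u (e * (1 - δ n)) - u (e * (1 - δ n / 2))) / (δ n - δ n / 2) := by
    have hd (r : ℝ) (hr : r ∈ Icc (δ n / 2) (δ n)) :
        HasDerivAt (fun r => u (e * (1 - r))) (-(e * deriv u (e * (1 - r)))) r := by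
      have h1 := hmem (r := r) (by linarith [hr.1, hδpos n]) (by linarith [hr.2, hδ1 n])
      have h2 := (hu.differentiableAt (isOpen_Ioo.mem_nhds h1)).hasDerivAt
      have h3 : HasDerivAt (fun r : ℝ => e * (1 - r)) (e * -1) r :=
        ((hasDerivAt_id r).const_sub 1).const_mul e
      exact (HasDerivAt.comp (h := fun r : ℝ => e * (1 - r)) (h₂ := u) r h2 h3).congr_deriv
        (by ring)
    exact exists_hasDerivAt_eq_slope _ _ (by linarith [hδpos n])
      (fun r hr => (hd r hr).continuousAt.continuousWithinAt)
      fun r hr => hd r (Ioo_subset_Icc_self hr)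
  choose r hr hru using hmvt
  have hr' (n : ℕ) : r n ∈ Ioc 0 (δ n) := ⟨by linarith [(hr n).1, hδpos n], (hr n).2.le⟩
  refine ⟨fun n => e * (1 - r n), fun n => hmem (hr' n).1 (by linarith [(hr' n).2, hδ1 n]),
    (tendsto_nhdsWithin_iff.1 (hlim hr')).1, ?_⟩
  have hdiff : Tendsto (fun n => 4 * |u (e * (1 - δ n)) - u (e * (1 - δ n / 2))|) atTop (𝓝 0) := by
    have h1 := hl.comp (hlim (r := δ) fun n => ⟨hδpos n, le_rfl⟩)
    have h2 := hl.comp (hlim (r := fun n => δ n / 2) fun n =>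
      ⟨by linarith [hδpos n], by linarith [hδpos n]⟩)
    simpa using ((h1.sub h2).abs).const_mul 4
  refine squeeze_zero_norm (fun n => ?_) hdiff
  have h1 := hru n
  have h2 : |e| = 1 := by rcases hee with rfl | rfl <;> simp
  have h3 : |deriv u (e * (1 - r n))| =
      |u (e * (1 - δ n)) - u (e * (1 - δ n / 2))| / (δ n / 2) := by
    have h4 := congrArg abs h1
    rw [abs_neg, abs_mul, h2, one_mul, abs_div,
      abs_of_pos (show 0 < δ n - δ n / 2 by linarith [hδpos n])] at h4
    rw [h4]
    congr 1
    ring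
  have h5 : 1 - (e * (1 - r n)) ^ 2 = r n * (2 - r n) := by rw [mul_pow, he]; ring
  have h6 : 0 ≤ r n * (2 - r n) := mul_nonneg (hr' n).1.le (by linarith [(hr' n).2, hδ1 n])
  have h7 : r n * (2 - r n) ≤ 2 * δ n := by nlinarith [(hr' n).1, (hr' n).2]
  rw [Real.norm_eq_abs, abs_mul, h3, h5, abs_of_nonneg h6]
  calc _ ≤ 2 * δ n * (|u (e * (1 - δ n)) - u (e * (1 - δ n / 2))| / (δ n / 2)) :=
        mul_le_mul_of_nonneg_right h7 (div_nonneg (abs_nonneg _) (by linarith [hδpos n]))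
    _ = _ := by have := (hδpos n).ne'; field_simp; ring

/-- A continuous function on `(-1, 1)` with finite limits at the endpoints is bounded. -/
lemma exists_bound_of_tendsto {u : ℝ → ℝ} (hu : ContinuousOn u (𝕀)) {l l' : ℝ}
    (hl : Tendsto u (𝓝[𝕀] (-1)) (𝓝 l)) (hl' : Tendsto u (𝓝[𝕀] 1) (𝓝 l')) :
    ∃ K, ∀ t ∈ 𝕀, |u t| ≤ K := by
  have hlt : (-1 : ℝ) < 1 := by norm_num
  have h1 := continuousOn_Icc_extendFrom_Ioo hu
    (by rwa [nhdsWithin_Ioo_eq_nhdsGT hlt] at hl) (by rwa [nhdsWithin_Ioo_eq_nhdsLT hlt] at hl')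
  obtain ⟨K, hK⟩ := isCompact_Icc.exists_bound_of_continuousOn h1
  refine ⟨K, fun t ht => ?_⟩
  have h2 := hK t (Ioo_subset_Icc_self ht)
  rwa [extendFrom_eq (by rw [closure_Ioo hlt.ne]; exact Ioo_subset_Icc_self ht)
    ((hu t ht).tendsto)] at h2

/-- The pointwise inequality, after multiplication by the test function and completion of the
square in the normal connection. -/
lemma renormalized_inequality {t u' u'' v' w' ch sh ξ ξ' m m' E C p D k k' Q₁ Q₂ Q₃ Δ D'' Λ : ℝ}
    (ht : 0 < 1 - t ^ 2) (hξ : 0 < ξ) (hE : 0 < E) (hC : 0 < C) (hp : 0 < p)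
    (hch : ch ^ 2 = 1 + sh ^ 2) (hD : p ^ 2 * D = E * (1 - t ^ 2))
    (hk : p ^ 2 * k = C ^ 2 * E * m) (hk' : p ^ 2 * k' = C ^ 2 * E * (m' + 4 * u' * m))
    (hΔ : p ^ 2 * Δ = E * (1 - t ^ 2) * ((2 * u' - t / (1 - t ^ 2)) ^ 2 -
      (v' - 1 / (1 - t ^ 2)) ^ 2 * ch ^ 2 - w' ^ 2))
    (hD'' : p ^ 2 * D'' = E * ((4 * u'' + 16 * u' ^ 2) * (1 - t ^ 2) - 16 * t * u' - 2))
    (h : k' + k ^ 2 / (2 * (C ^ 2 * D)) + C ^ 2 / 2 * Q₁ + C ^ 2 / 2 * Q₂ + C ^ 2 / 2 * Q₃ +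
      12 * Λ ≤ C ^ 2 * (1 / 2 * Δ - D'')) :
    3 * ξ * u' ^ 2 * (1 - t ^ 2) + 1 / 4 * ξ * (1 - t ^ 2) *
        (v' ^ 2 + w' ^ 2 + sh ^ 2 * (v' - 1 / (1 - t ^ 2)) ^ 2) +
        1 / 4 * ξ * (p ^ 2 / E) * (Q₁ + Q₂ + Q₃) + 6 * Λ * ξ * (p ^ 2 / E) / C ^ 2 ≤
      (1 - t ^ 2) * ξ' ^ 2 / (4 * ξ) + 3 / 4 * ξ + 3 * t * ξ * u' + 1 / 2 * ξ * v' -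
        2 * (ξ' * u' * (1 - t ^ 2) + ξ * u'' * (1 - t ^ 2) - 2 * t * ξ * u') -
        1 / 2 * (ξ' * m + ξ * m') := by
  have hp2 : p ^ 2 ≠ 0 := (pow_pos hp 2).ne'
  have eD : D = E * (1 - t ^ 2) / p ^ 2 := by rw [← hD]; field_simp
  have ek : k = C ^ 2 * E * m / p ^ 2 := by rw [← hk]; field_simp
  have ek' : k' = C ^ 2 * E * (m' + 4 * u' * m) / p ^ 2 := by rw [← hk']; field_simp
  have eΔ : Δ = E * (1 - t ^ 2) * ((2 * u' - t / (1 - t ^ 2)) ^ 2 -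
      (v' - 1 / (1 - t ^ 2)) ^ 2 * ch ^ 2 - w' ^ 2) / p ^ 2 := by rw [← hΔ]; field_simp
  have eD'' : D'' = E * ((4 * u'' + 16 * u' ^ 2) * (1 - t ^ 2) - 16 * t * u' - 2) / p ^ 2 := by
    rw [← hD'']; field_simp
  have h1 : 0 ≤ ξ * (p ^ 2 / E) / (2 * C ^ 2) * (C ^ 2 * (1 / 2 * Δ - D'') -
      (k' + k ^ 2 / (2 * (C ^ 2 * D)) + C ^ 2 / 2 * Q₁ + C ^ 2 / 2 * Q₂ + C ^ 2 / 2 * Q₃ +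
      12 * Λ)) := mul_nonneg (by positivity) (sub_nonneg.2 h)
  have h2 : 0 ≤ (ξ * m + (1 - t ^ 2) * (4 * ξ * u' - ξ')) ^ 2 / (4 * (1 - t ^ 2) * ξ) := by
    positivity
  rw [← sub_nonneg]
  refine (add_nonneg h1 h2).trans_eq ?_
  rw [eD, ek, ek', eΔ, eD'', hch]
  have ht' : (1 - t ^ 2) ≠ 0 := ht.ne'
  field_simp
  ring

section Profile

/-- The functions `u`, `v`, `w` of the orbit coordinate which parametrize the Gram matrix of the
generators, the normal connection `m` and the matter density `N`, subject to the stability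
inequality for test functions and to the regularity conditions at the axes. -/
structure IsStableProfile (ℓ s : ℝ) (u v w m N : ℝ → ℝ) : Prop where
  smooth_u : ContDiffOn ℝ ∞ u (𝕀)
  smooth_v : ContDiffOn ℝ ∞ v (𝕀)
  smooth_w : ContDiffOn ℝ ∞ w (𝕀)
  differentiable_m : DifferentiableOn ℝ m (𝕀)
  nonneg : ∀ t ∈ 𝕀, 0 ≤ N t
  measurable : AEMeasurable N (volume.restrict (𝕀))
  stability : ∀ t ∈ 𝕀, ∀ a a' : ℝ, 0 < a →
    3 * a * deriv u t ^ 2 * (1 - t ^ 2) + 1 / 4 * a * (1 - t ^ 2) *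
        (deriv v t ^ 2 + deriv w t ^ 2 +
          sinh (w t) ^ 2 * (deriv v t - 1 / (1 - t ^ 2)) ^ 2) + 1 / 4 * a * N t ≤
      (1 - t ^ 2) * a' ^ 2 / (4 * a) + 3 / 4 * a + 3 * t * a * deriv u t + 1 / 2 * a * deriv v t -
        2 * (a' * deriv u t * (1 - t ^ 2) + a * deriv (deriv u) t * (1 - t ^ 2) -
          2 * t * a * deriv u t) - 1 / 2 * (a' * m t + a * deriv m t)
  tendsto_m : ∀ e : ℝ, e ^ 2 = 1 → Tendsto m (𝓝[𝕀] e) (𝓝 0)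
  limits : ∀ e : ℝ, e ^ 2 = 1 → ∃ a b, Tendsto u (𝓝[𝕀] e) (𝓝 a) ∧
    Tendsto (fun t => v t + s * log (1 - t)) (𝓝[𝕀] e) (𝓝 b) ∧
    3 * e * a + 1 / 2 * (1 - s * (1 + e)) * b = 1 / 2 * e * ℓ

/-- The integrand of the area functional as a function of the orbit coordinate. -/
def areaDensity (s : ℝ) (u v w N ξ ξ' : ℝ → ℝ) (t : ℝ) : ℝ :=
  3 * ξ t * deriv u t ^ 2 * (1 - t ^ 2) + 1 / 4 * ξ t * (1 - t ^ 2) *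
      ((deriv v t - s / (1 - t)) ^ 2 + deriv w t ^ 2 +
        sinh (w t) ^ 2 * (deriv v t - 1 / (1 - t ^ 2)) ^ 2) + 1 / 4 * ξ t * N t +
    (3 * (ξ t + t * ξ' t) * u t +
      1 / 2 * ((1 - s * (1 + t)) * ξ' t - s * ξ t) * (v t + s * log (1 - t)))

/-- The integrand of the constant `β_ξ^s` as a function of the orbit coordinate. -/
def betaDensity (s : ℝ) (ξ ξ' : ℝ → ℝ) (t : ℝ) : ℝ :=
  (1 - t ^ 2) * ξ' t ^ 2 / (4 * ξ t) + (3 + s) / 4 * ξ t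

variable {ℓ s : ℝ} {u v w m N ξ ξ' : ℝ → ℝ}

/-- The boundary term in the area estimate. -/
def boundaryTerm (s : ℝ) (u v m ξ : ℝ → ℝ) (t : ℝ) : ℝ :=
  3 * t * ξ t * u t + 1 / 2 * (1 - s * (1 + t)) * ξ t * (v t + s * log (1 - t)) -
    2 * (1 - t ^ 2) * ξ t * deriv u t - 1 / 2 * ξ t * m t

lemma IsStableProfile.exists_hasDerivAt (h : IsStableProfile ℓ s u v w m N)
    (hs : s = 0 ∨ s = 1) {t : ℝ} (ht : t ∈ 𝕀) (hpos : 0 < ξ t) (hd : HasDerivAt ξ (ξ' t) t) :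
    HasDerivAt (boundaryTerm s u v m ξ) (deriv (boundaryTerm s u v m ξ) t) t ∧
      areaDensity s u v w N ξ ξ' t - betaDensity s ξ ξ' t ≤ deriv (boundaryTerm s u v m ξ) t := by
  have hn := isOpen_Ioo.mem_nhds ht
  have hu := ((h.smooth_u.differentiableOn (by simp)).differentiableAt hn).hasDerivAt
  have hv := ((h.smooth_v.differentiableOn (by simp)).differentiableAt hn).hasDerivAt
  have hu2 := (((h.smooth_u.deriv_of_isOpen (m := ∞) isOpen_Ioo (by simp)).differentiableOn
    (by simp)).differentiableAt hn).hasDerivAt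
  have hm := (h.differentiable_m.differentiableAt hn).hasDerivAt
  have h1t : 0 < 1 - t := by linarith [ht.2]
  have h1t' : 0 < 1 + t := by linarith [ht.1]
  have hq : 1 - t ^ 2 = (1 - t) * (1 + t) := by ring
  have hq0 : 0 < 1 - t ^ 2 := by rw [hq]; positivity
  have hid : HasDerivAt (fun t : ℝ => t) 1 t := hasDerivAt_id t
  have hlog : HasDerivAt (fun t : ℝ => log (1 - t)) (-1 / (1 - t)) t :=
    (hid.const_sub 1).log h1t.ne'
  have hH := ((((hid.const_mul 3).mul hd).mul hu).add
    (((((hid.const_add 1).const_mul s).const_sub 1).const_mul (1 / 2)).mul hd |>.mul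
      (hv.add (hlog.const_mul s)))).sub (((((hid.pow 2).const_sub 1).const_mul 2).mul hd).mul hu2)
      |>.sub ((hd.const_mul (1 / 2)).mul hm)
  have hH' : HasDerivAt (boundaryTerm s u v m ξ) _ t := hH
  refine ⟨hH'.differentiableAt.hasDerivAt, ?_⟩
  rw [hH'.deriv]
  have hst := h.stability t ht (ξ t) (ξ' t) hpos
  rw [areaDensity, betaDensity]
  have key : 1 / 4 * ξ t * (1 - t ^ 2) * deriv v t ^ 2 - 1 / 2 * ξ t * deriv v t =
      1 / 4 * ξ t * (1 - t ^ 2) * (deriv v t - s / (1 - t)) ^ 2 -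
        1 / 2 * (1 - s * (1 + t)) * ξ t * (deriv v t - s / (1 - t)) - s / 4 * ξ t := by
    rcases hs with rfl | rfl
    · simp
    · field_simp
      ring
  have e1 : s * (-1 / (1 - t)) = - (s / (1 - t)) := by ring
  simp only [Pi.add_apply, Pi.mul_apply, Pi.pow_apply, e1, Nat.cast_ofNat, Nat.add_one_sub_one, pow_one]
  generalize s / (1 - t) = y at key ⊢
  generalize 1 / (1 - t ^ 2) = z at hst ⊢
  generalize (1 - t ^ 2) * ξ' t ^ 2 / (4 * ξ t) = r at hst ⊢
  linarith

lemma IsStableProfile.continuousOn_vs (h : IsStableProfile ℓ s u v w m N) :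
    ContinuousOn (fun t => v t + s * log (1 - t)) (𝕀) :=
  h.smooth_v.continuousOn.add (continuousOn_const.mul
    (ContinuousOn.log (by fun_prop) fun t ht => by linarith [ht.2]))

lemma IsStableProfile.tendsto_boundaryTerm (h : IsStableProfile ℓ s u v w m N) {e : ℝ}
    (he : e ^ 2 = 1) (hξ : ContinuousOn ξ (Icc (-1) 1)) :
    ∃ c : ℕ → ℝ, (∀ n, c n ∈ 𝕀) ∧ Tendsto c atTop (𝓝 e) ∧
      Tendsto (fun n => boundaryTerm s u v m ξ (c n)) atTop (𝓝 (1 / 2 * e * ℓ * ξ e)) := by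
  obtain ⟨a, b, hu, hv, hab⟩ := h.limits e he
  obtain ⟨c, hc, hce, hcu⟩ := exists_seq_deriv_tendsto he (h.smooth_u.differentiableOn (by simp)) hu
  refine ⟨c, hc, hce, ?_⟩
  have hw : Tendsto c atTop (𝓝[𝕀] e) := tendsto_nhdsWithin_iff.2 ⟨hce, Eventually.of_forall hc⟩
  have hee : e ∈ Icc (-1 : ℝ) 1 := by
    rcases sq_eq_sq_iff_eq_or_eq_neg.1 (he.trans (one_pow 2).symm) with rfl | rfl <;> norm_num
  have hξe : Tendsto (fun n => ξ (c n)) atTop (𝓝 (ξ e)) :=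
    ((hξ e hee).mono Ioo_subset_Icc_self).tendsto.comp hw
  have h1 := (((hce.const_mul 3).mul hξe).mul (hu.comp hw)).add
    ((((((hce.const_add 1).const_mul s).const_sub 1).const_mul (1 / 2)).mul hξe).mul
      (hv.comp hw)) |>.sub ((hcu.mul hξe).const_mul 2) |>.sub
      ((hξe.const_mul (1 / 2)).mul ((h.tendsto_m e he).comp hw))
  have h2 : 3 * e * ξ e * a + 1 / 2 * (1 - s * (1 + e)) * ξ e * b - 2 * (0 * ξ e) -
      1 / 2 * ξ e * 0 = 1 / 2 * e * ℓ * ξ e := by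
    linear_combination ξ e * hab
  rw [h2] at h1
  refine h1.congr fun n => ?_
  simp only [boundaryTerm, Function.comp]
  ring

lemma continuousOn_betaDensity (hξ : ContinuousOn ξ (Icc (-1) 1))
    (hξ' : ContinuousOn ξ' (Icc (-1) 1)) (hpos : ∀ t ∈ Icc (-1 : ℝ) 1, 0 < ξ t) :
    ContinuousOn (betaDensity s ξ ξ') (Icc (-1) 1) :=
  (((continuousOn_const.sub (continuousOn_id.pow 2)).mul (hξ'.pow 2)).div
    (continuousOn_const.mul hξ) fun t ht => (mul_pos (by norm_num) (hpos t ht)).ne').add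
      (continuousOn_const.mul hξ)

lemma IsStableProfile.integrable_areaDensity (h : IsStableProfile ℓ s u v w m N)
    (hs : s = 0 ∨ s = 1) (hξ : ContinuousOn ξ (Icc (-1) 1))
    (hξ' : ContinuousOn ξ' (Icc (-1) 1)) (hpos : ∀ t ∈ Icc (-1 : ℝ) 1, 0 < ξ t)
    (hd : ∀ t ∈ 𝕀, HasDerivAt ξ (ξ' t) t) :
    IntegrableOn (areaDensity s u v w N ξ ξ') (𝕀) ∧
      ∫ t in 𝕀, areaDensity s u v w N ξ ξ' t ≤
        (∫ t in 𝕀, betaDensity s ξ ξ' t) + ℓ * ((ξ 1 + ξ (-1)) / 2) := by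
  have hsub : 𝕀 ⊆ Icc (-1) 1 := Ioo_subset_Icc_self
  have hβc := continuousOn_betaDensity (s := s) hξ hξ' hpos
  have hβi : IntegrableOn (betaDensity s ξ ξ') (𝕀) :=
    (hβc.integrableOn_compact isCompact_Icc).mono_set hsub
  obtain ⟨a₁, b₁, hu₁, hv₁, -⟩ := h.limits 1 (by norm_num)
  obtain ⟨a₂, b₂, hu₂, hv₂, -⟩ := h.limits (-1) (by norm_num)
  obtain ⟨Ku, hKu⟩ := exists_bound_of_tendsto h.smooth_u.continuousOn hu₂ hu₁
  obtain ⟨Kv, hKv⟩ := exists_bound_of_tendsto h.continuousOn_vs hv₂ hv₁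
  obtain ⟨K₁, hK₁⟩ := isCompact_Icc.exists_bound_of_continuousOn hβc
  obtain ⟨K₂, hK₂⟩ := isCompact_Icc.exists_bound_of_continuousOn
    (f := fun t => 3 * (ξ t + t * ξ' t))
    (continuousOn_const.mul (hξ.add (continuousOn_id.mul hξ')))
  obtain ⟨K₃, hK₃⟩ := isCompact_Icc.exists_bound_of_continuousOn
    (f := fun t => 1 / 2 * ((1 - s * (1 + t)) * ξ' t - s * ξ t))
    (continuousOn_const.mul ((ContinuousOn.mul (by fun_prop) hξ').sub (continuousOn_const.mul hξ)))
  have h0 : (0 : ℝ) ∈ 𝕀 := by norm_num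
  have hKn : 0 ≤ K₁ ∧ 0 ≤ K₂ ∧ 0 ≤ K₃ ∧ 0 ≤ Ku ∧ 0 ≤ Kv :=
    ⟨(norm_nonneg _).trans (hK₁ 0 (hsub h0)), (norm_nonneg _).trans (hK₂ 0 (hsub h0)),
      (norm_nonneg _).trans (hK₃ 0 (hsub h0)), (abs_nonneg _).trans (hKu 0 h0),
      (abs_nonneg _).trans (hKv 0 h0)⟩
  obtain ⟨k₁, k₂, k₃, ku, kv⟩ := hKn
  have hlower (t : ℝ) (ht : t ∈ 𝕀) :
      -(K₂ * Ku + K₃ * Kv + K₁) ≤ areaDensity s u v w N ξ ξ' t - betaDensity s ξ ξ' t := by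
    have e1 := (abs_le.1 (hK₁ t (hsub ht))).2
    have e2 : |3 * (ξ t + t * ξ' t) * u t| ≤ K₂ * Ku := by
      rw [abs_mul]
      exact mul_le_mul (hK₂ t (hsub ht)) (hKu t ht) (abs_nonneg _) k₂
    have e3 : |1 / 2 * ((1 - s * (1 + t)) * ξ' t - s * ξ t) * (v t + s * log (1 - t))| ≤
        K₃ * Kv := by
      rw [abs_mul]
      exact mul_le_mul (hK₃ t (hsub ht)) (hKv t ht) (abs_nonneg _) k₃
    have hq0 : 0 < 1 - t ^ 2 := by nlinarith [ht.1, ht.2]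
    have hp := hpos t (hsub ht)
    have hN := h.nonneg t ht
    have e4 : 0 ≤ 3 * ξ t * deriv u t ^ 2 * (1 - t ^ 2) + 1 / 4 * ξ t * (1 - t ^ 2) *
      ((deriv v t - s / (1 - t)) ^ 2 + deriv w t ^ 2 +
        sinh (w t) ^ 2 * (deriv v t - 1 / (1 - t ^ 2)) ^ 2) + 1 / 4 * ξ t * N t := by
      positivity
    rw [areaDensity]
    linarith [(abs_le.1 e2).1, (abs_le.1 e3).1]
  have hmeas : AEMeasurable (fun t => areaDensity s u v w N ξ ξ' t - betaDensity s ξ ξ' t)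
      (volume.restrict (𝕀)) := by
    have hc {f : ℝ → ℝ} (hf : ContinuousOn f (𝕀)) :
        AEMeasurable f (volume.restrict (𝕀)) := hf.aemeasurable measurableSet_Ioo
    have hξm := hc (hξ.mono hsub)
    have hξm' := hc (hξ'.mono hsub)
    have hwm := Real.measurable_sinh.comp_aemeasurable (hc h.smooth_w.continuousOn)
    have hid : AEMeasurable (fun t : ℝ => t) (volume.restrict (𝕀)) := aemeasurable_id
    have hβm := hc (hβc.mono hsub)
    have hvm := hc h.continuousOn_vs
    have hum := hc h.smooth_u.continuousOn
    have hdu := (measurable_deriv u).aemeasurable (μ := volume.restrict (𝕀))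
    have hdv := (measurable_deriv v).aemeasurable (μ := volume.restrict (𝕀))
    have hdw := (measurable_deriv w).aemeasurable (μ := volume.restrict (𝕀))
    have hN := h.measurable
    have hq := (hid.pow_const 2).const_sub 1
    refine AEMeasurable.sub ?_ hβm
    refine (((((hξm.const_mul 3).mul (hdu.pow_const 2)).mul hq).add
      (((hξm.const_mul (1 / 4)).mul hq).mul (AEMeasurable.add (AEMeasurable.add ?_
        (hdw.pow_const 2)) ((hwm.pow_const 2).mul ?_)))).add
      ((hξm.const_mul (1 / 4)).mul hN)).add
      ((((hξm.add (hid.mul hξm')).const_mul 3).mul hum).add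
        ((((((hid.const_add 1).const_mul s).const_sub 1).mul hξm').sub
          (hξm.const_mul s)).const_mul (1 / 2) |>.mul hvm))
    · exact (hdv.sub ((hid.const_sub 1).const_div s)).pow_const 2
    · exact (hdv.sub (hq.const_div 1)).pow_const 2
  obtain ⟨c₁, hc₁, hce₁, hcH₁⟩ := h.tendsto_boundaryTerm (e := 1) (by norm_num) hξ
  obtain ⟨c₂, hc₂, hce₂, hcH₂⟩ := h.tendsto_boundaryTerm (e := -1) (by norm_num) hξ
  obtain ⟨hi, hle⟩ := integrableOn_of_le_deriv hmeas (by positivity) hlower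
    (fun t ht => (h.exists_hasDerivAt hs ht (hpos t (hsub ht)) (hd t ht)).1)
    (fun t ht => (h.exists_hasDerivAt hs ht (hpos t (hsub ht)) (hd t ht)).2)
    hc₂ hc₁ hce₂ hce₁ (hcH₁.sub hcH₂) (by norm_num)
  have hfi : IntegrableOn (areaDensity s u v w N ξ ξ') (𝕀) := by
    refine (hi.add hβi).congr (Eventually.of_forall fun t => ?_)
    simp
  refine ⟨hfi, ?_⟩
  rw [integral_sub hfi hβi] at hle
  linarith

end Profile

section MetricFunctions

lemma tendsto_of_tendsto_exp {α : Type*} {l : Filter α} {f : α → ℝ} {c L : ℝ} (hL : 0 < L)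
    (hc : c ≠ 0) (h : Tendsto (fun t => exp (c * f t)) l (𝓝 L)) :
    Tendsto f l (𝓝 (log L / c)) := by
  refine ((h.log hL.ne').div_const c).congr fun t => ?_
  rw [Real.log_exp, mul_div_cancel_left₀ _ hc]

variable {a b c u v w : ℝ → ℝ}

/-- The functions `u`, `v`, `w` parametrize the matrix with entries `a`, `b`, `c`. -/
structure IsMetricProfile (a b c u v w : ℝ → ℝ) : Prop where
  smooth_a : ContDiffOn ℝ ∞ a (𝕀)
  smooth_b : ContDiffOn ℝ ∞ b (𝕀)
  smooth_c : ContDiffOn ℝ ∞ c (𝕀)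
  eq_a : ∀ t ∈ 𝕀, a t = exp (2 * u t + v t) * (1 - t) * cosh (w t)
  eq_c : ∀ t ∈ 𝕀, c t = exp (2 * u t - v t) * (1 + t) * cosh (w t)
  eq_b : ∀ t ∈ 𝕀, b t = exp (2 * u t) * sqrt (1 - t ^ 2) * sinh (w t)

namespace IsMetricProfile

lemma det_eq (h : IsMetricProfile a b c u v w) {t : ℝ} (ht : t ∈ 𝕀) :
    a t * c t - b t ^ 2 = exp (4 * u t) * (1 - t ^ 2) := by
  have h0 : 0 ≤ 1 - t ^ 2 := by nlinarith [ht.1, ht.2]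
  have e1 : exp (2 * u t + v t) * exp (2 * u t - v t) = exp (4 * u t) := by
    rw [← exp_add]; congr 1; ring
  have e2 : exp (2 * u t) ^ 2 = exp (4 * u t) := by
    rw [← exp_nat_mul]; congr 1; push_cast; ring
  rw [h.eq_a t ht, h.eq_b t ht, h.eq_c t ht, mul_pow, mul_pow, sq_sqrt h0, e2]
  linear_combination (1 - t ^ 2) * cosh (w t) ^ 2 * e1 +
    exp (4 * u t) * (1 - t ^ 2) * Real.cosh_sq' (w t)

lemma a_pos (h : IsMetricProfile a b c u v w) {t : ℝ} (ht : t ∈ 𝕀) :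
    0 < a t := by
  have : 0 < 1 - t := by linarith [ht.2]
  rw [h.eq_a t ht]
  exact mul_pos (mul_pos (exp_pos _) this) (Real.cosh_pos _)

lemma c_pos (h : IsMetricProfile a b c u v w) {t : ℝ} (ht : t ∈ 𝕀) :
    0 < c t := by
  have : 0 < 1 + t := by linarith [ht.1]
  rw [h.eq_c t ht]
  exact mul_pos (mul_pos (exp_pos _) this) (Real.cosh_pos _)

lemma det_pos (h : IsMetricProfile a b c u v w) {t : ℝ} (ht : t ∈ 𝕀) :
    0 < a t * c t - b t ^ 2 := by
  have : 0 < 1 - t ^ 2 := by nlinarith [ht.1, ht.2]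
  rw [h.det_eq ht]
  positivity

lemma exp_two_v (h : IsMetricProfile a b c u v w) {t : ℝ} (ht : t ∈ 𝕀) :
    exp (2 * v t) = a t * (1 + t) / (c t * (1 - t)) := by
  have h1 : 0 < 1 - t := by linarith [ht.2]
  have h2 : 0 < 1 + t := by linarith [ht.1]
  have e1 : exp (2 * v t) * exp (2 * u t - v t) = exp (2 * u t + v t) := by
    rw [← exp_add]; congr 1; ring
  rw [eq_div_iff (mul_pos (h.c_pos ht) h1).ne', h.eq_a t ht, h.eq_c t ht, ← e1]
  ring

lemma smooth_u (h : IsMetricProfile a b c u v w) : ContDiffOn ℝ ∞ u (𝕀) := by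
  have h0 (t : ℝ) (ht : t ∈ 𝕀) : 0 < 1 - t ^ 2 := by nlinarith [ht.1, ht.2]
  have h1 : ContDiffOn ℝ ∞ (fun t => 1 / 4 * log ((a t * c t - b t ^ 2) / (1 - t ^ 2)))
      (𝕀) := by
    refine contDiffOn_const.mul (ContDiffOn.log (ContDiffOn.div
      ((h.smooth_a.mul h.smooth_c).sub (h.smooth_b.pow 2))
      (contDiffOn_const.sub (contDiffOn_id.pow 2)) fun t ht => (h0 t ht).ne') fun t ht => ?_)
    exact (div_pos (h.det_pos ht) (h0 t ht)).ne'
  refine h1.congr fun t ht => ?_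
  rw [h.det_eq ht, mul_div_cancel_right₀ _ (h0 t ht).ne', Real.log_exp]
  ring

lemma smooth_v (h : IsMetricProfile a b c u v w) : ContDiffOn ℝ ∞ v (𝕀) := by
  have h1 (t : ℝ) (ht : t ∈ 𝕀) : 0 < 1 - t := by linarith [ht.2]
  have h2 (t : ℝ) (ht : t ∈ 𝕀) : 0 < 1 + t := by linarith [ht.1]
  have h3 : ContDiffOn ℝ ∞ (fun t => 1 / 2 * log (a t * (1 + t) / (c t * (1 - t))))
      (𝕀) := by
    refine contDiffOn_const.mul (ContDiffOn.log (ContDiffOn.div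
      (h.smooth_a.mul (contDiffOn_const.add contDiffOn_id))
      (h.smooth_c.mul (contDiffOn_const.sub contDiffOn_id)) fun t ht =>
        (mul_pos (h.c_pos ht) (h1 t ht)).ne') fun t ht => ?_)
    exact (div_pos (mul_pos (h.a_pos ht) (h2 t ht)) (mul_pos (h.c_pos ht) (h1 t ht))).ne'
  refine h3.congr fun t ht => ?_
  rw [← h.exp_two_v ht, Real.log_exp]
  ring

lemma smooth_w (h : IsMetricProfile a b c u v w) : ContDiffOn ℝ ∞ w (𝕀) := by
  have h3 : ContDiffOn ℝ ∞ (fun t => Real.arsinh (b t / sqrt (a t * c t - b t ^ 2)))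
      (𝕀) := by
    refine Real.contDiff_arsinh.comp_contDiffOn (ContDiffOn.div h.smooth_b
      (ContDiffOn.sqrt ((h.smooth_a.mul h.smooth_c).sub (h.smooth_b.pow 2)) fun t ht =>
        (h.det_pos ht).ne') fun t ht => (sqrt_pos.2 (h.det_pos ht)).ne')
  refine h3.congr fun t ht => ?_
  have h0 : 0 < 1 - t ^ 2 := by nlinarith [ht.1, ht.2]
  have e2 : exp (4 * u t) = exp (2 * u t) ^ 2 := by
    rw [← exp_nat_mul]; congr 1; push_cast; ring
  rw [h.det_eq ht, h.eq_b t ht, Real.sqrt_mul (exp_pos _).le, e2,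
    Real.sqrt_sq (exp_pos _).le, mul_div_cancel_left₀, Real.arsinh_sinh]
  exact (mul_pos (exp_pos _) (sqrt_pos.2 h0)).ne'

lemma hasDerivAt_u (h : IsMetricProfile a b c u v w) {t : ℝ} (ht : t ∈ 𝕀) :
    HasDerivAt u (deriv u t) t :=
  ((h.smooth_u.differentiableOn (by simp)).differentiableAt (isOpen_Ioo.mem_nhds ht)).hasDerivAt

lemma deriv_det (h : IsMetricProfile a b c u v w) {t : ℝ} (ht : t ∈ 𝕀) :
    deriv a t * deriv c t - deriv b t ^ 2 = exp (4 * u t) * (1 - t ^ 2) *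
      ((2 * deriv u t - t / (1 - t ^ 2)) ^ 2 -
        (deriv v t - 1 / (1 - t ^ 2)) ^ 2 * cosh (w t) ^ 2 - deriv w t ^ 2) := by
  have hn := isOpen_Ioo.mem_nhds ht
  have hu := h.hasDerivAt_u ht
  have hv := ((h.smooth_v.differentiableOn (by simp)).differentiableAt hn).hasDerivAt
  have hw := ((h.smooth_w.differentiableOn (by simp)).differentiableAt hn).hasDerivAt
  have h0 : 0 < 1 - t ^ 2 := by nlinarith [ht.1, ht.2]
  have h1 : 0 < 1 - t := by linarith [ht.2]
  have h2 : 0 < 1 + t := by linarith [ht.1]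
  have hr := sqrt_pos.2 h0
  set r := sqrt (1 - t ^ 2) with hrdef
  have hr2 : r ^ 2 = 1 - t ^ 2 := sq_sqrt h0.le
  have hid : HasDerivAt (fun t : ℝ => t) 1 t := hasDerivAt_id t
  set S := 2 * deriv u t - t / (1 - t ^ 2) with hS
  set T := deriv v t - 1 / (1 - t ^ 2) with hT
  have hq : 1 - t ^ 2 = (1 - t) * (1 + t) := by ring
  have ea : deriv a t = exp (2 * u t + v t) * (1 - t) *
      ((S + T) * cosh (w t) + sinh (w t) * deriv w t) := by
    have h3 := ((((hu.const_mul 2).add hv).exp.mul (hid.const_sub 1)).mul hw.cosh)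
    refine ((h3.congr_of_eventuallyEq ?_).congr_deriv ?_).deriv
    · filter_upwards [hn] with s hs using h.eq_a s hs
    · simp only [Pi.add_apply, Pi.mul_apply, hS, hT, hq]
      field_simp
      ring
  have ec : deriv c t = exp (2 * u t - v t) * (1 + t) *
      ((S - T) * cosh (w t) + sinh (w t) * deriv w t) := by
    have h3 := ((((hu.const_mul 2).sub hv).exp.mul (hid.const_add 1)).mul hw.cosh)
    refine ((h3.congr_of_eventuallyEq ?_).congr_deriv ?_).deriv
    · filter_upwards [hn] with s hs using h.eq_c s hs
    · simp only [Pi.sub_apply, Pi.mul_apply, hS, hT, hq]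
      field_simp
      ring
  have eb : deriv b t = exp (2 * u t) * r *
      (S * sinh (w t) + cosh (w t) * deriv w t) := by
    have h3 := (((hu.const_mul 2).exp.mul ((hid.pow 2).const_sub 1 |>.sqrt h0.ne')).mul hw.sinh)
    refine ((h3.congr_of_eventuallyEq ?_).congr_deriv ?_).deriv
    · filter_upwards [hn] with s hs using h.eq_b s hs
    · simp only [Pi.pow_apply, Pi.mul_apply, hS, Nat.cast_ofNat, Nat.add_one_sub_one, pow_one]
      rw [← hrdef, ← hr2]
      field_simp
      ring
  have e1 : exp (2 * u t + v t) * exp (2 * u t - v t) = exp (4 * u t) := by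
    rw [← exp_add]; congr 1; ring
  have e2 : exp (2 * u t) ^ 2 = exp (4 * u t) := by
    rw [← exp_nat_mul]; congr 1; push_cast; ring
  have e3 : deriv a t * deriv c t = exp (4 * u t) * (1 - t ^ 2) *
      (((S + T) * cosh (w t) + sinh (w t) * deriv w t) *
      ((S - T) * cosh (w t) + sinh (w t) * deriv w t)) := by
    rw [ea, ec, ← e1]; ring
  have e4 : deriv b t ^ 2 = exp (4 * u t) * (1 - t ^ 2) *
      (S * sinh (w t) + cosh (w t) * deriv w t) ^ 2 := by
    rw [eb, mul_pow, mul_pow, hr2, e2]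
  rw [e3, e4]
  linear_combination exp (4 * u t) * (1 - t ^ 2) * (S ^ 2 - deriv w t ^ 2) *
    Real.cosh_sq' (w t)

lemma deriv_deriv_exp (h : IsMetricProfile a b c u v w) {t : ℝ} (ht : t ∈ 𝕀) :
    deriv (deriv fun t => exp (4 * u t) * (1 - t ^ 2)) t = exp (4 * u t) *
      ((4 * deriv (deriv u) t + 16 * deriv u t ^ 2) * (1 - t ^ 2) - 16 * t * deriv u t - 2) := by
  have hn := isOpen_Ioo.mem_nhds ht
  have hid (t : ℝ) : HasDerivAt (fun t : ℝ => t) 1 t := hasDerivAt_id t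
  have h1 (s : ℝ) (hs : s ∈ 𝕀) :
      deriv (fun t => exp (4 * u t) * (1 - t ^ 2)) s =
        exp (4 * u s) * (4 * deriv u s * (1 - s ^ 2) - 2 * s) := by
    have h2 := ((h.hasDerivAt_u hs).const_mul 4).exp.mul (((hid s).pow 2).const_sub 1)
    refine (h2.congr_deriv ?_).deriv
    simp
    ring
  have hu2 := (((h.smooth_u.deriv_of_isOpen (m := ∞) isOpen_Ioo (by simp)).differentiableOn
    (by simp)).differentiableAt hn).hasDerivAt
  have h2 := ((h.hasDerivAt_u ht).const_mul 4).exp.mul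
    (((hu2.const_mul 4).mul (((hid t).pow 2).const_sub 1)).sub ((hid t).const_mul 2))
  refine ((h2.congr_of_eventuallyEq ?_).congr_deriv ?_).deriv
  · filter_upwards [hn] with s hs using h1 s hs
  · simp
    ring

lemma tendsto_u (h : IsMetricProfile a b c u v w) {f g : ℝ → ℝ} (hfg : ∀ t, f t * g t = a t * c t)
    {e α β : ℝ} (he : e ^ 2 = 1) (hα : 0 < α) (hβ : 0 < β)
    (hf : Tendsto (fun t => f t / (1 - e * t)) (𝓝[𝕀] e) (𝓝 α)) (hg : Tendsto g (𝓝[𝕀] e) (𝓝 β))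
    (hb : Tendsto (fun t => b t ^ 2 / (1 - e * t)) (𝓝[𝕀] e) (𝓝 0)) :
    Tendsto u (𝓝[𝕀] e) (𝓝 (log (α * β / 2) / 4)) := by
  refine tendsto_of_tendsto_exp (by positivity) (by norm_num) ?_
  have hid : Tendsto (fun t : ℝ => 1 + e * t) (𝓝[𝕀] e) (𝓝 2) := by
    have : Continuous fun t : ℝ => 1 + e * t := by fun_prop
    refine (this.tendsto' e 2 ?_).mono_left nhdsWithin_le_nhds
    linarith
  have h1 := ((hf.mul hg).sub hb).div hid (by norm_num)
  rw [sub_zero] at h1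
  refine h1.congr' ?_
  filter_upwards [self_mem_nhdsWithin] with t ht
  have h0 : 0 < 1 - t ^ 2 := by nlinarith [ht.1, ht.2]
  have h2 : (1 - e * t) * (1 + e * t) = 1 - t ^ 2 := by linear_combination -t ^ 2 * he
  have h3 : 1 - e * t ≠ 0 := fun h => by rw [h, zero_mul] at h2; linarith
  have h4 : 1 + e * t ≠ 0 := fun h => by rw [h, mul_zero] at h2; linarith
  have h5 := h.det_eq ht
  rw [← hfg, ← h2] at h5
  simp only [Pi.div_apply] at *
  field_simp
  linarith

end IsMetricProfile

end MetricFunctions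

lemma log_axis_identity {α β : ℝ} (hα : 0 < α) (hβ : 0 < β) :
    3 * (log (α * β / 2) / 4) + 1 / 2 * (log (2 * α / β) / 2) =
      1 / 2 * log (α ^ 2 * β / 2) := by
  rw [log_div (by positivity) two_ne_zero, log_div (by positivity) hβ.ne',
    log_div (by positivity) two_ne_zero, log_mul two_ne_zero hα.ne',
    log_mul hα.ne' hβ.ne', log_mul (by positivity) hβ.ne', Real.log_pow]
  push_cast
  ring

lemma IsMetricProfile.limits_first {a b c u v w : ℝ → ℝ} (h : IsMetricProfile a b c u v w)
    {α β : ℝ} (hα : 0 < α) (hβ : 0 < β) (ha : Tendsto (fun t => a t / (1 - 1 * t)) (𝓝[𝕀] 1) (𝓝 α))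
    (hc : Tendsto c (𝓝[𝕀] 1) (𝓝 β)) (hb : Tendsto (fun t => b t ^ 2 / (1 - 1 * t)) (𝓝[𝕀] 1) (𝓝 0)) :
    ∃ A B, Tendsto u (𝓝[𝕀] 1) (𝓝 A) ∧ Tendsto v (𝓝[𝕀] 1) (𝓝 B) ∧
      3 * A + 1 / 2 * B = 1 / 2 * log (α ^ 2 * β / 2) := by
  refine ⟨_, log (2 * α / β) / 2, h.tendsto_u (fun t => rfl) (by norm_num) hα hβ ha hc hb,
    tendsto_of_tendsto_exp (by positivity) (by norm_num) ?_, ?_⟩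
  · have hid : Tendsto (fun t : ℝ => 1 + t) (𝓝[𝕀] 1) (𝓝 2) := by
      have : Continuous fun t : ℝ => 1 + t := by fun_prop
      exact (this.tendsto' 1 2 (by norm_num)).mono_left nhdsWithin_le_nhds
    refine ((hid.mul ha).div hc hβ.ne').congr' ?_
    filter_upwards [self_mem_nhdsWithin] with t ht
    have h1 : 1 - t ≠ 0 := by linarith [ht.2]
    have h2 := (h.c_pos ht).ne'
    rw [h.exp_two_v ht]
    simp only [Pi.div_apply, one_mul]
    field_simp
  · linear_combination log_axis_identity hα hβ

lemma IsMetricProfile.limits_second {a b c u v w : ℝ → ℝ} (h : IsMetricProfile a b c u v w)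
    {α β : ℝ} (hα : 0 < α) (hβ : 0 < β)
    (hc : Tendsto (fun t => c t / (1 - -1 * t)) (𝓝[𝕀] (-1)) (𝓝 α))
    (ha : Tendsto a (𝓝[𝕀] (-1)) (𝓝 β))
    (hb : Tendsto (fun t => b t ^ 2 / (1 - -1 * t)) (𝓝[𝕀] (-1)) (𝓝 0)) :
    ∃ A B, Tendsto u (𝓝[𝕀] (-1)) (𝓝 A) ∧
      Tendsto v (𝓝[𝕀] (-1)) (𝓝 B) ∧
      3 * A - 1 / 2 * B = 1 / 2 * log (α ^ 2 * β / 2) := by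
  refine ⟨_, log (2 * α / β) / (-2),
    h.tendsto_u (fun t => mul_comm _ _) (by norm_num) hα hβ hc ha hb,
    tendsto_of_tendsto_exp (by positivity) (by norm_num) ?_, ?_⟩
  · have hid : Tendsto (fun t : ℝ => 1 - t) (𝓝[𝕀] (-1)) (𝓝 2) := by
      have : Continuous fun t : ℝ => 1 - t := by fun_prop
      exact (this.tendsto' (-1) 2 (by norm_num)).mono_left nhdsWithin_le_nhds
    refine ((hid.mul hc).div ha hβ.ne').congr' ?_
    filter_upwards [self_mem_nhdsWithin] with t ht
    have h1 : 1 - t ≠ 0 := by linarith [ht.2]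
    have h3 : 1 + t ≠ 0 := by linarith [ht.1]
    have h2 := (h.a_pos ht).ne'
    rw [neg_mul, exp_neg, h.exp_two_v ht]
    simp only [Pi.div_apply, neg_one_mul, sub_neg_eq_add, inv_div]
    field_simp
  · linear_combination log_axis_identity hα hβ

lemma IsMetricProfile.limits_ring {a b c u v w : ℝ → ℝ} (h : IsMetricProfile a b c u v w)
    {e α β : ℝ} (he : e ^ 2 = 1) (hα : 0 < α) (hβ : 0 < β)
    (hc : Tendsto (fun t => c t / (1 - e * t)) (𝓝[𝕀] e) (𝓝 α)) (ha : Tendsto a (𝓝[𝕀] e) (𝓝 β))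
    (hb : Tendsto (fun t => b t ^ 2 / (1 - e * t)) (𝓝[𝕀] e) (𝓝 0)) :
    ∃ A B, Tendsto u (𝓝[𝕀] e) (𝓝 A) ∧
      Tendsto (fun t => v t + 1 * log (1 - t)) (𝓝[𝕀] e) (𝓝 B) ∧
      3 * A - 1 / 2 * B = 1 / 2 * log (α ^ 2 * β / 4) := by
  refine ⟨_, log (2 * β / α) / 2, h.tendsto_u (fun t => mul_comm _ _) he hα hβ hc ha hb,
    tendsto_of_tendsto_exp (by positivity) (by norm_num) ?_, ?_⟩
  · have hid : Tendsto (fun t : ℝ => 1 + e * t) (𝓝[𝕀] e) (𝓝 2) := by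
      have : Continuous fun t : ℝ => 1 + e * t := by fun_prop
      exact (this.tendsto' e 2 (by linarith)).mono_left nhdsWithin_le_nhds
    refine ((hid.mul ha).div hc hα.ne').congr' ?_
    filter_upwards [self_mem_nhdsWithin] with t ht
    have h1 : 0 < 1 - t := by linarith [ht.2]
    have h0 : 0 < 1 - t ^ 2 := by nlinarith [ht.1, ht.2]
    have h2 : (1 - e * t) * (1 + e * t) = 1 - t ^ 2 := by linear_combination -t ^ 2 * he
    have h3 : 1 - e * t ≠ 0 := fun h => by rw [h, zero_mul] at h2; linarith
    have hc0 := (h.c_pos ht).ne'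
    have e1 : exp (2 * (v t + 1 * log (1 - t))) = exp (2 * v t) * (1 - t) ^ 2 := by
      nth_rewrite 2 [← Real.exp_log h1]
      rw [← exp_nat_mul, ← exp_add]
      congr 1
      push_cast
      ring
    rw [e1, h.exp_two_v ht]
    simp only [Pi.div_apply]
    field_simp
    linear_combination a t * h2
  · rw [log_div (by positivity) two_ne_zero, log_div (by positivity) hα.ne',
      log_div (by positivity) (by norm_num), log_mul two_ne_zero hβ.ne',
      log_mul hα.ne' hβ.ne', log_mul (by positivity) hβ.ne', Real.log_pow,
      show (4 : ℝ) = 2 ^ 2 by norm_num, Real.log_pow]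
    push_cast
    ring

/-- The entry of `Zᵀ λ Z` for the columns `w` and `w'` of `Z`. -/
def weightForm (γ : TwoTensor 3 B) (x : B → ℝ) (w w' : Fin 2 → ℤ) : ℝ → ℝ :=
  orbitForm γ x (realWeight w) (realWeight w')

lemma IsBiaxial.orbitGram_comm (h : IsBiaxial γ C x) (t : ℝ) :
    orbitGram γ x t 1 0 = orbitGram γ x t 0 1 := by
  unfold orbitGram
  split
  · exact h.symm _ _ _
  · rfl

lemma IsBiaxial.weightForm_eq (h : IsBiaxial γ C x) (w w' : Fin 2 → ℤ) :
    weightForm γ x w w' = fun t => w 0 * w' 0 * orbitGram γ x t 0 0 +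
      (w 0 * w' 1 + w 1 * w' 0) * orbitGram γ x t 0 1 + w 1 * w' 1 * orbitGram γ x t 1 1 := by
  funext t
  simp only [weightForm, orbitForm, sum_univ_two, realWeight, h.orbitGram_comm t]
  ring

lemma IsBiaxial.weightForm_comm (h : IsBiaxial γ C x) (w w' : Fin 2 → ℤ) :
    weightForm γ x w w' = weightForm γ x w' w := by
  rw [h.weightForm_eq, h.weightForm_eq]
  funext t
  ring

lemma IsBiaxial.weightForm_smooth (h : IsBiaxial γ C x) (w w' : Fin 2 → ℤ) :
    ContDiffOn ℝ ∞ (weightForm γ x w w') (𝕀) := by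
  rw [h.weightForm_eq]
  exact ((contDiffOn_const.mul (h.orbitGram_smooth 0 0)).add
    (contDiffOn_const.mul (h.orbitGram_smooth 0 1))).add
    (contDiffOn_const.mul (h.orbitGram_smooth 1 1))

lemma IsInducedMap.isMetricProfile (hΨ : IsInducedMap g F vol ι x p q Ψ)
    (hB : IsBiaxial (induced g ι) C x) :
    IsMetricProfile (weightForm (induced g ι) x ![1, 0] ![1, 0])
      (weightForm (induced g ι) x ![1, 0] ![q, p]) (weightForm (induced g ι) x ![q, p] ![q, p])
      (fun t => Ψ.U (arccos t)) (fun t => Ψ.V (arccos t))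
      (fun t => Ψ.W (arccos t)) := by
  have hg (b : B) (i j : Fin 2) : orbitGram (induced g ι) x (x b) i j =
    fiberMetric (induced g ι) b i j := hB.orbitGram_eq b i j
  refine ⟨hB.weightForm_smooth _ _, hB.weightForm_smooth _ _, hB.weightForm_smooth _ _, ?_, ?_, ?_⟩
  all_goals
    intro t ht
    obtain ⟨b, rfl⟩ := hB.exists_x_eq (Ioo_subset_Icc_self ht)
    have hsym : fiberMetric (induced g ι) b 1 0 = fiberMetric (induced g ι) b 0 1 := hB.symm _ _ _
  · rw [← hΨ.metric_zero_zero b ht.1 ht.2 _ rfl, hB.weightForm_eq]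
    simp [Matrix.mul_apply, sum_univ_two, lensMatrix, hg]
  · rw [← hΨ.metric_one_one b ht.1 ht.2 _ rfl, hB.weightForm_eq]
    simp [Matrix.mul_apply, sum_univ_two, lensMatrix, hg, hsym]
    ring
  · rw [← hΨ.metric_zero_one b ht.1 ht.2 _ rfl, hB.weightForm_eq]
    simp [Matrix.mul_apply, sum_univ_two, lensMatrix, hg]
    ring

lemma IsBiaxial.weightForm_det (h : IsBiaxial γ C x) (p : ℕ) (q : ℤ) (t : ℝ) :
    weightForm γ x ![1, 0] ![1, 0] t * weightForm γ x ![q, p] ![q, p] t -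
      weightForm γ x ![1, 0] ![q, p] t ^ 2 = p ^ 2 * orbitDet γ x t := by
  simp only [h.weightForm_eq, orbitDet]
  simp
  ring

lemma IsBiaxial.weightForm_deriv_det (h : IsBiaxial γ C x) (p : ℕ) (q : ℤ) {t : ℝ} (ht : t ∈ 𝕀) :
    deriv (weightForm γ x ![1, 0] ![1, 0]) t * deriv (weightForm γ x ![q, p] ![q, p]) t -
      deriv (weightForm γ x ![1, 0] ![q, p]) t ^ 2 =
    p ^ 2 * (deriv (fun t => orbitGram γ x t 0 0) t * deriv (fun t => orbitGram γ x t 1 1) t -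
      deriv (fun t => orbitGram γ x t 0 1) t ^ 2) := by
  have hd (i j : Fin 2) : HasDerivAt (fun t => orbitGram γ x t i j)
      (deriv (fun t => orbitGram γ x t i j) t) t :=
    (((h.orbitGram_smooth i j).differentiableOn (by simp)).differentiableAt
      (isOpen_Ioo.mem_nhds ht)).hasDerivAt
  have hw (w w' : Fin 2 → ℤ) : deriv (weightForm γ x w w') t =
      w 0 * w' 0 * deriv (fun t => orbitGram γ x t 0 0) t +
      (w 0 * w' 1 + w 1 * w' 0) * deriv (fun t => orbitGram γ x t 0 1) t +
      w 1 * w' 1 * deriv (fun t => orbitGram γ x t 1 1) t := by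
    rw [h.weightForm_eq]
    exact ((((hd 0 0).const_mul _).add ((hd 0 1).const_mul _)).add ((hd 1 1).const_mul _)).deriv
  simp only [hw]
  simp
  ring

lemma IsBiaxial.orbitAdj_nonneg (h : IsBiaxial γ C x) {t : ℝ}
    (ht : t ∈ 𝕀) (y : Fin 2 → ℝ) : 0 ≤ orbitAdj γ x t y := by
  have hD := h.orbitDet_pos ht
  have hnn : 0 ≤ orbitGram γ x t 0 0 := by
    obtain ⟨b, rfl⟩ := h.exists_x_eq (Ioo_subset_Icc_self ht)
    rw [h.orbitGram_eq]
    by_cases h0 : modelGen (n := 3) 0 b = 0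
    · simp [gram, h0]
    · exact (h.pos b _ h0).le
  rw [orbitDet] at hD
  have hpos : 0 < orbitGram γ x t 0 0 := by
    refine hnn.lt_of_ne fun h0 => ?_
    rw [← h0] at hD
    nlinarith [sq_nonneg (orbitGram γ x t 0 1)]
  refine (mul_nonneg_iff_of_pos_left hpos).1 ?_
  rw [orbitAdj]
  nlinarith [sq_nonneg (orbitGram γ x t 0 0 * y 1 - orbitGram γ x t 0 1 * y 0),
    mul_nonneg hD.le (sq_nonneg (y 0))]

lemma IsInducedMap.limits [T2Space B] (hΨ : IsInducedMap g F vol ι x p q Ψ)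
    (hB : IsBiaxial (induced g ι) C x) (htop : HasTopology x p q s) {e : ℝ} (he : e ^ 2 = 1) :
    ∃ a b, Tendsto (fun t => Ψ.U (arccos t)) (𝓝[𝕀] e) (𝓝 a) ∧
      Tendsto (fun t => Ψ.V (arccos t) + s * log (1 - t)) (𝓝[𝕀] e) (𝓝 b) ∧
      3 * e * a + 1 / 2 * (1 - s * (1 + e)) * b =
        1 / 2 * e * log (4 * p ^ 2 / (2 ^ (1 + s) * C ^ 2)) := by
  have hP := hΨ.isMetricProfile hB
  have hC := hB.orbit.pos
  rcases htop with ⟨rfl, hp, hpq, hv1, hv2⟩ | ⟨rfl, rfl, rfl, hv⟩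
  · have hp0 : (p : ℤ) ≠ 0 := by exact_mod_cast (Nat.one_le_iff_ne_zero.1 hp)
    have hκ {z : ℝ} (hz : z = 4 * p ^ 2 / C ^ 2) :
        z / 2 = 4 * p ^ 2 / (2 ^ (1 + 0) * C ^ 2) := by
      rw [hz, div_div]
      ring_nf
    rcases sq_eq_sq_iff_eq_or_eq_neg.1 (he.trans (one_pow 2).symm) with rfl | rfl
    · obtain ⟨α, β, hα, hβ, hαβ, h1, h2, h3⟩ := hB.axis_limits (w := ![1, 0]) (w' := ![q, p])
        (e := 1) isCoprime_one_left (by simpa using hp0) (by norm_num) (fun b hb => by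
          have : modelGen (n := 3) 0 b = 0 := hv1 b hb
          simp [genComb, realWeight, sum_univ_two, this])
      obtain ⟨a, b, hu, hv, hab⟩ := hP.limits_first hα hβ h1 h2 h3
      refine ⟨a, b, hu, by simpa using hv, ?_⟩
      rw [← hκ (z := α ^ 2 * β) (by rw [hαβ]; simp)]
      push_cast
      linarith
    · obtain ⟨α, β, hα, hβ, hαβ, h1, h2, h3⟩ := hB.axis_limits (w := ![q, p]) (w' := ![1, 0])
        (e := -1) (by simpa using hpq.symm) (by simpa using hp0) (by norm_num) (fun b hb => by
          have : (q : ℝ) • modelGen (n := 3) 0 b + (p : ℝ) • modelGen (n := 3) 1 b = 0 := hv2 b hb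
          simpa [genComb, realWeight, sum_univ_two] using this)
      have h3' : Tendsto (fun t => weightForm (induced g ι) x ![1, 0] ![q, p] t ^ 2 / (1 - -1 * t))
          (𝓝[𝕀] (-1)) (𝓝 0) := by
        rw [hB.weightForm_comm]; exact h3
      obtain ⟨a, b, hu, hv, hab⟩ := hP.limits_second hα hβ h1 h2 h3'
      refine ⟨a, b, hu, by simpa using hv, ?_⟩
      rw [← hκ (z := α ^ 2 * β) (by rw [hαβ]; simp)]
      push_cast
      linarith
  · obtain ⟨α, β, hα, hβ, hαβ, h1, h2, h3⟩ := hB.axis_limits (w := ![0, (1 : ℕ)]) (w' := ![1, 0])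
      (e := e) (by simpa using isCoprime_one_right) (by simp) he (fun b hb => by
        have : modelGen (n := 3) 1 b = 0 := hv b (hb ▸
          sq_eq_sq_iff_eq_or_eq_neg.1 (he.trans (one_pow 2).symm))
        simp [genComb, realWeight, sum_univ_two, this])
    have h3' : Tendsto
        (fun t => weightForm (induced g ι) x ![1, 0] ![0, (1 : ℕ)] t ^ 2 / (1 - e * t))
        (𝓝[𝕀] e) (𝓝 0) := by
      rw [hB.weightForm_comm]; exact h3
    obtain ⟨a, b, hu, hv, hab⟩ := hP.limits_ring he hα hβ h1 h2 h3'
    refine ⟨a, b, hu, by simpa using hv, ?_⟩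
    have : α ^ 2 * β / 4 = 4 * ((1 : ℕ) : ℝ) ^ 2 / (2 ^ (1 + 1) * C ^ 2) := by
      rw [hαβ]
      simp
      field_simp
      norm_num
    rw [← this]
    push_cast
    linear_combination e * hab

/-- The contribution of the matter fields and of the cosmological constant. -/
def matterDensity (Λ C : ℝ) (p : ℕ) (γ : TwoTensor 3 B) (x : B → ℝ) (Ψ : MapData) (t : ℝ) : ℝ :=
  p ^ 2 / exp (4 * Ψ.U (arccos t)) *
    (orbitAdj γ x t (fun i => Ψ.Θx i t) / orbitDet γ x t +
      orbitAdj γ x t (fun i => deriv (fun t => Ψ.ψ i (arccos t)) t) + Ψ.Υx t ^ 2 +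
      24 * Λ / C ^ 2)

lemma IsInducedMap.differentiableAt (hΨ : IsInducedMap g F vol ι x p q Ψ)
    (hB : IsBiaxial (induced g ι) C x) {t : ℝ} (ht : t ∈ 𝕀) :
    (∀ i, DifferentiableAt ℝ (fun t => Ψ.ψ i (arccos t)) t) ∧
      DifferentiableAt ℝ (fun t => Ψ.χ (arccos t)) t ∧
      ∀ i, DifferentiableAt ℝ (fun t => Ψ.ζ i (arccos t)) t := by
  obtain ⟨b, rfl⟩ := hB.exists_x_eq (Ioo_subset_Icc_self ht)
  exact ⟨fun i => (hB.differentiableAt_of_comp ht.1 ht.2 (hΨ.magnetic_smooth i b ht.1 ht.2)).1,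
    (hB.differentiableAt_of_comp ht.1 ht.2 (hΨ.electric_smooth b ht.1 ht.2)).1,
    fun i => (hB.differentiableAt_of_comp ht.1 ht.2 (hΨ.twist_smooth i b ht.1 ht.2)).1⟩

lemma IsInducedMap.aemeasurable_matterDensity (hΨ : IsInducedMap g F vol ι x p q Ψ)
    (hB : IsBiaxial (induced g ι) C x) :
    AEMeasurable (matterDensity Λ C p (induced g ι) x Ψ) (volume.restrict (𝕀)) := by
  have hc {f : ℝ → ℝ} (hf : ContinuousOn f (𝕀)) :
      AEMeasurable f (volume.restrict (𝕀)) := hf.aemeasurable measurableSet_Ioo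
  have hd (f : ℝ → ℝ) : AEMeasurable (deriv f) (volume.restrict (𝕀)) :=
    (measurable_deriv f).aemeasurable
  have hψ (i : Fin 2) : AEMeasurable (fun t => Ψ.ψ i (arccos t))
      (volume.restrict (𝕀)) :=
    hc fun t ht => ((hΨ.differentiableAt hB ht).1 i).continuousAt.continuousWithinAt
  have hL (i j : Fin 2) := hc (hB.orbitGram_smooth i j).continuousOn
  have hadj {y : ℝ → Fin 2 → ℝ}
      (hy : ∀ i, AEMeasurable (fun t => y t i) (volume.restrict (𝕀))) :
      AEMeasurable (fun t => orbitAdj (induced g ι) x t (y t))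
        (volume.restrict (𝕀)) :=
    (((hL 1 1).mul ((hy 0).pow_const 2)).sub ((((hL 0 1).const_mul 2).mul (hy 0)).mul (hy 1))).add
      ((hL 0 0).mul ((hy 1).pow_const 2))
  have hw := ((hψ 0).mul (hd fun t => Ψ.ψ 1 (arccos t))).sub
    ((hψ 1).mul (hd fun t => Ψ.ψ 0 (arccos t)))
  have hΥ : AEMeasurable Ψ.Υx (volume.restrict (𝕀)) := (hd _).add (hw.const_mul _)
  have hΘ (i : Fin 2) : AEMeasurable (Ψ.Θx i) (volume.restrict (𝕀)) :=
    (hd _).add ((hψ i).mul ((hd _).add (hw.const_mul _)))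
  have hD : AEMeasurable (orbitDet (induced g ι) x) (volume.restrict (𝕀)) :=
    ((hL 0 0).mul (hL 1 1)).sub ((hL 0 1).pow_const 2)
  have hU := (Real.measurable_exp.comp_aemeasurable
    ((hc (hΨ.isMetricProfile hB).smooth_u.continuousOn).const_mul 4)).const_div ((p : ℝ) ^ 2)
  exact hU.mul (((((hadj hΘ).div hD).add (hadj fun i => hd _)).add (hΥ.pow_const 2)).add_const _)

/-- The functions induced on the orbit space by a stable surface form a stable profile. -/
lemma IsInducedMap.isStableProfile [T2Space B] [CompactSpace B] (hΛ : 0 ≤ Λ)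
    (hM : IsBiaxisymmetricSolution Λ g F vol) (hΦ : IsGaussianNull g ι ε Φ)
    (hexp : ∀ b, expansion g Φ 0 0 b = 0) (hst : ∀ b, deriv (fun r => expansion g Φ 0 r b) 0 ≤ 0)
    (hΨ : IsInducedMap g F vol ι x p q Ψ) (hB : IsBiaxial (induced g ι) C x)
    (htop : HasTopology x p q s) (hp : 0 < p) :
    IsStableProfile (log (4 * p ^ 2 / (2 ^ (1 + s) * C ^ 2))) s
      (fun t => Ψ.U (arccos t)) (fun t => Ψ.V (arccos t)) (fun t => Ψ.W (arccos t))
      (fun t => p ^ 2 / C ^ 2 * fluxFun g Φ (induced g ι) x t *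
        exp (-(4 * Ψ.U (arccos t))))
      (matterDensity Λ C p (induced g ι) x Ψ) := by
  have hP := hΨ.isMetricProfile hB
  have hC := hB.orbit.pos
  have hp' : (0 : ℝ) < p := by exact_mod_cast hp
  have hm (t : ℝ) (ht : t ∈ 𝕀) :
      HasDerivAt (fun t => p ^ 2 / C ^ 2 * fluxFun g Φ (induced g ι) x t *
        exp (-(4 * Ψ.U (arccos t)))) _ t :=
    ((orbit_inequality hM hΦ hexp hst hB hΨ ht).1.hasDerivAt.const_mul
      ((p : ℝ) ^ 2 / C ^ 2)).mul ((hP.hasDerivAt_u ht).const_mul 4).neg.exp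
  refine ⟨hP.smooth_u, hP.smooth_v, hP.smooth_w, fun t ht => ?_, fun t ht => ?_,
    hΨ.aemeasurable_matterDensity hB, fun t ht a a' ha => ?_, fun e he => ?_,
    fun e he => hΨ.limits hB htop he⟩
  · exact (hm t ht).differentiableAt.differentiableWithinAt
  · have h1 := hB.orbitAdj_nonneg ht (fun i => Ψ.Θx i t)
    have h2 := hB.orbitAdj_nonneg ht (fun i => deriv (fun t => Ψ.ψ i (arccos t)) t)
    have h3 := hB.orbitDet_pos ht
    unfold matterDensity
    positivity
  · have hmd := (hm t ht).deriv
    have hdet : ∀ r ∈ 𝕀, orbitDet (induced g ι) x r =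
        1 / p ^ 2 * (exp (4 * Ψ.U (arccos r)) * (1 - r ^ 2)) := by
      intro r hr
      rw [← hP.det_eq hr, hB.weightForm_det]
      field_simp
    have hD'' : deriv (deriv (orbitDet (induced g ι) x)) t = 1 / p ^ 2 *
        deriv (deriv fun r => exp (4 * Ψ.U (arccos r)) * (1 - r ^ 2)) t := by
      have h1 : ∀ᶠ r in 𝓝 t, deriv (orbitDet (induced g ι) x) r = 1 / p ^ 2 *
          deriv (fun r => exp (4 * Ψ.U (arccos r)) * (1 - r ^ 2)) r := by
        filter_upwards [isOpen_Ioo.mem_nhds ht] with r hr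
        rw [← deriv_const_mul_field]
        refine Filter.EventuallyEq.deriv_eq ?_
        filter_upwards [isOpen_Ioo.mem_nhds hr] with r' hr' using hdet r' hr'
      rw [Filter.EventuallyEq.deriv_eq h1, deriv_const_mul_field]
    have hE := exp_pos (4 * Ψ.U (arccos t))
    have key := renormalized_inequality (ξ := a) (ξ' := a')
      (show 0 < 1 - t ^ 2 by nlinarith [ht.1, ht.2]) ha hE hC hp'
      (Real.cosh_sq' (Ψ.W (arccos t)))
      (by rw [hdet t ht]; field_simp)
      (m := p ^ 2 / C ^ 2 * fluxFun g Φ (induced g ι) x t *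
        exp (-(4 * Ψ.U (arccos t))))
      (by rw [exp_neg]; field_simp)
      (u' := deriv (fun t => Ψ.U (arccos t)) t)
      (u'' := deriv (deriv fun t => Ψ.U (arccos t)) t)
      (m' := deriv (fun t => p ^ 2 / C ^ 2 * fluxFun g Φ (induced g ι) x t *
        exp (-(4 * Ψ.U (arccos t)))) t)
      (by
        rw [hmd]
        simp only [Pi.neg_apply, exp_neg]
        field_simp
        ring)
      (by rw [← hB.weightForm_deriv_det p q ht, hP.deriv_det ht])
      (by rw [hD'', hP.deriv_deriv_exp ht]; field_simp)
      (orbit_inequality hM hΦ hexp hst hB hΨ ht).2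
    refine le_trans (le_of_eq ?_) key
    rw [matterDensity]
    ring
  · obtain ⟨a, b, hu, -⟩ := hΨ.limits hB htop he
    have h1 := tendsto_fluxFun hM.lorentzian hM.invariant_metric hM.action hΦ hB he
    have h2 := (h1.const_mul ((p : ℝ) ^ 2 / C ^ 2)).mul
      (Real.continuous_exp.continuousAt.tendsto.comp (hu.const_mul 4).neg)
    simpa using h2

section PolarAngle

lemma hasDerivAt_of_arccos {f : ℝ → ℝ} {θ : ℝ} (hθ : θ ∈ Ioo 0 π)
    (hf : DifferentiableAt ℝ (fun t => f (arccos t)) (cos θ)) :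
    HasDerivAt f (-sin θ * deriv (fun t => f (arccos t)) (cos θ)) θ := by
  have h1 := HasDerivAt.comp θ hf.hasDerivAt (hasDerivAt_cos θ)
  refine (h1.congr_of_eventuallyEq ?_).congr_deriv (by ring)
  filter_upwards [isOpen_Ioo.mem_nhds hθ] with r hr
  simp [Real.arccos_cos hr.1.le hr.2.le]

variable {θ : ℝ}

lemma cos_mem_Ioo (hθ : θ ∈ Ioo 0 π) : cos θ ∈ 𝕀 := by
  have h1 := sin_pos_of_pos_of_lt_pi hθ.1 hθ.2
  have h2 := Real.sin_sq_add_cos_sq θ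
  constructor <;> nlinarith [Real.neg_one_le_cos θ, Real.cos_le_one θ]

lemma tan_half_eq (hθ : θ ∈ Ioo 0 π) :
    Real.tan (θ / 2) = (1 - cos θ) / sin θ := by
  have h1 : 0 < sin (θ / 2) :=
    sin_pos_of_pos_of_lt_pi (by linarith [hθ.1]) (by linarith [hθ.1, hθ.2])
  have h2 : 0 < cos (θ / 2) :=
    Real.cos_pos_of_mem_Ioo ⟨by linarith [hθ.1, hθ.2], by linarith [hθ.2]⟩
  have h3 : sin θ = 2 * sin (θ / 2) * cos (θ / 2) := by
    rw [← Real.sin_two_mul]; congr 1; ring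
  have h4 : cos θ = 1 - 2 * sin (θ / 2) ^ 2 := by
    rw [show θ = 2 * (θ / 2) by ring, Real.cos_two_mul, Real.cos_sq']
    ring_nf
  rw [Real.tan_eq_sin_div_cos, h3, h4]
  field_simp
  ring

lemma exp_h₂ (hθ : θ ∈ Ioo 0 π) :
    exp (h₂ θ) = (1 - cos θ) / sin θ := by
  have h1 := sin_pos_of_pos_of_lt_pi hθ.1 hθ.2
  have h2 := (cos_mem_Ioo hθ).2
  rw [h₂, tan_half_eq hθ, Real.exp_log (div_pos (by linarith) h1)]

lemma exp_two_h₁ (hθ : θ ∈ Ioo 0 π) : exp (2 * h₁ θ) = sin θ := by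
  rw [h₁, show 2 * (1 / 2 * log (sin θ)) = log (sin θ) by ring,
    Real.exp_log (sin_pos_of_pos_of_lt_pi hθ.1 hθ.2)]

lemma h₁_add_h₂ (hθ : θ ∈ Ioo 0 π) :
    2 * h₁ θ + h₂ θ = log (1 - cos θ) := by
  have h1 := sin_pos_of_pos_of_lt_pi hθ.1 hθ.2
  rw [← Real.log_exp (2 * h₁ θ + h₂ θ), exp_add, exp_h₂ hθ, exp_two_h₁ hθ, mul_div_cancel₀ _ h1.ne']

lemma hasDerivAt_h₁ (hθ : θ ∈ Ioo 0 π) :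
    HasDerivAt h₁ (1 / 2 * (cos θ / sin θ)) θ :=
  ((Real.hasDerivAt_sin θ).log (sin_pos_of_pos_of_lt_pi hθ.1 hθ.2).ne').const_mul _

lemma hasDerivAt_h₂ (hθ : θ ∈ Ioo 0 π) : HasDerivAt h₂ (1 / sin θ) θ := by
  have h1 := sin_pos_of_pos_of_lt_pi hθ.1 hθ.2
  have h2 := (cos_mem_Ioo hθ).2
  have h3 : HasDerivAt (fun θ => log (1 - cos θ) - log (sin θ)) _ θ :=
    (((hasDerivAt_cos θ).const_sub 1).log (by linarith)).sub
      ((Real.hasDerivAt_sin θ).log h1.ne')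
  refine (h3.congr_of_eventuallyEq ?_).congr_deriv ?_
  · filter_upwards [isOpen_Ioo.mem_nhds hθ] with r hr
    rw [← h₁_add_h₂ hr, h₁]
    ring
  · have h4 := Real.sin_sq_add_cos_sq θ
    have h5 : 1 - cos θ ≠ 0 := by linarith
    field_simp
    linear_combination h4

lemma hasDerivAt_Vs {Ψ : MapData} (hθ : θ ∈ Ioo 0 π) (s : ℕ)
    (hV : DifferentiableAt ℝ (fun t => Ψ.V (arccos t)) (cos θ)) :
    HasDerivAt (Ψ.Vs s) (-sin θ * (deriv (fun t => Ψ.V (arccos t)) (cos θ) -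
      s / (1 - cos θ))) θ := by
  have h1 := sin_pos_of_pos_of_lt_pi hθ.1 hθ.2
  have h2 := (cos_mem_Ioo hθ).2
  have h3 : HasDerivAt (fun θ => Ψ.V θ + 2 * s * h₁ θ + s * h₂ θ) _ θ :=
    ((hasDerivAt_of_arccos hθ hV).add ((hasDerivAt_h₁ hθ).const_mul (2 * (s : ℝ)))).add
      ((hasDerivAt_h₂ hθ).const_mul (s : ℝ))
  refine h3.congr_deriv ?_
  have h4 := Real.sin_sq_add_cos_sq θ
  have h5 : 1 - cos θ ≠ 0 := by linarith
  field_simp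
  linear_combination -(s : ℝ) * h4

/-- The quadratic form of the inverse Gram matrix after completion of the square. -/
lemma adjugate_complete_square {t σ E ch sh X Y : ℝ} (hσ : 0 < σ) (ht : σ ^ 2 = 1 - t ^ 2)
    (hE : 0 < E) (hch : 0 < ch) (hcs : ch ^ 2 = 1 + sh ^ 2) :
    (1 + t) / (E * ch) * X ^ 2 + (1 - t) * E * ch * ((1 + t) / σ / E * (sh / ch) * X - Y) ^ 2 =
      (1 + t) / E * ch * X ^ 2 - 2 * σ * sh * X * Y + (1 - t) * E * ch * Y ^ 2 := by
  have h1 : (1 - t) * (1 + t) = σ ^ 2 := by rw [ht]; ring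
  field_simp
  linear_combination (X ^ 2 * (1 + t) * sh ^ 2 - 2 * X * Y * E * ch * σ * sh) * h1 -
    X ^ 2 * (1 + t) * σ ^ 2 * hcs

end PolarAngle

lemma IsBiaxial.orbitAdj_eq (h : IsBiaxial γ C x) (p : ℕ) (q : ℤ) (t : ℝ) (y : Fin 2 → ℝ) :
    p ^ 2 * orbitAdj γ x t y = weightForm γ x ![q, p] ![q, p] t * y 0 ^ 2 -
      2 * weightForm γ x ![1, 0] ![q, p] t * y 0 * (q * y 0 + p * y 1) +
      weightForm γ x ![1, 0] ![1, 0] t * (q * y 0 + p * y 1) ^ 2 := by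
  simp only [h.weightForm_eq, orbitAdj]
  simp
  ring

lemma IsInducedMap.matter_eq (hΨ : IsInducedMap g F vol ι x p q Ψ)
    (hB : IsBiaxial (induced g ι) C x) {θ : ℝ} (hθ : θ ∈ Ioo 0 π) (y : Fin 2 → ℝ) :
    (1 + cos θ) / (exp (Ψ.V θ) * cosh (Ψ.W θ)) * y 0 ^ 2 +
      (1 - cos θ) * exp (Ψ.V θ) * cosh (Ψ.W θ) *
        ((1 + cos θ) / sin θ / exp (Ψ.V θ) *
          (sinh (Ψ.W θ) / cosh (Ψ.W θ)) * y 0 - (q * y 0 + p * y 1)) ^ 2 =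
    p ^ 2 * orbitAdj (induced g ι) x (cos θ) y / exp (2 * Ψ.U θ) := by
  have hP := hΨ.isMetricProfile hB
  have ht := cos_mem_Ioo hθ
  have hσ := sin_pos_of_pos_of_lt_pi hθ.1 hθ.2
  have hsq : sin θ ^ 2 = 1 - cos θ ^ 2 := Real.sin_sq θ
  rw [adjugate_complete_square hσ hsq (exp_pos _) (Real.cosh_pos _) (Real.cosh_sq' _),
    hB.orbitAdj_eq p q, hP.eq_a _ ht, hP.eq_b _ ht, hP.eq_c _ ht, Real.arccos_cos hθ.1.le hθ.2.le,
    ← hsq, Real.sqrt_sq hσ.le, exp_add, exp_sub]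
  field_simp

lemma areaIntegrand_identity {t σ G E ch sh X Y X' Y' P Q Q' Υ u' v' w' y U V L a b ξ : ℝ}
    (hσ : 0 < σ) (hG : 0 < G) (hE : 0 < E) (hch : 0 < ch) (hξ : 0 < ξ) (hP : P ≠ 0)
    (m₁ : (1 + t) / (E * ch) * X ^ 2 +
      (1 - t) * E * ch * ((1 + t) / σ / E * (sh / ch) * X - Y) ^ 2 = P ^ 2 * Q / G)
    (m₂ : (1 + t) / (E * ch) * X' ^ 2 +
      (1 - t) * E * ch * ((1 + t) / σ / E * (sh / ch) * X' - Y') ^ 2 = P ^ 2 * Q' / G) :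
    ξ * (12 * (-σ * u') ^ 2 + (-σ * (v' - y)) ^ 2 + (-σ * w') ^ 2 +
        sh ^ 2 * (-σ * v' + 1 / σ) ^ 2 +
        P ^ 2 * ((1 + t) / σ ^ 4 / G ^ 3 / E / ch) * (-σ * X) ^ 2 +
        P ^ 2 * ((1 - t) / σ ^ 4 / G ^ 3 * E) * ch *
          ((1 + t) / σ / E * (sh / ch) * (-σ * X) - -σ * Y) ^ 2 +
        (1 + t) / σ ^ 2 / G / E / ch * (-σ * X') ^ 2 +
        (1 - t) / σ ^ 2 / G * E * ch * ((1 + t) / σ / E * (sh / ch) * (-σ * X') - -σ * Y') ^ 2 +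
        P ^ 2 * (1 / σ ^ 2 / G ^ 2) * (-σ * Υ) ^ 2 + 3 * P ^ 2 * Λ * (8 / C ^ 2) * (1 / G ^ 2) -
        ξ⁻¹ * (2 * (V + L) * (-σ * a) + 12 * U * (-σ * b)) * (1 / σ)) * σ =
      σ * (4 * (3 * ξ * u' ^ 2 * σ ^ 2 + 1 / 4 * ξ * σ ^ 2 *
        ((v' - y) ^ 2 + w' ^ 2 + sh ^ 2 * (v' - 1 / σ ^ 2) ^ 2) +
        1 / 4 * ξ * (P ^ 2 / G ^ 2 * (Q / (G ^ 2 * σ ^ 2 / P ^ 2) + Q' + Υ ^ 2 +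
          24 * Λ / C ^ 2)) + (3 * b * U + 1 / 2 * a * (V + L)))) := by
  have T₁ : P ^ 2 * ((1 + t) / σ ^ 4 / G ^ 3 / E / ch) * (-σ * X) ^ 2 +
      P ^ 2 * ((1 - t) / σ ^ 4 / G ^ 3 * E) * ch *
        ((1 + t) / σ / E * (sh / ch) * (-σ * X) - -σ * Y) ^ 2 =
      P ^ 2 / G ^ 2 * (Q / (G ^ 2 * σ ^ 2 / P ^ 2)) := by
    trans P ^ 2 / (σ ^ 2 * G ^ 3) * (P ^ 2 * Q / G)
    · rw [← m₁]
      field_simp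
      ring
    · field_simp
  have T₂ : (1 + t) / σ ^ 2 / G / E / ch * (-σ * X') ^ 2 +
      (1 - t) / σ ^ 2 / G * E * ch * ((1 + t) / σ / E * (sh / ch) * (-σ * X') - -σ * Y') ^ 2 =
      P ^ 2 / G ^ 2 * Q' := by
    trans 1 / G * (P ^ 2 * Q' / G)
    · rw [← m₂]
      field_simp
      ring
    · field_simp
  have T₃ : (-σ * v' + 1 / σ) ^ 2 = σ ^ 2 * (v' - 1 / σ ^ 2) ^ 2 := by
    field_simp
    ring
  have T₄ : P ^ 2 * (1 / σ ^ 2 / G ^ 2) * (-σ * Υ) ^ 2 = P ^ 2 / G ^ 2 * Υ ^ 2 := by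
    field_simp
  have T₅ : ξ * (ξ⁻¹ * (2 * (V + L) * (-σ * a) + 12 * U * (-σ * b)) * (1 / σ)) =
      -(2 * (V + L) * a + 12 * U * b) := by
    field_simp
    ring
  linear_combination ξ * σ * T₁ + ξ * σ * T₂ + ξ * σ * sh ^ 2 * T₃ + ξ * σ * T₄ - σ * T₅

lemma IsInducedMap.areaIntegrand_eq (hΨ : IsInducedMap g F vol ι x p q Ψ)
    (hB : IsBiaxial (induced g ι) C x) (hp : 0 < p) {A : ℝ} (hA : A = 8 * π ^ 2 / C)
    {ξ ξ' : ℝ → ℝ} {θ : ℝ} (hθ : θ ∈ Ioo 0 π) (hpos : 0 < ξ (cos θ))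
    (hd : HasDerivAt ξ (ξ' (cos θ)) (cos θ)) :
    areaIntegrand Λ A p q s ξ Ψ θ = sin θ * (4 * areaDensity s (fun t => Ψ.U (arccos t))
      (fun t => Ψ.V (arccos t)) (fun t => Ψ.W (arccos t))
      (matterDensity Λ C p (induced g ι) x Ψ) ξ ξ' (cos θ)) := by
  have hP := hΨ.isMetricProfile hB
  have hC := hB.orbit.pos
  have hp' : (0 : ℝ) < p := by exact_mod_cast hp
  have ht := cos_mem_Ioo hθ
  have hn := isOpen_Ioo.mem_nhds ht
  have hσ := sin_pos_of_pos_of_lt_pi hθ.1 hθ.2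
  have hsq : sin θ ^ 2 = 1 - cos θ ^ 2 := Real.sin_sq θ
  have harc : arccos (cos θ) = θ := Real.arccos_cos hθ.1.le hθ.2.le
  have hU := (hasDerivAt_of_arccos hθ
    ((hP.smooth_u.differentiableOn (by simp)).differentiableAt hn)).deriv
  have hVd := (hP.smooth_v.differentiableOn (by simp)).differentiableAt hn
  have hV := (hasDerivAt_of_arccos hθ hVd).deriv
  have hW := (hasDerivAt_of_arccos hθ
    ((hP.smooth_w.differentiableOn (by simp)).differentiableAt hn)).deriv
  have hVs' := (hasDerivAt_Vs hθ s hVd).deriv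
  have hh₂ := (hasDerivAt_h₂ hθ).deriv
  obtain ⟨hψd, hχd, hζd⟩ := hΨ.differentiableAt hB ht
  have hψ (i : Fin 2) := hasDerivAt_of_arccos hθ (hψd i)
  have hχ := (hasDerivAt_of_arccos hθ hχd).deriv
  have hζ (i : Fin 2) := (hasDerivAt_of_arccos hθ (hζd i)).deriv
  have hΥ : Ψ.Υ θ = -sin θ * Ψ.Υx (cos θ) := by
    rw [MapData.Υ, MapData.wronskian, MapData.Υx, harc, (hψ 0).deriv, (hψ 1).deriv, hχ]
    ring
  have hΘ (i : Fin 2) : Ψ.Θ i θ = -sin θ * Ψ.Θx i (cos θ) := by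
    rw [MapData.Θ, MapData.wronskian, MapData.Θx, harc, (hψ 0).deriv, (hψ 1).deriv, hχ, hζ]
    ring
  have hΘ0 : Ψ.Θbar p q 0 θ = -sin θ * Ψ.Θx 0 (cos θ) := by
    simp [MapData.Θbar, lensMatrix, Matrix.mulVec, dotProduct, sum_univ_two, hΘ]
  have hΘ1 : Ψ.Θbar p q 1 θ =
      -sin θ * (q * Ψ.Θx 0 (cos θ) + p * Ψ.Θx 1 (cos θ)) := by
    simp [MapData.Θbar, lensMatrix, Matrix.mulVec, dotProduct, sum_univ_two, hΘ]
    ring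
  set ψ' : Fin 2 → ℝ := fun i => deriv (fun t => Ψ.ψ i (arccos t)) (cos θ) with hψ'
  have hψ0 : deriv (Ψ.ψbar p q 0) θ = -sin θ * ψ' 0 := by
    have : Ψ.ψbar p q 0 = Ψ.ψ 0 := by
      funext r
      simp [MapData.ψbar, lensMatrix, Matrix.mulVec, dotProduct, sum_univ_two]
    rw [this, (hψ 0).deriv]
  have hψ1 : deriv (Ψ.ψbar p q 1) θ = -sin θ * (q * ψ' 0 + p * ψ' 1) := by
    have : Ψ.ψbar p q 1 = fun r => q * Ψ.ψ 0 r + p * Ψ.ψ 1 r := by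
      funext r
      simp [MapData.ψbar, lensMatrix, Matrix.mulVec, dotProduct, sum_univ_two]
    rw [this]
    refine ((((hψ 0).const_mul (q : ℝ)).add ((hψ 1).const_mul (p : ℝ))).congr_deriv ?_).deriv
    simp only [hψ']
    ring
  have hξ : HasDerivAt (fun r => ξ (cos r)) (ξ' (cos θ) * -sin θ) θ :=
    HasDerivAt.comp θ hd (hasDerivAt_cos θ)
  have hd1 : deriv (fun t => (1 - 2 * s * cos (t / 2) ^ 2) * ξ (cos t)) θ =
      -sin θ * ((1 - s * (1 + cos θ)) * ξ' (cos θ) - s * ξ (cos θ)) := by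
    have h1 : (fun t => (1 - 2 * s * cos (t / 2) ^ 2) * ξ (cos t)) =
        fun t => (1 - s * (1 + cos t)) * ξ (cos t) := by
      funext r
      rw [Real.cos_sq, show 2 * (r / 2) = r by ring]
      ring
    rw [h1]
    refine ((((((hasDerivAt_cos θ).const_add 1).const_mul (s : ℝ)).const_sub 1).mul
      hξ).congr_deriv ?_).deriv
    ring
  have hd2 : deriv (fun t => cos t * ξ (cos t)) θ =
      -sin θ * (ξ (cos θ) + cos θ * ξ' (cos θ)) := by
    refine (((hasDerivAt_cos θ).mul hξ).congr_deriv ?_).deriv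
    ring
  have hVs : Ψ.Vs s θ = Ψ.V θ + s * log (1 - cos θ) := by
    rw [MapData.Vs, ← h₁_add_h₂ hθ]
    ring
  have hAC : (A / (2 * sqrt 2 * π ^ 2)) ^ 2 = 8 / C ^ 2 := by
    have hπ := Real.pi_pos
    rw [hA, div_pow, mul_pow, mul_pow, sq_sqrt (by norm_num)]
    field_simp
    norm_num
  have e1 := exp_two_h₁ hθ
  have e2 := exp_h₂ hθ
  have e2' : exp (-h₂ θ) = (1 + cos θ) / sin θ := by
    have h1 : 1 - cos θ ≠ 0 := by linarith [ht.2]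
    rw [exp_neg, e2]
    field_simp
    linear_combination hsq
  have e4 : exp (4 * Ψ.U θ) = exp (2 * Ψ.U θ) ^ 2 := by
    rw [← exp_nat_mul]; congr 1; push_cast; ring
  have x1 : exp (-6 * h₁ θ - h₂ θ - 6 * Ψ.U θ - Ψ.V θ) =
      (1 + cos θ) / sin θ ^ 4 / exp (2 * Ψ.U θ) ^ 3 / exp (Ψ.V θ) := by
    rw [show -6 * h₁ θ - h₂ θ - 6 * Ψ.U θ - Ψ.V θ =
      -h₂ θ - (3 : ℕ) * (2 * h₁ θ) - (3 : ℕ) * (2 * Ψ.U θ) - Ψ.V θ by push_cast; ring,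
      exp_sub, exp_sub, exp_sub, exp_nat_mul, exp_nat_mul, e1, e2']
    field_simp
  have x2 : exp (-6 * h₁ θ + h₂ θ - 6 * Ψ.U θ + Ψ.V θ) =
      (1 - cos θ) / sin θ ^ 4 / exp (2 * Ψ.U θ) ^ 3 * exp (Ψ.V θ) := by
    rw [show -6 * h₁ θ + h₂ θ - 6 * Ψ.U θ + Ψ.V θ =
      h₂ θ - (3 : ℕ) * (2 * h₁ θ) - (3 : ℕ) * (2 * Ψ.U θ) + Ψ.V θ by push_cast; ring,
      exp_add, exp_sub, exp_sub, exp_nat_mul, exp_nat_mul, e1, e2]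
    field_simp
  have x3 : exp (-2 * h₁ θ - h₂ θ - 2 * Ψ.U θ - Ψ.V θ) =
      (1 + cos θ) / sin θ ^ 2 / exp (2 * Ψ.U θ) / exp (Ψ.V θ) := by
    rw [show -2 * h₁ θ - h₂ θ - 2 * Ψ.U θ - Ψ.V θ =
      -h₂ θ - (2 * h₁ θ) - (2 * Ψ.U θ) - Ψ.V θ by ring, exp_sub, exp_sub, exp_sub, e1, e2']
    field_simp
  have x4 : exp (-2 * h₁ θ + h₂ θ - 2 * Ψ.U θ + Ψ.V θ) =
      (1 - cos θ) / sin θ ^ 2 / exp (2 * Ψ.U θ) * exp (Ψ.V θ) := by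
    rw [show -2 * h₁ θ + h₂ θ - 2 * Ψ.U θ + Ψ.V θ =
      h₂ θ - (2 * h₁ θ) - (2 * Ψ.U θ) + Ψ.V θ by ring, exp_add, exp_sub, exp_sub, e1, e2]
    field_simp
  have x5 : exp (-h₂ θ - Ψ.V θ) = (1 + cos θ) / sin θ / exp (Ψ.V θ) := by
    rw [exp_sub, e2']
  have x6 : exp (-4 * h₁ θ - 4 * Ψ.U θ) =
      1 / sin θ ^ 2 / exp (2 * Ψ.U θ) ^ 2 := by
    rw [show -4 * h₁ θ - 4 * Ψ.U θ = -((2 : ℕ) * (2 * h₁ θ)) - 4 * Ψ.U θ by push_cast; ring,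
      exp_sub, exp_neg, exp_nat_mul, e1, e4, one_div]
  have x7 : exp (-4 * Ψ.U θ) = 1 / exp (2 * Ψ.U θ) ^ 2 := by
    rw [neg_mul, exp_neg, e4, one_div]
  have m1 := hΨ.matter_eq hB hθ fun i => Ψ.Θx i (cos θ)
  have m2 := hΨ.matter_eq hB hθ ψ'
  have hdet : orbitDet (induced g ι) x (cos θ) =
      exp (2 * Ψ.U θ) ^ 2 * sin θ ^ 2 / p ^ 2 := by
    rw [eq_div_iff (by positivity), mul_comm, ← hB.weightForm_det p q, hP.det_eq ht, harc, e4, hsq]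
  rw [areaIntegrand, hU, hV, hW, hVs', hh₂, hΘ0, hΘ1, hψ0, hψ1, hΥ, hd1, hd2, hVs, hAC, x1, x2, x3,
    x4, x5, x6, x7, areaDensity, matterDensity, hdet, harc, e4, Real.tanh_eq_sinh_div_cosh, ← hsq]
  exact areaIntegrand_identity hσ (exp_pos _) (exp_pos _) (Real.cosh_pos _) hpos hp'.ne'
    m1 m2

lemma cos_image_Ioo : cos '' Ioo 0 π = 𝕀 := by
  refine Set.Subset.antisymm (Set.image_subset_iff.2 fun θ hθ => cos_mem_Ioo hθ) fun t ht =>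
    ⟨arccos t, ⟨Real.arccos_pos.2 ht.2, ?_⟩, Real.cos_arccos ht.1.le ht.2.le⟩
  exact (Real.arccos_le_pi t).lt_of_ne fun h => by
    have := Real.arccos_eq_pi.1 h
    linarith [ht.1]

lemma integral_comp_cos {f : ℝ → ℝ} {h : ℝ → ℝ} (hf : ∀ θ ∈ Ioo 0 π, f θ = sin θ * h (cos θ)) :
    (IntervalIntegrable f volume 0 π ↔ IntegrableOn h (𝕀)) ∧
      ∫ θ in (0 : ℝ)..Real.pi, f θ = ∫ t in 𝕀, h t := by
  have hd : ∀ θ ∈ Ioo 0 π, HasDerivWithinAt cos (-sin θ) (Ioo 0 π) θ := fun θ _ =>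
    (hasDerivAt_cos θ).hasDerivWithinAt
  have hinj : InjOn cos (Ioo 0 π) := Real.injOn_cos.mono Ioo_subset_Icc_self
  have heq : Set.EqOn f (fun θ => |-sin θ| • h (cos θ)) (Ioo 0 π) := by
    intro θ hθ
    have := sin_pos_of_pos_of_lt_pi hθ.1 hθ.2
    simp only [smul_eq_mul, abs_neg, abs_of_pos this, hf θ hθ]
  constructor
  · rw [intervalIntegrable_iff_integrableOn_Ioo_of_le Real.pi_pos.le,
      integrableOn_congr_fun heq measurableSet_Ioo, ← cos_image_Ioo,
      integrableOn_image_iff_integrableOn_abs_deriv_smul measurableSet_Ioo hd hinj]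
  · rw [intervalIntegral.integral_of_le Real.pi_pos.le, integral_Ioc_eq_integral_Ioo,
      setIntegral_congr_fun measurableSet_Ioo heq, ← cos_image_Ioo,
      integral_image_eq_integral_abs_deriv_smul measurableSet_Ioo hd hinj]

lemma exp_half_log_mul {C p : ℝ} (s : ℕ) (hC : 0 < C) (hp : 0 < p) :
    4 * sqrt (2 ^ (1 + s)) * π ^ 2 / p *
      exp (log (4 * p ^ 2 / (2 ^ (1 + s) * C ^ 2)) / 2) = 8 * π ^ 2 / C := by
  have hr := sqrt_pos.2 (show (0 : ℝ) < 2 ^ (1 + s) by positivity)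
  have h1 : 4 * p ^ 2 / (2 ^ (1 + s) * C ^ 2) = (2 * p / (sqrt (2 ^ (1 + s)) * C)) ^ 2 := by
    rw [div_pow, mul_pow, mul_pow, sq_sqrt (by positivity)]
    norm_num
  rw [h1, Real.log_pow, Nat.cast_ofNat, mul_div_cancel_left₀ _ two_ne_zero,
    Real.exp_log (by positivity)]
  field_simp
  norm_num

lemma IsInducedMap.area_inequality [T2Space B] [CompactSpace B] (hΛ : 0 ≤ Λ)
    (hM : IsBiaxisymmetricSolution Λ g F vol) (hΦ : IsGaussianNull g ι ε Φ)
    (hexp : ∀ b, expansion g Φ 0 0 b = 0) (hst : ∀ b, deriv (fun r => expansion g Φ 0 r b) 0 ≤ 0)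
    (hΨ : IsInducedMap g F vol ι x p q Ψ) (hB : IsBiaxial (induced g ι) C x)
    (htop : HasTopology x p q s) {ξ : ℝ → ℝ} (hξ : ContDiffOn ℝ ∞ ξ (Icc (-1) 1))
    (hξpos : ∀ t ∈ Icc (-1 : ℝ) 1, 0 < ξ t) {A : ℝ} (hA : A = 8 * π ^ 2 / C) :
    IntervalIntegrable (areaIntegrand Λ A p q s ξ Ψ) volume 0 π ∧
    4 * sqrt (2 ^ (1 + s)) * π ^ 2 / p *
        exp ((areaFunctional Λ A p q s ξ Ψ - betaConst s ξ) / (2 * alphaConst ξ)) ≤ A := by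
  have hp : 0 < p := by
    rcases htop with ⟨-, hp, -⟩ | ⟨-, rfl, -⟩
    · exact hp
    · exact one_pos
  have hs : (s : ℝ) = 0 ∨ (s : ℝ) = 1 := by
    rcases htop with ⟨rfl, -⟩ | ⟨rfl, -⟩ <;> simp
  have hC := hB.orbit.pos
  set ξ' := derivWithin ξ (Icc (-1) 1) with hξ'
  have hξ'c : ContinuousOn ξ' (Icc (-1) 1) :=
    hξ.continuousOn_derivWithin (uniqueDiffOn_Icc (by norm_num)) (by simp)
  have hd : ∀ t ∈ 𝕀, HasDerivAt ξ (ξ' t) t := fun t ht =>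
    (hξ.differentiableOn (by simp) t (Ioo_subset_Icc_self ht)).hasDerivWithinAt.hasDerivAt
      (Icc_mem_nhds ht.1 ht.2)
  obtain ⟨hi, hle⟩ := (hΨ.isStableProfile hΛ hM hΦ hexp hst hB htop hp).integrable_areaDensity hs
    hξ.continuousOn hξ'c hξpos hd
  obtain ⟨hI, hI'⟩ := integral_comp_cos (f := areaIntegrand Λ A p q s ξ Ψ)
    (h := fun t => 4 * areaDensity s (fun t => Ψ.U (arccos t)) (fun t => Ψ.V (arccos t))
      (fun t => Ψ.W (arccos t)) (matterDensity Λ C p (induced g ι) x Ψ) ξ ξ' t) fun θ hθ =>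
    hΨ.areaIntegrand_eq (s := s) (Λ := Λ) hB hp hA hθ
      (hξpos _ (Ioo_subset_Icc_self (cos_mem_Ioo hθ))) (hd _ (cos_mem_Ioo hθ))
  have hβ : betaConst s ξ = ∫ t in 𝕀, betaDensity s ξ ξ' t := by
    refine (integral_comp_cos fun θ hθ => ?_).2
    have h1 : HasDerivAt (fun r => ξ (cos r)) (ξ' (cos θ) * -sin θ) θ :=
      HasDerivAt.comp θ (hd _ (cos_mem_Ioo hθ)) (hasDerivAt_cos θ)
    rw [h1.deriv, betaDensity, ← Real.sin_sq θ]
    ring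
  refine ⟨hI.2 (hi.const_mul 4), ?_⟩
  have hα : 0 < alphaConst ξ := by
    have h1 := hξpos 1 (by norm_num)
    have h2 := hξpos (-1) (by norm_num)
    rw [alphaConst]
    positivity
  have hF : areaFunctional Λ A p q s ξ Ψ - betaConst s ξ ≤
      log (4 * p ^ 2 / (2 ^ (1 + s) * C ^ 2)) * alphaConst ξ := by
    rw [areaFunctional, hI', integral_const_mul, hβ, alphaConst]
    linarith
  refine (mul_le_mul_of_nonneg_left (Real.exp_le_exp.2 ?_) (by positivity)).trans_eq
    ((exp_half_log_mul (p := p) s hC (by exact_mod_cast hp)).trans hA.symm)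
  rw [div_le_div_iff₀ (by positivity) two_pos]
  linarith

end BiaxialMOTS

end

open BiaxialMOTS in
theorem proposition5p1
    {M : Type*} [TopologicalSpace M] [T2Space M] [SecondCountableTopology M]
    [ChartedSpace (EuclideanSpace ℝ (Fin 5)) M] [IsManifold (𝓡 5) ∞ M] [MulAction Torus M]
    {B : Type*} [TopologicalSpace B] [T2Space B] [CompactSpace B] [ConnectedSpace B]
    [ChartedSpace (EuclideanSpace ℝ (Fin 3)) B] [IsManifold (𝓡 3) ∞ B] [MulAction Torus B]
    (Λ : ℝ) (hΛ : 0 ≤ Λ) (g F : TwoTensor 5 M) (vol : TopForm 5 M)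
    (hM : IsBiaxisymmetricSolution Λ g F vol)
    (ι : B → M) (hB : IsStableMOTS g ι)
    (C : ℝ) (x : B → ℝ) (hx : IsOrbitCoordinate (induced g ι) C x)
    (p : ℕ) (q : ℤ) (s : ℕ) (htop : HasTopology x p q s)
    (Ψ : MapData) (hΨ : IsInducedMap g F vol ι x p q Ψ)
    (ξ : ℝ → ℝ) (hξ : ContDiffOn ℝ ∞ ξ (Set.Icc (-1) 1)) (hξpos : ∀ t ∈ Set.Icc (-1 : ℝ) 1, 0 < ξ t)
    (A : ℝ) (hA : A = (riemannianVolume (induced g ι)).toReal) :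
    IntervalIntegrable (areaIntegrand Λ A p q s ξ Ψ) MeasureTheory.volume 0 Real.pi ∧
    4 * Real.sqrt (2 ^ (1 + s)) * Real.pi ^ 2 / p *
        Real.exp ((areaFunctional Λ A p q s ξ Ψ - betaConst s ξ) / (2 * alphaConst ξ)) ≤ A := by
  obtain ⟨ε, Φ, hΦ, hexp, hst⟩ := hB.stable
  have hgeom := isBiaxialGeometry_induced hM.lorentzian hM.invariant_metric hM.action hB.surface
    hΦ hx
  refine hΨ.area_inequality hΛ hM hΦ hexp hst hgeom htop hξ hξpos ?_
  have hC := hx.pos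
  rw [hA, hgeom.riemannianVolume_eq, ENNReal.toReal_ofReal (by positivity)]
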